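/- Let $G$ be a discrete group and $N$ a normal subgroup of $G$. **Conventions.** For a $C^*$-algebra $B$, $M(B)$ is its multiplier algebra and $UM(B)$ the unitary group of $M(B)$. A *(Green-)twisted action* $(B,G,N,\alpha,\tau)$ consists of a $C^*$-algebra $B$, an action $\alpha$ of $G$ on $B$ by $*$-automorphisms and a homomorphism $\tau:N\to UM(B)$ such that $\alpha_n(b)=\tau_n b\tau_{n^{-1}}$ and $\alpha_s(\tau_n)=\tau_{sns^{-1}}$ for $n\in N$, $s\in G$, $b\in B$. Its *twisted semidirect product bundle* $B\times_N G$ is the Fell bundle over $G/N$ whose total space is the orbit space of $B\times G$ under the action $(b,s)\cdot n=(b\tau_n,n^{-1}s)$ of $N$, whose fiber over $sN$ is $\{[b,s]:b\in B\}$ with the Banach space structure carried over from $B$ by $b\mapsto[b,s]$, and whose operations are induced from $(b,s)(c,t)=(b\alpha_s(c),st)$ and $(b,s)^*=(\alpha_{s^{-1}}(b)^*,s^{-1})$. The *reduced twisted crossed product* $B\times_{\alpha,\tau,r}G$ is the reduced cross sectional algebra $C^*_r(B\times_N G)$, that is, the completion of the $*$-algebra of finitely supported sections in the norm of the regular representation.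 A *multiplier of order $h\in G/N$* of a Fell bundle $\mathcal D=\{D_k\}_{k\in G/N}$ is a pair of maps $m$ of the bundle into itself, written $a\mapsto ma$ and $a\mapsto am$, with $mD_k\subseteq D_{hk}$, $D_km\subseteq D_{kh}$ and $a(mb)=(am)b$ for all $a,b$ in the bundle. The multipliers of all orders form a monoid with involution $m^*a=(a^*m)^*$, $am^*=(ma^*)^*$, and $UM(\mathcal D)$ denotes its group of unitary elements. A *coaction* of a discrete group $H$ on a $C^*$-algebra $D$ is an injective $*$-homomorphism $\delta:D\to D\otimes C^*(H)$ (minimal tensor product) such that the closed linear span of $\delta(D)(1\otimes C^*(H))$ is $D\otimes C^*(H)$ and $(\delta\otimes\mathrm{id})\circ\delta=(\mathrm{id}\otimes\delta_H)\circ\delta$, where $\delta_H(h)=h\otimes h$ for $h\in H$; we write $\delta$ also for its extension to multipliers. Put $D_h=\{a\in D:\delta(a)=a\otimes h\}$. A *covariant representation* of $(D,\delta)$ in the multiplier algebra of a $C^*$-algebra is a pair $(\pi,\mu)$ of nondegenerate homomorphisms of $D$ and $c_0(H)$ into it with $\pi(a)\mu(\chi_{\{k\}})=\mu(\chi_{\{hk\}})\pi(a)$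 for $a\in D_h$ and $h,k\in H$. The *crossed product* $D\times_\delta H$ is the $C^*$-algebra generated by the products $j_D(a)j_H(f)$ ($a\in D$, $f\in c_0(H)$) for a covariant representation $(j_D,j_H)$ that is universal among all covariant representations. The coaction is *normal* if $j_D$ is injective. **Theorem.** 1. A Fell bundle $\mathcal D$ over $G/N$ is isomorphic to the twisted semidirect product bundle $B\times_N G$ of some twisted action $(B,G,N,\alpha,\tau)$ if and only if there is a homomorphism $u:G\to UM(\mathcal D)$ such that $u_s$ is a multiplier of order $sN$ for every $s\in G$. 2. A $C^*$-algebra $D$ is isomorphic to the reduced twisted crossed product $B\times_{\alpha,\tau,r}G$ of some twisted action $(B,G,N,\alpha,\tau)$ if and only if there are a normal coaction $\delta$ of $G/N$ on $D$ and a homomorphism $u:G\to UM(D)$ such that $\delta(u_s)=u_s\otimes sN$ for every $s\in G$. -/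

import Mathlib

open scoped TensorProduct

universe u v w

set_option linter.unusedSectionVars false

/-- A C*-seminorm on a complex *-algebra. -/
structure CStarSeminorm (A : Type u) [NonUnitalRing A] [StarRing A] [Module ℂ A] where
  toFun : A → ℝ
  add_le : ∀ a b, toFun (a + b) ≤ toFun a + toFun b
  smul : ∀ (c : ℂ) a, toFun (c • a) = ‖c‖ * toFun a
  mul_le : ∀ a b, toFun (a * b) ≤ toFun a * toFun b
  star_mul_self : ∀ a, toFun (star a * a) = toFun a * toFun a

namespace CStarSeminorm

section Basic

variable {A : Type u} [NonUnitalRing A] [StarRing A] [Module ℂ A]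

instance : CoeFun (CStarSeminorm A) (fun _ => A → ℝ) := ⟨CStarSeminorm.toFun⟩

protected theorem map_zero (p : CStarSeminorm A) : p 0 = 0 := by
  simpa using p.smul 0 0

protected theorem map_neg (p : CStarSeminorm A) (a : A) : p (-a) = p a := by
  simpa using p.smul (-1) a

theorem nonneg (p : CStarSeminorm A) (a : A) : 0 ≤ p a := by
  have h := p.add_le a (-a)
  rw [add_neg_cancel, p.map_zero, p.map_neg] at h
  linarith

theorem le_map_star (p : CStarSeminorm A) (a : A) : p a ≤ p (star a) := by
  have h := p.mul_le (star a) a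
  rw [p.star_mul_self] at h
  rcases (p.nonneg a).eq_or_lt with h0 | h0
  · rw [← h0]; exact p.nonneg _
  · exact le_of_mul_le_mul_right h h0

protected theorem map_star (p : CStarSeminorm A) (a : A) : p (star a) = p a :=
  le_antisymm (by simpa using p.le_map_star (star a)) (p.le_map_star a)

/-- The pointwise supremum of a pointwise bounded set of C*-seminorms. -/
noncomputable def sup (S : Set (CStarSeminorm A)) (hS : ∀ a, ∃ C, ∀ p ∈ S, p a ≤ C) :
    CStarSeminorm A where
  toFun a := ⨆ p : S, p.1 a
  add_le a b := by
    have hb : ∀ a, BddAbove (Set.range fun p : S => p.1 a) := fun a =>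
      (hS a).imp fun C hC => by rintro _ ⟨p, rfl⟩; exact hC _ p.2
    rcases isEmpty_or_nonempty S with h | h
    · simp
    · exact ciSup_le fun p => (p.1.add_le a b).trans
        (add_le_add (le_ciSup (hb a) p) (le_ciSup (hb b) p))
  smul c a := by
    simp_rw [CStarSeminorm.smul]
    exact (Real.mul_iSup_of_nonneg (norm_nonneg c) _).symm
  mul_le a b := by
    have hb : ∀ a, BddAbove (Set.range fun p : S => p.1 a) := fun a =>
      (hS a).imp fun C hC => by rintro _ ⟨p, rfl⟩; exact hC _ p.2
    rcases isEmpty_or_nonempty S with h | h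
    · simp
    · exact ciSup_le fun p => (p.1.mul_le a b).trans
        (mul_le_mul (le_ciSup (hb a) p) (le_ciSup (hb b) p) (p.1.nonneg b)
          (Real.iSup_nonneg fun p => p.1.nonneg a))
  star_mul_self a := by
    have hb : ∀ a, BddAbove (Set.range fun p : S => p.1 a) := fun a =>
      (hS a).imp fun C hC => by rintro _ ⟨p, rfl⟩; exact hC _ p.2
    have h0 : 0 ≤ ⨆ p : S, p.1 a := Real.iSup_nonneg fun p => p.1.nonneg a
    rcases isEmpty_or_nonempty S with h | h
    · simp
    · apply le_antisymm
      · refine ciSup_le fun p => ?_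
        rw [p.1.star_mul_self]
        exact mul_le_mul (le_ciSup (hb a) p) (le_ciSup (hb a) p) (p.1.nonneg a) h0
      · have h1 : (⨆ p : S, p.1 a) ≤ √(⨆ p : S, p.1 (star a * a)) := by
          refine ciSup_le fun p => Real.le_sqrt_of_sq_le ?_
          rw [sq, ← p.1.star_mul_self]
          exact le_ciSup (hb (star a * a)) p
        calc _ ≤ √(⨆ p : S, p.1 (star a * a)) * √(⨆ p : S, p.1 (star a * a)) :=
              mul_le_mul h1 h1 h0 (Real.sqrt_nonneg _)
          _ = _ := Real.mul_self_sqrt (Real.iSup_nonneg fun p => p.1.nonneg _)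

theorem le_sup (S : Set (CStarSeminorm A)) (hS : ∀ a, ∃ C, ∀ p ∈ S, p a ≤ C)
    (p : CStarSeminorm A) (hp : p ∈ S) (a : A) : p a ≤ sup S hS a :=
  le_ciSup (f := fun p : S => p.1 a)
    ((hS a).imp fun C hC => by rintro _ ⟨p, rfl⟩; exact hC _ p.2) ⟨p, hp⟩

theorem sup_le (S : Set (CStarSeminorm A)) (hS : ∀ a, ∃ C, ∀ p ∈ S, p a ≤ C)
    (a : A) (r : ℝ) (hr : 0 ≤ r) (h : ∀ p ∈ S, p a ≤ r) : sup S hS a ≤ r :=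
  Real.iSup_le (fun p => h p.1 p.2) hr

/-- The C*-seminorm `a ↦ ‖φ a‖` of a *-homomorphism `φ` into a C*-algebra. -/
def ofHom {E : Type v} [NonUnitalCStarAlgebra E] (φ : A →⋆ₙₐ[ℂ] E) : CStarSeminorm A where
  toFun a := ‖φ a‖
  add_le a b := by rw [map_add]; exact norm_add_le _ _
  smul c a := by rw [map_smul, norm_smul]
  mul_le a b := by rw [map_mul]; exact norm_mul_le _ _
  star_mul_self a := by rw [map_mul, map_star, CStarRing.norm_star_mul_self]

end Basic

section Completion

variable {A : Type u} [NonUnitalRing A] [StarRing A] [Module ℂ A]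

/-- The algebra `A` seminormed by `p`. -/
def Pre (_p : CStarSeminorm A) : Type u := A

variable (p : CStarSeminorm A)

instance : NonUnitalRing p.Pre := inferInstanceAs (NonUnitalRing A)
instance : StarRing p.Pre := inferInstanceAs (StarRing A)
instance : Module ℂ p.Pre := inferInstanceAs (Module ℂ A)
instance [IsScalarTower ℂ A A] : IsScalarTower ℂ p.Pre p.Pre :=
  inferInstanceAs (IsScalarTower ℂ A A)
instance [SMulCommClass ℂ A A] : SMulCommClass ℂ p.Pre p.Pre :=
  inferInstanceAs (SMulCommClass ℂ A A)
instance [StarModule ℂ A] : StarModule ℂ p.Pre := inferInstanceAs (StarModule ℂ A)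

noncomputable instance : SeminormedAddCommGroup p.Pre :=
  AddGroupSeminorm.toSeminormedAddCommGroup
    { toFun := fun a : p.Pre => p.toFun a
      map_zero' := p.map_zero
      add_le' := p.add_le
      neg' := p.map_neg }

theorem norm_pre (a : p.Pre) : ‖a‖ = p.toFun a := rfl

noncomputable instance : NonUnitalSeminormedRing p.Pre :=
  { (inferInstance : SeminormedAddCommGroup p.Pre), (inferInstance : NonUnitalRing p.Pre) with
    norm_mul_le := p.mul_le }

noncomputable instance : NormedSpace ℂ p.Pre where
  norm_smul_le c a := (p.smul c a).le

instance : NormedStarGroup p.Pre where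
  norm_star_le a := (p.map_star a).le

/-- The Hausdorff completion of `A` in the seminorm `p`, as a Banach space. -/
def PreCompletion : Type u := UniformSpace.Completion p.Pre

noncomputable instance : NormedAddCommGroup p.PreCompletion :=
  inferInstanceAs (NormedAddCommGroup (UniformSpace.Completion p.Pre))
noncomputable instance : NormedSpace ℂ p.PreCompletion :=
  inferInstanceAs (NormedSpace ℂ (UniformSpace.Completion p.Pre))
instance : CompleteSpace p.PreCompletion :=
  inferInstanceAs (CompleteSpace (UniformSpace.Completion p.Pre))

/-- The canonical map of the algebra into its completion. -/
noncomputable def precoe (a : A) : p.PreCompletion := ((show p.Pre from a : p.Pre) : UniformSpace.Completion p.Pre)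

theorem norm_precoe (a : A) : ‖p.precoe a‖ = p a :=
  UniformSpace.Completion.norm_coe (E := p.Pre) a

theorem precoe_add (a b : A) : p.precoe (a + b) = p.precoe a + p.precoe b :=
  UniformSpace.Completion.coe_add (α := p.Pre) a b

theorem precoe_smul (c : ℂ) (a : A) : p.precoe (c • a) = c • p.precoe a :=
  UniformSpace.Completion.coe_smul (X := p.Pre) c a

theorem denseRange_precoe : DenseRange p.precoe :=
  UniformSpace.Completion.denseRange_coe (α := p.Pre)

theorem preinduction {P : p.PreCompletion → Prop} (hP : IsClosed {x | P x}) (h : ∀ a, P (p.precoe a))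
    (x : p.PreCompletion) : P x :=
  UniformSpace.Completion.induction_on (α := p.Pre) x hP h

end Completion

section Algebra

variable {A : Type u} [NonUnitalRing A] [StarRing A] [Module ℂ A]
  (p : CStarSeminorm A)

/-- A linear map bounded by the seminorm extends to the completion. -/
noncomputable def extend {E : Type v} [NormedAddCommGroup E] [NormedSpace ℂ E] [CompleteSpace E]
    (f : A →ₗ[ℂ] E) (C : ℝ) (hf : ∀ a, ‖f a‖ ≤ C * p a) : p.PreCompletion →L[ℂ] E :=
  ContinuousLinearMap.fromCompletion
    (LinearMap.mkContinuous (show p.Pre →ₗ[ℂ] E from f) C hf)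

theorem extend_precoe {E : Type v} [NormedAddCommGroup E] [NormedSpace ℂ E] [CompleteSpace E]
    (f : A →ₗ[ℂ] E) (C : ℝ) (hf : ∀ a, ‖f a‖ ≤ C * p a) (a : A) :
    p.extend f C hf (p.precoe a) = f a :=
  ContinuousLinearMap.fromCompletion_apply_coe _ (show p.Pre from a)

theorem ext_precoe {E : Type v} [TopologicalSpace E] [T2Space E] {f g : p.PreCompletion → E}
    (hf : Continuous f) (hg : Continuous g) (h : ∀ a, f (p.precoe a) = g (p.precoe a)) : f = g :=
  p.denseRange_precoe.equalizer hf hg (funext h)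

variable [IsScalarTower ℂ A A] [SMulCommClass ℂ A A]

/-- Multiplication by a fixed element, extended to the completion. -/
noncomputable def mulLeft (a : A) : p.PreCompletion →L[ℂ] p.PreCompletion :=
  p.extend
    { toFun := fun b => p.precoe (a * b)
      map_add' := fun b c => by rw [mul_add, precoe_add]
      map_smul' := fun c b => by rw [mul_smul_comm, precoe_smul, RingHom.id_apply] }
    (p a) (fun b => by
      change ‖p.precoe (a * b)‖ ≤ _
      rw [norm_precoe]; exact p.mul_le a b)

theorem mulLeft_precoe (a b : A) : p.mulLeft a (p.precoe b) = p.precoe (a * b) :=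
  p.extend_precoe _ _ _ b

theorem norm_mulLeft_le (a : A) : ‖p.mulLeft a‖ ≤ p a := by
  refine ContinuousLinearMap.opNorm_le_bound _ (p.nonneg a) fun x => ?_
  refine p.preinduction (P := fun x => ‖p.mulLeft a x‖ ≤ p a * ‖x‖)
    (isClosed_le (by fun_prop) (by fun_prop)) (fun b => ?_) x
  rw [mulLeft_precoe, norm_precoe, norm_precoe]
  exact p.mul_le a b

theorem mulLeft_add (a b : A) : p.mulLeft (a + b) = p.mulLeft a + p.mulLeft b := by
  refine DFunLike.coe_injective (p.ext_precoe (p.mulLeft (a + b)).continuous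
    (p.mulLeft a + p.mulLeft b).continuous fun c => ?_)
  rw [_root_.add_apply, mulLeft_precoe, mulLeft_precoe, mulLeft_precoe, add_mul, precoe_add]

theorem mulLeft_smul (c : ℂ) (a : A) : p.mulLeft (c • a) = c • p.mulLeft a := by
  refine DFunLike.coe_injective (p.ext_precoe (p.mulLeft (c • a)).continuous
    (c • p.mulLeft a).continuous fun b => ?_)
  rw [_root_.smul_apply, mulLeft_precoe, mulLeft_precoe, smul_mul_assoc, precoe_smul]

/-- Multiplication as a linear map into the bounded operators on the completion. -/
noncomputable def mulLin : A →ₗ[ℂ] (p.PreCompletion →L[ℂ] p.PreCompletion) where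
  toFun := p.mulLeft
  map_add' := p.mulLeft_add
  map_smul' := p.mulLeft_smul

/-- The multiplication of the completion. -/
noncomputable def mulL : p.PreCompletion →L[ℂ] (p.PreCompletion →L[ℂ] p.PreCompletion) :=
  p.extend p.mulLin 1 (fun a => by rw [one_mul]; exact p.norm_mulLeft_le a)

theorem mulL_precoe (a b : A) : p.mulL (p.precoe a) (p.precoe b) = p.precoe (a * b) := by
  have h : p.mulL (p.precoe a) = p.mulLeft a := p.extend_precoe _ _ _ a
  rw [h, mulLeft_precoe]

/-- The involution of the completion. -/
noncomputable def starMap : p.PreCompletion → p.PreCompletion :=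
  UniformSpace.Completion.map (star : p.Pre → p.Pre)

theorem starMap_precoe (a : A) : p.starMap (p.precoe a) = p.precoe (star a) :=
  UniformSpace.Completion.map_coe (α := p.Pre) (β := p.Pre)
    (star_isometry (E := p.Pre)).uniformContinuous a

theorem continuous_starMap : Continuous p.starMap :=
  UniformSpace.Completion.continuous_map

theorem continuous_mulL {X : Type*} [TopologicalSpace X] {f g : X → p.PreCompletion}
    (hf : Continuous f) (hg : Continuous g) : Continuous fun x => p.mulL (f x) (g x) :=
  (p.mulL.continuous.comp hf).clm_apply hg

theorem mulL_assoc (x y z : p.PreCompletion) :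
    p.mulL (p.mulL x y) z = p.mulL x (p.mulL y z) := by
  refine p.preinduction (P := fun x => p.mulL (p.mulL x y) z = p.mulL x (p.mulL y z))
    (isClosed_eq (p.continuous_mulL (p.continuous_mulL continuous_id continuous_const)
      continuous_const) (p.continuous_mulL continuous_id continuous_const)) (fun a => ?_) x
  refine p.preinduction (P := fun y => p.mulL (p.mulL (p.precoe a) y) z = p.mulL (p.precoe a) (p.mulL y z))
    (isClosed_eq (p.continuous_mulL (p.continuous_mulL continuous_const continuous_id)
      continuous_const) (p.continuous_mulL continuous_const
      (p.continuous_mulL continuous_id continuous_const))) (fun b => ?_) y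
  refine p.preinduction
    (P := fun z => p.mulL (p.mulL (p.precoe a) (p.precoe b)) z = p.mulL (p.precoe a) (p.mulL (p.precoe b) z))
    (isClosed_eq (p.continuous_mulL continuous_const continuous_id)
      (p.continuous_mulL continuous_const (p.continuous_mulL continuous_const continuous_id)))
    (fun c => ?_) z
  simp only [mulL_precoe, mul_assoc]

theorem norm_mulL_le (x y : p.PreCompletion) : ‖p.mulL x y‖ ≤ ‖x‖ * ‖y‖ := by
  refine p.preinduction (P := fun x => ‖p.mulL x y‖ ≤ ‖x‖ * ‖y‖)
    (isClosed_le (p.continuous_mulL continuous_id continuous_const).norm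
      (continuous_norm.mul continuous_const)) (fun a => ?_) x
  refine p.preinduction (P := fun y => ‖p.mulL (p.precoe a) y‖ ≤ ‖p.precoe a‖ * ‖y‖)
    (isClosed_le (p.continuous_mulL continuous_const continuous_id).norm
      (continuous_const.mul continuous_norm)) (fun b => ?_) y
  rw [mulL_precoe, norm_precoe, norm_precoe, norm_precoe]
  exact p.mul_le a b

theorem starMap_starMap (x : p.PreCompletion) : p.starMap (p.starMap x) = x := by
  refine p.preinduction (P := fun x => p.starMap (p.starMap x) = x)
    (isClosed_eq (p.continuous_starMap.comp p.continuous_starMap) continuous_id) (fun a => ?_) x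
  rw [starMap_precoe, starMap_precoe, star_star]

theorem starMap_add (x y : p.PreCompletion) : p.starMap (x + y) = p.starMap x + p.starMap y := by
  refine p.preinduction (P := fun x => p.starMap (x + y) = p.starMap x + p.starMap y)
    (isClosed_eq (p.continuous_starMap.comp (continuous_id.add continuous_const))
      (p.continuous_starMap.add continuous_const)) (fun a => ?_) x
  refine p.preinduction (P := fun y => p.starMap (p.precoe a + y) = p.starMap (p.precoe a) + p.starMap y)
    (isClosed_eq (p.continuous_starMap.comp (continuous_const.add continuous_id))
      (continuous_const.add p.continuous_starMap)) (fun b => ?_) y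
  rw [← precoe_add, starMap_precoe, starMap_precoe, starMap_precoe, star_add, precoe_add]

theorem starMap_mul (x y : p.PreCompletion) :
    p.starMap (p.mulL x y) = p.mulL (p.starMap y) (p.starMap x) := by
  refine p.preinduction (P := fun x => p.starMap (p.mulL x y) = p.mulL (p.starMap y) (p.starMap x))
    (isClosed_eq (p.continuous_starMap.comp (p.continuous_mulL continuous_id continuous_const))
      (p.continuous_mulL continuous_const p.continuous_starMap)) (fun a => ?_) x
  refine p.preinduction
    (P := fun y => p.starMap (p.mulL (p.precoe a) y) = p.mulL (p.starMap y) (p.starMap (p.precoe a)))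
    (isClosed_eq (p.continuous_starMap.comp (p.continuous_mulL continuous_const continuous_id))
      (p.continuous_mulL p.continuous_starMap continuous_const)) (fun b => ?_) y
  rw [mulL_precoe, starMap_precoe, starMap_precoe, starMap_precoe, mulL_precoe, star_mul]

theorem norm_starMap_mulL (x : p.PreCompletion) : ‖p.mulL (p.starMap x) x‖ = ‖x‖ * ‖x‖ := by
  refine p.preinduction (P := fun x => ‖p.mulL (p.starMap x) x‖ = ‖x‖ * ‖x‖)
    (isClosed_eq (p.continuous_mulL p.continuous_starMap continuous_id).norm
      (continuous_norm.mul continuous_norm)) (fun a => ?_) x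
  rw [starMap_precoe, mulL_precoe, norm_precoe, norm_precoe]
  exact p.star_mul_self a

noncomputable instance : NonUnitalRing p.PreCompletion :=
  { (inferInstance : AddCommGroup p.PreCompletion) with
    mul := fun x y => p.mulL x y
    left_distrib := fun x y z => map_add (p.mulL x) y z
    right_distrib := fun x y z => by
      change p.mulL (x + y) z = p.mulL x z + p.mulL y z
      rw [map_add]; rfl
    zero_mul := fun x => by change p.mulL 0 x = 0; rw [map_zero]; rfl
    mul_zero := fun x => map_zero (p.mulL x)
    mul_assoc := p.mulL_assoc }

noncomputable instance : NonUnitalNormedRing p.PreCompletion :=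
  { (inferInstance : NormedAddCommGroup p.PreCompletion),
    (inferInstance : NonUnitalRing p.PreCompletion) with
    norm_mul_le := p.norm_mulL_le }

noncomputable instance : StarRing p.PreCompletion where
  star := p.starMap
  star_involutive := p.starMap_starMap
  star_mul := p.starMap_mul
  star_add := p.starMap_add

variable [StarModule ℂ A]

theorem starMap_smul (c : ℂ) (x : p.PreCompletion) :
    p.starMap (c • x) = star c • p.starMap x := by
  refine p.preinduction (P := fun x => p.starMap (c • x) = star c • p.starMap x)
    (isClosed_eq (p.continuous_starMap.comp (continuous_const_smul c))
      ((continuous_const_smul (star c)).comp p.continuous_starMap)) (fun a => ?_) x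
  rw [← precoe_smul, starMap_precoe, starMap_precoe, star_smul, precoe_smul]

/-- The C*-algebra structure of the completion. -/
noncomputable abbrev preCStar : NonUnitalCStarAlgebra p.PreCompletion :=
  { (inferInstance : NonUnitalNormedRing p.PreCompletion),
    (inferInstance : StarRing p.PreCompletion),
    (inferInstance : CompleteSpace p.PreCompletion),
    (inferInstance : NormedSpace ℂ p.PreCompletion) with
    norm_mul_self_le := fun x => (p.norm_starMap_mulL x).ge
    smul_assoc := fun c x y => by
      change p.mulL (c • x) y = c • p.mulL x y
      rw [map_smul]; rfl
    smul_comm := fun c x y => (map_smul (p.mulL x) c y).symm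
    star_smul := p.starMap_smul }

/-- The Hausdorff completion of a *-algebra in a C*-seminorm, as a C*-algebra. -/
def Completion : Type u := p.PreCompletion

noncomputable instance : NonUnitalCStarAlgebra p.Completion := p.preCStar

/-- The canonical map of the algebra into its completion. -/
noncomputable def coe (a : A) : p.Completion := p.precoe a

theorem norm_coe (a : A) : ‖p.coe a‖ = p a := p.norm_precoe a

theorem coe_add (a b : A) : p.coe (a + b) = p.coe a + p.coe b := p.precoe_add a b

theorem coe_smul (c : ℂ) (a : A) : p.coe (c • a) = c • p.coe a := p.precoe_smul c a

theorem coe_mul (a b : A) : p.coe (a * b) = p.coe a * p.coe b := (p.mulL_precoe a b).symm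

theorem coe_star (a : A) : p.coe (star a) = star (p.coe a) := (p.starMap_precoe a).symm

theorem denseRange_coe : DenseRange p.coe := p.denseRange_precoe

theorem induction {P : p.Completion → Prop} (hP : IsClosed {x | P x}) (h : ∀ a, P (p.coe a))
    (x : p.Completion) : P x :=
  p.preinduction (P := P) hP h x

/-- The canonical *-homomorphism of the algebra into its completion. -/
noncomputable def coeHom : A →⋆ₙₐ[ℂ] p.Completion where
  toFun := p.coe
  map_smul' := p.coe_smul
  map_zero' := by simpa using p.coe_smul 0 0
  map_add' := p.coe_add
  map_mul' := p.coe_mul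
  map_star' := p.coe_star

/-- The function underlying the extension of a *-homomorphism to the completion. -/
noncomputable def liftFun {E : Type v} [NonUnitalCStarAlgebra E] (φ : A →⋆ₙₐ[ℂ] E)
    (h : ∀ a, ‖φ a‖ ≤ p a) : p.PreCompletion →L[ℂ] E :=
  p.extend { toFun := φ, map_add' := map_add φ, map_smul' := map_smul φ } 1 (fun a => by
      rw [one_mul]; exact h a)

/-- A *-homomorphism bounded by the seminorm extends to the completion. -/
noncomputable def lift {E : Type v} [NonUnitalCStarAlgebra E] (φ : A →⋆ₙₐ[ℂ] E)
    (h : ∀ a, ‖φ a‖ ≤ p a) : p.Completion →⋆ₙₐ[ℂ] E :=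
  let F : p.Completion → E := p.liftFun φ h
  have hF : ∀ a, F (p.coe a) = φ a := fun a => p.extend_precoe _ _ _ a
  have hc : Continuous F := (p.liftFun φ h).continuous
  { toFun := F
    map_smul' := map_smul (p.liftFun φ h)
    map_zero' := map_zero (p.liftFun φ h)
    map_add' := map_add (p.liftFun φ h)
    map_mul' := fun x y => by
      refine p.induction (P := fun x => F (x * y) = F x * F y)
        (isClosed_eq (hc.comp (continuous_id.mul continuous_const)) (hc.mul continuous_const))
        (fun a => ?_) x
      refine p.induction (P := fun y => F (p.coe a * y) = F (p.coe a) * F y)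
        (isClosed_eq (hc.comp (continuous_const.mul continuous_id)) (continuous_const.mul hc))
        (fun b => ?_) y
      rw [← coe_mul, hF, hF, hF, map_mul]
    map_star' := fun x => by
      refine p.induction (P := fun x => F (star x) = star (F x))
        (isClosed_eq (hc.comp continuous_star) hc.star) (fun a => ?_) x
      rw [← coe_star, hF, hF, map_star] }

theorem lift_coe {E : Type v} [NonUnitalCStarAlgebra E] (φ : A →⋆ₙₐ[ℂ] E)
    (h : ∀ a, ‖φ a‖ ≤ p a) (a : A) : p.lift φ h (p.coe a) = φ a :=
  p.extend_precoe _ _ _ a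

end Algebra
end CStarSeminorm

/-! ### Spatial (minimal) tensor products -/

section TensorStar

variable {A : Type u} {C : Type v} [NonUnitalCStarAlgebra A] [NonUnitalCStarAlgebra C]

noncomputable instance TensorProduct.instStarRingCStar : StarRing (A ⊗[ℂ] C) :=
  { (inferInstance : StarAddMonoid (A ⊗[ℂ] C)) with
    star_mul := fun x y => by
      induction x with
      | zero => simp
      | add x x' hx hx' => rw [add_mul, star_add, hx, hx', star_add, mul_add]
      | tmul a c =>
        induction y with
        | zero => simp
        | add y y' hy hy' => rw [mul_add, star_add, hy, hy', star_add, add_mul]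
        | tmul b d => simp }

end TensorStar

namespace HilbertTensor

variable {K : Type u} {L : Type v} [NormedAddCommGroup K] [InnerProductSpace ℂ K] [CompleteSpace K]
  [NormedAddCommGroup L] [InnerProductSpace ℂ L] [CompleteSpace L]

/-- Adjoints of algebraic tensor products of operators. -/
theorem inner_map (S : K →L[ℂ] K) (T : L →L[ℂ] L) (x y : K ⊗[ℂ] L) :
    inner ℂ (TensorProduct.map (star S).toLinearMap (star T).toLinearMap x) y =
      inner ℂ x (TensorProduct.map S.toLinearMap T.toLinearMap y) := by
  induction x with
  | zero => simp
  | add x x' hx hx' => rw [map_add, inner_add_left, inner_add_left, hx, hx']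
  | tmul k l =>
    induction y with
    | zero => simp
    | add y y' hy hy' => rw [map_add, inner_add_right, inner_add_right, hy, hy']
    | tmul k' l' =>
      simp [ContinuousLinearMap.star_eq_adjoint, ContinuousLinearMap.adjoint_inner_left]

theorem inner_map_left (S : K →L[ℂ] K) (x : K ⊗[ℂ] L) :
    inner ℂ x (TensorProduct.map (star S * S).toLinearMap (LinearMap.id : L →ₗ[ℂ] L) x) =
      inner ℂ (TensorProduct.map S.toLinearMap (LinearMap.id : L →ₗ[ℂ] L) x)
        (TensorProduct.map S.toLinearMap (LinearMap.id : L →ₗ[ℂ] L) x) := by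
  have h := inner_map (star S) (1 : L →L[ℂ] L) x
    (TensorProduct.map S.toLinearMap (LinearMap.id : L →ₗ[ℂ] L) x)
  rw [star_star, star_one] at h
  have e : ((1 : L →L[ℂ] L) : L →ₗ[ℂ] L) = LinearMap.id := rfl
  rw [e] at h
  rw [h, ← LinearMap.comp_apply, ← TensorProduct.map_comp, LinearMap.id_comp]
  rfl

theorem norm_map_left_le (S : K →L[ℂ] K) (x : K ⊗[ℂ] L) :
    ‖TensorProduct.map S.toLinearMap (LinearMap.id : L →ₗ[ℂ] L) x‖ ≤ ‖S‖ * ‖x‖ := by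
  have hpos : 0 ≤ algebraMap ℝ (K →L[ℂ] K) (‖S‖ ^ 2) - star S * S := by
    rw [sub_nonneg]
    exact CStarAlgebra.star_mul_le_algebraMap_norm_sq
  obtain ⟨R, hR⟩ := CStarAlgebra.nonneg_iff_eq_star_mul_self.mp hpos
  have h1 : (star S * S).toLinearMap + (star R * R).toLinearMap =
      ((‖S‖ ^ 2 : ℝ) : ℂ) • (LinearMap.id : K →ₗ[ℂ] K) := by
    have h2 : star S * S + star R * R = algebraMap ℝ (K →L[ℂ] K) (‖S‖ ^ 2) := by
      rw [← hR]; abel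
    ext k
    have h3 := congrArg (fun U : K →L[ℂ] K => U k) h2
    simpa [Algebra.algebraMap_eq_smul_one, ← Complex.coe_smul] using h3
  have h4 := congrArg (fun U : K →ₗ[ℂ] K =>
    inner ℂ x (TensorProduct.map U (LinearMap.id : L →ₗ[ℂ] L) x)) h1
  simp only [TensorProduct.map_add_left, TensorProduct.map_smul_left, LinearMap.add_apply,
    LinearMap.smul_apply, inner_add_right, inner_smul_right, inner_map_left,
    TensorProduct.map_id, LinearMap.id_apply] at h4
  have h5 := congrArg Complex.re h4
  rw [Complex.add_re, Complex.re_ofReal_mul] at h5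
  have n := fun y : K ⊗[ℂ] L => inner_self_eq_norm_sq (𝕜 := ℂ) y
  simp only [RCLike.re_to_complex] at n
  rw [n, n, n] at h5
  refine abs_le_of_sq_le_sq' ?_ (by positivity) |>.2
  rw [mul_pow]
  nlinarith [sq_nonneg ‖TensorProduct.map R.toLinearMap (LinearMap.id : L →ₗ[ℂ] L) x‖]

theorem norm_map_right_le (T : L →L[ℂ] L) (x : K ⊗[ℂ] L) :
    ‖TensorProduct.map (LinearMap.id : K →ₗ[ℂ] K) T.toLinearMap x‖ ≤ ‖T‖ * ‖x‖ := by
  rw [← TensorProduct.norm_comm, ← TensorProduct.norm_comm x, ← TensorProduct.map_comm]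
  exact norm_map_left_le T _

theorem norm_map_le (S : K →L[ℂ] K) (T : L →L[ℂ] L) (x : K ⊗[ℂ] L) :
    ‖TensorProduct.map S.toLinearMap T.toLinearMap x‖ ≤ ‖S‖ * ‖T‖ * ‖x‖ := by
  have h : TensorProduct.map S.toLinearMap T.toLinearMap x =
      TensorProduct.map S.toLinearMap LinearMap.id
        (TensorProduct.map LinearMap.id T.toLinearMap x) := by
    rw [← LinearMap.comp_apply, ← TensorProduct.map_comp, LinearMap.id_comp, LinearMap.comp_id]
  rw [h, mul_assoc]
  exact (norm_map_left_le S _).trans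
    (mul_le_mul_of_nonneg_left (norm_map_right_le T x) (norm_nonneg S))

variable (K L) in
/-- The Hilbert space tensor product. -/
abbrev HTensor : Type (max u v) := UniformSpace.Completion (K ⊗[ℂ] L)

/-- The operator `S ⊗ T` on the Hilbert space tensor product. -/
noncomputable def opTensor (S : K →L[ℂ] K) (T : L →L[ℂ] L) : HTensor K L →L[ℂ] HTensor K L :=
  ((TensorProduct.map S.toLinearMap T.toLinearMap).mkContinuous (‖S‖ * ‖T‖)
    (norm_map_le S T)).completion

theorem opTensor_coe (S : K →L[ℂ] K) (T : L →L[ℂ] L) (x : K ⊗[ℂ] L) :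
    opTensor S T (x : HTensor K L) =
      ((TensorProduct.map S.toLinearMap T.toLinearMap x : K ⊗[ℂ] L) : HTensor K L) :=
  ContinuousLinearMap.completion_apply_coe _ x

theorem op_ext {U V : HTensor K L →L[ℂ] HTensor K L}
    (h : ∀ k l, U ((k ⊗ₜ[ℂ] l : K ⊗[ℂ] L) : HTensor K L) =
      V ((k ⊗ₜ[ℂ] l : K ⊗[ℂ] L) : HTensor K L)) : U = V := by
  ext x
  induction x using UniformSpace.Completion.induction_on with
  | hp => exact isClosed_eq U.continuous V.continuous
  | ih x =>
    induction x with
    | zero => rw [UniformSpace.Completion.coe_zero, map_zero, map_zero]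
    | add x y hx hy => rw [UniformSpace.Completion.coe_add, map_add, map_add, hx, hy]
    | tmul k l => exact h k l

theorem opTensor_mul (S S' : K →L[ℂ] K) (T T' : L →L[ℂ] L) :
    opTensor (S * S') (T * T') = opTensor S T * opTensor S' T' :=
  op_ext fun k l => by
    rw [mul_apply_eq_comp, opTensor_coe, opTensor_coe, opTensor_coe]
    simp

theorem opTensor_star (S : K →L[ℂ] K) (T : L →L[ℂ] L) :
    opTensor (star S) (star T) = star (opTensor S T) := by
  refine (ContinuousLinearMap.eq_adjoint_iff _ _).mpr fun x y => ?_
  induction x, y using UniformSpace.Completion.induction_on₂ with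
  | hp => apply isClosed_eq <;> fun_prop
  | ih x y =>
    rw [opTensor_coe, opTensor_coe, UniformSpace.Completion.inner_coe,
      UniformSpace.Completion.inner_coe, inner_map]

/-- `(S, T) ↦ S ⊗ T` as a bilinear map. -/
noncomputable def opTensorBilin :
    (K →L[ℂ] K) →ₗ[ℂ] (L →L[ℂ] L) →ₗ[ℂ] (HTensor K L →L[ℂ] HTensor K L) :=
  LinearMap.mk₂ ℂ opTensor
    (fun S S' T => op_ext fun k l => by
      simp [opTensor_coe, TensorProduct.add_tmul, UniformSpace.Completion.coe_add])
    (fun c S T => op_ext fun k l => by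
      rw [_root_.smul_apply, opTensor_coe, opTensor_coe, ← UniformSpace.Completion.coe_smul]
      simp [TensorProduct.smul_tmul'])
    (fun S T T' => op_ext fun k l => by
      simp [opTensor_coe, TensorProduct.tmul_add, UniformSpace.Completion.coe_add])
    (fun c S T => op_ext fun k l => by
      simp [opTensor_coe, TensorProduct.tmul_smul, UniformSpace.Completion.coe_smul])

theorem norm_opTensor_le (S : K →L[ℂ] K) (T : L →L[ℂ] L) : ‖opTensor S T‖ ≤ ‖S‖ * ‖T‖ := by
  refine ContinuousLinearMap.opNorm_le_bound _ (by positivity) fun x => ?_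
  induction x using UniformSpace.Completion.induction_on with
  | hp => exact isClosed_le (by fun_prop) (by fun_prop)
  | ih x =>
    rw [opTensor_coe, UniformSpace.Completion.norm_coe, UniformSpace.Completion.norm_coe]
    exact norm_map_le S T x

section Rep

variable {A : Type u} {C : Type v} [NonUnitalCStarAlgebra A] [NonUnitalCStarAlgebra C]

/-- The linear map underlying `π ⊗ ρ`. -/
noncomputable def tensorLin (π : A →⋆ₙₐ[ℂ] (K →L[ℂ] K)) (ρ : C →⋆ₙₐ[ℂ] (L →L[ℂ] L)) :
    A ⊗[ℂ] C →ₗ[ℂ] (HTensor K L →L[ℂ] HTensor K L) :=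
  TensorProduct.lift (opTensorBilin.compl₁₂
    { toFun := π, map_add' := map_add π, map_smul' := map_smul π : A →ₗ[ℂ] (K →L[ℂ] K) }
    { toFun := ρ, map_add' := map_add ρ, map_smul' := map_smul ρ : C →ₗ[ℂ] (L →L[ℂ] L) })

theorem tensorLin_tmul (π : A →⋆ₙₐ[ℂ] (K →L[ℂ] K)) (ρ : C →⋆ₙₐ[ℂ] (L →L[ℂ] L)) (a : A) (c : C) :
    tensorLin π ρ (a ⊗ₜ[ℂ] c) = opTensor (π a) (ρ c) := by
  simp [tensorLin, opTensorBilin]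

/-- The tensor product `π ⊗ ρ` of two representations on Hilbert spaces, on the algebraic
tensor product. -/
noncomputable def tensorRep (π : A →⋆ₙₐ[ℂ] (K →L[ℂ] K)) (ρ : C →⋆ₙₐ[ℂ] (L →L[ℂ] L)) :
    A ⊗[ℂ] C →⋆ₙₐ[ℂ] (HTensor K L →L[ℂ] HTensor K L) where
  toFun := tensorLin π ρ
  map_smul' := map_smul _
  map_zero' := map_zero _
  map_add' := map_add _
  map_mul' x y := by
    induction x with
    | zero => simp
    | add x x' hx hx' => rw [add_mul, map_add, hx, hx', map_add, add_mul]
    | tmul a c =>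
      induction y with
      | zero => simp
      | add y y' hy hy' => rw [mul_add, map_add, hy, hy', map_add, mul_add]
      | tmul b d =>
        rw [Algebra.TensorProduct.tmul_mul_tmul, tensorLin_tmul, tensorLin_tmul, tensorLin_tmul,
          map_mul, map_mul, opTensor_mul]
  map_star' x := by
    induction x with
    | zero => rw [star_zero, map_zero]; exact (star_zero (HTensor K L →L[ℂ] HTensor K L)).symm
    | add x x' hx hx' =>
      rw [star_add, map_add, hx, hx', map_add]
      exact (star_add (R := HTensor K L →L[ℂ] HTensor K L) _ _).symm
    | tmul a c =>
      rw [TensorProduct.star_tmul, tensorLin_tmul, tensorLin_tmul, map_star, map_star,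
        opTensor_star]

theorem tensorRep_tmul (π : A →⋆ₙₐ[ℂ] (K →L[ℂ] K)) (ρ : C →⋆ₙₐ[ℂ] (L →L[ℂ] L)) (a : A) (c : C) :
    tensorRep π ρ (a ⊗ₜ[ℂ] c) = opTensor (π a) (ρ c) :=
  tensorLin_tmul π ρ a c

/-- The C*-seminorm `t ↦ ‖(π ⊗ ρ) t‖`. -/
noncomputable def repSeminorm (π : A →⋆ₙₐ[ℂ] (K →L[ℂ] K)) (ρ : C →⋆ₙₐ[ℂ] (L →L[ℂ] L)) :
    CStarSeminorm (A ⊗[ℂ] C) :=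
  CStarSeminorm.ofHom (E := HTensor K L →L[ℂ] HTensor K L) (tensorRep π ρ)

theorem repSeminorm_apply (π : A →⋆ₙₐ[ℂ] (K →L[ℂ] K)) (ρ : C →⋆ₙₐ[ℂ] (L →L[ℂ] L))
    (t : A ⊗[ℂ] C) : repSeminorm π ρ t = ‖tensorRep π ρ t‖ := rfl

end Rep

end HilbertTensor

section SpatialTensor

variable (A C : Type u) [NonUnitalCStarAlgebra A] [NonUnitalCStarAlgebra C]

/-- The C*-seminorms `t ↦ ‖(π ⊗ ρ) t‖`, where `π` and `ρ` are representations of `A` and `C` on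
Hilbert spaces. -/
def spatialSeminorms : Set (CStarSeminorm (A ⊗[ℂ] C)) :=
  {p | ∃ (K : Type u) (_ : NormedAddCommGroup K) (_ : InnerProductSpace ℂ K) (_ : CompleteSpace K)
      (L : Type u) (_ : NormedAddCommGroup L) (_ : InnerProductSpace ℂ L) (_ : CompleteSpace L)
      (π : A →⋆ₙₐ[ℂ] (K →L[ℂ] K)) (ρ : C →⋆ₙₐ[ℂ] (L →L[ℂ] L)),
      p = HilbertTensor.repSeminorm π ρ}

theorem spatialSeminorms_bdd (t : A ⊗[ℂ] C) : ∃ r, ∀ p ∈ spatialSeminorms A C, p t ≤ r := by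
  induction t with
  | zero => exact ⟨0, fun p _ => p.map_zero.le⟩
  | add s t hs ht =>
    obtain ⟨r, hr⟩ := hs
    obtain ⟨r', hr'⟩ := ht
    exact ⟨r + r', fun p hp => (p.add_le s t).trans (add_le_add (hr p hp) (hr' p hp))⟩
  | tmul a c =>
    refine ⟨‖a‖ * ‖c‖, ?_⟩
    rintro _ ⟨K, _, _, _, L, _, _, _, π, ρ, rfl⟩
    rw [HilbertTensor.repSeminorm_apply, HilbertTensor.tensorRep_tmul]
    exact (HilbertTensor.norm_opTensor_le _ _).trans
      (mul_le_mul (NonUnitalStarAlgHom.norm_apply_le π a) (NonUnitalStarAlgHom.norm_apply_le ρ c)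
        (norm_nonneg _) (norm_nonneg _))

/-- The spatial (minimal) C*-norm on the algebraic tensor product. -/
noncomputable def spatialNorm : CStarSeminorm (A ⊗[ℂ] C) :=
  CStarSeminorm.sup (spatialSeminorms A C) (spatialSeminorms_bdd A C)

/-- The spatial (minimal) C*-tensor product. -/
def SpatialTensor : Type u := (spatialNorm A C).Completion

noncomputable instance : NonUnitalCStarAlgebra (SpatialTensor A C) :=
  inferInstanceAs (NonUnitalCStarAlgebra (spatialNorm A C).Completion)

end SpatialTensor

namespace SpatialTensor

variable {A B C D : Type u} [NonUnitalCStarAlgebra A] [NonUnitalCStarAlgebra B]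
  [NonUnitalCStarAlgebra C] [NonUnitalCStarAlgebra D]

/-- The canonical map of the algebraic tensor product into the spatial tensor product. -/
noncomputable def of : A ⊗[ℂ] C →⋆ₙₐ[ℂ] SpatialTensor A C := (spatialNorm A C).coeHom

theorem norm_of (t : A ⊗[ℂ] C) : ‖of t‖ = spatialNorm A C t := (spatialNorm A C).norm_coe t

theorem denseRange_of : DenseRange (of : A ⊗[ℂ] C →⋆ₙₐ[ℂ] SpatialTensor A C) :=
  (spatialNorm A C).denseRange_coe

/-- The elementary tensor `a ⊗ c` in the spatial tensor product. -/
noncomputable def tmul (a : A) (c : C) : SpatialTensor A C := of (a ⊗ₜ[ℂ] c)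

theorem tmul_mul_tmul (a b : A) (c d : C) : tmul (a * b) (c * d) = tmul a c * tmul b d := by
  rw [tmul, tmul, tmul, ← map_mul, Algebra.TensorProduct.tmul_mul_tmul]

theorem star_tmul (a : A) (c : C) : star (tmul a c) = tmul (star a) (star c) := by
  rw [tmul, tmul, ← map_star, TensorProduct.star_tmul]

/-- The linear map underlying `φ ⊗ ψ` on algebraic tensor products. -/
noncomputable def algMapLin (φ : A →⋆ₙₐ[ℂ] B) (ψ : C →⋆ₙₐ[ℂ] D) : A ⊗[ℂ] C →ₗ[ℂ] B ⊗[ℂ] D :=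
  TensorProduct.map
    { toFun := φ, map_add' := map_add φ, map_smul' := map_smul φ : A →ₗ[ℂ] B }
    { toFun := ψ, map_add' := map_add ψ, map_smul' := map_smul ψ : C →ₗ[ℂ] D }

theorem algMapLin_tmul (φ : A →⋆ₙₐ[ℂ] B) (ψ : C →⋆ₙₐ[ℂ] D) (a : A) (c : C) :
    algMapLin φ ψ (a ⊗ₜ[ℂ] c) = φ a ⊗ₜ[ℂ] ψ c := by
  simp [algMapLin]

/-- `φ ⊗ ψ` on algebraic tensor products. -/
noncomputable def algMap (φ : A →⋆ₙₐ[ℂ] B) (ψ : C →⋆ₙₐ[ℂ] D) : A ⊗[ℂ] C →⋆ₙₐ[ℂ] B ⊗[ℂ] D where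
  toFun := algMapLin φ ψ
  map_smul' := map_smul _
  map_zero' := map_zero _
  map_add' := map_add _
  map_mul' x y := by
    induction x with
    | zero => simp
    | add x x' hx hx' => rw [add_mul, map_add, hx, hx', map_add, add_mul]
    | tmul a c =>
      induction y with
      | zero => simp
      | add y y' hy hy' => rw [mul_add, map_add, hy, hy', map_add, mul_add]
      | tmul b d => simp [algMapLin_tmul]
  map_star' x := by
    induction x with
    | zero => simp
    | add x x' hx hx' => rw [star_add, map_add, hx, hx', map_add, star_add]
    | tmul a c => simp [algMapLin_tmul, map_star]

theorem algMap_tmul (φ : A →⋆ₙₐ[ℂ] B) (ψ : C →⋆ₙₐ[ℂ] D) (a : A) (c : C) :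
    algMap φ ψ (a ⊗ₜ[ℂ] c) = φ a ⊗ₜ[ℂ] ψ c :=
  algMapLin_tmul φ ψ a c

theorem tensorRep_algMap {K L : Type u} [NormedAddCommGroup K] [InnerProductSpace ℂ K]
    [CompleteSpace K] [NormedAddCommGroup L] [InnerProductSpace ℂ L] [CompleteSpace L]
    (φ : A →⋆ₙₐ[ℂ] B) (ψ : C →⋆ₙₐ[ℂ] D)
    (π : B →⋆ₙₐ[ℂ] (K →L[ℂ] K)) (ρ : D →⋆ₙₐ[ℂ] (L →L[ℂ] L)) (t : A ⊗[ℂ] C) :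
    HilbertTensor.tensorRep π ρ (algMap φ ψ t) =
      HilbertTensor.tensorRep (π.comp φ) (ρ.comp ψ) t := by
  induction t with
  | zero => rw [map_zero, map_zero, map_zero]
  | add t t' h h' => rw [map_add, map_add, map_add, h, h']
  | tmul a c =>
    rw [algMap_tmul, HilbertTensor.tensorRep_tmul, HilbertTensor.tensorRep_tmul]
    rfl

theorem spatialNorm_algMap_le (φ : A →⋆ₙₐ[ℂ] B) (ψ : C →⋆ₙₐ[ℂ] D) (t : A ⊗[ℂ] C) :
    spatialNorm B D (algMap φ ψ t) ≤ spatialNorm A C t := by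
  refine CStarSeminorm.sup_le _ _ _ _ (CStarSeminorm.nonneg _ _) ?_
  rintro _ ⟨K, _, _, _, L, _, _, _, π, ρ, rfl⟩
  rw [HilbertTensor.repSeminorm_apply, tensorRep_algMap, ← HilbertTensor.repSeminorm_apply]
  exact CStarSeminorm.le_sup _ (spatialSeminorms_bdd A C)
    (HilbertTensor.repSeminorm (π.comp φ) (ρ.comp ψ))
    ⟨K, _, _, _, L, _, _, _, π.comp φ, ρ.comp ψ, rfl⟩ t

/-- The *-homomorphism `φ ⊗ ψ` of spatial tensor products. -/
noncomputable def map (φ : A →⋆ₙₐ[ℂ] B) (ψ : C →⋆ₙₐ[ℂ] D) :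
    SpatialTensor A C →⋆ₙₐ[ℂ] SpatialTensor B D :=
  (spatialNorm A C).lift (of.comp (algMap φ ψ)) fun t =>
    (norm_of (algMap φ ψ t)).le.trans (spatialNorm_algMap_le φ ψ t)

theorem map_of (φ : A →⋆ₙₐ[ℂ] B) (ψ : C →⋆ₙₐ[ℂ] D) (t : A ⊗[ℂ] C) :
    map φ ψ (of t) = of (algMap φ ψ t) :=
  (spatialNorm A C).lift_coe _ _ t

theorem map_tmul (φ : A →⋆ₙₐ[ℂ] B) (ψ : C →⋆ₙₐ[ℂ] D) (a : A) (c : C) :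
    map φ ψ (tmul a c) = tmul (φ a) (ψ c) := by
  rw [tmul, map_of, algMap_tmul, tmul]

end SpatialTensor

/-! ### The full group C*-algebra -/

section GroupAlgebra

variable {H : Type u} [Group H]

/-- The conjugate-linear map `s ↦ s⁻¹` of the complex group algebra. -/
noncomputable def groupAlgStar : MonoidAlgebra ℂ H →+ MonoidAlgebra ℂ H :=
  MonoidAlgebra.liftNC
    ((MonoidAlgebra.singleOneRingHom (R := ℂ) (M := H)).toAddMonoidHom.comp
      (starRingEnd ℂ).toAddMonoidHom)
    (fun s : H => MonoidAlgebra.single s⁻¹ (1 : ℂ))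

theorem groupAlgStar_single (s : H) (c : ℂ) :
    groupAlgStar (MonoidAlgebra.single s c) = MonoidAlgebra.single s⁻¹ (star c) := by
  simp [groupAlgStar, MonoidAlgebra.single_mul_single]

/-- The *-algebra structure of the complex group algebra, with `(c s)* = c̄ s⁻¹`. -/
noncomputable instance : StarRing (MonoidAlgebra ℂ H) where
  star := groupAlgStar
  star_involutive f := by
    induction f using MonoidAlgebra.induction_linear with
    | zero => simp
    | add f g hf hg => rw [map_add, map_add, hf, hg]
    | single s c => simp [groupAlgStar_single]
  star_mul f g := by
    change groupAlgStar (f * g) = groupAlgStar g * groupAlgStar f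
    induction f using MonoidAlgebra.induction_linear with
    | zero => simp
    | add f f' hf hf' => rw [add_mul, map_add, hf, hf', map_add, mul_add]
    | single s c =>
      induction g using MonoidAlgebra.induction_linear with
      | zero => simp
      | add g g' hg hg' => rw [mul_add, map_add, hg, hg', map_add, add_mul]
      | single t d => simp [groupAlgStar_single, MonoidAlgebra.single_mul_single, mul_comm]
  star_add := map_add groupAlgStar

theorem groupAlg_star_single (s : H) (c : ℂ) :
    star (MonoidAlgebra.single s c) = MonoidAlgebra.single s⁻¹ (star c) :=
  groupAlgStar_single s c

instance : StarModule ℂ (MonoidAlgebra ℂ H) where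
  star_smul c f := by
    induction f using MonoidAlgebra.induction_linear with
    | zero => simp
    | add f g hf hg => rw [smul_add, star_add, hf, hg, star_add, smul_add]
    | single s d => simp [groupAlg_star_single]

variable (H)

theorem groupSeminorms_bdd (f : MonoidAlgebra ℂ H) :
    ∃ r, ∀ p ∈ (Set.univ : Set (CStarSeminorm (MonoidAlgebra ℂ H))), p f ≤ r := by
  induction f using MonoidAlgebra.induction_linear with
  | zero => exact ⟨0, fun p _ => p.map_zero.le⟩
  | add f g hf hg =>
    obtain ⟨r, hr⟩ := hf
    obtain ⟨r', hr'⟩ := hg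
    exact ⟨r + r', fun p hp => (p.add_le f g).trans (add_le_add (hr p hp) (hr' p hp))⟩
  | single s c =>
    refine ⟨‖c‖, fun p _ => ?_⟩
    have h1 : p 1 = p 1 * p 1 := by simpa using p.star_mul_self 1
    have h2 : p 1 ≤ 1 := by nlinarith [p.nonneg 1]
    have h3 : p (MonoidAlgebra.single s 1) * p (MonoidAlgebra.single s 1) = p 1 := by
      rw [← p.star_mul_self, groupAlg_star_single, MonoidAlgebra.single_mul_single]
      simp [MonoidAlgebra.one_def]
    have h4 : p (MonoidAlgebra.single s 1) ≤ 1 := by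
      nlinarith [p.nonneg (MonoidAlgebra.single s 1)]
    have h5 : (MonoidAlgebra.single s c : MonoidAlgebra ℂ H) = c • MonoidAlgebra.single s 1 := by
      simp
    rw [h5, p.smul]
    exact mul_le_of_le_one_right (norm_nonneg c) h4

/-- The largest C*-seminorm on the complex group algebra. -/
noncomputable def groupNorm : CStarSeminorm (MonoidAlgebra ℂ H) :=
  CStarSeminorm.sup Set.univ (groupSeminorms_bdd H)

/-- The full group C*-algebra of a discrete group: the enveloping C*-algebra of its complex group
algebra. -/
def GroupCStar : Type u := (groupNorm H).Completion

noncomputable instance : NonUnitalCStarAlgebra (GroupCStar H) :=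
  inferInstanceAs (NonUnitalCStarAlgebra (groupNorm H).Completion)

variable {H}

namespace GroupCStar

/-- The canonical map of the complex group algebra into the group C*-algebra. -/
noncomputable def coeHom : MonoidAlgebra ℂ H →⋆ₙₐ[ℂ] GroupCStar H := (groupNorm H).coeHom

/-- The canonical image of a group element in the group C*-algebra. -/
noncomputable def of (s : H) : GroupCStar H := coeHom (MonoidAlgebra.single s 1)

theorem of_mul (s t : H) : of (s * t) = of s * of t := by
  rw [of, of, of, ← map_mul, MonoidAlgebra.single_mul_single, mul_one]

theorem star_of (s : H) : star (of s) = of s⁻¹ := by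
  rw [of, of, ← map_star, groupAlg_star_single, star_one]

/-- The map `s ↦ s ⊗ s` on the group. -/
noncomputable def diag : H →ₙ* SpatialTensor (GroupCStar H) (GroupCStar H) where
  toFun s := SpatialTensor.tmul (of s) (of s)
  map_mul' s t := by
    rw [of_mul, SpatialTensor.tmul_mul_tmul]

/-- The comultiplication on the complex group algebra. -/
noncomputable def preComul :
    MonoidAlgebra ℂ H →⋆ₙₐ[ℂ] SpatialTensor (GroupCStar H) (GroupCStar H) :=
  { MonoidAlgebra.liftMagma ℂ diag with
    map_star' := fun f => by
      change MonoidAlgebra.liftMagma ℂ diag (star f) = star (MonoidAlgebra.liftMagma ℂ diag f)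
      induction f using MonoidAlgebra.induction_linear with
      | zero => simp
      | add f g hf hg => rw [star_add, map_add, hf, hg, map_add, star_add]
      | single s c =>
        rw [groupAlg_star_single]
        simp [MonoidAlgebra.liftMagma, diag, SpatialTensor.star_tmul, star_of] }

theorem preComul_single (s : H) :
    preComul (MonoidAlgebra.single s 1) = SpatialTensor.tmul (of s) (of s) := by
  change MonoidAlgebra.liftMagma ℂ diag _ = _
  simp [MonoidAlgebra.liftMagma, diag]

/-- The comultiplication `δ_H : C*(H) → C*(H) ⊗ C*(H)`, the *-homomorphism with
`δ_H(s) = s ⊗ s`. -/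
noncomputable def comul : GroupCStar H →⋆ₙₐ[ℂ] SpatialTensor (GroupCStar H) (GroupCStar H) :=
  (groupNorm H).lift preComul fun f =>
    CStarSeminorm.le_sup _ (groupSeminorms_bdd H) (CStarSeminorm.ofHom preComul)
      (Set.mem_univ _) f

theorem comul_of (s : H) : comul (of s) = SpatialTensor.tmul (of s) (of s) :=
  ((groupNorm H).lift_coe _ _ _).trans (preComul_single s)

end GroupCStar

end GroupAlgebra

/-! ### Coactions of discrete groups -/

open scoped ZeroAtInfty MultiplierAlgebra

/-- `x` and `y` correspond under the canonical isomorphism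
`(A ⊗ B) ⊗ C ≅ A ⊗ (B ⊗ C)`, `(a ⊗ b) ⊗ c ↦ a ⊗ (b ⊗ c)`: the pair `(x, y)` is in the graph of
that isomorphism, which is the closed span of the pairs `((a ⊗ b) ⊗ c, a ⊗ (b ⊗ c))`. -/
def SpatialTensor.AssocRel {A B C : Type u} [NonUnitalCStarAlgebra A] [NonUnitalCStarAlgebra B]
    [NonUnitalCStarAlgebra C] (x : SpatialTensor (SpatialTensor A B) C)
    (y : SpatialTensor A (SpatialTensor B C)) : Prop :=
  (x, y) ∈ (Submodule.span ℂ
    {z : SpatialTensor (SpatialTensor A B) C × SpatialTensor A (SpatialTensor B C) |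
      ∃ a b c, z = (tmul (tmul a b) c, tmul a (tmul b c))}).topologicalClosure

/-- `x = m ⊗ c` for a multiplier `m` of `A` and `c ∈ C`: the multiplier `x` of `A ⊗ C` is
characterized by `x (a ⊗ d) = m a ⊗ c d`. Here `m.fst a` is the product `m a` and `m.snd a` is the
product `a m` of a multiplier `m` and `a ∈ A`. -/
def SpatialTensor.IsMulTensor {A C : Type u} [NonUnitalCStarAlgebra A] [NonUnitalCStarAlgebra C]
    (m : 𝓜(ℂ, A)) (c : C) (x : 𝓜(ℂ, SpatialTensor A C)) : Prop :=
  ∀ a d, x.fst (tmul a d) = tmul (m.fst a) (c * d)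

/-- A coaction of the discrete group `H` on the C*-algebra `D`: an injective, nondegenerate
*-homomorphism `δ : D → D ⊗ C*(H)` satisfying the coaction identity. -/
structure Coaction (H D : Type u) [Group H] [NonUnitalCStarAlgebra D] where
  toHom : D →⋆ₙₐ[ℂ] SpatialTensor D (GroupCStar H)
  injective : Function.Injective toHom
  /-- Nondegeneracy: the closed span of `δ(D)(1 ⊗ C*(H))` is `D ⊗ C*(H)`. In particular, the
  closed span of `δ(D)(D ⊗ C*(H))` is `D ⊗ C*(H)`. -/
  nondegenerate : (Submodule.span ℂ {z : SpatialTensor D (GroupCStar H) |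
    ∃ a c x, SpatialTensor.IsMulTensor 1 c x ∧ z = x.snd (toHom a)}).topologicalClosure = ⊤
  /-- `(δ ⊗ id) ∘ δ = (id ⊗ δ_H) ∘ δ` -/
  coassoc : ∀ a, SpatialTensor.AssocRel
    (SpatialTensor.map toHom (NonUnitalStarAlgHom.id ℂ (GroupCStar H)) (toHom a))
    (SpatialTensor.map (NonUnitalStarAlgHom.id ℂ D) GroupCStar.comul (toHom a))

/-- A *-homomorphism `π : A → M(B)` is nondegenerate if `π(A)B` has dense span in `B`. -/
def IsNondegenerateHom {A : Type v} {B : Type u} [NonUnitalCStarAlgebra A]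
    [NonUnitalCStarAlgebra B] (π : A →⋆ₙₐ[ℂ] 𝓜(ℂ, B)) : Prop :=
  (Submodule.span ℂ {z : B | ∃ a b, z = (π a).fst b}).topologicalClosure = ⊤

open Classical in
/-- The characteristic function of the singleton `{t}`, as an element of `c₀(H)`. -/
noncomputable def c0Single {H : Type u} (t : H) : C₀(WithDiscreteTopology H, ℂ) where
  toFun s := if s.ofTopology = t then 1 else 0
  continuous_toFun := continuous_of_discreteTopology
  zero_at_infty' := by
    rw [Filter.cocompact_eq_cofinite]
    refine tendsto_const_nhds.congr' ?_
    refine Filter.mem_of_superset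
      (Set.finite_singleton (WithTopology.toTopology _ t)).compl_mem_cofinite ?_
    intro s hs
    have : s.ofTopology ≠ t := fun h => hs (by rw [← h]; rfl)
    simp [this]

namespace Coaction

variable {H D : Type u} [Group H] [NonUnitalCStarAlgebra D] (δ : Coaction H D)

/-- The spectral subspace `{a | δ(a) = a ⊗ s}`. -/
def spectralSubspace (s : H) : Set D :=
  {a | δ.toHom a = SpatialTensor.tmul a (GroupCStar.of s)}

/-- A covariant representation `(π, μ)` of a coaction in the multiplier algebra `M(B)`. -/
structure CovariantRep (B : Type u) [NonUnitalCStarAlgebra B] where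
  onAlg : D →⋆ₙₐ[ℂ] 𝓜(ℂ, B)
  onC0 : C₀(WithDiscreteTopology H, ℂ) →⋆ₙₐ[ℂ] 𝓜(ℂ, B)
  nondegenerate_onAlg : IsNondegenerateHom onAlg
  nondegenerate_onC0 : IsNondegenerateHom onC0
  covariant : ∀ s t, ∀ a ∈ δ.spectralSubspace s,
    onAlg a * onC0 (c0Single t) = onC0 (c0Single (s * t)) * onAlg a

variable {δ}

/-- The C*-algebra `C*(π, μ)`, the closed span of `π(D)μ(c₀(H))`. By covariance that closed span
is a C*-algebra, so it is the C*-algebra generated by the products `π(a)μ(f)`. -/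
noncomputable def CovariantRep.algebra {B : Type u} [NonUnitalCStarAlgebra B]
    (P : δ.CovariantRep B) : NonUnitalStarSubalgebra ℂ 𝓜(ℂ, B) :=
  (NonUnitalStarAlgebra.adjoin ℂ
    {z : 𝓜(ℂ, B) | ∃ a f, z = P.onAlg a * P.onC0 f}).topologicalClosure

theorem CovariantRep.mul_mem {B : Type u} [NonUnitalCStarAlgebra B] (P : δ.CovariantRep B)
    (a : D) (f : C₀(WithDiscreteTopology H, ℂ)) : P.onAlg a * P.onC0 f ∈ P.algebra :=
  NonUnitalStarSubalgebra.le_topologicalClosure _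
    (NonUnitalStarAlgebra.subset_adjoin ℂ _ ⟨a, f, rfl⟩)

/-- `C*(π, μ)` is a crossed product if every covariant representation `(ρ, ν)` factors through it:
there is a *-homomorphism `Θ = ρ × ν` of `C*(π, μ)` into `C*(ρ, ν)` with `Θ ∘ π = ρ` and
`Θ ∘ μ = ν`, that is, with `Θ(π(a)μ(f)) = ρ(a)ν(f)`. -/
def CovariantRep.IsCrossedProduct {B : Type u} [NonUnitalCStarAlgebra B]
    (P : δ.CovariantRep B) : Prop :=
  ∀ (E : Type u) [NonUnitalCStarAlgebra E] (Q : δ.CovariantRep E),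
    ∃ Θ : P.algebra →⋆ₙₐ[ℂ] Q.algebra,
      ∀ a f, (Θ ⟨P.onAlg a * P.onC0 f, P.mul_mem a f⟩ : 𝓜(ℂ, E)) = Q.onAlg a * Q.onC0 f

variable (δ)

/-- The coaction is normal if the canonical homomorphism `j_D` of `D` into the multipliers of the
crossed product is faithful. -/
def IsNormal : Prop :=
  ∃ (B : Type u) (_ : NonUnitalCStarAlgebra B) (P : δ.CovariantRep B),
    P.IsCrossedProduct ∧ Function.Injective P.onAlg

/-- `δ(m) = m ⊗ s` for a multiplier `m` of `D` and `s ∈ H`. The extension of the nondegenerate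
homomorphism `δ` to multipliers is determined by `δ(m) δ(a) = δ(m a)`, so the equation says that the
multiplier `x = m ⊗ s` of `D ⊗ C*(H)` satisfies `x δ(a) = δ(m a)` for all `a`. -/
def MapsMultiplier (m : 𝓜(ℂ, D)) (s : H) : Prop :=
  ∃ x : 𝓜(ℂ, SpatialTensor D (GroupCStar H)),
    SpatialTensor.IsMulTensor m (GroupCStar.of s) x ∧ ∀ a, x.fst (δ.toHom a) = δ.toHom (m.fst a)

end Coaction

/-! ### Fell bundles over discrete groups -/

/-- A Fell bundle (C*-algebraic bundle) over the discrete group `H`. The product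
`A_s × A_t → A_{st}` is given as maps `A_s × A_t → A_r`, one for every proof of `s t = r`, and
the involution `A_s → A_{s⁻¹}` is given in the same way. -/
structure FellBundle (H : Type v) [Group H] where
  Fiber : H → Type u
  [normedAddCommGroup : ∀ s, NormedAddCommGroup (Fiber s)]
  [normedSpace : ∀ s, NormedSpace ℂ (Fiber s)]
  [completeSpace : ∀ s, CompleteSpace (Fiber s)]
  mul {s t r : H} (h : s * t = r) : Fiber s → Fiber t → Fiber r
  inv {s r : H} (h : s⁻¹ = r) : Fiber s → Fiber r
  add_mul {s t r : H} (h : s * t = r) (a a' : Fiber s) (b : Fiber t) :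
    mul h (a + a') b = mul h a b + mul h a' b
  mul_add {s t r : H} (h : s * t = r) (a : Fiber s) (b b' : Fiber t) :
    mul h a (b + b') = mul h a b + mul h a b'
  smul_mul {s t r : H} (h : s * t = r) (c : ℂ) (a : Fiber s) (b : Fiber t) :
    mul h (c • a) b = c • mul h a b
  mul_smul {s t r : H} (h : s * t = r) (c : ℂ) (a : Fiber s) (b : Fiber t) :
    mul h a (c • b) = c • mul h a b
  mul_assoc {s t r x y z : H} (h₁ : s * t = x) (h₂ : x * r = z) (h₃ : t * r = y) (h₄ : s * y = z)
    (a : Fiber s) (b : Fiber t) (c : Fiber r) : mul h₂ (mul h₁ a b) c = mul h₄ a (mul h₃ b c)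
  inv_add {s r : H} (h : s⁻¹ = r) (a b : Fiber s) : inv h (a + b) = inv h a + inv h b
  inv_smul {s r : H} (h : s⁻¹ = r) (c : ℂ) (a : Fiber s) :
    inv h (c • a) = (starRingEnd ℂ) c • inv h a
  inv_inv {s r : H} (h : s⁻¹ = r) (h' : r⁻¹ = s) (a : Fiber s) : inv h' (inv h a) = a
  inv_mul {s t r s' t' r' : H} (h : s * t = r) (hr : r⁻¹ = r') (hs : s⁻¹ = s') (ht : t⁻¹ = t')
    (h' : t' * s' = r') (a : Fiber s) (b : Fiber t) :
    inv hr (mul h a b) = mul h' (inv ht b) (inv hs a)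
  norm_mul_le {s t r : H} (h : s * t = r) (a : Fiber s) (b : Fiber t) :
    ‖mul h a b‖ ≤ ‖a‖ * ‖b‖
  norm_inv {s r : H} (h : s⁻¹ = r) (a : Fiber s) : ‖inv h a‖ = ‖a‖
  /-- `‖a* a‖ = ‖a‖²` -/
  norm_inv_mul_self {s : H} (a : Fiber s) :
    ‖mul (inv_mul_cancel s) (inv rfl a) a‖ = ‖a‖ ^ 2
  /-- `a* a` is positive in the C*-algebra `A_e`. -/
  positive {s : H} (a : Fiber s) : ∃ b : Fiber 1,
    mul (inv_mul_cancel s) (inv rfl a) a = mul (one_mul 1) (inv inv_one b) b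

namespace FellBundle

attribute [instance] normedAddCommGroup normedSpace completeSpace

section Iso

variable {H : Type v} [Group H]

/-- Isomorphisms of Fell bundles over `H`. -/
structure Iso (𝒜 ℬ : FellBundle.{u} H) where
  equiv (s : H) : 𝒜.Fiber s ≃ₗᵢ[ℂ] ℬ.Fiber s
  map_mul {s t r : H} (h : s * t = r) (a : 𝒜.Fiber s) (b : 𝒜.Fiber t) :
    equiv r (𝒜.mul h a b) = ℬ.mul h (equiv s a) (equiv t b)
  map_inv {s r : H} (h : s⁻¹ = r) (a : 𝒜.Fiber s) : equiv r (𝒜.inv h a) = ℬ.inv h (equiv s a)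

end Iso

section Multiplier

variable {H : Type v} [Group H]

/-- A multiplier `m` of order `s` of a Fell bundle: a pair of maps `a ↦ m a` and `a ↦ a m` of the
bundle to itself, taking `A_t` into `A_{st}` and `A_{ts}` respectively, such that
`(a m) b = a (m b)`. -/
structure Multiplier (𝒜 : FellBundle.{u} H) where
  order : H
  left {t r : H} (h : order * t = r) : 𝒜.Fiber t → 𝒜.Fiber r
  right {t r : H} (h : t * order = r) : 𝒜.Fiber t → 𝒜.Fiber r
  right_mul {t t' x y z : H} (h₁ : t * order = x) (h₂ : x * t' = z) (h₃ : order * t' = y)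
    (h₄ : t * y = z) (a : 𝒜.Fiber t) (b : 𝒜.Fiber t') :
    𝒜.mul h₂ (right h₁ a) b = 𝒜.mul h₄ a (left h₃ b)

namespace Multiplier

variable {𝒜 : FellBundle.{u} H}

theorem ext' {m n : 𝒜.Multiplier} (ho : m.order = n.order)
    (hl : ∀ {t r : H} (h : m.order * t = r) (h' : n.order * t = r) (a : 𝒜.Fiber t),
      m.left h a = n.left h' a)
    (hr : ∀ {t r : H} (h : t * m.order = r) (h' : t * n.order = r) (a : 𝒜.Fiber t),
      m.right h a = n.right h' a) : m = n := by
  obtain ⟨o, l, r, _⟩ := m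
  obtain ⟨o', l', r', _⟩ := n
  obtain rfl : o = o' := ho
  congr
  · funext t x h a; exact hl h h a
  · funext t x h a; exact hr h h a

theorem left_left (m n : 𝒜.Multiplier) {t x x' r : H} (h₁ : n.order * t = x)
    (h₂ : m.order * x = r) (h₁' : n.order * t = x') (h₂' : m.order * x' = r) (a : 𝒜.Fiber t) :
    m.left h₂ (n.left h₁ a) = m.left h₂' (n.left h₁' a) := by
  subst h₁; subst h₁'; rfl

theorem right_right (m n : 𝒜.Multiplier) {t x x' r : H} (h₁ : t * n.order = x)
    (h₂ : x * m.order = r) (h₁' : t * n.order = x') (h₂' : x' * m.order = r) (a : 𝒜.Fiber t) :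
    m.right h₂ (n.right h₁ a) = m.right h₂' (n.right h₁' a) := by
  subst h₁; subst h₁'; rfl

/-- The product: `(m n) a = m (n a)` and `a (m n) = (a m) n`. -/
instance : Mul 𝒜.Multiplier where
  mul m n :=
    { order := m.order * n.order
      left := fun {t r} h a => m.left (t := n.order * t) (by rw [← h, _root_.mul_assoc])
        (n.left rfl a)
      right := fun {t r} h a => n.right (t := t * m.order) (by rw [← h, _root_.mul_assoc])
        (m.right rfl a)
      right_mul := fun {t t' x y z} h₁ h₂ h₃ h₄ a b => by
        rw [n.right_mul (y := n.order * t') (z := z) _ _ rfl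
          (by rw [← h₂, ← h₁]; simp only [_root_.mul_assoc])]
        exact m.right_mul _ _ _ _ a _ }

/-- The identity multiplier. -/
instance : One 𝒜.Multiplier where
  one :=
    { order := 1
      left := fun {t r} h a => (show t = r by simpa using h) ▸ a
      right := fun {t r} h a => (show t = r by simpa using h) ▸ a
      right_mul := fun {t t' x y z} h₁ h₂ h₃ h₄ a b => by
        obtain rfl : t = x := by simpa using h₁
        obtain rfl : t' = y := by simpa using h₃
        rfl }

/-- The adjoint: `m* a = (a* m)*` and `a m* = (m a*)*`. -/
instance : Star 𝒜.Multiplier where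
  star m :=
    { order := m.order⁻¹
      left := fun {t r} h a => 𝒜.inv (s := t⁻¹ * m.order) (by rw [← h]; simp)
        (m.right rfl (𝒜.inv rfl a))
      right := fun {t r} h a => 𝒜.inv (s := m.order * t⁻¹) (by rw [← h]; simp)
        (m.left rfl (𝒜.inv rfl a))
      right_mul := fun {t t' x y z} h₁ h₂ h₃ h₄ a b => by
        have key := m.right_mul (t := t'⁻¹) (t' := t⁻¹) (z := z⁻¹) rfl
          (by rw [← h₂, ← h₁]; group) rfl (by rw [← h₂, ← h₁]; group) (𝒜.inv rfl b) (𝒜.inv rfl a)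
        have key' := congrArg (𝒜.inv (_root_.inv_inv z)) key
        rw [𝒜.inv_mul (s' := y) (t' := t) (r' := z) _ _ (by rw [← h₃]; group) (by group) h₄,
          𝒜.inv_mul (s' := t') (t' := x) (r' := z) _ _ (by group) (by rw [← h₁]; group) h₂,
          𝒜.inv_inv, 𝒜.inv_inv] at key'
        exact key'.symm }

@[simp] theorem mul_order (m n : 𝒜.Multiplier) : (m * n).order = m.order * n.order := rfl
@[simp] theorem one_order : (1 : 𝒜.Multiplier).order = 1 := rfl
@[simp] theorem star_order (m : 𝒜.Multiplier) : (star m).order = m.order⁻¹ := rfl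

theorem mul_left' (m n : 𝒜.Multiplier) {t x r : H} (h : (m * n).order * t = r)
    (h₁ : n.order * t = x) (h₂ : m.order * x = r) (a : 𝒜.Fiber t) :
    (m * n).left h a = m.left h₂ (n.left h₁ a) := by
  subst h₁; rfl

theorem mul_right' (m n : 𝒜.Multiplier) {t x r : H} (h : t * (m * n).order = r)
    (h₁ : t * m.order = x) (h₂ : x * n.order = r) (a : 𝒜.Fiber t) :
    (m * n).right h a = n.right h₂ (m.right h₁ a) := by
  subst h₁; rfl

theorem one_left' {t : H} (h : (1 : 𝒜.Multiplier).order * t = t) (a : 𝒜.Fiber t) :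
    (1 : 𝒜.Multiplier).left h a = a := rfl

theorem one_right' {t : H} (h : t * (1 : 𝒜.Multiplier).order = t) (a : 𝒜.Fiber t) :
    (1 : 𝒜.Multiplier).right h a = a := rfl

theorem star_left' (m : 𝒜.Multiplier) {t t' x r : H} (h : (star m).order * t = r)
    (h₁ : t⁻¹ = t') (h₂ : t' * m.order = x) (h₃ : x⁻¹ = r) (a : 𝒜.Fiber t) :
    (star m).left h a = 𝒜.inv h₃ (m.right h₂ (𝒜.inv h₁ a)) := by
  subst h₁; subst h₂; rfl

theorem star_right' (m : 𝒜.Multiplier) {t t' x r : H} (h : t * (star m).order = r)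
    (h₁ : t⁻¹ = t') (h₂ : m.order * t' = x) (h₃ : x⁻¹ = r) (a : 𝒜.Fiber t) :
    (star m).right h a = 𝒜.inv h₃ (m.left h₂ (𝒜.inv h₁ a)) := by
  subst h₁; subst h₂; rfl

instance : Monoid 𝒜.Multiplier where
  mul_assoc m n k := by
    refine ext' (_root_.mul_assoc _ _ _) (fun {t r} h h' a => ?_) (fun {t r} h h' a => ?_)
    · have e : m.order * (n.order * (k.order * t)) = r := by
        rw [← h']; simp [_root_.mul_assoc]
      have e' : (m * n).order * (k.order * t) = r := by rw [← e, mul_order, _root_.mul_assoc]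
      have e'' : (n * k).order * t = n.order * (k.order * t) := by
        rw [mul_order, _root_.mul_assoc]
      rw [mul_left' (m * n) k h rfl e', mul_left' m n e' rfl e,
        mul_left' m (n * k) h' e'' e, mul_left' n k e'' rfl rfl]
    · have e : t * m.order * n.order * k.order = r := by
        rw [← h']; simp [_root_.mul_assoc]
      have e' : t * m.order * (n * k).order = r := by
        rw [← e, mul_order]; simp only [_root_.mul_assoc]
      have e'' : t * (m * n).order = t * m.order * n.order := by
        rw [mul_order, _root_.mul_assoc]
      rw [mul_right' (m * n) k h e'' e, mul_right' m n e'' rfl rfl,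
        mul_right' m (n * k) h' rfl e', mul_right' n k e' rfl e]
  one_mul m := by
    refine ext' (_root_.one_mul _) (fun {t r} h h' a => ?_) (fun {t r} h h' a => ?_)
    · rw [mul_left' 1 m h h' (_root_.one_mul r)]; rfl
    · rw [mul_right' 1 m h (_root_.mul_one t) h']; rfl
  mul_one m := by
    refine ext' (_root_.mul_one _) (fun {t r} h h' a => ?_) (fun {t r} h h' a => ?_)
    · rw [mul_left' m 1 h (_root_.one_mul t) h']; rfl
    · rw [mul_right' m 1 h h' (_root_.mul_one r)]; rfl

instance : StarMul 𝒜.Multiplier where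
  star_involutive m := by
    refine ext' (_root_.inv_inv _) (fun {t r} h h' a => ?_) (fun {t r} h h' a => ?_)
    · rw [star_left' (star m) h rfl (x := r⁻¹) (by rw [← h']; simp) (_root_.inv_inv r),
        star_right' m _ (_root_.inv_inv t) h' rfl, 𝒜.inv_inv, 𝒜.inv_inv]
    · rw [star_right' (star m) h rfl (x := r⁻¹) (by rw [← h']; simp) (_root_.inv_inv r),
        star_left' m _ (_root_.inv_inv t) h' rfl, 𝒜.inv_inv, 𝒜.inv_inv]
  star_mul m n := by
    refine ext' (_root_.mul_inv_rev _ _) (fun {t r} h h' a => ?_) (fun {t r} h h' a => ?_)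
    · have e : t⁻¹ * m.order * n.order = r⁻¹ := by rw [← h']; simp [_root_.mul_assoc]
      have e₁ : t⁻¹ * (m * n).order = r⁻¹ := by rw [← e, mul_order, _root_.mul_assoc]
      have e₂ : (star m).order * t = (t⁻¹ * m.order)⁻¹ := by simp
      have e₃ : (star n).order * (t⁻¹ * m.order)⁻¹ = r := by
        rw [← _root_.inv_inv r, ← e]; simp
      rw [star_left' (m * n) h rfl e₁ (_root_.inv_inv r), mul_right' m n e₁ rfl e,
        mul_left' (star n) (star m) h' e₂ e₃, star_left' m e₂ rfl rfl rfl,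
        star_left' n e₃ (_root_.inv_inv _) e (_root_.inv_inv r), 𝒜.inv_inv]
    · have e : m.order * (n.order * t⁻¹) = r⁻¹ := by rw [← h']; simp [_root_.mul_assoc]
      have e₁ : (m * n).order * t⁻¹ = r⁻¹ := by rw [← e, mul_order, _root_.mul_assoc]
      have e₂ : t * (star n).order = (n.order * t⁻¹)⁻¹ := by simp
      have e₃ : (n.order * t⁻¹)⁻¹ * (star m).order = r := by
        rw [← _root_.inv_inv r, ← e]; simp
      rw [star_right' (m * n) h rfl e₁ (_root_.inv_inv r), mul_left' m n e₁ rfl e,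
        mul_right' (star n) (star m) h' e₂ e₃, star_right' n e₂ rfl rfl rfl,
        star_right' m e₃ (_root_.inv_inv _) e (_root_.inv_inv r), 𝒜.inv_inv]

end Multiplier

end Multiplier

section CrossSections

variable {H : Type v} [Group H] (𝒜 : FellBundle.{u} H)

/-- The finitely supported sections of a Fell bundle. -/
abbrev Sections : Type (max u v) := Π₀ s, 𝒜.Fiber s

open Classical in
/-- The convolution product of finitely supported sections. -/
noncomputable def conv (f g : 𝒜.Sections) : 𝒜.Sections :=
  f.sum fun s a => g.sum fun t b => DFinsupp.single (s * t) (𝒜.mul rfl a b)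

open Classical in
/-- The norm `‖∑ g(t)* g(t)‖^{1/2}` of the Hilbert `A_e`-module `ℓ²(𝒜)`, on finitely supported
sections. -/
noncomputable def l2Norm (g : 𝒜.Sections) : ℝ :=
  √‖g.sum fun t a => 𝒜.mul (inv_mul_cancel t) (𝒜.inv rfl a) a‖

/-- The reduced norm of a finitely supported section `f`: the norm of the operator
`λ(f) : g ↦ f * g` of the regular representation `λ` on the Hilbert module `ℓ²(𝒜)`. -/
noncomputable def reducedNorm (f : 𝒜.Sections) : ℝ :=
  sSup {r | ∃ g : 𝒜.Sections, 𝒜.l2Norm g ≤ 1 ∧ r = 𝒜.l2Norm (𝒜.conv f g)}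

open Classical in
/-- The C*-algebra `D` is isomorphic to the reduced cross sectional algebra `C*_r(𝒜)`, the
completion of the *-algebra of finitely supported sections in the reduced norm: there is a
*-homomorphism of that *-algebra into `D`, given by linear maps `ι_s : A_s → D`, with dense range
and with `‖ι(f)‖ = ‖f‖_r`. -/
def IsReducedSectionalAlgebra (D : Type w) [NonUnitalCStarAlgebra D] : Prop :=
  ∃ ι : ∀ s, 𝒜.Fiber s →ₗ[ℂ] D,
    (∀ s t (a : 𝒜.Fiber s) (b : 𝒜.Fiber t), ι (s * t) (𝒜.mul rfl a b) = ι s a * ι t b) ∧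
    (∀ s (a : 𝒜.Fiber s), ι s⁻¹ (𝒜.inv rfl a) = star (ι s a)) ∧
    DenseRange (fun f : 𝒜.Sections => f.sum fun s a => ι s a) ∧
    ∀ f : 𝒜.Sections, ‖f.sum fun s a => ι s a‖ = 𝒜.reducedNorm f

end CrossSections

end FellBundle

/-! ### Twisted actions and their semidirect product bundles -/

/-- A twisted action `(B, G, N, α, τ)` in the sense of Green: an action `α` of the discrete group
`G` on the C*-algebra `B` and a homomorphism `τ` of the normal subgroup `N` into the unitary
multipliers of `B` with `α_s(τ_n) = τ_{s n s⁻¹}` and `α_n(b) = τ_n b τ_{n⁻¹}`. For a multiplier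
`m`, `m.fst b` is `m b` and `m.snd b` is `b m`; the first equation says that
`α_s(τ_n b) = τ_{s n s⁻¹} α_s(b)` for all `b`. -/
structure TwistedAction {G : Type v} [Group G] (N : Subgroup G) [N.Normal] (B : Type u)
    [NonUnitalCStarAlgebra B] where
  act : G →* (B ≃⋆ₐ[ℂ] B)
  twist : N →* unitary 𝓜(ℂ, B)
  act_twist (s : G) (n : N) (b : B) : act s ((twist n : 𝓜(ℂ, B)).fst b) =
    (twist ⟨s * n * s⁻¹, ‹N.Normal›.conj_mem n n.2 s⟩ : 𝓜(ℂ, B)).fst (act s b)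
  act_coe (n : N) (b : B) : act (n : G) b =
    (twist n : 𝓜(ℂ, B)).fst ((twist n⁻¹ : 𝓜(ℂ, B)).snd b)

namespace TwistedAction

variable {G : Type v} [Group G] {N : Subgroup G} [N.Normal] {B : Type u}
  [NonUnitalCStarAlgebra B] (T : TwistedAction N B)

/-- The product `b τ_n`. -/
noncomputable def rmul (n : N) : B →L[ℂ] B := (T.twist n : 𝓜(ℂ, B)).snd

/-- The product `τ_n b`. -/
noncomputable def lmul (n : N) : B →L[ℂ] B := (T.twist n : 𝓜(ℂ, B)).fst

theorem rmul_mul (n m : N) (b : B) : T.rmul (n * m) b = T.rmul m (T.rmul n b) := by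
  simp [rmul]

theorem lmul_mul (n m : N) (b : B) : T.lmul (n * m) b = T.lmul n (T.lmul m b) := by
  simp [lmul]

theorem rmul_one (b : B) : T.rmul 1 b = b := by
  simp [rmul]

theorem lmul_one (b : B) : T.lmul 1 b = b := by
  simp [lmul]

theorem rmul_mul_eq (n : N) (a b : B) : T.rmul n a * b = a * T.lmul n b :=
  (T.twist n : 𝓜(ℂ, B)).central a b

theorem eq_of_mul_right {a b : B} (h : ∀ c, a * c = b * c) : a = b := by
  rw [← sub_eq_zero, ← CStarRing.mul_star_self_eq_zero_iff, sub_mul, h, sub_self]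

theorem eq_of_mul_left {a b : B} (h : ∀ c, c * a = c * b) : a = b := by
  rw [← sub_eq_zero, ← CStarRing.star_mul_self_eq_zero_iff, mul_sub, h, sub_self]

theorem mul_rmul (n : N) (a b : B) : a * T.rmul n b = T.rmul n (a * b) :=
  eq_of_mul_right fun c => by rw [mul_assoc, rmul_mul_eq, rmul_mul_eq, mul_assoc]

theorem lmul_mul_eq (n : N) (a b : B) : T.lmul n a * b = T.lmul n (a * b) :=
  eq_of_mul_left fun c => by rw [← mul_assoc, ← rmul_mul_eq, ← rmul_mul_eq, mul_assoc]

theorem rmul_lmul (n m : N) (b : B) : T.rmul n (T.lmul m b) = T.lmul m (T.rmul n b) :=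
  eq_of_mul_right fun c => by rw [rmul_mul_eq, lmul_mul_eq, lmul_mul_eq, rmul_mul_eq]

theorem star_rmul (n : N) (b : B) : star (T.rmul n b) = T.lmul n⁻¹ (star b) := by
  have h : (T.twist n⁻¹ : 𝓜(ℂ, B)) = star (T.twist n : 𝓜(ℂ, B)) := by
    rw [map_inv]; rfl
  rw [lmul, h, DoubleCentralizer.star_fst, star_star, rmul]

theorem norm_rmul (n : N) (b : B) : ‖T.rmul n b‖ = ‖b‖ := by
  have h : T.rmul n b * star (T.rmul n b) = b * star b := by
    rw [star_rmul, rmul_mul_eq, ← lmul_mul, mul_inv_cancel, lmul_one]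
  have h2 := congrArg norm h
  rw [CStarRing.norm_self_mul_star, CStarRing.norm_self_mul_star] at h2
  exact (mul_self_inj (norm_nonneg _) (norm_nonneg _)).mp h2

/-- The conjugate `s n s⁻¹` in `N`. -/
def conj (_T : TwistedAction N B) (s : G) (n : N) : N :=
  ⟨s * n * s⁻¹, ‹N.Normal›.conj_mem n n.2 s⟩

theorem act_lmul (s : G) (n : N) (b : B) :
    T.act s (T.lmul n b) = T.lmul (T.conj s n) (T.act s b) :=
  T.act_twist s n b

theorem act_mul_apply (s t : G) (b : B) : T.act (s * t) b = T.act s (T.act t b) := by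
  rw [map_mul]; rfl

theorem act_one_apply (b : B) : T.act 1 b = b := by
  rw [map_one]; rfl

theorem act_rmul (s : G) (n : N) (b : B) :
    T.act s (T.rmul n b) = T.rmul (T.conj s n) (T.act s b) := by
  refine eq_of_mul_right fun c => ?_
  obtain ⟨d, rfl⟩ := (T.act s).surjective c
  change T.act s (T.rmul n b) * T.act s d = T.rmul (T.conj s n) (T.act s b) * T.act s d
  rw [← map_mul, rmul_mul_eq, map_mul, act_lmul, rmul_mul_eq]

theorem act_coe' (n : N) (b : B) : T.act (n : G) b = T.lmul n (T.rmul n⁻¹ b) :=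
  T.act_coe n b

theorem norm_act (s : G) (b : B) : ‖T.act s b‖ = ‖b‖ := StarAlgEquiv.norm_map (T.act s) b

/-- The fiber over `x ∈ G/N` of the twisted semidirect product bundle. The group `N` acts from the
right on `B × G` by `(b, s) · n = (b τ_n, n⁻¹ s)`, and the fiber is the set of orbits `[b, s]` with
`s N = x`. Such an orbit is the graph of a function `x → B`, and the functions that occur are those
with `f(n⁻¹ s) = f(s) τ_n`; they are extended by `0` to `G`. -/
def fiber (x : G ⧸ N) : Submodule ℂ (G → B) where
  carrier := {f | (∀ s : G, (s : G ⧸ N) ≠ x → f s = 0) ∧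
    ∀ (n : N) (s : G), f ((n : G)⁻¹ * s) = T.rmul n (f s)}
  add_mem' {f g} hf hg := ⟨fun s hs => by rw [Pi.add_apply, hf.1 s hs, hg.1 s hs, add_zero],
    fun n s => by rw [Pi.add_apply, Pi.add_apply, hf.2, hg.2, map_add]⟩
  zero_mem' := ⟨fun _ _ => rfl, fun n s => by simp⟩
  smul_mem' c f hf := ⟨fun s hs => by rw [Pi.smul_apply, hf.1 s hs, smul_zero],
    fun n s => by rw [Pi.smul_apply, Pi.smul_apply, hf.2, map_smul]⟩

/-- The fiber over `x ∈ G/N` of the twisted semidirect product bundle, as a type. -/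
def Fib (x : G ⧸ N) : Type (max u v) := T.fiber x

instance (x : G ⧸ N) : AddCommGroup (T.Fib x) := inferInstanceAs (AddCommGroup (T.fiber x))
instance (x : G ⧸ N) : Module ℂ (T.Fib x) := inferInstanceAs (Module ℂ (T.fiber x))

variable {T} {x y z : G ⧸ N}

theorem coe_inv_mul (n : N) (s : G) : (((n : G)⁻¹ * s : G) : G ⧸ N) = s := by
  rw [QuotientGroup.mk_mul, (QuotientGroup.eq_one_iff ((n : G)⁻¹)).mpr (N.inv_mem n.2), one_mul]

theorem exists_inv_mul {s t : G} (h : (t : G ⧸ N) = s) : ∃ n : N, t = (n : G)⁻¹ * s := by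
  refine ⟨⟨s * t⁻¹, ?_⟩, by simp⟩
  rw [← QuotientGroup.eq_one_iff, QuotientGroup.mk_mul, QuotientGroup.mk_inv, h, mul_inv_cancel]

theorem fiber_ext {f g : T.Fib x} {s : G} (hs : (s : G ⧸ N) = x) (h : f.1 s = g.1 s) :
    f = g := by
  refine Subtype.ext (funext fun t => ?_)
  by_cases ht : (t : G ⧸ N) = x
  · obtain ⟨n, rfl⟩ := exists_inv_mul (ht.trans hs.symm)
    rw [f.2.2, g.2.2, h]
  · rw [f.2.1 t ht, g.2.1 t ht]

variable (T) in
open Classical in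
/-- The orbit `[b, s]` of `(b, s) ∈ B × G`, as an element of the fiber over `s N`. -/
noncomputable def orbit (b : B) (s : G) (hs : (s : G ⧸ N) = x) : T.Fib x :=
  ⟨fun t => if h : s * t⁻¹ ∈ N then T.rmul ⟨s * t⁻¹, h⟩ b else 0, by
    have key : ∀ t : G, s * t⁻¹ ∈ N ↔ (t : G ⧸ N) = x := fun t => by
      rw [← QuotientGroup.eq_one_iff, QuotientGroup.mk_mul, QuotientGroup.mk_inv, hs,
        mul_inv_eq_one, eq_comm]
    refine ⟨fun t ht => dif_neg fun h => ht ((key t).mp h), fun n t => ?_⟩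
    by_cases h : s * t⁻¹ ∈ N
    · have h' : s * ((n : G)⁻¹ * t)⁻¹ ∈ N := by
        rw [key, coe_inv_mul, ← key]; exact h
      simp only [dif_pos h, dif_pos h']
      rw [← rmul_mul]
      congr 2
      ext
      simp [mul_assoc]
    · have h' : s * ((n : G)⁻¹ * t)⁻¹ ∉ N := by
        rw [key, coe_inv_mul, ← key]; exact h
      simp only [dif_neg h, dif_neg h', map_zero]⟩

theorem orbit_self (b : B) (s : G) (hs : (s : G ⧸ N) = x) : (T.orbit b s hs).1 s = b := by
  have h : s * s⁻¹ ∈ N := by simp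
  have h1 : (⟨s * s⁻¹, h⟩ : N) = 1 := by ext; simp
  have h2 : (T.orbit b s hs).1 s = T.rmul ⟨s * s⁻¹, h⟩ b := dif_pos h
  rw [h2, h1, rmul_one]

/-- Every element of the fiber over `s N` is of the form `[b, s]`. -/
theorem orbit_apply (f : T.Fib x) (s : G) (hs : (s : G ⧸ N) = x) : T.orbit (f.1 s) s hs = f :=
  fiber_ext hs (orbit_self _ s hs)

/-- `[b τ_n, n⁻¹ s] = [b, s]` -/
theorem orbit_twist (b : B) (s : G) (hs : (s : G ⧸ N) = x) (n : N) :
    T.orbit (T.rmul n b) ((n : G)⁻¹ * s) ((coe_inv_mul n s).trans hs) = T.orbit b s hs :=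
  fiber_ext ((coe_inv_mul n s).trans hs) (by
    rw [orbit_self, (T.orbit b s hs).2.2, orbit_self])

theorem norm_apply_eq (f : T.Fib x) {s t : G} (hs : (s : G ⧸ N) = x) (ht : (t : G ⧸ N) = x) :
    ‖f.1 t‖ = ‖f.1 s‖ := by
  obtain ⟨n, rfl⟩ := exists_inv_mul (ht.trans hs.symm)
  rw [f.2.2, norm_rmul]

variable (T x) in
/-- Evaluation at a coset representative. -/
noncomputable def evalLin : T.Fib x →ₗ[ℂ] B where
  toFun f := f.1 x.out
  map_add' _ _ := rfl
  map_smul' _ _ := rfl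

theorem evalLin_injective : Function.Injective (evalLin T x) :=
  fun _ _ h => fiber_ext (QuotientGroup.out_eq' x) h

/-- The norm of the fiber: `‖[b, s]‖ = ‖b‖`. -/
noncomputable instance : NormedAddCommGroup (T.Fib x) :=
  NormedAddCommGroup.induced _ _ (evalLin T x) evalLin_injective

theorem norm_def (f : T.Fib x) {s : G} (hs : (s : G ⧸ N) = x) : ‖f‖ = ‖f.1 s‖ :=
  norm_apply_eq f hs (QuotientGroup.out_eq' x)

noncomputable instance : NormedSpace ℂ (T.Fib x) where
  norm_smul_le c f := (norm_smul c (evalLin T x f)).le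

instance : CompleteSpace (T.Fib x) := by
  let e : T.Fib x ≃ₗᵢ[ℂ] B :=
    { toFun := evalLin T x
      map_add' := map_add _
      map_smul' := map_smul _
      invFun := fun b => T.orbit b x.out (QuotientGroup.out_eq' x)
      left_inv := fun f => orbit_apply f _ _
      right_inv := fun b => orbit_self b x.out (QuotientGroup.out_eq' x)
      norm_map' := fun _ => rfl }
  exact e.symm.isometry.isUniformInducing.completeSpace_congr e.symm.surjective |>.mp inferInstance

variable (T) in
/-- The product `[b, s][c, t] = [b α_s(c), s t]`. -/
noncomputable def fiberMul (h : x * y = z) (f : T.Fib x) (g : T.Fib y) : T.Fib z :=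
  ⟨fun r => f.1 x.out * T.act x.out (g.1 (x.out⁻¹ * r)), fun r hr => by
    beta_reduce
    rw [g.2.1, map_zero, mul_zero]
    intro h'
    apply hr
    rw [← h, ← h', QuotientGroup.mk_mul, QuotientGroup.mk_inv, QuotientGroup.out_eq',
      mul_inv_cancel_left], fun n r => by
    have e : x.out⁻¹ * ((n : G)⁻¹ * r) = ((T.conj x.out⁻¹ n : N) : G)⁻¹ * (x.out⁻¹ * r) := by
      simp [conj, mul_assoc]
    have e' : T.conj x.out (T.conj x.out⁻¹ n) = n := by ext; simp [conj, mul_assoc]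
    beta_reduce
    rw [e, g.2.2, act_rmul, e', mul_rmul]⟩

theorem fiberMul_apply (h : x * y = z) (f : T.Fib x) (g : T.Fib y) {s : G}
    (hs : (s : G ⧸ N) = x) (r : G) :
    (T.fiberMul h f g).1 r = f.1 s * T.act s (g.1 (s⁻¹ * r)) := by
  obtain ⟨n, hn⟩ := exists_inv_mul (hs.trans (QuotientGroup.out_eq' x).symm)
  set s₀ := x.out
  change f.1 s₀ * T.act s₀ (g.1 (s₀⁻¹ * r)) = _
  have e : s⁻¹ * r = ((T.conj s₀⁻¹ n⁻¹ : N) : G)⁻¹ * (s₀⁻¹ * r) := by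
    rw [hn]; simp [conj, mul_assoc]
  have e' : T.conj s₀ (T.conj s₀⁻¹ n⁻¹) = n⁻¹ := by ext; simp [conj, mul_assoc]
  have e'' : T.act s (g.1 (s⁻¹ * r)) = T.lmul n⁻¹ (T.act s₀ (g.1 (s₀⁻¹ * r))) := by
    rw [e, g.2.2, hn, act_mul_apply, act_rmul, e']
    have := T.act_coe' n⁻¹ (T.rmul n⁻¹ (T.act s₀ (g.1 (s₀⁻¹ * r))))
    rw [inv_inv, ← rmul_mul, inv_mul_cancel, rmul_one] at this
    exact this
  rw [e'', hn, f.2.2, rmul_mul_eq, ← lmul_mul, mul_inv_cancel, lmul_one]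

variable (T) in
/-- The involution `[b, s]* = [α_{s⁻¹}(b)*, s⁻¹]`. -/
noncomputable def fiberInv (h : x⁻¹ = y) (f : T.Fib x) : T.Fib y :=
  ⟨fun r => T.act r (star (f.1 r⁻¹)), fun r hr => by
    beta_reduce
    rw [f.2.1, star_zero, map_zero]
    intro h'
    apply hr
    rw [← h, ← h', QuotientGroup.mk_inv, inv_inv], fun n r => by
    have e : ((n : G)⁻¹ * r)⁻¹ = ((T.conj r⁻¹ n⁻¹ : N) : G)⁻¹ * r⁻¹ := by
      simp [conj, mul_assoc]
    have e' : T.conj r (T.conj r⁻¹ n⁻¹)⁻¹ = n := by ext; simp [conj, mul_assoc]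
    beta_reduce
    rw [e, f.2.2, star_rmul, act_mul_apply, act_lmul, e']
    have := T.act_coe' n⁻¹ (T.lmul n (T.act r (star (f.1 r⁻¹))))
    rw [inv_inv, rmul_lmul, ← lmul_mul, inv_mul_cancel, lmul_one] at this
    exact this⟩

theorem fiberInv_apply (h : x⁻¹ = y) (f : T.Fib x) (r : G) :
    (T.fiberInv h f).1 r = T.act r (star (f.1 r⁻¹)) := rfl

variable (T) in
/-- The twisted semidirect product bundle `B ×_N G` over `G/N`. -/
noncomputable def bundle : FellBundle.{max u v} (G ⧸ N) where
  Fiber x := T.Fib x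
  mul := T.fiberMul
  inv := T.fiberInv
  add_mul h a a' b := Subtype.ext (funext fun r => add_mul _ _ _)
  mul_add {x y z} h a b b' := Subtype.ext (funext fun r => by
    change _ * T.act x.out (b.1 _ + b'.1 _) = _
    rw [map_add, mul_add]; rfl)
  smul_mul h c a b := Subtype.ext (funext fun r => smul_mul_assoc _ _ _)
  mul_smul {x y z} h c a b := Subtype.ext (funext fun r => by
    change _ * T.act x.out (c • b.1 _) = _
    rw [map_smul, mul_smul_comm]; rfl)
  mul_assoc {x y z p q r} h₁ h₂ h₃ h₄ a b c := by
    obtain ⟨s, rfl⟩ := QuotientGroup.mk_surjective x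
    obtain ⟨t, rfl⟩ := QuotientGroup.mk_surjective y
    refine Subtype.ext (funext fun g => ?_)
    rw [fiberMul_apply h₂ _ _ (s := s * t) h₁, fiberMul_apply h₁ a b (s := s) rfl,
      fiberMul_apply h₄ a _ (s := s) rfl, fiberMul_apply h₃ b c (s := t) rfl]
    simp [mul_assoc]
  inv_add h a b := Subtype.ext (funext fun r => by
    change T.act r (star (a.1 r⁻¹ + b.1 r⁻¹)) = _
    rw [star_add, map_add]; rfl)
  inv_smul h c a := Subtype.ext (funext fun r => by
    change T.act r (star (c • a.1 r⁻¹)) = _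
    rw [star_smul, map_smul]; rfl)
  inv_inv h h' a := Subtype.ext (funext fun r => by
    rw [fiberInv_apply, fiberInv_apply, inv_inv, ← map_star, star_star, ← act_mul_apply,
      mul_inv_cancel, act_one_apply])
  inv_mul {x y z x' y' z'} h hr hs ht h' a b := by
    obtain ⟨s, rfl⟩ := QuotientGroup.mk_surjective x
    obtain ⟨t, rfl⟩ := QuotientGroup.mk_surjective y
    have ez : ((t⁻¹ * s⁻¹ : G) : G ⧸ N) = z' := by rw [← h', ← ht, ← hs]; rfl
    have ey : ((t⁻¹ : G) : G ⧸ N) = y' := by rw [← ht]; rfl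
    refine fiber_ext ez ?_
    rw [fiberInv_apply, fiberMul_apply h a b (s := s) rfl, fiberMul_apply h' _ _ ey,
      fiberInv_apply, fiberInv_apply]
    have e₁ : T.act (t⁻¹ * s⁻¹) (T.act s (star (b.1 t))) = T.act t⁻¹ (star (b.1 t)) := by
      rw [← act_mul_apply, inv_mul_cancel_right]
    have i₁ : s⁻¹ * (t⁻¹ * s⁻¹)⁻¹ = t := by group
    have i₂ : t⁻¹⁻¹ * (t⁻¹ * s⁻¹) = s⁻¹ := by group
    rw [i₁, i₂, inv_inv, inv_inv, star_mul, map_mul (T.act (t⁻¹ * s⁻¹)), ← map_star, e₁,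
      act_mul_apply]
  norm_mul_le {x y z} h a b := by
    obtain ⟨s, rfl⟩ := QuotientGroup.mk_surjective x
    obtain ⟨t, rfl⟩ := QuotientGroup.mk_surjective y
    rw [norm_def _ (s := s * t) h, norm_def a (s := s) rfl, norm_def b (s := t) rfl,
      fiberMul_apply h a b (s := s) rfl, inv_mul_cancel_left, ← T.norm_act s (b.1 t)]
    exact norm_mul_le _ _
  norm_inv {x y} h a := by
    obtain ⟨s, rfl⟩ := QuotientGroup.mk_surjective x
    rw [norm_def _ (s := s⁻¹) h, norm_def a (s := s) rfl, fiberInv_apply, inv_inv, norm_act,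
      norm_star]
  norm_inv_mul_self {x} a := by
    obtain ⟨s, rfl⟩ := QuotientGroup.mk_surjective x
    rw [norm_def _ (s := 1) rfl, norm_def a (s := s) rfl,
      fiberMul_apply (inv_mul_cancel (s : G ⧸ N)) (T.fiberInv rfl a) a (s := s⁻¹) rfl, fiberInv_apply, inv_inv, mul_one, ← map_mul, norm_act,
      CStarRing.norm_star_mul_self, sq]
  positive {x} a := by
    obtain ⟨s, rfl⟩ := QuotientGroup.mk_surjective x
    refine ⟨T.orbit (T.act s⁻¹ (a.1 s)) 1 rfl, ?_⟩
    refine fiber_ext (s := 1) rfl ?_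
    rw [fiberMul_apply (inv_mul_cancel (s : G ⧸ N)) (T.fiberInv rfl a) a (s := s⁻¹) rfl, fiberInv_apply,
      fiberMul_apply (one_mul 1) (T.fiberInv inv_one (T.orbit (T.act s⁻¹ (a.1 s)) 1 rfl))
        (T.orbit (T.act s⁻¹ (a.1 s)) 1 rfl) (s := 1) rfl, fiberInv_apply]
    simp [orbit_self, map_star]

variable (T) in
/-- The C*-algebra `D` is isomorphic to the reduced twisted crossed product `B ×_{α,τ,r} G`, the
reduced cross sectional algebra of the twisted semidirect product bundle. -/
def IsReducedCrossedProduct (D : Type w) [NonUnitalCStarAlgebra D] : Prop :=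
  T.bundle.IsReducedSectionalAlgebra D

end TwistedAction

/-!
# Fell bundles and coactions that come from twisted actions

For a twisted action `(B, G, N, α, τ)` the maps `[b, t] ↦ [α_s(b), s t]` and `[b, t] ↦ [b, t s]`
form a unitary multiplier `u_s` of order `s N` of the bundle `B ×_N G`, and `s ↦ u_s` is a homomorphism.
Conversely, a homomorphism `u` into the unitary multipliers of a bundle `𝒟` gives a twisted action
on the fiber `D_e`, by `α_s(b) = u_s b u_{s⁻¹}` and `τ_n = u_n`. The orbits that make up the bundle
of this action are encoded as functions on cosets, and `a ∈ D_x` corresponds to the function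
`s ↦ a u_{s⁻¹}` on `x`. This is the first equivalence
(`FellBundle.exists_iso_bundle_iff`).

The second one follows once reduced cross sectional algebras of bundles over `H = G / N` and
C*-algebras with a normal coaction of `H` are seen to be the same. The spectral subspaces of a
coaction form a Fell bundle (`Coaction.spectralBundle`), and their span is dense: slicing `δ(a)`
with the regular representation `λ` projects onto a spectral subspace, by the coaction identity
(`Coaction.proj_mem`, `Coaction.span_spectral_closure`). Let `σ` be a faithful representation of the
algebra `D`.

* If `δ` is normal, then `(σ ⊗ λ) ∘ δ` is isometric (`Coaction.IsNormal.norm_le`), and the reduced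
  norm of a section of the spectral bundle is the norm of `(σ ⊗ λ) ∘ δ`
  (`FellBundle.Rep.reducedNorm_eq`), so `D` is the reduced cross sectional algebra
  (`FellBundle.Rep.isReducedSectionalAlgebra`).
* If `D` is the reduced cross sectional algebra of `𝒜`, then `a ↦ a ⊗ s` for `a ∈ A_s` is bounded
  for the reduced norm (`FellBundle.Rep.norm_tensorLift_le`) and extends to a coaction `δ` with
  `(σ ⊗ λ) ∘ δ` injective. The covariant pair `((σ ⊗ λ) ∘ δ, 1 ⊗ M)`, with `c₀(H)` acting on `ℓ²(H)`
  by multiplication, is universal, so `δ` is normal (`Coaction.isNormal_of_injective`).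

Unitary multipliers of the bundle extend to the completion
(`FellBundle.MultiplierRep.exists_unitary`), and those of `D` that are compatible with the coaction
restrict to the spectral bundle (`Coaction.exists_spectral_unitary`).

All norm estimates rest on one principle. A self-adjoint operator `T` satisfies `‖T‖ ≤ r` as soon
as `|⟨x, T ^ m x⟩| ≤ C_x r ^ m` for `x` in a total set, whatever the constants `C_x`
(`IsSelfAdjoint.norm_le_of_inner_growth`, and `IsSelfAdjoint.multiplier_norm_le_of_growth` for
multipliers). It reduces an inequality `‖Ψ(f)‖ ≤ ‖Φ(f)‖` of *-representations to a bound on diagonal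
coefficients of `Ψ` at conveniently chosen vectors. In this way one faithful representation of the
first factor computes the spatial norm (`SpatialTensor.norm_tensorRep_le_of_injective`), the
`ℓ²`-norm of sections determines the norm of `σ ⊗ λ`, and, at vectors over a single point of `H`,
only the component in the fiber over the identity matters, which gives the estimates behind normality,
the existence of the dual coaction, and the universality of covariant pairs
(`Coaction.CovariantRep.isCrossedProduct`).
-/

/-! ### Bounding self-adjoint elements through their powers -/

/-- If `a (2 ^ n)` grows at most like `r ^ (2 ^ n)` and the sequence satisfies the Cauchy-Schwarz
inequalities `a (2 ^ n) ^ 2 ≤ a 0 * a (2 ^ (n + 1))`, then the constant in the growth bound does not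
matter: `a 1 ≤ r * a 0`. -/
theorem le_mul_of_sq_le_of_growth {a : ℕ → ℝ} {C r : ℝ} (ha : ∀ n, 0 ≤ a n) (hr : 0 ≤ r)
    (hsq : ∀ n, a (2 ^ n) ^ 2 ≤ a 0 * a (2 ^ (n + 1)))
    (hC : ∀ n, a (2 ^ n) ≤ C * r ^ (2 ^ n)) : a 1 ≤ r * a 0 := by
  rcases (ha 0).eq_or_lt with h0 | h0
  · have := hsq 0
    rw [← h0, zero_mul, pow_zero] at this
    rw [← h0, mul_zero]
    exact (pow_eq_zero_iff two_ne_zero).mp (le_antisymm this (sq_nonneg _)) |>.le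
  -- otherwise `b = a 1 / a 0 > r`, and `a (2 ^ n) ≥ b ^ (2 ^ n) * a 0` outgrows `C * r ^ (2 ^ n)`
  by_contra! hlt
  set b := a 1 / a 0 with hb
  have hrb : r < b := by rwa [hb, lt_div_iff₀ h0]
  have hb0 : 0 < b := hr.trans_lt hrb
  have key : ∀ n, b ^ (2 ^ n) * a 0 ≤ a (2 ^ n) := by
    intro n
    induction n with
    | zero => rw [pow_zero, pow_one, hb, div_mul_cancel₀ _ h0.ne']
    | succ n ih =>
      have h1 : (b ^ (2 ^ n) * a 0) ^ 2 ≤ a 0 * a (2 ^ (n + 1)) :=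
        (pow_le_pow_left₀ (by positivity) ih 2).trans (hsq n)
      have h2 : b ^ (2 ^ (n + 1)) = (b ^ (2 ^ n)) ^ 2 := by rw [← pow_mul, pow_succ]
      rw [h2]
      refine le_of_mul_le_mul_left ?_ h0
      calc _ = (b ^ (2 ^ n) * a 0) ^ 2 := by ring
        _ ≤ _ := h1
  have h1 : ∀ n, a 0 ≤ C * (r / b) ^ (2 ^ n) := fun n => by
    rw [div_pow, ← mul_div_assoc, le_div_iff₀ (by positivity), mul_comm]
    exact (key n).trans (hC n)
  have h2 : Filter.Tendsto (fun n : ℕ => C * (r / b) ^ (2 ^ n)) Filter.atTop (nhds (C * 0)) := by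
    refine Filter.Tendsto.const_mul _ ?_
    exact (tendsto_pow_atTop_nhds_zero_of_lt_one (div_nonneg hr hb0.le)
      ((div_lt_one hb0).mpr hrb)).comp (tendsto_pow_atTop_atTop_of_one_lt one_lt_two)
  rw [mul_zero] at h2
  exact h0.not_ge (ge_of_tendsto' h2 h1)

/-- An operator satisfying the Cauchy-Schwarz inequalities `‖T ^ m x‖ ^ 2 ≤ ‖x‖ ‖T ^ (2 m) x‖` has
norm at most `r` if its powers grow at most like `r ^ m` on a total set, with constants that depend
on the vector. -/
theorem ContinuousLinearMap.norm_le_of_growth {E : Type*} [SeminormedAddCommGroup E]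
    [NormedSpace ℂ E] (T : E →L[ℂ] E) {r : ℝ} (hr : 0 ≤ r)
    (hT : ∀ (m : ℕ) x, ‖(T ^ m) x‖ ^ 2 ≤ ‖x‖ * ‖(T ^ (2 * m)) x‖) {S : Set E}
    (hS : (Submodule.span ℂ S).topologicalClosure = ⊤)
    (hg : ∀ x ∈ S, ∃ C : ℝ, ∀ m : ℕ, ‖(T ^ (m + 1)) x‖ ≤ C * r ^ (m + 1)) : ‖T‖ ≤ r := by
  have hspan : ∀ x ∈ Submodule.span ℂ S, ∃ C : ℝ, ∀ m : ℕ, ‖(T ^ (m + 1)) x‖ ≤ C * r ^ (m + 1) := by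
    intro x hx
    induction hx using Submodule.span_induction with
    | mem x hx => exact hg x hx
    | zero => exact ⟨0, fun m => by simp⟩
    | add x y _ _ hx hy =>
      obtain ⟨C, hC⟩ := hx
      obtain ⟨C', hC'⟩ := hy
      refine ⟨C + C', fun m => ?_⟩
      rw [map_add, add_mul]
      exact (norm_add_le _ _).trans (add_le_add (hC m) (hC' m))
    | smul c x _ hx =>
      obtain ⟨C, hC⟩ := hx
      refine ⟨‖c‖ * C, fun m => ?_⟩
      rw [map_smul, norm_smul, mul_assoc]
      exact mul_le_mul_of_nonneg_left (hC m) (norm_nonneg c)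
  have hb : ∀ x ∈ Submodule.span ℂ S, ‖T x‖ ≤ r * ‖x‖ := by
    intro x hx
    obtain ⟨C, hC⟩ := hspan x hx
    have := le_mul_of_sq_le_of_growth (a := fun m => ‖(T ^ m) x‖) (C := C) (r := r)
      (fun n => norm_nonneg _) hr
      (fun n => by
        have := hT (2 ^ n) x
        rw [pow_succ' 2 n]
        simpa using this)
      (fun n => by
        have := hC (2 ^ n - 1)
        rwa [Nat.sub_add_cancel Nat.one_le_two_pow] at this)
    simpa using this
  refine ContinuousLinearMap.opNorm_le_bound _ hr fun x => ?_
  have hx : x ∈ (Submodule.span ℂ S).topologicalClosure := by rw [hS]; trivial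
  have hcl : IsClosed {x | ‖T x‖ ≤ r * ‖x‖} := isClosed_le (by fun_prop) (by fun_prop)
  exact closure_minimal hb hcl hx

/-- A self-adjoint operator on a Hilbert space has norm at most `r` if its diagonal matrix
coefficients at the vectors of a total set grow at most like `r ^ m`. -/
theorem IsSelfAdjoint.norm_le_of_inner_growth {X : Type*} [NormedAddCommGroup X]
    [InnerProductSpace ℂ X] [CompleteSpace X] {T : X →L[ℂ] X} (hT : IsSelfAdjoint T) {r : ℝ}
    (hr : 0 ≤ r) {S : Set X} (hS : (Submodule.span ℂ S).topologicalClosure = ⊤)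
    (hg : ∀ x ∈ S, ∃ C : ℝ, ∀ m : ℕ, ‖inner ℂ x ((T ^ (m + 1)) x)‖ ≤ C * r ^ (m + 1)) :
    ‖T‖ ≤ r := by
  have key : ∀ (m : ℕ) x, inner ℂ ((T ^ m) x) ((T ^ m) x) = inner ℂ x ((T ^ (2 * m)) x) := by
    intro m x
    have h := (hT.pow m).adjoint_eq
    rw [← ContinuousLinearMap.adjoint_inner_right, h, two_mul, pow_add]
    rfl
  have key' : ∀ (m : ℕ) x, ‖(T ^ m) x‖ ^ 2 = ‖inner ℂ x ((T ^ (2 * m)) x)‖ := fun m x => by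
    rw [← key, inner_self_eq_norm_sq_to_K]
    simp
  refine T.norm_le_of_growth hr (fun m x => ?_) hS fun x hx => ?_
  · rw [key']
    exact norm_inner_le_norm _ _
  · obtain ⟨C, hC⟩ := hg x hx
    refine ⟨√C, fun m => ?_⟩
    have h1 : ‖(T ^ (m + 1)) x‖ ^ 2 ≤ C * (r ^ (m + 1)) ^ 2 := by
      rw [key', ← pow_mul, mul_comm (m + 1) 2]
      exact hC (2 * m + 1)
    rw [← Real.sqrt_sq (pow_nonneg hr (m + 1)), ← Real.sqrt_mul' _ (sq_nonneg _)]
    exact Real.le_sqrt_of_sq_le h1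

/-- A self-adjoint multiplier of a C*-algebra has norm at most `r` if `x* T ^ m x` grows at most
like `r ^ m` for all `x` in a total set. -/
theorem IsSelfAdjoint.multiplier_norm_le_of_growth {B : Type*} [NonUnitalCStarAlgebra B]
    {T : 𝓜(ℂ, B)} (hT : IsSelfAdjoint T) {r : ℝ} (hr : 0 ≤ r) {S : Set B}
    (hS : (Submodule.span ℂ S).topologicalClosure = ⊤)
    (hg : ∀ x ∈ S, ∃ C : ℝ, ∀ m : ℕ, ‖star x * (T ^ (m + 1)).fst x‖ ≤ C * r ^ (m + 1)) :
    ‖T‖ ≤ r := by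
  have hpow : ∀ m : ℕ, T.fst ^ m = (T ^ m).fst := fun m => by
    induction m with
    | zero => rfl
    | succ m ih => rw [pow_succ, pow_succ, ih]; rfl
  have key : ∀ (m : ℕ) x, star ((T ^ m).fst x) * (T ^ m).fst x = star x * (T ^ (2 * m)).fst x := by
    intro m x
    have h : star ((T ^ m).fst x) = (T ^ m).snd (star x) := by
      have := DoubleCentralizer.star_snd (T ^ m) (star x)
      rw [star_star, (hT.pow m).star_eq] at this
      exact this.symm
    rw [h, (T ^ m).central, two_mul, pow_add]
    rfl
  have key' : ∀ (m : ℕ) x, ‖(T ^ m).fst x‖ ^ 2 = ‖star x * (T ^ (2 * m)).fst x‖ := fun m x => by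
    rw [← key, CStarRing.norm_star_mul_self, sq]
  rw [← DoubleCentralizer.norm_fst]
  refine T.fst.norm_le_of_growth hr (fun m x => ?_) hS fun x hx => ?_
  · rw [hpow, hpow, key']
    exact (norm_mul_le _ _).trans (by rw [norm_star])
  · obtain ⟨C, hC⟩ := hg x hx
    refine ⟨√C, fun m => ?_⟩
    rw [hpow]
    have h1 : ‖(T ^ (m + 1)).fst x‖ ^ 2 ≤ C * (r ^ (m + 1)) ^ 2 := by
      rw [key', ← pow_mul, mul_comm (m + 1) 2]
      exact hC (2 * m + 1)
    rw [← Real.sqrt_sq (pow_nonneg hr (m + 1)), ← Real.sqrt_mul' _ (sq_nonneg _)]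
    exact Real.le_sqrt_of_sq_le h1

/-- The power `a ^ (m + 1)` in a ring without unit. -/
def powSucc {A : Type*} [Mul A] (a : A) : ℕ → A
  | 0 => a
  | m + 1 => a * powSucc a m

theorem map_powSucc {A B F : Type*} [Mul A] [Monoid B] [FunLike F A B] [MulHomClass F A B] (φ : F)
    (a : A) (m : ℕ) : φ (powSucc a m) = φ a ^ (m + 1) := by
  induction m with
  | zero => rw [zero_add, pow_one]; rfl
  | succ m ih => rw [powSucc, map_mul, ih, ← pow_succ']

/-! ### Faithful representations -/

section Diagonal

variable {ι : Type*} {E : ι → Type*} [∀ i, NormedAddCommGroup (E i)]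
  [∀ i, InnerProductSpace ℂ (E i)]

theorem memℓp_diagonal (T : ∀ i, E i →L[ℂ] E i) {C : ℝ} (hT : ∀ i, ‖T i‖ ≤ C) (x : lp E 2) :
    Memℓp (fun i => T i (x i)) 2 := by
  refine Memℓp.mono (g := fun i => C * ‖x i‖) ?_ fun i => ?_
  · exact (lp.memℓp x).norm.const_mul C
  · exact (T i).le_of_opNorm_le (hT i) _

/-- The diagonal operator on an `ℓ²`-sum of Hilbert spaces given by a bounded family of
operators. -/
noncomputable def lpDiagonal (T : ∀ i, E i →L[ℂ] E i) {C : ℝ} (hT : ∀ i, ‖T i‖ ≤ C) :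
    lp E 2 →L[ℂ] lp E 2 :=
  LinearMap.mkContinuous
    { toFun := fun x => ⟨fun i => T i (x i), memℓp_diagonal T hT x⟩
      map_add' := fun x y => by ext i; exact map_add (T i) _ _
      map_smul' := fun c x => by ext i; exact map_smul (T i) _ _ } |C| fun x => by
    have h : ‖(C : ℂ) • x‖ = |C| * ‖x‖ := by rw [norm_smul, Complex.norm_real, Real.norm_eq_abs]
    rw [← h]
    refine lp.norm_mono two_ne_zero fun i => ?_
    rw [lp.coeFn_smul, Pi.smul_apply, norm_smul, Complex.norm_real]
    exact (T i).le_of_opNorm_le ((hT i).trans (Real.le_norm_self C)) _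

theorem lpDiagonal_apply (T : ∀ i, E i →L[ℂ] E i) {C : ℝ} (hT : ∀ i, ‖T i‖ ≤ C) (x : lp E 2)
    (i : ι) : lpDiagonal T hT x i = T i (x i) := rfl

variable [∀ i, CompleteSpace (E i)]

theorem lpDiagonal_star (T : ∀ i, E i →L[ℂ] E i) {C C' : ℝ} (hT : ∀ i, ‖T i‖ ≤ C)
    (hT' : ∀ i, ‖star (T i)‖ ≤ C') :
    lpDiagonal (fun i => star (T i)) hT' = star (lpDiagonal T hT) := by
  refine (ContinuousLinearMap.eq_adjoint_iff _ _).mpr fun x y => ?_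
  rw [lp.inner_eq_tsum, lp.inner_eq_tsum]
  refine tsum_congr fun i => ?_
  rw [lpDiagonal_apply, lpDiagonal_apply, ContinuousLinearMap.star_eq_adjoint,
    ContinuousLinearMap.adjoint_inner_left]

/-- The direct sum of a family of *-homomorphisms into operators on Hilbert spaces which is
pointwise bounded by `‖a‖`. -/
noncomputable def lpDiagonalHom {A : Type*} [NonUnitalCStarAlgebra A]
    (π : ∀ i, A →⋆ₙₐ[ℂ] (E i →L[ℂ] E i)) : A →⋆ₙₐ[ℂ] (lp E 2 →L[ℂ] lp E 2) where
  toFun a := lpDiagonal (fun i => π i a) (fun i => NonUnitalStarAlgHom.norm_apply_le (π i) a)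
  map_smul' c a := by ext x i; simp [lpDiagonal_apply]
  map_zero' := by ext x i; simp [lpDiagonal_apply]
  map_add' a b := by ext x i; simp [lpDiagonal_apply]
  map_mul' a b := by ext x i; simp [lpDiagonal_apply]
  map_star' a := by
    rw [← lpDiagonal_star (fun i => π i a) _ fun i => by
      rw [norm_star]; exact NonUnitalStarAlgHom.norm_apply_le (π i) a]
    ext x i; simp only [lpDiagonal_apply, map_star]

theorem lpDiagonalHom_apply {A : Type*} [NonUnitalCStarAlgebra A]
    (π : ∀ i, A →⋆ₙₐ[ℂ] (E i →L[ℂ] E i)) (a : A) (x : lp E 2) (i : ι) :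
    lpDiagonalHom π a x i = π i a (x i) := rfl

end Diagonal

section Faithful

variable {A : Type u} [NonUnitalCStarAlgebra A]

open scoped ComplexOrder

/-- Positive functionals separate the points of the positive cone: the cone is closed and contains
no line, so the Hahn-Banach theorem applies. -/
theorem exists_positiveLinearMap_ne_zero [PartialOrder A] [StarOrderedRing A] {b : A}
    (hb : 0 ≤ b) (hb0 : b ≠ 0) :
    ∃ f : A →ₚ[ℂ] ℂ, f b ≠ 0 := by
  have hmem : -b ∉ ProperCone.positive ℝ A := fun h =>
    hb0 (le_antisymm (neg_nonneg.mp h) hb)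
  obtain ⟨g, hg, hgb⟩ := ProperCone.hyperplane_separation_point _ hmem
  let g' : A →ₗ[ℝ] ℝ := g.toLinearMap ∘ₗ (selfAdjoint.submodule ℝ A).subtype ∘ₗ realPart
  have hg' : ∀ x : A, g' x = g (realPart x : A) := fun x => rfl
  have key : ∀ x : A, 0 ≤ x → Module.Dual.extendRCLike (𝕜 := ℂ) g' x = (g x : ℂ) := by
    intro x hx
    have hs : IsSelfAdjoint x := .of_nonneg hx
    have h1 : (realPart (Complex.I • x) : A) = 0 := by
      rw [realPart_I_smul, hs.imaginaryPart, neg_zero]; rfl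
    rw [Module.Dual.extendRCLike_apply, hg', hg', hs.coe_realPart]
    have h2 : (RCLike.I : ℂ) = Complex.I := rfl
    rw [h2, h1, map_zero]
    simp
  refine ⟨PositiveLinearMap.mk₀ (Module.Dual.extendRCLike (𝕜 := ℂ) g') fun x hx => ?_, fun h => ?_⟩
  · rw [key x hx]
    exact Complex.zero_le_real.mpr (hg x hx)
  · have h1 : (g b : ℂ) = 0 := (key b hb).symm.trans h
    rw [map_neg, neg_lt_zero] at hgb
    exact hgb.ne' (by exact_mod_cast h1)

theorem PositiveLinearMap.gns_ne_zero [PartialOrder A] [StarOrderedRing A] (f : A →ₚ[ℂ] ℂ) {a : A}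
    (hf : f (star (a * star a) * (a * star a)) ≠ 0) : f.gnsNonUnitalStarAlgHom a ≠ 0 := by
  intro h
  have h1 : f.gnsNonUnitalStarAlgHom a ((f.toPreGNS (star a) : f.PreGNS) : f.GNS) = 0 := by
    rw [h]; rfl
  rw [PositiveLinearMap.gnsNonUnitalStarAlgHom_apply_coe] at h1
  have h3 : ‖f.leftMulMapPreGNS a (f.toPreGNS (star a))‖ = 0 := by
    rw [← UniformSpace.Completion.norm_coe, h1, norm_zero]
  have h2 := f.preGNS_norm_sq (f.leftMulMapPreGNS a (f.toPreGNS (star a)))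
  rw [h3] at h2
  refine hf (h2.symm.trans ?_)
  simp

theorem exists_rep_ne_zero {a : A} (ha : a ≠ 0) :
    ∃ (K : Type u) (_ : NormedAddCommGroup K) (_ : InnerProductSpace ℂ K) (_ : CompleteSpace K)
      (π : A →⋆ₙₐ[ℂ] (K →L[ℂ] K)), π a ≠ 0 := by
  let _ : PartialOrder A := CStarAlgebra.spectralOrder A
  have : StarOrderedRing A := CStarAlgebra.spectralOrderedRing A
  have hb0 : star (a * star a) * (a * star a) ≠ 0 := by
    rwa [Ne, CStarRing.star_mul_self_eq_zero_iff, CStarRing.mul_star_self_eq_zero_iff]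
  obtain ⟨f, hf⟩ := exists_positiveLinearMap_ne_zero (star_mul_self_nonneg _) hb0
  exact ⟨f.GNS, _, _, inferInstance, f.gnsNonUnitalStarAlgHom, f.gns_ne_zero hf⟩

variable (A) in
/-- **Gelfand-Naimark theorem**: a C*-algebra has a faithful representation on a Hilbert space. -/
theorem exists_faithful_rep :
    ∃ (K : Type u) (_ : NormedAddCommGroup K) (_ : InnerProductSpace ℂ K) (_ : CompleteSpace K)
      (π : A →⋆ₙₐ[ℂ] (K →L[ℂ] K)), Function.Injective π := by
  have h : ∀ a : {a : A // a ≠ 0}, _ := fun a => exists_rep_ne_zero a.2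
  choose K i₁ i₂ i₃ π hπ using h
  refine ⟨lp K 2, inferInstance, inferInstance, inferInstance, lpDiagonalHom π, ?_⟩
  refine (injective_iff_map_eq_zero _).mpr fun a ha => ?_
  by_contra h0
  refine hπ ⟨a, h0⟩ ?_
  ext k
  classical
  have := congrArg (fun T => (T (lp.single 2 (⟨a, h0⟩ : {a : A // a ≠ 0}) k) :
    ∀ i, K i) ⟨a, h0⟩) ha
  simpa [lpDiagonalHom_apply] using this

end Faithful

/-! ### *-homomorphisms defined on a total set -/

/-- A contractive relation between two C*-algebras, given by a set of pairs whose span is closed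
under multiplication and involution, is the restriction of a *-homomorphism if the first
components are total. -/
theorem exists_starHom_of_span {A : Type v} {E : Type w} [NonUnitalCStarAlgebra A]
    [NonUnitalCStarAlgebra E] (S : Set (A × E))
    (hmul : ∀ x ∈ S, ∀ y ∈ S, x * y ∈ Submodule.span ℂ S) (hstar : ∀ x ∈ S, star x ∈ S)
    (hle : ∀ x ∈ Submodule.span ℂ S, ‖x.2‖ ≤ ‖x.1‖)
    (hd : (Submodule.span ℂ (Prod.fst '' S)).topologicalClosure = ⊤) :
    ∃ Φ : A →⋆ₙₐ[ℂ] E, ∀ x ∈ S, Φ x.1 = x.2 := by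
  set V := Submodule.span ℂ S with hV
  have hmulV : ∀ x ∈ V, ∀ y ∈ V, x * y ∈ V := by
    intro x hx y hy
    induction hx using Submodule.span_induction with
    | mem x hx =>
      induction hy using Submodule.span_induction with
      | mem y hy => exact hmul x hx y hy
      | zero => rw [mul_zero]; exact V.zero_mem
      | add y y' _ _ h h' => rw [mul_add]; exact V.add_mem h h'
      | smul c y _ h => rw [mul_smul_comm]; exact V.smul_mem c h
    | zero => rw [zero_mul]; exact V.zero_mem
    | add x x' _ _ h h' => rw [add_mul]; exact V.add_mem h h'
    | smul c x _ h => rw [smul_mul_assoc]; exact V.smul_mem c h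
  have hstarV : ∀ x ∈ V, star x ∈ V := by
    intro x hx
    induction hx using Submodule.span_induction with
    | mem x hx => exact Submodule.subset_span (hstar x hx)
    | zero => rw [star_zero]; exact V.zero_mem
    | add x x' _ _ h h' => rw [star_add]; exact V.add_mem h h'
    | smul c x _ h => rw [star_smul]; exact V.smul_mem _ h
  let e : V →ₗ[ℂ] A := LinearMap.fst ℂ A E ∘ₗ V.subtype
  let f : V →ₗ[ℂ] E := LinearMap.snd ℂ A E ∘ₗ V.subtype
  have he : DenseRange e := by
    have h1 : Submodule.span ℂ (Prod.fst '' S) ≤ LinearMap.range e := by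
      rw [Submodule.span_le]
      rintro _ ⟨x, hx, rfl⟩
      exact ⟨⟨x, Submodule.subset_span hx⟩, rfl⟩
    have h2 : Dense ((Submodule.span ℂ (Prod.fst '' S) : Submodule ℂ A) : Set A) :=
      Submodule.dense_iff_topologicalClosure_eq_top.mpr hd
    exact h2.mono h1
  have hn : ∃ C, ∀ x, ‖f x‖ ≤ C * ‖e x‖ := ⟨1, fun x => by rw [one_mul]; exact hle _ x.2⟩
  set F := f.extendOfNorm e with hF
  have hFe : ∀ x, F (e x) = f x := LinearMap.extendOfNorm_eq he hn
  refine ⟨{ toFun := F, map_smul' := map_smul F, map_zero' := map_zero F, map_add' := map_add F,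
            map_mul' := fun x y => ?_, map_star' := fun x => ?_ }, fun x hx => ?_⟩
  · refine DenseRange.induction_on₂ he ?_ (fun a b => ?_) x y
    · exact isClosed_eq (by fun_prop) (by fun_prop)
    · have h : e a * e b = e ⟨a.1 * b.1, hmulV _ a.2 _ b.2⟩ := rfl
      rw [h, hFe, hFe, hFe]
      rfl
  · refine DenseRange.induction_on he x ?_ fun a => ?_
    · exact isClosed_eq (by fun_prop) (by fun_prop)
    · have h : star (e a) = e ⟨star a.1, hstarV _ a.2⟩ := rfl
      change F (star (e a)) = star (F (e a))
      rw [h, hFe, hFe]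
      rfl
  · exact hFe ⟨x, Submodule.subset_span hx⟩

/-- Two continuous linear maps agree if they agree on a total set. -/
theorem ContinuousLinearMap.ext_of_span {V W : Type*} [NormedAddCommGroup V] [NormedSpace ℂ V]
    [NormedAddCommGroup W] [NormedSpace ℂ W] {S : Set V}
    (hS : (Submodule.span ℂ S).topologicalClosure = ⊤) {f g : V →L[ℂ] W}
    (h : ∀ x ∈ S, f x = g x) : f = g :=
  ContinuousLinearMap.ext_on (Submodule.dense_iff_topologicalClosure_eq_top.mpr hS) h

/-- A *-homomorphism of C*-algebras as a continuous linear map. -/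
noncomputable def NonUnitalStarAlgHom.toCLM {A : Type v} {E : Type w} [NonUnitalCStarAlgebra A]
    [NonUnitalCStarAlgebra E] (φ : A →⋆ₙₐ[ℂ] E) : A →L[ℂ] E :=
  LinearMap.mkContinuous
    { toFun := φ, map_add' := map_add φ, map_smul' := map_smul φ } 1 fun a => by
      rw [one_mul]; exact NonUnitalStarAlgHom.norm_apply_le φ a

@[simp]
theorem NonUnitalStarAlgHom.toCLM_apply {A : Type v} {E : Type w} [NonUnitalCStarAlgebra A]
    [NonUnitalCStarAlgebra E] (φ : A →⋆ₙₐ[ℂ] E) (a : A) : φ.toCLM a = φ a := rfl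

/-! ### Spatial tensor products -/

namespace HilbertTensor

variable {K : Type u} {L : Type v} [NormedAddCommGroup K] [InnerProductSpace ℂ K] [CompleteSpace K]
  [NormedAddCommGroup L] [InnerProductSpace ℂ L] [CompleteSpace L]

/-- The elementary tensor `k ⊗ l` in the Hilbert space tensor product. -/
noncomputable def tm (k : K) (l : L) : HTensor K L := ((k ⊗ₜ[ℂ] l : K ⊗[ℂ] L) : HTensor K L)

theorem opTensor_tm (S : K →L[ℂ] K) (T : L →L[ℂ] L) (k : K) (l : L) :
    opTensor S T (tm k l) = tm (S k) (T l) := by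
  rw [tm, opTensor_coe, TensorProduct.map_tmul]; rfl

theorem inner_tm (k k' : K) (l l' : L) :
    inner ℂ (tm k l) (tm k' l') = inner ℂ k k' * inner ℂ l l' := by
  rw [tm, tm, UniformSpace.Completion.inner_coe, TensorProduct.inner_tmul]

theorem norm_tm (k : K) (l : L) : ‖tm k l‖ = ‖k‖ * ‖l‖ := by
  rw [tm, UniformSpace.Completion.norm_coe, TensorProduct.norm_tmul]

/-- `k ↦ k ⊗ l` as a bounded operator. -/
noncomputable def tmLeft (l : L) : K →L[ℂ] HTensor K L :=
  LinearMap.mkContinuous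
    { toFun := fun k => tm k l
      map_add' := fun k k' => by
        rw [tm, TensorProduct.add_tmul, UniformSpace.Completion.coe_add]; rfl
      map_smul' := fun c k => by
        rw [tm, ← TensorProduct.smul_tmul', UniformSpace.Completion.coe_smul]; rfl } ‖l‖
    fun k => (norm_tm k l).le.trans (mul_comm _ _).le

/-- `l ↦ k ⊗ l` as a bounded operator. -/
noncomputable def tmRight (k : K) : L →L[ℂ] HTensor K L :=
  LinearMap.mkContinuous
    { toFun := fun l => tm k l
      map_add' := fun l l' => by
        rw [tm, TensorProduct.tmul_add, UniformSpace.Completion.coe_add]; rfl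
      map_smul' := fun c l => by
        rw [tm, TensorProduct.tmul_smul, UniformSpace.Completion.coe_smul]; rfl } ‖k‖
    fun l => (norm_tm k l).le

theorem total_tm {S : Set K} {S' : Set L} (hS : (Submodule.span ℂ S).topologicalClosure = ⊤)
    (hS' : (Submodule.span ℂ S').topologicalClosure = ⊤) :
    (Submodule.span ℂ (Set.image2 tm S S' : Set (HTensor K L))).topologicalClosure = ⊤ := by
  set V := (Submodule.span ℂ (Set.image2 tm S S' : Set (HTensor K L))).topologicalClosure with hV
  have hcl : IsClosed (V : Set (HTensor K L)) := Submodule.isClosed_topologicalClosure _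
  have h1 : ∀ k ∈ S, ∀ l : L, tm k l ∈ V := by
    intro k hk l
    have h2 : (Submodule.span ℂ S').topologicalClosure ≤
        V.comap (tmRight (L := L) k).toLinearMap := by
      refine Submodule.topologicalClosure_minimal _ (Submodule.span_le.mpr fun l hl => ?_) ?_
      · exact Submodule.le_topologicalClosure _ (Submodule.subset_span ⟨k, hk, l, hl, rfl⟩)
      · exact hcl.preimage (tmRight k).continuous
    rw [hS'] at h2
    exact h2 (Submodule.mem_top : l ∈ ⊤)
  have h3 : ∀ (k : K) (l : L), tm k l ∈ V := by
    intro k l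
    have h2 : (Submodule.span ℂ S).topologicalClosure ≤
      V.comap (tmLeft (K := K) l).toLinearMap := by
      refine Submodule.topologicalClosure_minimal _ (Submodule.span_le.mpr fun k hk => h1 k hk l) ?_
      exact hcl.preimage (tmLeft l).continuous
    rw [hS] at h2
    exact h2 (Submodule.mem_top : k ∈ ⊤)
  rw [eq_top_iff]
  rintro x -
  refine UniformSpace.Completion.induction_on x hcl fun y => ?_
  induction y with
  | zero => rw [UniformSpace.Completion.coe_zero]; exact V.zero_mem
  | add y z hy hz => rw [UniformSpace.Completion.coe_add]; exact V.add_mem hy hz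
  | tmul k l => exact h3 k l

theorem span_univ_closure {V : Type*} [NormedAddCommGroup V] [NormedSpace ℂ V] :
    (Submodule.span ℂ (Set.univ : Set V)).topologicalClosure = ⊤ := by
  rw [Submodule.span_univ, eq_top_iff]; exact Submodule.le_topologicalClosure _

end HilbertTensor

theorem ContinuousLinearMap.opNorm_le_of_inner {K : Type*} [NormedAddCommGroup K]
    [InnerProductSpace ℂ K] (T : K →L[ℂ] K) {C : ℝ} (hC : 0 ≤ C)
    (h : ∀ k k', ‖inner ℂ k' (T k)‖ ≤ C * ‖k‖ * ‖k'‖) : ‖T‖ ≤ C := by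
  refine T.opNorm_le_bound hC fun k => ?_
  have h1 := h k (T k)
  rw [inner_self_eq_norm_sq_to_K] at h1
  rcases (norm_nonneg (T k)).eq_or_lt with h0 | h0
  · rw [← h0]; positivity
  · refine le_of_mul_le_mul_right ?_ h0
    simpa [sq] using h1

namespace SpatialTensor

open HilbertTensor

variable {A C : Type u} [NonUnitalCStarAlgebra A] [NonUnitalCStarAlgebra C]
  {K L : Type u} [NormedAddCommGroup K] [InnerProductSpace ℂ K] [CompleteSpace K]
  [NormedAddCommGroup L] [InnerProductSpace ℂ L] [CompleteSpace L]

theorem norm_tensorRep_le (π : A →⋆ₙₐ[ℂ] (K →L[ℂ] K)) (ρ : C →⋆ₙₐ[ℂ] (L →L[ℂ] L)) (t : A ⊗[ℂ] C) :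
    ‖tensorRep π ρ t‖ ≤ spatialNorm A C t :=
  CStarSeminorm.le_sup _ (spatialSeminorms_bdd A C) (repSeminorm π ρ)
    ⟨K, _, _, _, L, _, _, _, π, ρ, rfl⟩ t

/-- The representation `π ⊗ ρ` of the spatial tensor product. -/
noncomputable def rep (π : A →⋆ₙₐ[ℂ] (K →L[ℂ] K)) (ρ : C →⋆ₙₐ[ℂ] (L →L[ℂ] L)) :
    SpatialTensor A C →⋆ₙₐ[ℂ] (HTensor K L →L[ℂ] HTensor K L) :=
  (spatialNorm A C).lift (E := HTensor K L →L[ℂ] HTensor K L) (tensorRep π ρ)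
    (norm_tensorRep_le π ρ)

theorem rep_of (π : A →⋆ₙₐ[ℂ] (K →L[ℂ] K)) (ρ : C →⋆ₙₐ[ℂ] (L →L[ℂ] L)) (t : A ⊗[ℂ] C) :
    rep π ρ (of t) = tensorRep π ρ t :=
  (spatialNorm A C).lift_coe (E := HTensor K L →L[ℂ] HTensor K L) _ _ t

theorem rep_tmul (π : A →⋆ₙₐ[ℂ] (K →L[ℂ] K)) (ρ : C →⋆ₙₐ[ℂ] (L →L[ℂ] L)) (a : A) (c : C) :
    rep π ρ (tmul a c) = opTensor (π a) (ρ c) := by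
  rw [tmul, rep_of, tensorRep_tmul]

theorem norm_rep_le (π : A →⋆ₙₐ[ℂ] (K →L[ℂ] K)) (ρ : C →⋆ₙₐ[ℂ] (L →L[ℂ] L))
    (x : SpatialTensor A C) : ‖rep π ρ x‖ ≤ ‖x‖ :=
  NonUnitalStarAlgHom.norm_apply_le (rep π ρ) x

/-- The representations `π ⊗ ρ` separate the points of the spatial tensor product. -/
theorem eq_zero_of_rep {x : SpatialTensor A C}
    (h : ∀ (K : Type u) [NormedAddCommGroup K] [InnerProductSpace ℂ K] [CompleteSpace K]
      (L : Type u) [NormedAddCommGroup L] [InnerProductSpace ℂ L] [CompleteSpace L]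
      (π : A →⋆ₙₐ[ℂ] (K →L[ℂ] K)) (ρ : C →⋆ₙₐ[ℂ] (L →L[ℂ] L)), rep π ρ x = 0) : x = 0 := by
  rw [← norm_le_zero_iff]
  refine le_of_forall_pos_le_add fun ε hε => ?_
  obtain ⟨t, ht⟩ := denseRange_of.exists_dist_lt x (half_pos hε)
  rw [dist_eq_norm] at ht
  have h1 : ‖(of t : SpatialTensor A C)‖ ≤ ε / 2 := by
    rw [norm_of]
    refine CStarSeminorm.sup_le _ _ _ _ (half_pos hε).le ?_
    rintro _ ⟨K, _, _, _, L, _, _, _, π, ρ, rfl⟩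
    rw [repSeminorm_apply, ← rep_of]
    have h2 : rep π ρ (of t) = rep π ρ (of t - x) := by rw [map_sub, h K L π ρ, sub_zero]
    rw [h2]
    rw [norm_sub_rev] at ht
    exact (norm_rep_le π ρ _).trans ht.le
  calc ‖x‖ = ‖(x - of t) + of t‖ := by rw [sub_add_cancel]
    _ ≤ _ := norm_add_le _ _
    _ ≤ 0 + ε := by linarith

/-- The slice map `a ⊗ c ↦ ⟨η', ρ(c) η⟩ a` on the algebraic tensor product. -/
noncomputable def sliceAlg (A : Type u) [NonUnitalCStarAlgebra A] (ρ : C →⋆ₙₐ[ℂ] (L →L[ℂ] L))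
    (η' η : L) : A ⊗[ℂ] C →ₗ[ℂ] A :=
  TensorProduct.lift (LinearMap.mk₂ ℂ (fun a c => (inner ℂ η' (ρ c η) : ℂ) • a)
    (fun a a' c => smul_add _ _ _) (fun z a c => smul_comm _ _ _)
    (fun a c c' => by rw [map_add, _root_.add_apply, inner_add_right, add_smul])
    (fun z a c => by rw [map_smul, _root_.smul_apply, inner_smul_right, mul_smul]))

@[simp]
theorem sliceAlg_tmul (ρ : C →⋆ₙₐ[ℂ] (L →L[ℂ] L)) (η' η : L) (a : A) (c : C) :
    sliceAlg A ρ η' η (a ⊗ₜ c) = (inner ℂ η' (ρ c η) : ℂ) • a := by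
  simp [sliceAlg]

theorem inner_sliceAlg (π : A →⋆ₙₐ[ℂ] (K →L[ℂ] K)) (ρ : C →⋆ₙₐ[ℂ] (L →L[ℂ] L)) (η' η : L)
    (t : A ⊗[ℂ] C) (k' k : K) : inner ℂ (tm k' η') (tensorRep π ρ t (tm k η)) =
      (inner ℂ k' (π (sliceAlg A ρ η' η t) k) : ℂ) := by
  induction t with
  | zero => simp
  | add t t' h h' =>
    rw [map_add, _root_.add_apply, inner_add_right, h, h', map_add, map_add, _root_.add_apply,
      inner_add_right]
  | tmul a c =>
    rw [tensorRep_tmul, opTensor_tm, inner_tm, sliceAlg_tmul, map_smul, _root_.smul_apply,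
      inner_smul_right, mul_comm]

/-- A slice is bounded by the norm of `π ⊗ ρ` as soon as `π` is faithful: its matrix coefficients
are matrix coefficients of `π ⊗ ρ`. -/
theorem norm_sliceAlg_le {π : A →⋆ₙₐ[ℂ] (K →L[ℂ] K)} (hπ : Function.Injective π)
    (ρ : C →⋆ₙₐ[ℂ] (L →L[ℂ] L)) (η' η : L) (t : A ⊗[ℂ] C) :
    ‖sliceAlg A ρ η' η t‖ ≤ ‖η'‖ * ‖η‖ * ‖tensorRep π ρ t‖ := by
  rw [← NonUnitalStarAlgHom.norm_map π hπ]
  refine ContinuousLinearMap.opNorm_le_of_inner _ (by positivity) fun k k' => ?_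
  rw [← inner_sliceAlg]
  refine (norm_inner_le_norm _ _).trans ?_
  calc _ ≤ ‖tm k' η'‖ * (‖tensorRep π ρ t‖ * ‖tm k η‖) :=
        mul_le_mul_of_nonneg_left (ContinuousLinearMap.le_opNorm _ _) (norm_nonneg _)
    _ = _ := by rw [norm_tm, norm_tm]; ring

/-- The spatial norm can be computed with one faithful representation in the first factor. -/
theorem norm_tensorRep_le_of_injective {π : A →⋆ₙₐ[ℂ] (K →L[ℂ] K)} (hπ : Function.Injective π)
    {K' : Type u} [NormedAddCommGroup K'] [InnerProductSpace ℂ K'] [CompleteSpace K']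
    (π' : A →⋆ₙₐ[ℂ] (K' →L[ℂ] K')) (ρ : C →⋆ₙₐ[ℂ] (L →L[ℂ] L)) (t : A ⊗[ℂ] C) :
    ‖tensorRep π' ρ t‖ ≤ ‖tensorRep π ρ t‖ := by
  -- the coefficients of `(π' ⊗ ρ) ((t* t) ^ (m + 1))` at elementary tensors only involve slices of
  -- `(t* t) ^ (m + 1)`, whose norms `(π ⊗ ρ)` controls
  have h : ‖tensorRep π' ρ (star t * t)‖ ≤ ‖tensorRep π ρ (star t * t)‖ := by
    have hsa : IsSelfAdjoint (tensorRep π' ρ (star t * t)) :=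
      (IsSelfAdjoint.star_mul_self t).map (tensorRep π' ρ)
    refine hsa.norm_le_of_inner_growth (norm_nonneg (tensorRep π ρ (star t * t)))
      (total_tm span_univ_closure span_univ_closure) ?_
    rintro _ ⟨k, -, l, -, rfl⟩
    refine ⟨‖k‖ * (‖l‖ * ‖l‖ * ‖k‖), fun m => ?_⟩
    rw [← map_powSucc, inner_sliceAlg]
    refine (norm_inner_le_norm _ _).trans ?_
    rw [mul_assoc]
    refine mul_le_mul_of_nonneg_left ?_ (norm_nonneg k)
    refine (ContinuousLinearMap.le_opNorm _ _).trans ?_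
    rw [mul_right_comm]
    refine mul_le_mul_of_nonneg_right ?_ (norm_nonneg k)
    refine (NonUnitalStarAlgHom.norm_apply_le π' _).trans ?_
    refine (norm_sliceAlg_le hπ ρ l l _).trans ?_
    refine mul_le_mul_of_nonneg_left ?_ (by positivity)
    rw [map_powSucc]
    exact norm_pow_le' (tensorRep π ρ (star t * t)) m.succ_pos
  have e : ∀ {X : Type u} [NormedAddCommGroup X] [InnerProductSpace ℂ X] [CompleteSpace X]
      (Φ : A ⊗[ℂ] C →⋆ₙₐ[ℂ] (X →L[ℂ] X)), ‖Φ (star t * t)‖ = ‖Φ t‖ * ‖Φ t‖ := fun Φ => by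
    rw [map_mul, map_star, CStarRing.norm_star_mul_self]
  rw [e, e] at h
  exact (mul_self_le_mul_self_iff (norm_nonneg _) (norm_nonneg _)).mpr h

/-- To bound the spatial norm it suffices to consider representations `π ⊗ ρ` with a fixed faithful
`π`. -/
theorem norm_of_le {π : A →⋆ₙₐ[ℂ] (K →L[ℂ] K)} (hπ : Function.Injective π) (t : A ⊗[ℂ] C) {M : ℝ}
    (hM : 0 ≤ M)
    (h : ∀ (L : Type u) [NormedAddCommGroup L] [InnerProductSpace ℂ L] [CompleteSpace L]
      (ρ : C →⋆ₙₐ[ℂ] (L →L[ℂ] L)), ‖tensorRep π ρ t‖ ≤ M) :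
    ‖(of t : SpatialTensor A C)‖ ≤ M := by
  rw [norm_of]
  refine CStarSeminorm.sup_le _ _ _ _ hM ?_
  rintro _ ⟨K', _, _, _, L, _, _, _, π', ρ, rfl⟩
  rw [repSeminorm_apply]
  exact (norm_tensorRep_le_of_injective hπ π' ρ t).trans (h L ρ)

variable (A) in
/-- The slice map `a ⊗ c ↦ ⟨η', ρ(c) η⟩ a` on the spatial tensor product. -/
noncomputable def slice (ρ : C →⋆ₙₐ[ℂ] (L →L[ℂ] L)) (η' η : L) : SpatialTensor A C →L[ℂ] A :=
  (sliceAlg A ρ η' η).extendOfNorm (of : A ⊗[ℂ] C →⋆ₙₐ[ℂ] SpatialTensor A C)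

theorem exists_norm_sliceAlg_le (ρ : C →⋆ₙₐ[ℂ] (L →L[ℂ] L)) (η' η : L) (t : A ⊗[ℂ] C) :
    ‖sliceAlg A ρ η' η t‖ ≤ ‖η'‖ * ‖η‖ * ‖(of t : SpatialTensor A C)‖ := by
  obtain ⟨K, _, _, _, π, hπ⟩ := exists_faithful_rep A
  refine (norm_sliceAlg_le hπ ρ η' η t).trans (mul_le_mul_of_nonneg_left ?_ (by positivity))
  rw [norm_of]
  exact norm_tensorRep_le π ρ t

theorem slice_of (ρ : C →⋆ₙₐ[ℂ] (L →L[ℂ] L)) (η' η : L) (t : A ⊗[ℂ] C) :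
    slice A ρ η' η (of t) = sliceAlg A ρ η' η t :=
  LinearMap.extendOfNorm_eq (f := sliceAlg A ρ η' η)
    (e := ((of : A ⊗[ℂ] C →⋆ₙₐ[ℂ] SpatialTensor A C) : A ⊗[ℂ] C →ₗ[ℂ] SpatialTensor A C))
    denseRange_of ⟨_, exists_norm_sliceAlg_le ρ η' η⟩ t

theorem slice_tmul (ρ : C →⋆ₙₐ[ℂ] (L →L[ℂ] L)) (η' η : L) (a : A) (c : C) :
    slice A ρ η' η (tmul a c) = (inner ℂ η' (ρ c η) : ℂ) • a := by
  rw [tmul, slice_of, sliceAlg_tmul]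

theorem norm_slice_le (ρ : C →⋆ₙₐ[ℂ] (L →L[ℂ] L)) (η' η : L) (x : SpatialTensor A C) :
    ‖slice A ρ η' η x‖ ≤ ‖η'‖ * ‖η‖ * ‖x‖ := by
  refine denseRange_of.induction_on x (isClosed_le (by fun_prop) (by fun_prop)) fun t => ?_
  rw [slice_of]
  exact exists_norm_sliceAlg_le ρ η' η t

theorem norm_tmul_le (a : A) (c : C) : ‖tmul a c‖ ≤ ‖a‖ * ‖c‖ := by
  rw [tmul, norm_of]
  refine CStarSeminorm.sup_le _ _ _ _ (by positivity) ?_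
  rintro _ ⟨K, _, _, _, L, _, _, _, π, ρ, rfl⟩
  rw [repSeminorm_apply, tensorRep_tmul]
  exact (norm_opTensor_le _ _).trans
    (mul_le_mul (NonUnitalStarAlgHom.norm_apply_le π a) (NonUnitalStarAlgHom.norm_apply_le ρ c)
      (norm_nonneg _) (norm_nonneg _))

variable (A) in
/-- `a ↦ a ⊗ c` as a bounded linear map. -/
noncomputable def tmulLeft (c : C) : A →L[ℂ] SpatialTensor A C :=
  LinearMap.mkContinuous
    { toFun := fun a => tmul a c
      map_add' := fun a a' => by rw [tmul, TensorProduct.add_tmul, map_add]; rfl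
      map_smul' := fun z a => by rw [tmul, ← TensorProduct.smul_tmul', map_smul]; rfl } ‖c‖
    fun a => (norm_tmul_le a c).trans (mul_comm _ _).le

variable (C) in
/-- `c ↦ a ⊗ c` as a bounded linear map. -/
noncomputable def tmulRight (a : A) : C →L[ℂ] SpatialTensor A C :=
  LinearMap.mkContinuous
    { toFun := fun c => tmul a c
      map_add' := fun c c' => by rw [tmul, TensorProduct.tmul_add, map_add]; rfl
      map_smul' := fun z c => by rw [tmul, TensorProduct.tmul_smul, map_smul]; rfl } ‖a‖
    fun c => norm_tmul_le a c

theorem span_tmul_closure {S : Set A} {S' : Set C}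
    (hS : (Submodule.span ℂ S).topologicalClosure = ⊤)
    (hS' : (Submodule.span ℂ S').topologicalClosure = ⊤) :
    (Submodule.span ℂ (Set.image2 tmul S S' : Set (SpatialTensor A C))).topologicalClosure = ⊤ := by
  set V := (Submodule.span ℂ (Set.image2 tmul S S' : Set (SpatialTensor A C))).topologicalClosure
    with hV
  have hcl : IsClosed (V : Set (SpatialTensor A C)) := Submodule.isClosed_topologicalClosure _
  have h1 : ∀ a ∈ S, ∀ c : C, tmul a c ∈ V := by
    intro a ha c
    have h2 : (Submodule.span ℂ S').topologicalClosure ≤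
        V.comap (tmulRight C a).toLinearMap := by
      refine Submodule.topologicalClosure_minimal _ (Submodule.span_le.mpr fun c hc => ?_) ?_
      · exact Submodule.le_topologicalClosure _ (Submodule.subset_span ⟨a, ha, c, hc, rfl⟩)
      · exact hcl.preimage (tmulRight C a).continuous
    rw [hS'] at h2
    exact h2 (Submodule.mem_top : c ∈ ⊤)
  have h3 : ∀ (a : A) (c : C), tmul a c ∈ V := by
    intro a c
    have h2 : (Submodule.span ℂ S).topologicalClosure ≤
        V.comap (tmulLeft A c).toLinearMap := by
      refine Submodule.topologicalClosure_minimal _ (Submodule.span_le.mpr fun a ha => h1 a ha c) ?_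
      exact hcl.preimage (tmulLeft A c).continuous
    rw [hS] at h2
    exact h2 (Submodule.mem_top : a ∈ ⊤)
  rw [eq_top_iff]
  rintro x -
  refine denseRange_of.induction_on x hcl fun t => ?_
  induction t with
  | zero => rw [map_zero]; exact V.zero_mem
  | add t t' h h' => rw [map_add]; exact V.add_mem h h'
  | tmul a c => exact h3 a c

theorem span_tmul_univ :
    (Submodule.span ℂ (Set.image2 tmul Set.univ Set.univ :
      Set (SpatialTensor A C))).topologicalClosure = ⊤ :=
  span_tmul_closure span_univ_closure span_univ_closure

theorem ext_tmul {V : Type*} [NormedAddCommGroup V] [NormedSpace ℂ V]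
    {f g : SpatialTensor A C →L[ℂ] V} (h : ∀ a c, f (tmul a c) = g (tmul a c)) : f = g :=
  ContinuousLinearMap.ext_of_span span_tmul_univ fun _ ⟨a, _, c, _, hx⟩ => hx ▸ h a c

end SpatialTensor

/-! ### The regular representation and multipliers of `A ⊗ C*(H)` -/

namespace GroupCStar

variable {H : Type u} [Group H]

theorem denseRange_coeHom : DenseRange (coeHom : MonoidAlgebra ℂ H →⋆ₙₐ[ℂ] GroupCStar H) :=
  (groupNorm H).denseRange_coe

theorem span_of_closure :
    (Submodule.span ℂ (Set.range (of : H → GroupCStar H))).topologicalClosure = ⊤ := by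
  rw [← Submodule.dense_iff_topologicalClosure_eq_top]
  refine denseRange_coeHom.mono ?_
  rintro _ ⟨f, rfl⟩
  induction f using MonoidAlgebra.induction_linear with
  | zero => rw [map_zero]; exact Submodule.zero_mem _
  | add f g hf hg => rw [map_add]; exact Submodule.add_mem _ hf hg
  | single s c =>
    have h : (MonoidAlgebra.single s c : MonoidAlgebra ℂ H) = c • MonoidAlgebra.single s 1 := by
      simp
    rw [h, map_smul]
    exact Submodule.smul_mem _ c (Submodule.subset_span ⟨s, rfl⟩)

theorem of_one_mul (c : GroupCStar H) : of 1 * c = c := by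
  have h : ContinuousLinearMap.mul ℂ (GroupCStar H) (of 1) = ContinuousLinearMap.id ℂ _ := by
    refine ContinuousLinearMap.ext_of_span span_of_closure ?_
    rintro _ ⟨s, rfl⟩
    rw [ContinuousLinearMap.mul_apply', ← of_mul, one_mul]; rfl
  exact congrArg (fun f => f c) h

/-- The *-homomorphism of `C*(H)` given by a unitary representation of `H`. -/
theorem exists_hom {E : Type v} [CStarAlgebra E] (u : H →* unitary E) :
    ∃ φ : GroupCStar H →⋆ₙₐ[ℂ] E, ∀ s, φ (of s) = u s := by
  let φ₀ : MonoidAlgebra ℂ H →ₐ[ℂ] E := MonoidAlgebra.lift ℂ E H ((unitary E).subtype.comp u)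
  have hφ₀ : ∀ s c, φ₀ (MonoidAlgebra.single s c) = c • (u s : E) := fun s c =>
    MonoidAlgebra.lift_single _ _ _
  let φ : MonoidAlgebra ℂ H →⋆ₙₐ[ℂ] E :=
    { (φ₀ : MonoidAlgebra ℂ H →ₙₐ[ℂ] E) with
      map_star' := fun f => by
        change φ₀ (star f) = star (φ₀ f)
        induction f using MonoidAlgebra.induction_linear with
        | zero => simp
        | add f g hf hg => rw [star_add, map_add, hf, hg, map_add, star_add]
        | single s c =>
          rw [groupAlg_star_single, hφ₀, hφ₀, star_smul, map_inv]; rfl }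
  refine ⟨(groupNorm H).lift φ fun f => CStarSeminorm.le_sup _ (groupSeminorms_bdd H)
    (CStarSeminorm.ofHom φ) (Set.mem_univ _) f, fun s => ?_⟩
  refine ((groupNorm H).lift_coe _ _ _).trans ?_
  change φ₀ _ = _
  rw [hφ₀, one_smul]

variable (H) in
/-- The Hilbert space `ℓ²(H)`. -/
abbrev L2 : Type u := lp (fun _ : H => ℂ) 2

open Classical in
/-- The canonical basis vector `e_t` of `ℓ²(H)`. -/
noncomputable def bv (t : H) : L2 H := lp.single 2 t (1 : ℂ)

open Classical in
theorem inner_bv (s t : H) : inner ℂ (bv s) (bv t) = if s = t then (1 : ℂ) else 0 := by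
  rw [bv, bv, lp.inner_single_left, lp.single_apply, Pi.single_apply]
  split_ifs <;> simp

theorem inner_bv_ne {s t : H} (h : s ≠ t) : inner ℂ (bv s) (bv t) = (0 : ℂ) := by
  classical rw [inner_bv, if_neg h]

theorem norm_bv (t : H) : ‖bv t‖ = 1 := by
  classical rw [bv, lp.norm_single (by norm_num), norm_one]

theorem span_bv_closure :
    (Submodule.span ℂ (Set.range (bv : H → L2 H))).topologicalClosure = ⊤ := by
  classical
  rw [eq_top_iff]
  rintro x -
  have h := lp.hasSum_single (p := 2) (by norm_num) x
  refine mem_closure_of_tendsto h (Filter.Eventually.of_forall fun s => ?_)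
  refine Submodule.sum_mem _ fun t _ => ?_
  have h1 : lp.single 2 t (x t) = x t • (bv t : L2 H) := by
    rw [bv, ← lp.single_smul, smul_eq_mul, mul_one]
  rw [h1]
  exact Submodule.smul_mem _ _ (Submodule.subset_span ⟨t, rfl⟩)

theorem orthonormal_bv : Orthonormal ℂ (bv : H → L2 H) :=
  ⟨norm_bv, fun _ _ h => inner_bv_ne h⟩

theorem exists_translation (s : H) : ∃ V : L2 H ≃ₗᵢ[ℂ] L2 H, ∀ t, V (bv t) = bv (s * t) := by
  classical
  have ho : Orthonormal ℂ (fun t => bv (s * t) : H → L2 H) :=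
    orthonormal_bv.comp _ (mul_right_injective s)
  have hr : Set.range (fun t => bv (s * t) : H → L2 H) = Set.range bv :=
    (Equiv.mulLeft s).surjective.range_comp bv
  let b := HilbertBasis.mk ho (by rw [hr, span_bv_closure])
  refine ⟨b.repr.symm, fun t => ?_⟩
  change b.repr.symm (lp.single 2 t (1 : ℂ)) = _
  rw [HilbertBasis.repr_symm_single, HilbertBasis.coe_mk]

variable (H) in
theorem exists_regularRep :
    ∃ φ : GroupCStar H →⋆ₙₐ[ℂ] (L2 H →L[ℂ] L2 H), ∀ s t, φ (of s) (bv t) = bv (s * t) := by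
  choose V hV using exists_translation (H := H)
  have hext : ∀ {W W' : L2 H ≃ₗᵢ[ℂ] L2 H}, (∀ t, W (bv t) = W' (bv t)) → W = W' := fun {W W'} h => by
    have h1 : (W : L2 H →L[ℂ] L2 H) = (W' : L2 H →L[ℂ] L2 H) :=
      ContinuousLinearMap.ext_of_span span_bv_closure (by rintro _ ⟨t, rfl⟩; exact h t)
    ext1 x
    exact congrArg (fun f : L2 H →L[ℂ] L2 H => f x) h1
  let u₀ : H →* (L2 H ≃ₗᵢ[ℂ] L2 H) :=
    { toFun := V
      map_one' := hext fun r => by rw [hV, one_mul]; rfl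
      map_mul' := fun s t => hext fun r => by
        rw [LinearIsometryEquiv.coe_mul, Function.comp_apply, hV, hV, hV, mul_assoc] }
  let u : H →* unitary (L2 H →L[ℂ] L2 H) :=
    (Unitary.linearIsometryEquiv (𝕜 := ℂ) (H := L2 H)).symm.toMonoidHom.comp u₀
  obtain ⟨φ, hφ⟩ := exists_hom u
  exact ⟨φ, fun s t => by rw [hφ]; exact hV s t⟩

variable (H) in
/-- The left regular representation of `C*(H)` on `ℓ²(H)`. -/
noncomputable def regularRep : GroupCStar H →⋆ₙₐ[ℂ] (L2 H →L[ℂ] L2 H) :=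
  (exists_regularRep H).choose

theorem regularRep_of (s t : H) : regularRep H (of s) (bv t) = bv (s * t) :=
  (exists_regularRep H).choose_spec s t

end GroupCStar

namespace SpatialTensor

variable {A : Type u} [NonUnitalCStarAlgebra A] {H : Type u} [Group H]

theorem star_fst_mul_fst (m : unitary 𝓜(ℂ, A)) (a b : A) :
    star ((m : 𝓜(ℂ, A)).fst a) * (m : 𝓜(ℂ, A)).fst b = star a * b := by
  have h1 : star ((m : 𝓜(ℂ, A)).fst a) = (star (m : 𝓜(ℂ, A))).snd (star a) := by
    rw [DoubleCentralizer.star_snd, star_star]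
  have h2 : (star (m : 𝓜(ℂ, A))).fst ((m : 𝓜(ℂ, A)).fst b) = b := by
    have := congrArg (fun k : 𝓜(ℂ, A) => k.fst b) (Unitary.coe_star_mul_self m)
    exact this
  rw [h1, DoubleCentralizer.central, h2]

theorem snd_mul_star_snd (m : unitary 𝓜(ℂ, A)) (a b : A) :
    (m : 𝓜(ℂ, A)).snd a * star ((m : 𝓜(ℂ, A)).snd b) = a * star b := by
  have h1 : star ((m : 𝓜(ℂ, A)).snd b) = (star (m : 𝓜(ℂ, A))).fst (star b) := by
    rw [DoubleCentralizer.star_fst, star_star]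
  have h2 : (m : 𝓜(ℂ, A)).fst ((star (m : 𝓜(ℂ, A))).fst (star b)) = star b := by
    have := congrArg (fun k : 𝓜(ℂ, A) => k.fst (star b)) (Unitary.coe_mul_star_self m)
    exact this
  rw [h1, DoubleCentralizer.central, h2]

/-- Left multiplication by `m ⊗ s` on the algebraic tensor product. -/
noncomputable def mulTensorLeftAlg (m : 𝓜(ℂ, A)) (s : H) :
    A ⊗[ℂ] GroupCStar H →ₗ[ℂ] A ⊗[ℂ] GroupCStar H :=
  TensorProduct.map m.fst.toLinearMap (LinearMap.mulLeft ℂ (GroupCStar.of s))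

/-- Right multiplication by `m ⊗ s` on the algebraic tensor product. -/
noncomputable def mulTensorRightAlg (m : 𝓜(ℂ, A)) (s : H) :
    A ⊗[ℂ] GroupCStar H →ₗ[ℂ] A ⊗[ℂ] GroupCStar H :=
  TensorProduct.map m.snd.toLinearMap (LinearMap.mulRight ℂ (GroupCStar.of s))

@[simp]
theorem mulTensorLeftAlg_tmul (m : 𝓜(ℂ, A)) (s : H) (a : A) (c : GroupCStar H) :
    mulTensorLeftAlg m s (a ⊗ₜ c) = m.fst a ⊗ₜ (GroupCStar.of s * c) := rfl

@[simp]
theorem mulTensorRightAlg_tmul (m : 𝓜(ℂ, A)) (s : H) (a : A) (c : GroupCStar H) :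
    mulTensorRightAlg m s (a ⊗ₜ c) = m.snd a ⊗ₜ (c * GroupCStar.of s) := rfl

theorem star_mulTensorLeftAlg_mul (m : unitary 𝓜(ℂ, A)) (s : H) (x y : A ⊗[ℂ] GroupCStar H) :
    star (mulTensorLeftAlg (m : 𝓜(ℂ, A)) s x) * mulTensorLeftAlg (m : 𝓜(ℂ, A)) s y =
      star x * y := by
  induction x with
  | zero => simp
  | add x x' h h' => rw [map_add, star_add, add_mul, h, h', star_add, add_mul]
  | tmul a c =>
    induction y with
    | zero => simp
    | add y y' h h' => rw [map_add, mul_add, h, h', mul_add]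
    | tmul b d =>
      rw [mulTensorLeftAlg_tmul, mulTensorLeftAlg_tmul, TensorProduct.star_tmul,
        Algebra.TensorProduct.tmul_mul_tmul, star_fst_mul_fst, star_mul, GroupCStar.star_of,
        mul_assoc, ← mul_assoc _ _ d, ← GroupCStar.of_mul, inv_mul_cancel, GroupCStar.of_one_mul,
        TensorProduct.star_tmul, Algebra.TensorProduct.tmul_mul_tmul]

theorem mulTensorRightAlg_mul_star (m : unitary 𝓜(ℂ, A)) (s : H) (x y : A ⊗[ℂ] GroupCStar H) :
    mulTensorRightAlg (m : 𝓜(ℂ, A)) s x * star (mulTensorRightAlg (m : 𝓜(ℂ, A)) s y) =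
      x * star y := by
  induction x with
  | zero => simp
  | add x x' h h' => rw [map_add, add_mul, h, h', add_mul]
  | tmul a c =>
    induction y with
    | zero => simp
    | add y y' h h' => rw [map_add, star_add, mul_add, h, h', star_add, mul_add]
    | tmul b d =>
      rw [mulTensorRightAlg_tmul, mulTensorRightAlg_tmul, TensorProduct.star_tmul,
        Algebra.TensorProduct.tmul_mul_tmul, snd_mul_star_snd, star_mul, GroupCStar.star_of,
        mul_assoc, ← mul_assoc _ _ (star d), ← GroupCStar.of_mul, mul_inv_cancel,
        GroupCStar.of_one_mul, TensorProduct.star_tmul, Algebra.TensorProduct.tmul_mul_tmul]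

/-- A linear endomorphism of the algebraic tensor product that is isometric for the spatial norm
extends to the spatial tensor product. -/
theorem exists_extend {B C : Type u} [NonUnitalCStarAlgebra B] [NonUnitalCStarAlgebra C]
    (f : B ⊗[ℂ] C →ₗ[ℂ] B ⊗[ℂ] C)
    (hf : ∀ t, ‖(of (f t) : SpatialTensor B C)‖ = ‖(of t : SpatialTensor B C)‖) :
    ∃ F : SpatialTensor B C →L[ℂ] SpatialTensor B C, ∀ t, F (of t) = of (f t) := by
  let e : B ⊗[ℂ] C →ₗ[ℂ] SpatialTensor B C := (of : B ⊗[ℂ] C →⋆ₙₐ[ℂ] SpatialTensor B C)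
  have he : DenseRange e := denseRange_of
  exact ⟨(e ∘ₗ f).extendOfNorm e, fun t => LinearMap.extendOfNorm_eq (f := e ∘ₗ f) he
    ⟨1, fun t => by rw [one_mul]; exact (hf t).le⟩ t⟩

/-- The multiplier `m ⊗ s` of `A ⊗ C*(H)` for a unitary multiplier `m`. Unitarity makes both
multiplication maps isometric for the spatial norm, so that they extend. -/
theorem exists_mulTensor (m : unitary 𝓜(ℂ, A)) (s : H) :
    ∃ x : 𝓜(ℂ, SpatialTensor A (GroupCStar H)),
      (∀ a c, x.fst (tmul a c) = tmul ((m : 𝓜(ℂ, A)).fst a) (GroupCStar.of s * c)) ∧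
      (∀ a c, x.snd (tmul a c) = tmul ((m : 𝓜(ℂ, A)).snd a) (c * GroupCStar.of s)) := by
  obtain ⟨F, hF⟩ := exists_extend (mulTensorLeftAlg (m : 𝓜(ℂ, A)) s) fun t => by
    rw [← mul_self_inj (norm_nonneg _) (norm_nonneg _), ← CStarRing.norm_star_mul_self,
      ← CStarRing.norm_star_mul_self, ← map_star of, ← map_star of, ← map_mul of, ← map_mul of,
      star_mulTensorLeftAlg_mul]
  obtain ⟨F', hF'⟩ := exists_extend (mulTensorRightAlg (m : 𝓜(ℂ, A)) s) fun t => by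
    rw [← mul_self_inj (norm_nonneg _) (norm_nonneg _), ← CStarRing.norm_self_mul_star,
      ← CStarRing.norm_self_mul_star, ← map_star of, ← map_star of, ← map_mul of, ← map_mul of,
      mulTensorRightAlg_mul_star]
  have h1 : ∀ a c, F (tmul a c) = tmul ((m : 𝓜(ℂ, A)).fst a) (GroupCStar.of s * c) :=
    fun a c => by rw [tmul, hF, mulTensorLeftAlg_tmul, tmul]
  have h2 : ∀ a c, F' (tmul a c) = tmul ((m : 𝓜(ℂ, A)).snd a) (c * GroupCStar.of s) :=
    fun a c => by rw [tmul, hF', mulTensorRightAlg_tmul, tmul]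
  refine ⟨⟨(F, F'), fun x y => ?_⟩, h1, h2⟩
  have e1 : ∀ a c, ∀ y, F' (tmul a c) * y = tmul a c * F y := by
    intro a c y
    have := ext_tmul (f := ContinuousLinearMap.mul ℂ _ (F' (tmul a c)))
      (g := (ContinuousLinearMap.mul ℂ _ (tmul a c)).comp F) fun b d => by
        rw [ContinuousLinearMap.comp_apply, ContinuousLinearMap.mul_apply',
          ContinuousLinearMap.mul_apply', h1, h2, ← tmul_mul_tmul, ← tmul_mul_tmul,
          DoubleCentralizer.central, mul_assoc]
    exact congrArg (fun f => f y) this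
  have := ext_tmul (f := ((ContinuousLinearMap.mul ℂ _).flip y).comp F')
      (g := (ContinuousLinearMap.mul ℂ _).flip (F y)) fun b d => by
        rw [ContinuousLinearMap.comp_apply, ContinuousLinearMap.flip_apply,
          ContinuousLinearMap.flip_apply, ContinuousLinearMap.mul_apply',
          ContinuousLinearMap.mul_apply', e1]
  exact congrArg (fun f => f x) this

/-- The right multiplication by `1 ⊗ c`, as determined by the left multiplication. -/
theorem IsMulTensor.snd_tmul {C : Type u} [NonUnitalCStarAlgebra C] {c : C}
    {x : 𝓜(ℂ, SpatialTensor A C)} (hx : IsMulTensor 1 c x) (a : A) (d : C) :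
    x.snd (tmul a d) = tmul a (d * c) := by
  refine TwistedAction.eq_of_mul_right fun z => ?_
  rw [x.central]
  have := ext_tmul (f := (ContinuousLinearMap.mul ℂ _ (tmul a d)).comp x.fst)
      (g := ContinuousLinearMap.mul ℂ _ (tmul a (d * c))) fun b e => by
        rw [ContinuousLinearMap.comp_apply, ContinuousLinearMap.mul_apply',
          ContinuousLinearMap.mul_apply', hx, ← tmul_mul_tmul, ← tmul_mul_tmul, mul_assoc]
        rfl
  exact congrArg (fun f => f z) this

end SpatialTensor

/-! ### Functions vanishing at infinity on a discrete set -/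

section C0

variable {H : Type u}

/-- The representation of `c₀(H)` on `ℓ²(H)` by multiplication operators. -/
noncomputable def multRep :
    C₀(WithDiscreteTopology H, ℂ) →⋆ₙₐ[ℂ] (GroupCStar.L2 H →L[ℂ] GroupCStar.L2 H) :=
  lpDiagonalHom fun t =>
    { toFun := fun f => f (WithTopology.toTopology _ t) • (1 : ℂ →L[ℂ] ℂ)
      map_smul' := fun c f => by simp [mul_smul]
      map_zero' := by simp
      map_add' := fun f g => by ext; simp
      map_mul' := fun f g => by ext; simp [mul_comm]
      map_star' := fun f => by ext; simp }

theorem c0Single_apply_self (t : H) : c0Single t (WithTopology.toTopology _ t) = 1 := if_pos rfl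

theorem c0Single_apply_ne {s t : H} (h : s ≠ t) : c0Single t (WithTopology.toTopology _ s) = 0 :=
  if_neg h

theorem multRep_bv (f : C₀(WithDiscreteTopology H, ℂ)) (t : H) :
    multRep f (GroupCStar.bv t) = f (WithTopology.toTopology _ t) • GroupCStar.bv t := by
  classical
  ext s
  change f (WithTopology.toTopology _ s) • (GroupCStar.bv t : ∀ _, ℂ) s =
    f (WithTopology.toTopology _ t) • (GroupCStar.bv t : ∀ _, ℂ) s
  by_cases h : s = t
  · rw [h]
  · have : (GroupCStar.bv t : ∀ _, ℂ) s = 0 := by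
      unfold GroupCStar.bv
      exact lp.single_apply_ne _ _ _ h
    rw [this, smul_zero, smul_zero]

theorem c0Single_apply (s t : H) [Decidable (s = t)] :
    c0Single t (WithTopology.toTopology _ s) = if s = t then 1 else 0 := by
  split_ifs with h
  · rw [h, c0Single_apply_self]
  · exact c0Single_apply_ne h

theorem span_c0Single_closure : (Submodule.span ℂ
    (Set.range (c0Single : H → C₀(WithDiscreteTopology H, ℂ)))).topologicalClosure = ⊤ := by
  classical
  refine (Submodule.eq_top_iff'.mpr fun f => ?_)
  change f ∈ closure _
  refine Metric.mem_closure_iff.mpr fun ε hε => ?_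
  have hf := f.zero_at_infty'
  rw [Filter.cocompact_eq_cofinite, Metric.tendsto_nhds] at hf
  have hfin : {x | ε / 2 ≤ ‖f x‖}.Finite := by
    have := hf (ε / 2) (half_pos hε)
    rw [Filter.eventually_cofinite] at this
    refine this.subset fun x hx => ?_
    simpa [dist_zero_right] using hx
  refine ⟨∑ x ∈ hfin.toFinset, f x • c0Single x.ofTopology, Submodule.sum_mem _ fun x _ =>
    Submodule.smul_mem _ _ (Submodule.subset_span ⟨_, rfl⟩), ?_⟩
  rw [dist_eq_norm, ← ZeroAtInftyContinuousMap.norm_toBCF_eq_norm]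
  refine lt_of_le_of_lt ((BoundedContinuousFunction.norm_le (half_pos hε).le).mpr fun y => ?_)
    (half_lt_self hε)
  have hs : (∑ x ∈ hfin.toFinset, f x • c0Single x.ofTopology : C₀(WithDiscreteTopology H, ℂ)) y =
      if y ∈ hfin.toFinset then f y else 0 := by
    let ev : C₀(WithDiscreteTopology H, ℂ) →+ ℂ :=
      { toFun := fun g => g y, map_zero' := rfl, map_add' := fun _ _ => rfl }
    change ev _ = _
    rw [map_sum]
    have : ∀ x, ev (f x • c0Single x.ofTopology) = if y = x then f x else 0 := by
      intro x
      change f x * c0Single x.ofTopology (WithTopology.toTopology _ y.ofTopology) = _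
      rw [c0Single_apply]
      by_cases h : y = x
      · simp [h]
      · rw [if_neg h, if_neg, mul_zero]
        exact fun h' => h (WithTopology.ofTopology_injective _ h')
    simp_rw [this]
    simp
  change ‖f y - (∑ x ∈ hfin.toFinset, f x • c0Single x.ofTopology : C₀(WithDiscreteTopology H, ℂ)) y‖ ≤ _
  rw [hs]
  split_ifs with h
  · rw [sub_self, norm_zero]; exact (half_pos hε).le
  · rw [sub_zero]
    by_contra! h'
    exact h (hfin.mem_toFinset.mpr h'.le)

theorem star_c0Single (t : H) : star (c0Single t) = c0Single t := by
  classical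
  ext s
  change star (c0Single t (WithTopology.toTopology _ s.ofTopology)) =
    c0Single t (WithTopology.toTopology _ s.ofTopology)
  rw [c0Single_apply]
  split_ifs <;> simp

theorem c0Single_mul_self (t : H) : c0Single t * c0Single t = c0Single t := by
  classical
  ext s
  change c0Single t (WithTopology.toTopology _ s.ofTopology) *
    c0Single t (WithTopology.toTopology _ s.ofTopology) =
    c0Single t (WithTopology.toTopology _ s.ofTopology)
  rw [c0Single_apply]
  split_ifs <;> simp

theorem c0Single_mul_of_ne {s t : H} (h : s ≠ t) : c0Single s * c0Single t = 0 := by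
  classical
  ext r
  change c0Single s (WithTopology.toTopology _ r.ofTopology) *
    c0Single t (WithTopology.toTopology _ r.ofTopology) = 0
  rw [c0Single_apply, c0Single_apply]
  split_ifs with h1 h2 <;> simp
  exact h (h1.symm.trans h2)

end C0

/-! ### Unitary multipliers of Fell bundles -/

namespace FellBundle

variable {H : Type v} [Group H] (𝒜 : FellBundle.{u} H)

/-- The product of a Fell bundle as a bilinear map. -/
def mulBilin {s t r : H} (h : s * t = r) : 𝒜.Fiber s →ₗ[ℂ] 𝒜.Fiber t →ₗ[ℂ] 𝒜.Fiber r :=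
  LinearMap.mk₂ ℂ (𝒜.mul h) (𝒜.add_mul h) (𝒜.smul_mul h) (𝒜.mul_add h) (𝒜.mul_smul h)

@[simp]
theorem mulBilin_apply {s t r : H} (h : s * t = r) (a : 𝒜.Fiber s) (b : 𝒜.Fiber t) :
    𝒜.mulBilin h a b = 𝒜.mul h a b := rfl

theorem mul_zero {s t r : H} (h : s * t = r) (a : 𝒜.Fiber s) : 𝒜.mul h a (0 : 𝒜.Fiber t) = 0 :=
  map_zero (𝒜.mulBilin h a)

theorem zero_mul {s t r : H} (h : s * t = r) (b : 𝒜.Fiber t) : 𝒜.mul h (0 : 𝒜.Fiber s) b = 0 :=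
  LinearMap.map_zero₂ (𝒜.mulBilin h) b

theorem mul_sub {s t r : H} (h : s * t = r) (a : 𝒜.Fiber s) (b b' : 𝒜.Fiber t) :
    𝒜.mul h a (b - b') = 𝒜.mul h a b - 𝒜.mul h a b' :=
  map_sub (𝒜.mulBilin h a) b b'

theorem sub_mul {s t r : H} (h : s * t = r) (a a' : 𝒜.Fiber s) (b : 𝒜.Fiber t) :
    𝒜.mul h (a - a') b = 𝒜.mul h a b - 𝒜.mul h a' b :=
  LinearMap.map_sub₂ (𝒜.mulBilin h) a a' b

theorem inv_zero {s r : H} (h : s⁻¹ = r) : 𝒜.inv h (0 : 𝒜.Fiber s) = 0 := by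
  simpa using 𝒜.inv_smul h 0 0

theorem norm_inv_mul_self' {s r : H} (h : s⁻¹ = r) (h' : r * s = 1) (a : 𝒜.Fiber s) :
    ‖𝒜.mul h' (𝒜.inv h a) a‖ = ‖a‖ ^ 2 := by
  subst h
  exact 𝒜.norm_inv_mul_self a

theorem norm_mul_inv_self {s r : H} (h : s⁻¹ = r) (h' : s * r = 1) (a : 𝒜.Fiber s) :
    ‖𝒜.mul h' a (𝒜.inv h a)‖ = ‖a‖ ^ 2 := by
  have h'' : r⁻¹ = s := by rw [← h, _root_.inv_inv]
  have := 𝒜.norm_inv_mul_self' h'' h' (𝒜.inv h a)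
  rwa [𝒜.inv_inv, 𝒜.norm_inv] at this

variable {𝒜}

theorem eq_zero_of_mul_left {r : H} {x : 𝒜.Fiber r}
    (h : 𝒜.mul (inv_mul_cancel r) (𝒜.inv rfl x) x = 0) : x = 0 := by
  have := 𝒜.norm_inv_mul_self x
  rw [h, norm_zero] at this
  exact norm_eq_zero.mp (pow_eq_zero_iff two_ne_zero |>.mp this.symm)

theorem ext_mul_left {r : H} {x y : 𝒜.Fiber r}
    (h : ∀ b : 𝒜.Fiber r⁻¹, 𝒜.mul (inv_mul_cancel r) b x = 𝒜.mul (inv_mul_cancel r) b y) :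
    x = y :=
  sub_eq_zero.mp (eq_zero_of_mul_left (by rw [𝒜.mul_sub, h, sub_self]))

theorem ext_mul_right {r : H} {x y : 𝒜.Fiber r}
    (h : ∀ b : 𝒜.Fiber r⁻¹, 𝒜.mul (mul_inv_cancel r) x b = 𝒜.mul (mul_inv_cancel r) y b) :
    x = y := by
  have := 𝒜.norm_mul_inv_self rfl (mul_inv_cancel r) (x - y)
  rw [𝒜.sub_mul, h, sub_self, norm_zero] at this
  exact sub_eq_zero.mp (norm_eq_zero.mp (pow_eq_zero_iff two_ne_zero |>.mp this.symm))

namespace Multiplier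

variable (m n : 𝒜.Multiplier)

theorem mul_left_assoc {t t' x y z : H} (h₁ : t * t' = x) (h₂ : m.order * x = z)
    (h₃ : m.order * t = y) (h₄ : y * t' = z) (a : 𝒜.Fiber t) (b : 𝒜.Fiber t') :
    m.left h₂ (𝒜.mul h₁ a b) = 𝒜.mul h₄ (m.left h₃ a) b := by
  refine ext_mul_left fun c => ?_
  have e : z⁻¹ * y * t' = 1 := by rw [_root_.mul_assoc, h₄, inv_mul_cancel]
  have e' : z⁻¹ * m.order * t = z⁻¹ * y := by rw [_root_.mul_assoc, h₃]
  have e'' : z⁻¹ * m.order * x = 1 := by rw [_root_.mul_assoc, h₂, inv_mul_cancel]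
  rw [← m.right_mul rfl e'' h₂ (inv_mul_cancel z) c, ← 𝒜.mul_assoc e' e h₁ e'',
    m.right_mul rfl e' h₃ rfl, 𝒜.mul_assoc rfl e h₄ (inv_mul_cancel z)]

theorem mul_right_assoc {t t' x y z : H} (h₁ : t * t' = x) (h₂ : x * m.order = z)
    (h₃ : t' * m.order = y) (h₄ : t * y = z) (a : 𝒜.Fiber t) (b : 𝒜.Fiber t') :
    m.right h₂ (𝒜.mul h₁ a b) = 𝒜.mul h₄ a (m.right h₃ b) := by
  refine ext_mul_right fun c => ?_
  have e : x * (m.order * z⁻¹) = 1 := by rw [← _root_.mul_assoc, h₂, mul_inv_cancel]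
  have e' : t' * (m.order * z⁻¹) = y * z⁻¹ := by rw [← _root_.mul_assoc, h₃]
  have e'' : t * (y * z⁻¹) = 1 := by rw [← _root_.mul_assoc, h₄, mul_inv_cancel]
  rw [m.right_mul h₂ (mul_inv_cancel z) rfl e, 𝒜.mul_assoc h₁ e e' e'',
    𝒜.mul_assoc h₄ (mul_inv_cancel z) rfl e'', m.right_mul h₃ rfl rfl e']

theorem left_right {t x y z : H} (h₁ : m.order * t = x) (h₂ : x * n.order = z)
    (h₃ : t * n.order = y) (h₄ : m.order * y = z) (a : 𝒜.Fiber t) :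
    n.right h₂ (m.left h₁ a) = m.left h₄ (n.right h₃ a) := by
  refine ext_mul_left fun c => ?_
  have e : z⁻¹ * m.order * y = 1 := by rw [_root_.mul_assoc, h₄, inv_mul_cancel]
  have e' : z⁻¹ * x * n.order = 1 := by rw [_root_.mul_assoc, h₂, inv_mul_cancel]
  have e'' : z⁻¹ * m.order * t = z⁻¹ * x := by rw [_root_.mul_assoc, h₁]
  rw [← m.right_mul rfl e h₄ (inv_mul_cancel z) c, ← n.mul_right_assoc rfl e' h₂,
    ← n.mul_right_assoc e'' e' h₃, m.right_mul rfl e'' h₁ rfl]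

theorem left_add {t r : H} (h : m.order * t = r) (a b : 𝒜.Fiber t) :
    m.left h (a + b) = m.left h a + m.left h b := by
  refine ext_mul_left fun c => ?_
  have e : r⁻¹ * m.order * t = 1 := by rw [_root_.mul_assoc, h, inv_mul_cancel]
  rw [𝒜.mul_add, ← m.right_mul rfl e, ← m.right_mul rfl e, ← m.right_mul rfl e, 𝒜.mul_add]

theorem left_smul {t r : H} (h : m.order * t = r) (k : ℂ) (a : 𝒜.Fiber t) :
    m.left h (k • a) = k • m.left h a := by
  refine ext_mul_left fun c => ?_
  have e : r⁻¹ * m.order * t = 1 := by rw [_root_.mul_assoc, h, inv_mul_cancel]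
  rw [𝒜.mul_smul, ← m.right_mul rfl e, ← m.right_mul rfl e, 𝒜.mul_smul]

theorem right_add {t r : H} (h : t * m.order = r) (a b : 𝒜.Fiber t) :
    m.right h (a + b) = m.right h a + m.right h b := by
  refine ext_mul_right fun c => ?_
  have e : t * (m.order * r⁻¹) = 1 := by rw [← _root_.mul_assoc, h, mul_inv_cancel]
  rw [𝒜.add_mul, m.right_mul h _ rfl e, m.right_mul h _ rfl e, m.right_mul h _ rfl e, 𝒜.add_mul]

theorem right_smul {t r : H} (h : t * m.order = r) (k : ℂ) (a : 𝒜.Fiber t) :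
    m.right h (k • a) = k • m.right h a := by
  refine ext_mul_right fun c => ?_
  have e : t * (m.order * r⁻¹) = 1 := by rw [← _root_.mul_assoc, h, mul_inv_cancel]
  rw [𝒜.smul_mul, m.right_mul h _ rfl e, m.right_mul h _ rfl e, 𝒜.smul_mul]

variable {m n} in
theorem left_congr (e : m = n) {t r : H} (h : m.order * t = r) (h' : n.order * t = r)
    (a : 𝒜.Fiber t) : m.left h a = n.left h' a := by
  subst e; rfl

variable {m n} in
theorem right_congr (e : m = n) {t r : H} (h : t * m.order = r) (h' : t * n.order = r)
    (a : 𝒜.Fiber t) : m.right h a = n.right h' a := by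
  subst e; rfl

end Multiplier

section UnitaryMultipliers

variable {G : Type w} [Group G] (φ : G →* H)

/-- A homomorphism of `G` into the unitary multipliers of a Fell bundle, with the order of the
multiplier of `s` given by a homomorphism `φ : G → H`, as a pair of families of linear maps
`a ↦ u_s a` and `a ↦ a u_s`. -/
structure MultiplierRep (𝒜 : FellBundle.{u} H) where
  left (s : G) {t r : H} (h : φ s * t = r) : 𝒜.Fiber t →ₗ[ℂ] 𝒜.Fiber r
  right (s : G) {t r : H} (h : t * φ s = r) : 𝒜.Fiber t →ₗ[ℂ] 𝒜.Fiber r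
  right_mul (s : G) {t t' x y z : H} (h₁ : t * φ s = x) (h₂ : x * t' = z) (h₃ : φ s * t' = y)
    (h₄ : t * y = z) (a : 𝒜.Fiber t) (b : 𝒜.Fiber t') :
    𝒜.mul h₂ (right s h₁ a) b = 𝒜.mul h₄ a (left s h₃ b)
  left_mul (s : G) {t t' x y z : H} (h₁ : t * t' = x) (h₂ : φ s * x = z)
    (h₃ : φ s * t = y) (h₄ : y * t' = z) (a : 𝒜.Fiber t) (b : 𝒜.Fiber t') :
    left s h₂ (𝒜.mul h₁ a b) = 𝒜.mul h₄ (left s h₃ a) b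
  mul_right (s : G) {t t' x y z : H} (h₁ : t * t' = x) (h₂ : x * φ s = z)
    (h₃ : t' * φ s = y) (h₄ : t * y = z) (a : 𝒜.Fiber t) (b : 𝒜.Fiber t') :
    right s h₂ (𝒜.mul h₁ a b) = 𝒜.mul h₄ a (right s h₃ b)
  left_right (s s' : G) {t x y z : H} (h₁ : φ s * t = x) (h₂ : x * φ s' = z)
    (h₃ : t * φ s' = y) (h₄ : φ s * y = z) (a : 𝒜.Fiber t) :
    right s' h₂ (left s h₁ a) = left s h₄ (right s' h₃ a)
  left_left (s s' r : G) (hr : s * s' = r) {t x z : H} (h₁ : φ s' * t = x) (h₂ : φ s * x = z)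
    (h₃ : φ r * t = z) (a : 𝒜.Fiber t) : left s h₂ (left s' h₁ a) = left r h₃ a
  right_right (s s' r : G) (hr : s' * s = r) {t x z : H} (h₁ : t * φ s' = x) (h₂ : x * φ s = z)
    (h₃ : t * φ r = z) (a : 𝒜.Fiber t) : right s h₂ (right s' h₁ a) = right r h₃ a
  left_one {s : G} (hs : s = 1) {t : H} (h : φ s * t = t) (a : 𝒜.Fiber t) : left s h a = a
  right_one {s : G} (hs : s = 1) {t : H} (h : t * φ s = t) (a : 𝒜.Fiber t) : right s h a = a
  inv_left (s s' : G) (hs : s⁻¹ = s') {t t' x x' : H} (h₁ : φ s * t = x) (h₂ : x⁻¹ = x')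
    (h₃ : t⁻¹ = t') (h₄ : t' * φ s' = x') (a : 𝒜.Fiber t) :
    𝒜.inv h₂ (left s h₁ a) = right s' h₄ (𝒜.inv h₃ a)

variable {φ}

/-- The families of linear maps given by a homomorphism into the unitary multipliers. -/
def MultiplierRep.ofUnitary (U : G →* unitary 𝒜.Multiplier)
    (hU : ∀ s, (U s : 𝒜.Multiplier).order = φ s) : MultiplierRep φ 𝒜 where
  left s {t r} h :=
    { toFun := (U s : 𝒜.Multiplier).left ((hU s).symm ▸ h)
      map_add' := Multiplier.left_add _ _
      map_smul' := Multiplier.left_smul _ _ }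
  right s {t r} h :=
    { toFun := (U s : 𝒜.Multiplier).right ((hU s).symm ▸ h)
      map_add' := Multiplier.right_add _ _
      map_smul' := Multiplier.right_smul _ _ }
  right_mul s {t t' x y z} h₁ h₂ h₃ h₄ a b := Multiplier.right_mul _ _ _ _ _ a b
  left_mul s {t t' x y z} h₁ h₂ h₃ h₄ a b := Multiplier.mul_left_assoc _ _ _ _ _ a b
  mul_right s {t t' x y z} h₁ h₂ h₃ h₄ a b := Multiplier.mul_right_assoc _ _ _ _ _ a b
  left_right s s' {t x y z} h₁ h₂ h₃ h₄ a := Multiplier.left_right _ _ _ _ _ _ a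
  left_left s s' r hr {t x z} h₁ h₂ h₃ a := by
    have e : (U r : 𝒜.Multiplier) = U s * U s' := by rw [← hr, map_mul]; rfl
    exact ((Multiplier.left_congr e _ (by simpa [hU, ← hr] using h₃) a).trans
      (Multiplier.mul_left' _ _ _ _ _ a)).symm
  right_right s s' r hr {t x z} h₁ h₂ h₃ a := by
    have e : (U r : 𝒜.Multiplier) = U s' * U s := by rw [← hr, map_mul]; rfl
    exact ((Multiplier.right_congr e _ (by simpa [hU, ← hr] using h₃) a).trans
      (Multiplier.mul_right' _ _ _ _ _ a)).symm
  left_one {s} hs {t} h a := by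
    have e : (U s : 𝒜.Multiplier) = 1 := by rw [hs, map_one]; rfl
    exact (Multiplier.left_congr e _ (_root_.one_mul t) a).trans (Multiplier.one_left' _ a)
  right_one {s} hs {t} h a := by
    have e : (U s : 𝒜.Multiplier) = 1 := by rw [hs, map_one]; rfl
    exact (Multiplier.right_congr e _ (_root_.mul_one t) a).trans (Multiplier.one_right' _ a)
  inv_left s s' hs {t t' x x'} h₁ h₂ h₃ h₄ a := by
    have e : (U s' : 𝒜.Multiplier) = star (U s : 𝒜.Multiplier) := by rw [← hs, map_inv]; rfl
    have h₃' : t'⁻¹ = t := by rw [← h₃, _root_.inv_inv]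
    refine ((Multiplier.right_congr e _ (by simpa [hU, ← hs] using h₄) _).trans
      ((Multiplier.star_right' _ _ h₃' ((hU s).symm ▸ h₁) h₂ _).trans ?_)).symm
    rw [𝒜.inv_inv]
    rfl

namespace MultiplierRep

variable (W : MultiplierRep φ 𝒜)

theorem inv_right (s s' : G) (hs : s⁻¹ = s') {t t' x x' : H} (h₁ : t * φ s = x) (h₂ : x⁻¹ = x')
    (h₃ : t⁻¹ = t') (h₄ : φ s' * t' = x') (a : 𝒜.Fiber t) :
    𝒜.inv h₂ (W.right s h₁ a) = W.left s' h₄ (𝒜.inv h₃ a) := by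
  have h₂' : x'⁻¹ = x := by rw [← h₂, _root_.inv_inv]
  have h₃' : t'⁻¹ = t := by rw [← h₃, _root_.inv_inv]
  have := W.inv_left s' s (by rw [← hs, _root_.inv_inv]) h₄ h₂' h₃' h₁ (𝒜.inv h₃ a)
  rw [𝒜.inv_inv] at this
  rw [← this, 𝒜.inv_inv]

theorem norm_left (s : G) {t r : H} (h : φ s * t = r) (a : 𝒜.Fiber t) : ‖W.left s h a‖ = ‖a‖ := by
  have h1 := 𝒜.norm_inv_mul_self' rfl (inv_mul_cancel r) (W.left s h a)
  have e : r⁻¹ * φ s = t⁻¹ := by rw [← h]; simp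
  have e' : t⁻¹ * φ s⁻¹ = r⁻¹ := by rw [← h]; simp
  have e1 : φ (1 : G) * t = t := by simp
  rw [W.inv_left s s⁻¹ rfl h rfl rfl e', W.right_mul s⁻¹ e' _ (by rw [← h]; simp) (inv_mul_cancel t),
    W.left_left s⁻¹ s 1 (inv_mul_cancel s) _ _ e1, W.left_one rfl,
    𝒜.norm_inv_mul_self' rfl (inv_mul_cancel t)] at h1
  exact ((sq_eq_sq₀ (norm_nonneg _) (norm_nonneg _)).mp h1).symm

theorem norm_right (s : G) {t r : H} (h : t * φ s = r) (a : 𝒜.Fiber t) :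
    ‖W.right s h a‖ = ‖a‖ := by
  have e : φ s⁻¹ * t⁻¹ = r⁻¹ := by rw [← h]; simp
  rw [← 𝒜.norm_inv rfl (W.right s h a), W.inv_right s s⁻¹ rfl h rfl rfl e, W.norm_left, 𝒜.norm_inv]

end MultiplierRep

end UnitaryMultipliers

end FellBundle

/-! ### The unit fiber and the multipliers of a semidirect product bundle -/

namespace FellBundle

section UnitFiber

variable {H : Type v} [Group H] (𝒜 : FellBundle.{u} H)

/-- The fiber `A_e` over the identity, as a C*-algebra. -/
abbrev UnitFiber : Type u := 𝒜.Fiber 1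

instance : Mul 𝒜.UnitFiber := ⟨fun a b => 𝒜.mul (one_mul 1) a b⟩

theorem unitFiber_mul_def (a b : 𝒜.UnitFiber) : a * b = 𝒜.mul (one_mul 1) a b := rfl

noncomputable instance : NonUnitalNormedRing 𝒜.UnitFiber :=
  { (inferInstance : NormedAddCommGroup 𝒜.UnitFiber) with
    mul := (· * ·)
    left_distrib := fun a b c => 𝒜.mul_add (one_mul 1) a b c
    right_distrib := fun a b c => 𝒜.add_mul (one_mul 1) a b c
    zero_mul := fun a => 𝒜.zero_mul (one_mul 1) a
    mul_zero := fun a => 𝒜.mul_zero (one_mul 1) a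
    mul_assoc := fun a b c => 𝒜.mul_assoc (one_mul 1) (one_mul 1) (one_mul 1) (one_mul 1) a b c
    norm_mul_le := fun a b => 𝒜.norm_mul_le (one_mul 1) a b }

noncomputable instance : StarRing 𝒜.UnitFiber where
  star a := 𝒜.inv inv_one a
  star_involutive a := 𝒜.inv_inv inv_one inv_one a
  star_mul a b := 𝒜.inv_mul (one_mul 1) inv_one inv_one inv_one (one_mul 1) a b
  star_add a b := 𝒜.inv_add inv_one a b

theorem unitFiber_star_def (a : 𝒜.UnitFiber) : star a = 𝒜.inv inv_one a := rfl

noncomputable instance : NonUnitalCStarAlgebra 𝒜.UnitFiber where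
  norm_mul_self_le a := by
    have := 𝒜.norm_inv_mul_self' inv_one (one_mul 1) a
    rw [← sq]
    exact this.symm.le
  smul_assoc c a b := 𝒜.smul_mul (one_mul 1) c a b
  smul_comm c a b := (𝒜.mul_smul (one_mul 1) c a b).symm
  star_smul c a := 𝒜.inv_smul inv_one c a

end UnitFiber

section ExistsUnitary

variable {G : Type w} [Group G] {H : Type v} [Group H] {φ : G →* H} {𝒜 : FellBundle.{u} H}

/-- Families of left and right multiplications that are compatible with each other, with the product
of `G` and with the involution define a homomorphism into the unitary multipliers. -/
theorem exists_unitary_of_family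
    (L : ∀ (s : G) {t r : H}, φ s * t = r → 𝒜.Fiber t → 𝒜.Fiber r)
    (R : ∀ (s : G) {t r : H}, t * φ s = r → 𝒜.Fiber t → 𝒜.Fiber r)
    (right_mul : ∀ (s : G) {t t' x y z : H} (h₁ : t * φ s = x) (h₂ : x * t' = z)
      (h₃ : φ s * t' = y) (h₄ : t * y = z) (a : 𝒜.Fiber t) (b : 𝒜.Fiber t'),
      𝒜.mul h₂ (R s h₁ a) b = 𝒜.mul h₄ a (L s h₃ b))
    (left_left : ∀ (s s' : G) {t x z : H} (h₁ : φ s' * t = x) (h₂ : φ s * x = z)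
      (h₃ : φ (s * s') * t = z) (a : 𝒜.Fiber t), L s h₂ (L s' h₁ a) = L (s * s') h₃ a)
    (right_right : ∀ (s s' : G) {t x z : H} (h₁ : t * φ s = x) (h₂ : x * φ s' = z)
      (h₃ : t * φ (s * s') = z) (a : 𝒜.Fiber t), R s' h₂ (R s h₁ a) = R (s * s') h₃ a)
    (left_one : ∀ {t : H} (h : φ 1 * t = t) (a : 𝒜.Fiber t), L 1 h a = a)
    (right_one : ∀ {t : H} (h : t * φ 1 = t) (a : 𝒜.Fiber t), R 1 h a = a)
    (inv_left : ∀ (s : G) {t t' x x' : H} (h₁ : φ s * t = x) (h₂ : x⁻¹ = x')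
      (h₃ : t⁻¹ = t') (h₄ : t' * φ s⁻¹ = x') (a : 𝒜.Fiber t),
      𝒜.inv h₂ (L s h₁ a) = R s⁻¹ h₄ (𝒜.inv h₃ a)) :
    ∃ U : G →* unitary 𝒜.Multiplier, ∀ s, (U s : 𝒜.Multiplier).order = φ s := by
  let m : G → 𝒜.Multiplier := fun s =>
    { order := φ s
      left := L s
      right := R s
      right_mul := right_mul s }
  have m_mul : ∀ s s', m (s * s') = m s * m s' := fun s s' => by
    refine Multiplier.ext' (map_mul φ s s') (fun {t r} h h' a => ?_) (fun {t r} h h' a => ?_)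
    · rw [Multiplier.mul_left' (m s) (m s') h' rfl (by rw [← h']; simp [_root_.mul_assoc])]
      exact (left_left s s' _ _ _ a).symm
    · rw [Multiplier.mul_right' (m s) (m s') h' rfl (by rw [← h']; simp [_root_.mul_assoc])]
      exact (right_right s s' _ _ _ a).symm
  have m_one : m 1 = 1 := by
    refine Multiplier.ext' (map_one φ) (fun {t r} h h' a => ?_) (fun {t r} h h' a => ?_)
    · obtain rfl : t = r := by simpa using h'
      exact left_one _ a
    · obtain rfl : t = r := by simpa using h'
      exact right_one _ a
  have m_star : ∀ s, star (m s) = m s⁻¹ := fun s => by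
    refine Multiplier.ext' (map_inv φ s).symm (fun {t r} h h' a => ?_) (fun {t r} h h' a => ?_)
    · have e : t⁻¹ * φ s = r⁻¹ := by rw [← h']; simp [m]
      have e' : t⁻¹ * φ s⁻¹⁻¹ = r⁻¹ := by rw [_root_.inv_inv]; exact e
      have := congrArg (𝒜.inv (_root_.inv_inv r)) (inv_left s⁻¹ h' rfl rfl e' a)
      rw [𝒜.inv_inv] at this
      rw [Multiplier.star_left' (m s) h rfl e (_root_.inv_inv r)]
      refine Eq.trans ?_ this.symm
      congr 1
      have h2 : ∀ s' (hs : s = s') (e' : t⁻¹ * φ s' = r⁻¹) (b : 𝒜.Fiber t⁻¹),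
        R s e b = R s' e' b := by rintro _ rfl _ _; rfl
      exact h2 _ (_root_.inv_inv s).symm _ _
    · have e : φ s * t⁻¹ = r⁻¹ := by rw [← h']; simp [m]
      rw [Multiplier.star_right' (m s) h rfl e (_root_.inv_inv r)]
      exact (inv_left s e (_root_.inv_inv r) (_root_.inv_inv t) h' _).trans (by rw [𝒜.inv_inv])
  have hu : ∀ s, m s ∈ unitary 𝒜.Multiplier := fun s => by
    rw [Unitary.mem_iff, m_star, ← m_mul, ← m_mul, inv_mul_cancel, mul_inv_cancel, m_one]
    exact ⟨rfl, rfl⟩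
  exact ⟨{ toFun := fun s => ⟨m s, hu s⟩
           map_one' := Subtype.ext m_one
           map_mul' := fun s s' => Subtype.ext (m_mul s s') }, fun s => rfl⟩

end ExistsUnitary

end FellBundle

namespace TwistedAction

variable {G : Type v} [Group G] {N : Subgroup G} [N.Normal] {B : Type u}
  [NonUnitalCStarAlgebra B] {T : TwistedAction N B} {x y z : G ⧸ N}

variable (T) in
/-- The left multiplication `u_s [b, t] = [α_s(b), s t]`. -/
def fiberLeft (s : G) (h : (s : G ⧸ N) * x = y) (f : T.Fib x) : T.Fib y :=
  ⟨fun r => T.act s (f.1 (s⁻¹ * r)), fun r hr => by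
    beta_reduce
    rw [f.2.1, map_zero]
    intro h'
    apply hr
    rw [← h, ← h', QuotientGroup.mk_mul, QuotientGroup.mk_inv, mul_inv_cancel_left], fun n r => by
    have e : s⁻¹ * ((n : G)⁻¹ * r) = ((T.conj s⁻¹ n : N) : G)⁻¹ * (s⁻¹ * r) := by
      simp [conj, mul_assoc]
    have e' : T.conj s (T.conj s⁻¹ n) = n := by ext; simp [conj, mul_assoc]
    beta_reduce
    rw [e, f.2.2, act_rmul, e']⟩

variable (T) in
/-- The right multiplication `[b, t] u_s = [b, t s]`. -/
def fiberRight (s : G) (h : x * (s : G ⧸ N) = y) (f : T.Fib x) : T.Fib y :=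
  ⟨fun r => f.1 (r * s⁻¹), fun r hr => by
    beta_reduce
    rw [f.2.1]
    intro h'
    apply hr
    rw [← h, ← h', QuotientGroup.mk_mul, QuotientGroup.mk_inv, inv_mul_cancel_right], fun n r => by
    beta_reduce
    rw [mul_assoc, f.2.2]⟩

theorem fiberRight_mul (s : G) {t t' x y z : G ⧸ N} (h₁ : t * (s : G ⧸ N) = x) (h₂ : x * t' = z)
    (h₃ : (s : G ⧸ N) * t' = y) (h₄ : t * y = z) (a : T.Fib t) (b : T.Fib t') :
    T.fiberMul h₂ (T.fiberRight s h₁ a) b = T.fiberMul h₄ a (T.fiberLeft s h₃ b) := by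
  obtain ⟨p, rfl⟩ := QuotientGroup.mk_surjective t
  refine Subtype.ext (funext fun r => ?_)
  rw [fiberMul_apply h₂ _ _ (s := p * s) h₁, fiberMul_apply h₄ _ _ (s := p) rfl]
  simp [fiberRight, fiberLeft, mul_assoc]

theorem fiberInv_fiberLeft (s : G) {t t' x x' : G ⧸ N} (h₁ : (s : G ⧸ N) * t = x) (h₂ : x⁻¹ = x')
    (h₃ : t⁻¹ = t') (h₄ : t' * ((s⁻¹ : G) : G ⧸ N) = x') (a : T.Fib t) :
    T.fiberInv h₂ (T.fiberLeft s h₁ a) = T.fiberRight s⁻¹ h₄ (T.fiberInv h₃ a) := by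
  refine Subtype.ext (funext fun r => ?_)
  change T.act r (star (T.act s (a.1 (s⁻¹ * r⁻¹)))) =
    T.act (r * s⁻¹⁻¹) (star (a.1 (r * s⁻¹⁻¹)⁻¹))
  rw [← map_star, ← act_mul_apply]
  simp

end TwistedAction

namespace FellBundle

variable {G : Type u} [Group G] {N : Subgroup G} [N.Normal] {𝒟 : FellBundle.{u, u} (G ⧸ N)}

/-- A bundle isomorphic to a twisted semidirect product bundle carries the unitary multipliers
`u_s` corresponding to `[b, t] ↦ [α_s(b), s t]` and `[b, t] ↦ [b, t s]`. -/
theorem Iso.exists_unitary {B : Type u} [NonUnitalCStarAlgebra B] {T : TwistedAction N B}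
    (e : 𝒟.Iso T.bundle) : ∃ U : G →* unitary 𝒟.Multiplier,
        ∀ s : G, (U s : 𝒟.Multiplier).order = (s : G ⧸ N) := by
  let toF : ∀ {x}, 𝒟.Fiber x → T.Fib x := fun {x} => e.equiv x
  let ofF : ∀ {x}, T.Fib x → 𝒟.Fiber x := fun {x} => (e.equiv x).symm
  have h1 : ∀ {x} (a : 𝒟.Fiber x), ofF (toF a) = a := fun {x} a => (e.equiv x).symm_apply_apply a
  have h2 : ∀ {x} (a : T.Fib x), toF (ofF a) = a := fun {x} a => (e.equiv x).apply_symm_apply a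
  have inj : ∀ {x} {a b : 𝒟.Fiber x}, toF a = toF b → a = b := fun {x a b} h =>
    (e.equiv x).injective h
  have hm : ∀ {x y z} (h : x * y = z) (a : 𝒟.Fiber x) (b : 𝒟.Fiber y),
    toF (𝒟.mul h a b) = T.fiberMul h (toF a) (toF b) := fun h a b => e.map_mul h a b
  have hi : ∀ {x y} (h : x⁻¹ = y) (a : 𝒟.Fiber x), toF (𝒟.inv h a) = T.fiberInv h (toF a) :=
    fun h a => e.map_inv h a
  refine exists_unitary_of_family (φ := QuotientGroup.mk' N)
    (fun s {t r} h a => ofF (T.fiberLeft s h (toF a)))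
    (fun s {t r} h a => ofF (T.fiberRight s h (toF a))) ?_ ?_ ?_ ?_ ?_ ?_
  · intro s t t' x y z h₁ h₂ h₃ h₄ a b
    apply inj
    rw [hm, hm, h2, h2]
    exact TwistedAction.fiberRight_mul s h₁ h₂ h₃ h₄ _ _
  · intro s s' t x z h₁ h₂ h₃ a
    rw [h2]
    congr 1
    refine Subtype.ext (funext fun r => ?_)
    simp [TwistedAction.fiberLeft, _root_.mul_assoc]
  · intro s s' t x z h₁ h₂ h₃ a
    rw [h2]
    congr 1
    refine Subtype.ext (funext fun r => ?_)
    simp [TwistedAction.fiberRight, _root_.mul_assoc]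
  · intro t h a
    refine Eq.trans ?_ (h1 a)
    congr 1
    refine Subtype.ext (funext fun r => ?_)
    simp [TwistedAction.fiberLeft]
  · intro t h a
    refine Eq.trans ?_ (h1 a)
    congr 1
    refine Subtype.ext (funext fun r => ?_)
    simp [TwistedAction.fiberRight]
  · intro s t t' x x' h₁ h₂ h₃ h₄ a
    apply inj
    rw [hi, h2, h2, hi]
    exact TwistedAction.fiberInv_fiberLeft s h₁ h₂ h₃ h₄ _

end FellBundle

/-! ### The twisted action on the unit fiber -/

namespace FellBundle

variable {G : Type v} [Group G] {N : Subgroup G} [N.Normal] {𝒟 : FellBundle.{u} (G ⧸ N)}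

namespace MultiplierRep

variable (W : MultiplierRep (QuotientGroup.mk' N) 𝒟)

/-- The map `b ↦ u_s b u_{s⁻¹}` of the unit fiber. -/
def conjFun (s : G) (b : 𝒟.UnitFiber) : 𝒟.UnitFiber :=
  W.right (r := 1) s⁻¹ (by simp) (W.left (r := (s : G ⧸ N)) s (by simp) (show 𝒟.Fiber 1 from b))

theorem conjFun_eq (s s' : G) (hs : s⁻¹ = s') {x : G ⧸ N} (h₁ : QuotientGroup.mk' N s * 1 = x)
    (h₂ : x * QuotientGroup.mk' N s' = 1) (b : 𝒟.Fiber 1) :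
    W.conjFun s b = W.right s' h₂ (W.left s h₁ b) := by
  subst hs
  obtain rfl : (s : G ⧸ N) = x := by rw [← h₁]; simp
  rfl

theorem conjFun_mul (s : G) (a b : 𝒟.UnitFiber) :
    W.conjFun s (a * b) = W.conjFun s a * W.conjFun s b := by
  have e : QuotientGroup.mk' N s * 1 = (s : G ⧸ N) := by simp
  have e1 : (s : G ⧸ N) * QuotientGroup.mk' N s⁻¹ = 1 := by simp
  have e2 : QuotientGroup.mk' N s⁻¹ * (s : G ⧸ N) = 1 := by simp
  have e3 : 1 * QuotientGroup.mk' N s⁻¹ = (s⁻¹ : G) := by simp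
  have e4 : QuotientGroup.mk' N (1 : G) * 1 = 1 := by simp
  rw [W.conjFun_eq s _ rfl e e1, W.conjFun_eq s _ rfl e e1, W.conjFun_eq s _ rfl e e1,
    unitFiber_mul_def, unitFiber_mul_def,
    W.right_mul s⁻¹ e1 (one_mul 1) (by simp) (x := 1) (y := (s⁻¹ : G)) (by simp),
    ← W.left_right s⁻¹ s⁻¹ e2 (by simp) e1 (by simp), W.left_left s⁻¹ s 1 (inv_mul_cancel s) e e2 e4,
    W.left_one rfl, W.left_mul s (one_mul 1) e e (_root_.mul_one _),
    W.mul_right s⁻¹ (_root_.mul_one _) e1 e3 (by simp)]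

theorem conjFun_star (s : G) (a : 𝒟.UnitFiber) :
    W.conjFun s (star a) = star (W.conjFun s a) := by
  have e : QuotientGroup.mk' N s * 1 = (s : G ⧸ N) := by simp
  have e1 : (s : G ⧸ N) * QuotientGroup.mk' N s⁻¹ = 1 := by simp
  have e2 : 1 * QuotientGroup.mk' N s⁻¹ = (s⁻¹ : G) := by simp
  have e3 : QuotientGroup.mk' N s * (s⁻¹ : G) = 1 := by simp
  have e4 : (s : G ⧸ N)⁻¹ = (s⁻¹ : G) := by simp
  rw [W.conjFun_eq s _ rfl e e1, W.conjFun_eq s _ rfl e e1, unitFiber_star_def, unitFiber_star_def,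
    W.inv_right s⁻¹ s (_root_.inv_inv s) e1 inv_one (t' := (s⁻¹ : G)) e4 e3,
    W.inv_left s s⁻¹ rfl e e4 inv_one e2, W.left_right s s⁻¹ e e1 e2 e3]

theorem conjFun_conjFun (s t : G) (b : 𝒟.UnitFiber) :
    W.conjFun s (W.conjFun t b) = W.conjFun (s * t) b := by
  have e : ∀ s : G, QuotientGroup.mk' N s * 1 = (s : G ⧸ N) := fun s => by simp
  have e1 : ∀ s : G, (s : G ⧸ N) * QuotientGroup.mk' N s⁻¹ = 1 := fun s => by simp
  have e2 : QuotientGroup.mk' N s * (t : G ⧸ N) = ((s * t : G) : G ⧸ N) := by simp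
  have e3 : ((s * t : G) : G ⧸ N) * QuotientGroup.mk' N t⁻¹ = (s : G ⧸ N) := by simp
  rw [W.conjFun_eq s _ rfl (e s) (e1 s), W.conjFun_eq t _ rfl (e t) (e1 t),
    W.conjFun_eq (s * t) _ rfl (e _) (e1 _), ← W.left_right s t⁻¹ e2 e3 (e1 t) (e s),
    W.left_left s t _ rfl (e t) e2 (e _), W.right_right s⁻¹ t⁻¹ (s * t)⁻¹ (by group) e3 (e1 s) (e1 _)]

theorem conjFun_one (b : 𝒟.UnitFiber) : W.conjFun 1 b = b := by
  rw [W.conjFun_eq 1 1 inv_one (x := 1) (by simp) (by simp), W.right_one rfl, W.left_one rfl]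

/-- The automorphism `b ↦ u_s b u_{s⁻¹}` of the unit fiber. -/
def conjEquiv (s : G) : 𝒟.UnitFiber ≃⋆ₐ[ℂ] 𝒟.UnitFiber where
  toFun := W.conjFun s
  invFun := W.conjFun s⁻¹
  left_inv b := by rw [conjFun_conjFun, inv_mul_cancel, conjFun_one]
  right_inv b := by rw [conjFun_conjFun, mul_inv_cancel, conjFun_one]
  map_mul' := W.conjFun_mul s
  map_add' a b := by simp only [conjFun]; exact (congrArg _ (map_add _ _ _)).trans (map_add _ _ _)
  map_star' := W.conjFun_star s
  map_smul' c a := by simp only [conjFun]; exact (congrArg _ (map_smul _ _ _)).trans (map_smul _ _ _)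

theorem mk_mul_one (n : N) : QuotientGroup.mk' N (n : G) * 1 = 1 := by
  simp

theorem one_mul_mk (n : N) : 1 * QuotientGroup.mk' N (n : G) = 1 := by
  simp

/-- The multiplier `u_n` of the unit fiber, for `n ∈ N`. -/
noncomputable def unitMultiplier (n : N) : 𝓜(ℂ, 𝒟.UnitFiber) where
  fst := LinearMap.mkContinuous (E := 𝒟.UnitFiber) (F := 𝒟.UnitFiber) (W.left n (mk_mul_one n)) 1
    fun b => by rw [_root_.one_mul]; exact (W.norm_left _ _ _).le
  snd := LinearMap.mkContinuous (E := 𝒟.UnitFiber) (F := 𝒟.UnitFiber) (W.right n (one_mul_mk n)) 1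
    fun b => by rw [_root_.one_mul]; exact (W.norm_right _ _ _).le
  central a b := W.right_mul n _ _ _ _ a b

theorem unitMultiplier_mul (n n' : N) :
    W.unitMultiplier (n * n') = W.unitMultiplier n * W.unitMultiplier n' := by
  refine DoubleCentralizer.ext ℂ _ _ _ (Prod.ext ?_ ?_)
  · ext b
    exact (W.left_left n n' _ rfl (mk_mul_one n') (mk_mul_one n) (mk_mul_one (n * n')) b).symm
  · ext b
    exact (W.right_right n' n _ rfl (one_mul_mk n) (one_mul_mk n') (one_mul_mk (n * n')) b).symm

theorem unitMultiplier_one : W.unitMultiplier 1 = 1 := by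
  refine DoubleCentralizer.ext ℂ _ _ _ (Prod.ext ?_ ?_)
  · ext b
    exact W.left_one rfl _ b
  · ext b
    exact W.right_one rfl _ b

theorem star_unitMultiplier (n : N) : star (W.unitMultiplier n) = W.unitMultiplier n⁻¹ := by
  refine DoubleCentralizer.ext ℂ _ _ _ (Prod.ext ?_ ?_)
  · ext b
    refine (W.inv_right (n : G) (n⁻¹ : G) rfl (one_mul_mk n) inv_one inv_one (mk_mul_one n⁻¹)
      (star b)).trans ?_
    exact congrArg _ (star_star b)
  · ext b
    refine (W.inv_left (n : G) (n⁻¹ : G) rfl (mk_mul_one n) inv_one inv_one (one_mul_mk n⁻¹)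
      (star b)).trans ?_
    exact congrArg _ (star_star b)

/-- The unitary multiplier `u_n` of the unit fiber, for `n ∈ N`. -/
noncomputable def unitTwist : N →* unitary 𝓜(ℂ, 𝒟.UnitFiber) where
  toFun n := ⟨W.unitMultiplier n, by
    rw [Unitary.mem_iff, star_unitMultiplier, ← unitMultiplier_mul, ← unitMultiplier_mul,
      inv_mul_cancel, mul_inv_cancel, unitMultiplier_one]
    exact ⟨rfl, rfl⟩⟩
  map_one' := Subtype.ext W.unitMultiplier_one
  map_mul' n n' := Subtype.ext (W.unitMultiplier_mul n n')

/-- The twisted action on the unit fiber given by the unitary multipliers `u_s`: the action is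
conjugation by `u_s` and the twist is the restriction of `u` to `N`. -/
noncomputable def twistedAction : TwistedAction N 𝒟.UnitFiber where
  act :=
    { toFun := W.conjEquiv
      map_one' := StarAlgEquiv.ext W.conjFun_one
      map_mul' := fun s t => StarAlgEquiv.ext fun b => (W.conjFun_conjFun s t b).symm }
  twist := W.unitTwist
  act_twist s n b := by
    have e : QuotientGroup.mk' N s * 1 = (s : G ⧸ N) := by simp
    have e1 : (s : G ⧸ N) * QuotientGroup.mk' N s⁻¹ = 1 := by simp
    have e2 : QuotientGroup.mk' N (s * n * s⁻¹) * (s : G ⧸ N) = (s : G ⧸ N) := by simp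
    have e3 : QuotientGroup.mk' N (s * n) * 1 = (s : G ⧸ N) := by simp
    change W.conjFun s (W.left (n : G) (mk_mul_one n) b) =
      W.left (s * n * s⁻¹ : G) (mk_mul_one ⟨s * n * s⁻¹, ‹N.Normal›.conj_mem n n.2 s⟩) (W.conjFun s b)
    rw [W.conjFun_eq s _ rfl e e1, W.conjFun_eq s _ rfl e e1, ← W.left_right _ _ e2 e1,
      W.left_left s n _ rfl _ e e3, W.left_left (s * n * s⁻¹) s (s * n) (by group) e e2 e3]
  act_coe n b := by
    change W.conjFun n b = W.left (n : G) (mk_mul_one n) (W.right ((n⁻¹ : N) : G) (one_mul_mk n⁻¹) b)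
    rw [W.conjFun_eq n _ rfl (mk_mul_one n) (one_mul_mk n⁻¹)]
    exact W.left_right _ _ _ _ _ _ b

theorem twistedAction_act (s : G) (b : 𝒟.UnitFiber) : W.twistedAction.act s b = W.conjFun s b := rfl

theorem twistedAction_rmul (n : N) (b : 𝒟.UnitFiber) :
    W.twistedAction.rmul n b = W.right (n : G) (one_mul_mk n) b := rfl

open Classical in
/-- The element `a` of the fiber over `x` corresponds to the orbit of the pairs
`(a u_{s⁻¹}, s)`, `s ∈ x`. -/
noncomputable def toFib {x : G ⧸ N} (a : 𝒟.Fiber x) : W.twistedAction.Fib x :=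
  ⟨fun s => if h : x * QuotientGroup.mk' N s⁻¹ = 1 then W.right s⁻¹ h a else (0 : 𝒟.Fiber 1), by
    have key : ∀ s : G, x * QuotientGroup.mk' N s⁻¹ = 1 ↔ (s : G ⧸ N) = x := fun s => by
      rw [QuotientGroup.mk'_apply, QuotientGroup.mk_inv, mul_inv_eq_one, eq_comm]
    refine ⟨fun s hs => dif_neg fun h => hs ((key s).mp h), fun n s => ?_⟩
    by_cases h : x * QuotientGroup.mk' N s⁻¹ = 1
    · have h' : x * QuotientGroup.mk' N ((n : G)⁻¹ * s)⁻¹ = 1 := by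
        rw [key, TwistedAction.coe_inv_mul, ← key]; exact h
      simp only [dif_pos h, dif_pos h']
      rw [twistedAction_rmul]
      exact (W.right_right n s⁻¹ ((n : G)⁻¹ * s)⁻¹ (by group) h (one_mul_mk n) h' a).symm
    · have h' : ¬ x * QuotientGroup.mk' N ((n : G)⁻¹ * s)⁻¹ = 1 := by
        rw [key, TwistedAction.coe_inv_mul, ← key]; exact h
      simp only [dif_neg h, dif_neg h']
      exact (map_zero _).symm⟩

theorem toFib_apply {x : G ⧸ N} (a : 𝒟.Fiber x) (s s' : G) (hs : s⁻¹ = s')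
    (h : x * QuotientGroup.mk' N s' = 1) :
    (W.toFib a).1 s = W.right s' h a := by
  subst hs
  exact dif_pos h

theorem toFib_mul {x y z : G ⧸ N} (h : x * y = z) (a : 𝒟.Fiber x) (b : 𝒟.Fiber y) :
    W.toFib (𝒟.mul h a b) = W.twistedAction.fiberMul h (W.toFib a) (W.toFib b) := by
  obtain ⟨s, rfl⟩ := QuotientGroup.mk_surjective x
  obtain ⟨t, rfl⟩ := QuotientGroup.mk_surjective y
  obtain rfl := h
  have e1 : (s : G ⧸ N) * QuotientGroup.mk' N s⁻¹ = 1 := by simp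
  have e2 : (t : G ⧸ N) * QuotientGroup.mk' N t⁻¹ = 1 := by simp
  have e3 : (s : G ⧸ N) * (t : G ⧸ N) * QuotientGroup.mk' N (s * t)⁻¹ = 1 := by simp
  have e4 : QuotientGroup.mk' N s * 1 = (s : G ⧸ N) := by simp
  have e5 : 1 * QuotientGroup.mk' N s⁻¹ = (s⁻¹ : G) := by simp
  have e6 : QuotientGroup.mk' N s⁻¹ * (s : G ⧸ N) = 1 := by simp
  have e7 : QuotientGroup.mk' N (1 : G) * 1 = 1 := by simp
  have e8 : (t : G ⧸ N) * QuotientGroup.mk' N (s * t)⁻¹ = (s⁻¹ : G) := by simp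
  have e9 : (s : G ⧸ N) * ((s⁻¹ : G) : G ⧸ N) = 1 := by simp
  refine TwistedAction.fiber_ext (s := s * t) rfl ?_
  rw [TwistedAction.fiberMul_apply rfl _ _ (s := s) rfl, inv_mul_cancel_left,
    W.toFib_apply _ _ _ rfl e1, W.toFib_apply _ _ _ rfl e2, W.toFib_apply _ _ _ rfl e3,
    twistedAction_act, W.conjFun_eq s _ rfl e4 e1, unitFiber_mul_def,
    W.right_mul s⁻¹ e1 (one_mul 1) (by simp) (y := (s⁻¹ : G)) e9,
    ← W.left_right s⁻¹ s⁻¹ e6 e5 e1 (by simp), W.left_left s⁻¹ s 1 (inv_mul_cancel s) e4 e6 e7,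
    W.left_one rfl, W.right_right s⁻¹ t⁻¹ (s * t)⁻¹ (by group) e2 e5 e8,
    W.mul_right _ rfl e3 e8 e9]

theorem toFib_inv {x y : G ⧸ N} (h : x⁻¹ = y) (a : 𝒟.Fiber x) :
    W.toFib (𝒟.inv h a) = W.twistedAction.fiberInv h (W.toFib a) := by
  obtain ⟨s, rfl⟩ := QuotientGroup.mk_surjective x
  obtain rfl := h
  have e1 : (s : G ⧸ N) * QuotientGroup.mk' N s⁻¹ = 1 := by simp
  have e2 : (s : G ⧸ N)⁻¹ * QuotientGroup.mk' N s = 1 := by simp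
  have e3 : QuotientGroup.mk' N s * (s : G ⧸ N)⁻¹ = 1 := by simp
  have e4 : QuotientGroup.mk' N s⁻¹ * 1 = (s : G ⧸ N)⁻¹ := by simp
  have e5 : QuotientGroup.mk' N (1 : G) * (s : G ⧸ N)⁻¹ = (s : G ⧸ N)⁻¹ := by simp
  refine TwistedAction.fiber_ext (s := s⁻¹) rfl ?_
  rw [TwistedAction.fiberInv_apply, W.toFib_apply _ s⁻¹ s (_root_.inv_inv s) e2, _root_.inv_inv,
    W.toFib_apply _ _ _ rfl e1, twistedAction_act, W.conjFun_eq s⁻¹ s (_root_.inv_inv s) e4 e2,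
    unitFiber_star_def, W.inv_right s⁻¹ s (_root_.inv_inv s) e1 inv_one rfl e3,
    W.left_left s⁻¹ s 1 (inv_mul_cancel s) e3 e4 e5, W.left_one rfl]

theorem toFib_surjective {x : G ⧸ N} (f : W.twistedAction.Fib x) : ∃ a, W.toFib a = f := by
  obtain ⟨s, rfl⟩ := QuotientGroup.mk_surjective x
  have e1 : (s : G ⧸ N) * QuotientGroup.mk' N s⁻¹ = 1 := by simp
  have e2 : 1 * QuotientGroup.mk' N s = (s : G ⧸ N) := by simp
  refine ⟨W.right s e2 (f.1 s), TwistedAction.fiber_ext (s := s) rfl ?_⟩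
  rw [W.toFib_apply _ _ _ rfl e1,
    W.right_right s⁻¹ s 1 (mul_inv_cancel s) e2 e1 (by simp), W.right_one rfl]

theorem norm_toFib {x : G ⧸ N} (a : 𝒟.Fiber x) : ‖W.toFib a‖ = ‖a‖ := by
  obtain ⟨s, rfl⟩ := QuotientGroup.mk_surjective x
  have e1 : (s : G ⧸ N) * QuotientGroup.mk' N s⁻¹ = 1 := by simp
  rw [TwistedAction.norm_def _ (s := s) rfl, W.toFib_apply _ _ _ rfl e1]
  exact W.norm_right _ _ _

/-- A Fell bundle with unitary multipliers `u_s` of order `s N` is isomorphic to the twisted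
semidirect product bundle of the twisted action on its unit fiber. -/
noncomputable def toFibEquiv (x : G ⧸ N) : 𝒟.Fiber x ≃ₗᵢ[ℂ] W.twistedAction.Fib x :=
  LinearIsometryEquiv.ofSurjective
    { toFun := W.toFib
      map_add' := fun a b => by
        obtain ⟨s, rfl⟩ := QuotientGroup.mk_surjective x
        have e1 : (s : G ⧸ N) * QuotientGroup.mk' N s⁻¹ = 1 := by simp
        refine TwistedAction.fiber_ext (s := s) rfl ?_
        refine (W.toFib_apply _ _ _ rfl e1).trans ((map_add _ _ _).trans ?_)
        exact (congrArg₂ (fun p q : 𝒟.Fiber 1 => p + q) (W.toFib_apply _ _ _ rfl e1).symm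
          (W.toFib_apply _ _ _ rfl e1).symm)
      map_smul' := fun c a => by
        obtain ⟨s, rfl⟩ := QuotientGroup.mk_surjective x
        have e1 : (s : G ⧸ N) * QuotientGroup.mk' N s⁻¹ = 1 := by simp
        refine TwistedAction.fiber_ext (s := s) rfl ?_
        refine (W.toFib_apply _ _ _ rfl e1).trans ((map_smul _ _ _).trans ?_)
        exact (congrArg (fun p : 𝒟.Fiber 1 => c • p) (W.toFib_apply _ _ _ rfl e1).symm)
      norm_map' := W.norm_toFib }
    W.toFib_surjective

end MultiplierRep

/-- A Fell bundle over `G / N` is a twisted semidirect product bundle if and only if it has unitary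
multipliers `u_s` of order `s N` that depend multiplicatively on `s`. -/
theorem exists_iso_bundle_iff {G : Type u} [Group G] {N : Subgroup G} [N.Normal]
    (𝒟 : FellBundle.{u, u} (G ⧸ N)) :
    (∃ (B : Type u) (_ : NonUnitalCStarAlgebra B) (T : TwistedAction N B),
      Nonempty (𝒟.Iso T.bundle)) ↔
    ∃ U : G →* unitary 𝒟.Multiplier, ∀ s : G, (U s : 𝒟.Multiplier).order = (s : G ⧸ N) := by
  refine ⟨fun ⟨B, _, T, ⟨e⟩⟩ => e.exists_unitary, fun ⟨U, hU⟩ => ?_⟩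
  let W : MultiplierRep (QuotientGroup.mk' N) 𝒟 := MultiplierRep.ofUnitary U hU
  exact ⟨𝒟.UnitFiber, inferInstance, W.twistedAction,
    ⟨{ equiv := W.toFibEquiv, map_mul := W.toFib_mul, map_inv := W.toFib_inv }⟩⟩

end FellBundle

/-! ### Finitely supported sections and the reduced norm -/

namespace FellBundle

variable {H : Type u} [Group H] (𝒜 : FellBundle.{u, u} H)

section Sections

open Classical in
/-- The linear map on finitely supported sections given by linear maps on the fibers. -/
noncomputable def sectionsLift {M : Type*} [AddCommGroup M] [Module ℂ M]
    (F : ∀ s, 𝒜.Fiber s →ₗ[ℂ] M) : 𝒜.Sections →ₗ[ℂ] M :=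
  DFinsupp.lsum ℂ F

open Classical in
theorem sectionsLift_apply {M : Type*} [AddCommGroup M] [Module ℂ M]
    (F : ∀ s, 𝒜.Fiber s →ₗ[ℂ] M) (f : 𝒜.Sections) :
    𝒜.sectionsLift F f = f.sum fun s a => F s a := by
  rw [sectionsLift, DFinsupp.lsum_apply_apply, DFinsupp.sumAddHom_apply]
  rfl

open Classical in
@[simp]
theorem sectionsLift_single {M : Type*} [AddCommGroup M] [Module ℂ M]
    (F : ∀ s, 𝒜.Fiber s →ₗ[ℂ] M) (s : H) (a : 𝒜.Fiber s) :
    𝒜.sectionsLift F (DFinsupp.single s a) = F s a :=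
  DFinsupp.lsum_single ..

open Classical in
theorem sections_hom_ext {M : Type*} [AddCommGroup M] [Module ℂ M] {F F' : 𝒜.Sections →ₗ[ℂ] M}
    (h : ∀ s (a : 𝒜.Fiber s), F (DFinsupp.single s a) = F' (DFinsupp.single s a)) : F = F' :=
  DFinsupp.lhom_ext h

open Classical in
/-- The convolution as a bilinear map. -/
noncomputable def convLin : 𝒜.Sections →ₗ[ℂ] 𝒜.Sections →ₗ[ℂ] 𝒜.Sections :=
  𝒜.sectionsLift fun s => (𝒜.sectionsLift fun t =>
    ((𝒜.mulBilin (rfl : s * t = s * t)).compr₂ (DFinsupp.lsingle (s * t))).flip).flip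

theorem conv_eq (f g : 𝒜.Sections) : 𝒜.conv f g = 𝒜.convLin f g := by
  classical
  rw [convLin, sectionsLift_apply, conv, DFinsupp.sum, DFinsupp.sum, LinearMap.sum_apply]
  refine Finset.sum_congr (by congr) fun s _ => ?_
  rw [LinearMap.flip_apply, sectionsLift_apply, DFinsupp.sum, DFinsupp.sum, LinearMap.sum_apply]
  refine Finset.sum_congr (by congr) fun t _ => ?_
  rfl

open Classical in
theorem conv_single_single (s t : H) (a : 𝒜.Fiber s) (b : 𝒜.Fiber t) :
    𝒜.conv (DFinsupp.single s a) (DFinsupp.single t b) =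
      DFinsupp.single (s * t) (𝒜.mul rfl a b) := by
  rw [conv_eq, convLin, sectionsLift_single, LinearMap.flip_apply, sectionsLift_single]
  rfl

open Classical in
/-- The involution of finitely supported sections. -/
noncomputable def starSection : 𝒜.Sections →+ 𝒜.Sections :=
  DFinsupp.sumAddHom fun s =>
    (DFinsupp.singleAddHom 𝒜.Fiber s⁻¹).comp
      { toFun := 𝒜.inv rfl, map_zero' := 𝒜.inv_zero rfl, map_add' := 𝒜.inv_add rfl }

open Classical in
@[simp]
theorem starSection_single (s : H) (a : 𝒜.Fiber s) :
    𝒜.starSection (DFinsupp.single s a) = DFinsupp.single s⁻¹ (𝒜.inv rfl a) :=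
  DFinsupp.sumAddHom_single _ _ _

/-- The powers `h, h * h, h * h * h, …` for the convolution. -/
noncomputable def convPow (h : 𝒜.Sections) : ℕ → 𝒜.Sections
  | 0 => h
  | m + 1 => 𝒜.conv h (convPow h m)

open Classical in
/-- The `A_e`-valued inner product `∑ g(t)* g(t)` of the Hilbert module `ℓ²(𝒜)`. -/
noncomputable def innerSelf (g : 𝒜.Sections) : 𝒜.Fiber 1 :=
  g.sum fun t a => 𝒜.mul (inv_mul_cancel t) (𝒜.inv rfl a) a

theorem l2Norm_sq (g : 𝒜.Sections) : 𝒜.l2Norm g ^ 2 = ‖𝒜.innerSelf g‖ :=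
  Real.sq_sqrt (norm_nonneg _)

theorem l2Norm_nonneg (g : 𝒜.Sections) : 0 ≤ 𝒜.l2Norm g := Real.sqrt_nonneg _

end Sections

section ReducedNorm

variable {𝒜}

/-- Left convolution operators on a Hilbert space model of `ℓ²(𝒜)`: a *-representation `Λ` of the
finitely supported sections such that the norm of `Λ(g) J_t` is the norm of `g` in `ℓ²(𝒜)`, where
the ranges of the operators `J_t` are total. -/
structure IsRegularModel {K X : Type*} [NormedAddCommGroup K] [NormedSpace ℂ K]
    [NormedAddCommGroup X] [InnerProductSpace ℂ X] [CompleteSpace X]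
    (Λ : 𝒜.Sections →ₗ[ℂ] (X →L[ℂ] X)) (J : H → K →L[ℂ] X) : Prop where
  map_conv (f g : 𝒜.Sections) : Λ (𝒜.conv f g) = Λ f * Λ g
  map_star (f : 𝒜.Sections) : Λ (𝒜.starSection f) = star (Λ f)
  norm_comp (g : 𝒜.Sections) (t : H) : ‖(Λ g).comp (J t)‖ = 𝒜.l2Norm g
  total : (Submodule.span ℂ {x | ∃ t k, x = J t k}).topologicalClosure = ⊤

namespace IsRegularModel

variable {K X : Type*} [NormedAddCommGroup K] [NormedSpace ℂ K]
    [NormedAddCommGroup X] [InnerProductSpace ℂ X] [CompleteSpace X]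
    {Λ : 𝒜.Sections →ₗ[ℂ] (X →L[ℂ] X)} {J : H → K →L[ℂ] X}

theorem l2Norm_conv_le (M : IsRegularModel Λ J) (f g : 𝒜.Sections) :
    𝒜.l2Norm (𝒜.conv f g) ≤ ‖Λ f‖ * 𝒜.l2Norm g := by
  rw [← M.norm_comp _ 1, ← M.norm_comp g 1, M.map_conv]
  exact ContinuousLinearMap.opNorm_comp_le (Λ f) ((Λ g).comp (J 1))

theorem reducedNorm_le_of_forall {f : 𝒜.Sections} {C : ℝ}
    (h : ∀ g, 𝒜.l2Norm g ≤ 1 → 𝒜.l2Norm (𝒜.conv f g) ≤ C) : 𝒜.reducedNorm f ≤ C := by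
  refine csSup_le ⟨_, 0, ?_, rfl⟩ ?_
  · classical
    rw [l2Norm, DFinsupp.sum_zero_index, norm_zero, Real.sqrt_zero]
    exact zero_le_one
  · rintro _ ⟨g, hg, rfl⟩
    exact h g hg

theorem reducedNorm_nonneg (f : 𝒜.Sections) : 0 ≤ 𝒜.reducedNorm f :=
  Real.sSup_nonneg (by rintro _ ⟨g, -, rfl⟩; exact 𝒜.l2Norm_nonneg _)

theorem reducedNorm_le (M : IsRegularModel Λ J) (f : 𝒜.Sections) : 𝒜.reducedNorm f ≤ ‖Λ f‖ :=
  reducedNorm_le_of_forall fun g hg =>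
    (M.l2Norm_conv_le f g).trans (mul_le_of_le_one_right (norm_nonneg _) hg)

theorem l2Norm_smul (M : IsRegularModel Λ J) {c : ℝ} (hc : 0 ≤ c) (k : 𝒜.Sections) :
    𝒜.l2Norm ((c : ℂ) • k) = c * 𝒜.l2Norm k := by
  have : (Λ ((c : ℂ) • k)).comp (J 1) = (c : ℂ) • (Λ k).comp (J 1) := by
    rw [map_smul]; rfl
  rw [← M.norm_comp _ 1, ← M.norm_comp k 1, this, norm_smul, Complex.norm_real,
    Real.norm_of_nonneg hc]

/-- The supremum that defines the reduced norm is finite, and bounds left convolution on all of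
`ℓ²(𝒜)`, including the sections of norm zero. -/
theorem l2Norm_conv_le_reducedNorm (M : IsRegularModel Λ J) (f g : 𝒜.Sections) :
    𝒜.l2Norm (𝒜.conv f g) ≤ 𝒜.reducedNorm f * 𝒜.l2Norm g := by
  have hb : BddAbove {r | ∃ g : 𝒜.Sections, 𝒜.l2Norm g ≤ 1 ∧ r = 𝒜.l2Norm (𝒜.conv f g)} := by
    refine ⟨‖Λ f‖, ?_⟩
    rintro _ ⟨g, hg, rfl⟩
    exact (M.l2Norm_conv_le f g).trans (mul_le_of_le_one_right (norm_nonneg _) hg)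
  rcases (𝒜.l2Norm_nonneg g).eq_or_lt with h0 | h0
  · rw [← h0, MulZeroClass.mul_zero]
    have := M.l2Norm_conv_le f g
    rwa [← h0, MulZeroClass.mul_zero] at this
  · have hi : 0 ≤ (𝒜.l2Norm g)⁻¹ := inv_nonneg.mpr h0.le
    have h1 : (𝒜.l2Norm g)⁻¹ * 𝒜.l2Norm (𝒜.conv f g) ≤ 𝒜.reducedNorm f := by
      refine le_csSup hb ⟨(((𝒜.l2Norm g)⁻¹ : ℝ) : ℂ) • g, ?_, ?_⟩
      · rw [M.l2Norm_smul hi, inv_mul_cancel₀ h0.ne']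
      · rw [conv_eq, conv_eq, map_smul, ← conv_eq, M.l2Norm_smul hi]
    rwa [inv_mul_le_iff₀ h0, mul_comm] at h1

theorem map_convPow (M : IsRegularModel Λ J) (h : 𝒜.Sections) (m : ℕ) :
    Λ (𝒜.convPow h m) = Λ h ^ (m + 1) := by
  induction m with
  | zero => rw [zero_add, pow_one]; rfl
  | succ m ih => rw [convPow, M.map_conv, ih, pow_succ' _ (m + 1)]

/-- `‖Λ(h) ^ (m + 1) J_t‖` is the norm of a convolution power of `h` in `ℓ²(𝒜)`, hence grows at most
like the powers of the reduced norm; for self-adjoint `Λ(h)` this bounds `‖Λ(h)‖`. -/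
theorem norm_le_of_isSelfAdjoint (M : IsRegularModel Λ J) {h : 𝒜.Sections}
    (hh : IsSelfAdjoint (Λ h)) :
    ‖Λ h‖ ≤ 𝒜.reducedNorm h := by
  have hr := reducedNorm_nonneg h
  have hp : ∀ m, 𝒜.l2Norm (𝒜.convPow h m) ≤ 𝒜.reducedNorm h ^ m * 𝒜.l2Norm h := by
    intro m
    induction m with
    | zero => rw [pow_zero, _root_.one_mul]; exact le_rfl
    | succ m ih =>
      refine (M.l2Norm_conv_le_reducedNorm _ _).trans ?_
      rw [pow_succ', _root_.mul_assoc]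
      exact mul_le_mul_of_nonneg_left ih hr
  -- a strict upper bound `r'` is positive, which allows division by it in the constant below
  refine le_of_forall_gt_imp_ge_of_dense fun r' hr' => ?_
  have hr0 : 0 < r' := hr.trans_lt hr'
  refine hh.norm_le_of_inner_growth hr0.le M.total ?_
  rintro _ ⟨t, k, rfl⟩
  refine ⟨‖J t k‖ * (𝒜.l2Norm h * ‖k‖) / r', fun m => ?_⟩
  have e : ‖(Λ h ^ (m + 1)) (J t k)‖ ≤ r' ^ m * 𝒜.l2Norm h * ‖k‖ := by
    rw [← M.map_convPow]
    refine (((Λ (𝒜.convPow h m)).comp (J t)).le_opNorm k).trans ?_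
    rw [M.norm_comp]
    refine mul_le_mul_of_nonneg_right ((hp m).trans ?_) (norm_nonneg _)
    exact mul_le_mul_of_nonneg_right (pow_le_pow_left₀ hr hr'.le m) (𝒜.l2Norm_nonneg h)
  refine (norm_inner_le_norm _ _).trans ?_
  refine (mul_le_mul_of_nonneg_left e (norm_nonneg _)).trans (le_of_eq ?_)
  rw [pow_succ]
  field_simp

theorem reducedNorm_eq (M : IsRegularModel Λ J) (f : 𝒜.Sections) : 𝒜.reducedNorm f = ‖Λ f‖ := by
  refine le_antisymm (M.reducedNorm_le f) ?_
  have e : Λ (𝒜.conv (𝒜.starSection f) f) = star (Λ f) * Λ f := by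
    rw [M.map_conv, M.map_star]
  have h1 : ‖Λ f‖ * ‖Λ f‖ ≤ 𝒜.reducedNorm (𝒜.conv (𝒜.starSection f) f) := by
    rw [← CStarRing.norm_star_mul_self, ← e]
    refine M.norm_le_of_isSelfAdjoint ?_
    rw [e]
    exact IsSelfAdjoint.star_mul_self _
  have h2 : 𝒜.reducedNorm (𝒜.conv (𝒜.starSection f) f) ≤ ‖Λ f‖ * 𝒜.reducedNorm f := by
    refine reducedNorm_le_of_forall fun g hg => ?_
    have hassoc : (Λ (𝒜.conv (𝒜.conv (𝒜.starSection f) f) g)).comp (J 1) =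
        (Λ (𝒜.conv (𝒜.starSection f) (𝒜.conv f g))).comp (J 1) := by
      rw [M.map_conv, M.map_conv, M.map_conv, M.map_conv, _root_.mul_assoc]
    rw [← M.norm_comp _ 1, hassoc, M.norm_comp]
    refine (M.l2Norm_conv_le _ _).trans ?_
    rw [M.map_star, norm_star]
    refine mul_le_mul_of_nonneg_left ?_ (norm_nonneg _)
    exact (M.l2Norm_conv_le_reducedNorm f g).trans
      (mul_le_of_le_one_right (reducedNorm_nonneg f) hg)
  rcases (norm_nonneg (Λ f)).eq_or_lt with h0 | h0
  · rw [← h0]; exact reducedNorm_nonneg f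
  · exact le_of_mul_le_mul_left (h1.trans h2) h0

end IsRegularModel

end ReducedNorm

/-- A representation of a Fell bundle in a C*-algebra: linear maps of the fibers, compatible with
product and involution. -/
structure Rep (D : Type w) [NonUnitalCStarAlgebra D] where
  toLin (s : H) : 𝒜.Fiber s →ₗ[ℂ] D
  map_mul {s t r : H} (h : s * t = r) (a : 𝒜.Fiber s) (b : 𝒜.Fiber t) :
    toLin r (𝒜.mul h a b) = toLin s a * toLin t b
  map_inv {s r : H} (h : s⁻¹ = r) (a : 𝒜.Fiber s) : toLin r (𝒜.inv h a) = star (toLin s a)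

namespace Rep

variable {𝒜} {D : Type u} [NonUnitalCStarAlgebra D] (R : 𝒜.Rep D)

/-- The integrated form of a representation on finitely supported sections. -/
noncomputable def lift : 𝒜.Sections →ₗ[ℂ] D := 𝒜.sectionsLift R.toLin

/-- The *-homomorphism `a ↦ a ⊗ s`, `a ∈ A_s`, on finitely supported sections. -/
noncomputable def tensorLift : 𝒜.Sections →ₗ[ℂ] D ⊗[ℂ] GroupCStar H :=
  𝒜.sectionsLift fun s => ((TensorProduct.mk ℂ D (GroupCStar H)).flip (GroupCStar.of s)).comp
    (R.toLin s)

open Classical in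
@[simp]
theorem lift_single (s : H) (a : 𝒜.Fiber s) : R.lift (DFinsupp.single s a) = R.toLin s a :=
  𝒜.sectionsLift_single _ _ _

open Classical in
@[simp]
theorem tensorLift_single (s : H) (a : 𝒜.Fiber s) :
    R.tensorLift (DFinsupp.single s a) = R.toLin s a ⊗ₜ GroupCStar.of s :=
  𝒜.sectionsLift_single _ _ _

theorem lift_conv (f g : 𝒜.Sections) : R.lift (𝒜.conv f g) = R.lift f * R.lift g := by
  classical
  rw [conv_eq]
  have : 𝒜.convLin.compr₂ R.lift =
      (LinearMap.mul ℂ D).compl₁₂ R.lift R.lift := by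
    refine 𝒜.sections_hom_ext fun s a => 𝒜.sections_hom_ext fun t b => ?_
    simp only [LinearMap.compr₂_apply, ← conv_eq, conv_single_single, LinearMap.compl₁₂_apply,
      LinearMap.mul_apply', lift_single]
    exact R.map_mul rfl a b
  exact LinearMap.congr_fun₂ this f g

theorem tensorLift_conv (f g : 𝒜.Sections) :
    R.tensorLift (𝒜.conv f g) = R.tensorLift f * R.tensorLift g := by
  classical
  rw [conv_eq]
  have : 𝒜.convLin.compr₂ R.tensorLift =
      (LinearMap.mul ℂ (D ⊗[ℂ] GroupCStar H)).compl₁₂ R.tensorLift R.tensorLift := by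
    refine 𝒜.sections_hom_ext fun s a => 𝒜.sections_hom_ext fun t b => ?_
    simp only [LinearMap.compr₂_apply, ← conv_eq, conv_single_single, LinearMap.compl₁₂_apply,
      LinearMap.mul_apply', tensorLift_single]
    rw [Algebra.TensorProduct.tmul_mul_tmul, R.map_mul, GroupCStar.of_mul]
  exact LinearMap.congr_fun₂ this f g

theorem lift_starSection (f : 𝒜.Sections) : R.lift (𝒜.starSection f) = star (R.lift f) := by
  classical
  have : R.lift.toAddMonoidHom.comp 𝒜.starSection =
      (starAddEquiv : D ≃+ D).toAddMonoidHom.comp R.lift.toAddMonoidHom := by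
    refine DFinsupp.addHom_ext fun s a => ?_
    simp only [AddMonoidHom.comp_apply, starSection_single, LinearMap.toAddMonoidHom_coe,
      lift_single]
    exact R.map_inv rfl a
  exact DFunLike.congr_fun this f

theorem tensorLift_starSection (f : 𝒜.Sections) :
    R.tensorLift (𝒜.starSection f) = star (R.tensorLift f) := by
  classical
  have : R.tensorLift.toAddMonoidHom.comp 𝒜.starSection =
      (starAddEquiv : (D ⊗[ℂ] GroupCStar H) ≃+ _).toAddMonoidHom.comp
        R.tensorLift.toAddMonoidHom := by
    refine DFinsupp.addHom_ext fun s a => ?_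
    simp only [AddMonoidHom.comp_apply, starSection_single, LinearMap.toAddMonoidHom_coe,
      tensorLift_single, R.map_inv]
    refine Eq.trans ?_ (TensorProduct.star_tmul _ _).symm
    rw [GroupCStar.star_of]
  exact DFunLike.congr_fun this f

open HilbertTensor SpatialTensor

variable {K : Type u} [NormedAddCommGroup K] [InnerProductSpace ℂ K] [CompleteSpace K]
  (σ : D →⋆ₙₐ[ℂ] (K →L[ℂ] K))

/-- The representation `σ ⊗ λ` of finitely supported sections on `K ⊗ ℓ²(H)`, given by
`a ↦ σ(a) ⊗ λ_s` for `a ∈ A_s`. -/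
noncomputable def regular :
    𝒜.Sections →ₗ[ℂ] (HTensor K (GroupCStar.L2 H) →L[ℂ] HTensor K (GroupCStar.L2 H)) :=
  (tensorRep σ (GroupCStar.regularRep H) : _ →ₗ[ℂ] _).comp R.tensorLift

theorem regular_apply (f : 𝒜.Sections) :
    R.regular σ f = tensorRep σ (GroupCStar.regularRep H) (R.tensorLift f) := rfl

theorem regular_conv (f g : 𝒜.Sections) :
    R.regular σ (𝒜.conv f g) = R.regular σ f * R.regular σ g := by
  rw [regular_apply, tensorLift_conv, _root_.map_mul]; rfl

theorem regular_starSection (f : 𝒜.Sections) :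
    R.regular σ (𝒜.starSection f) = star (R.regular σ f) := by
  rw [regular_apply, tensorLift_starSection, map_star]; rfl

open Classical in
theorem regular_tm (g : 𝒜.Sections) (k : K) (t : H) :
    R.regular σ g (tm k (GroupCStar.bv t)) =
      g.sum fun s a => tm (σ (R.toLin s a) k) (GroupCStar.bv (s * t)) := by
  rw [regular_apply, tensorLift, sectionsLift_apply, DFinsupp.sum, DFinsupp.sum, map_sum,
    _root_.sum_apply]
  refine Finset.sum_congr rfl fun s _ => ?_
  change tensorRep σ (GroupCStar.regularRep H) (R.toLin s (g s) ⊗ₜ GroupCStar.of s) _ = _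
  rw [tensorRep_tmul, opTensor_tm, GroupCStar.regularRep_of]

open Classical in
theorem inner_regular_tm (g : 𝒜.Sections) (k k' : K) (t : H) :
    inner ℂ (R.regular σ g (tm k' (GroupCStar.bv t))) (R.regular σ g (tm k (GroupCStar.bv t))) =
      inner ℂ k' (σ (R.toLin 1 (𝒜.innerSelf g)) k) := by
  rw [regular_tm, regular_tm, innerSelf, DFinsupp.sum, DFinsupp.sum, DFinsupp.sum, sum_inner, map_sum, map_sum,
    _root_.sum_apply, inner_sum]
  refine Finset.sum_congr rfl fun s hs => ?_
  rw [inner_sum, Finset.sum_eq_single s]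
  · rw [inner_tm, GroupCStar.inner_bv, if_pos rfl, mul_one, R.map_mul, R.map_inv, _root_.map_mul, map_star,
      ContinuousLinearMap.star_eq_adjoint, mul_apply_eq_comp,
      ContinuousLinearMap.adjoint_inner_right]
  · intro s' _ hne
    rw [inner_tm, GroupCStar.inner_bv, if_neg, MulZeroClass.mul_zero]
    exact fun h => hne (mul_right_cancel h).symm
  · exact fun h => absurd hs h

variable {σ}

/-- The regular representation `σ ⊗ λ` is a model of the left convolution on `ℓ²(𝒜)`, with
`J_t(k) = k ⊗ e_t`. -/
theorem isRegularModel (hσ : Function.Injective σ) (hR : ∀ a : 𝒜.Fiber 1, ‖R.toLin 1 a‖ = ‖a‖) :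
    IsRegularModel (R.regular σ) fun t => tmLeft (K := K) (GroupCStar.bv t) where
  map_conv := R.regular_conv σ
  map_star := R.regular_starSection σ
  norm_comp g t := by
    set V : K →L[ℂ] HTensor K (GroupCStar.L2 H) :=
      (R.regular σ g).comp (tmLeft (GroupCStar.bv t)) with hV
    have h : ContinuousLinearMap.adjoint V ∘L V = σ (R.toLin 1 (𝒜.innerSelf g)) := by
      refine ContinuousLinearMap.ext fun k => ext_inner_left ℂ fun k' => ?_
      rw [ContinuousLinearMap.comp_apply, ContinuousLinearMap.adjoint_inner_right]
      exact R.inner_regular_tm σ g k k' t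
    have h2 := ContinuousLinearMap.norm_adjoint_comp_self V
    rw [h, NonUnitalStarAlgHom.norm_map σ hσ, hR, ← l2Norm_sq, sq] at h2
    exact ((mul_self_inj (𝒜.l2Norm_nonneg g) (norm_nonneg _)).mp h2).symm
  total := by
    refine top_le_iff.mp ?_
    rw [← total_tm (HilbertTensor.span_univ_closure (V := K)) (GroupCStar.span_bv_closure (H := H))]
    refine Submodule.topologicalClosure_mono (Submodule.span_mono ?_)
    rintro _ ⟨k, -, _, ⟨t, rfl⟩, rfl⟩
    exact ⟨t, k, rfl⟩

/-- The reduced norm of a Fell bundle is the norm of the regular representation `σ ⊗ λ` built from a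
representation of the bundle that is isometric on the unit fiber. -/
theorem reducedNorm_eq (hσ : Function.Injective σ) (hR : ∀ a : 𝒜.Fiber 1, ‖R.toLin 1 a‖ = ‖a‖)
    (f : 𝒜.Sections) : 𝒜.reducedNorm f = ‖R.regular σ f‖ :=
  (R.isRegularModel hσ hR).reducedNorm_eq f

end Rep

end FellBundle

open HilbertTensor SpatialTensor

/-! ### Spectral subspaces of a coaction -/

section MatrixCoefficients

variable {A : Type*} [NonUnitalCStarAlgebra A] {X : Type*} [NormedAddCommGroup X]
  [InnerProductSpace ℂ X] [CompleteSpace X]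

/-- The matrix coefficient `a ↦ ⟨x, Φ(a) y⟩` of a representation. -/
noncomputable def matrixCoeff (Φ : A →⋆ₙₐ[ℂ] (X →L[ℂ] X)) (x y : X) : A →L[ℂ] ℂ :=
  (innerSL ℂ x).comp ((ContinuousLinearMap.apply ℂ X y).comp (NonUnitalStarAlgHom.toCLM Φ))

theorem matrixCoeff_apply (Φ : A →⋆ₙₐ[ℂ] (X →L[ℂ] X)) (x y : X) (a : A) :
    matrixCoeff Φ x y a = inner ℂ x (Φ a y) := rfl

end MatrixCoefficients

namespace SpatialTensor

variable {A C : Type u} [NonUnitalCStarAlgebra A] [NonUnitalCStarAlgebra C]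
variable {K L : Type u} [NormedAddCommGroup K] [InnerProductSpace ℂ K] [CompleteSpace K]
  [NormedAddCommGroup L] [InnerProductSpace ℂ L] [CompleteSpace L]

/-- A matrix coefficient of `π ⊗ ρ` at elementary tensors. -/
noncomputable def repCoeff (π : A →⋆ₙₐ[ℂ] (K →L[ℂ] K)) (ρ : C →⋆ₙₐ[ℂ] (L →L[ℂ] L))
    (k' k : K) (l' l : L) : SpatialTensor A C →L[ℂ] ℂ :=
  matrixCoeff (X := HTensor K L) (rep π ρ) (tm k' l') (tm k l)

theorem repCoeff_apply (π : A →⋆ₙₐ[ℂ] (K →L[ℂ] K)) (ρ : C →⋆ₙₐ[ℂ] (L →L[ℂ] L))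
    (k' k : K) (l' l : L) (x : SpatialTensor A C) :
    repCoeff π ρ k' k l' l x = inner ℂ (tm k' l') (rep π ρ x (tm k l)) := rfl

theorem repCoeff_tmul (π : A →⋆ₙₐ[ℂ] (K →L[ℂ] K)) (ρ : C →⋆ₙₐ[ℂ] (L →L[ℂ] L))
    (k' k : K) (l' l : L) (a : A) (c : C) :
    repCoeff π ρ k' k l' l (tmul a c) = inner ℂ k' (π a k) * inner ℂ l' (ρ c l) := by
  rw [repCoeff_apply, rep_tmul, opTensor_tm, inner_tm]

/-- The coefficients of `π ⊗ ρ` at elementary tensors are the coefficients of slices. -/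
theorem inner_slice (π : A →⋆ₙₐ[ℂ] (K →L[ℂ] K)) (ρ : C →⋆ₙₐ[ℂ] (L →L[ℂ] L))
    (k' k : K) (l' l : L) (x : SpatialTensor A C) :
    inner ℂ (tm k' l') (rep π ρ x (tm k l)) = inner ℂ k' (π (slice A ρ l' l x) k) := by
  have : repCoeff π ρ k' k l' l = (matrixCoeff π k' k).comp (slice A ρ l' l) :=
    ext_tmul fun a c => by
      rw [repCoeff_tmul, ContinuousLinearMap.comp_apply, slice_tmul, map_smul, matrixCoeff_apply,
        smul_eq_mul, mul_comm]
  exact congrArg (fun f => f x) this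

/-- Matrix coefficients at elementary tensors separate the points of the spatial tensor product. -/
theorem eq_of_repCoeff {x y : SpatialTensor A C}
    (h : ∀ (K : Type u) [NormedAddCommGroup K] [InnerProductSpace ℂ K] [CompleteSpace K]
      (L : Type u) [NormedAddCommGroup L] [InnerProductSpace ℂ L] [CompleteSpace L]
      (π : A →⋆ₙₐ[ℂ] (K →L[ℂ] K)) (ρ : C →⋆ₙₐ[ℂ] (L →L[ℂ] L)) (k' k : K) (l' l : L),
      repCoeff π ρ k' k l' l x = repCoeff π ρ k' k l' l y) : x = y := by
  refine sub_eq_zero.mp (eq_zero_of_rep fun K _ _ _ L _ _ _ π ρ => ?_)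
  have tot := total_tm (HilbertTensor.span_univ_closure (V := K))
    (HilbertTensor.span_univ_closure (V := L))
  refine ContinuousLinearMap.ext_of_span tot ?_
  rintro _ ⟨k, -, l, -, rfl⟩
  have : innerSL ℂ (rep π ρ (x - y) (tm k l)) = 0 := by
    refine ContinuousLinearMap.ext_of_span tot ?_
    rintro _ ⟨k', -, l', -, rfl⟩
    have := h K L π ρ k' k l' l
    rw [← sub_eq_zero, ← map_sub, repCoeff_apply] at this
    rw [innerSL_apply_apply, ← inner_conj_symm, this, map_zero]
    rfl
  have h2 := congrArg (fun f => f (rep π ρ (x - y) (tm k l))) this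
  exact inner_self_eq_zero.mp h2

theorem AssocRel.repCoeff_eq {A B C : Type u} [NonUnitalCStarAlgebra A] [NonUnitalCStarAlgebra B]
    [NonUnitalCStarAlgebra C] {K L M : Type u}
    [NormedAddCommGroup K] [InnerProductSpace ℂ K] [CompleteSpace K]
    [NormedAddCommGroup L] [InnerProductSpace ℂ L] [CompleteSpace L]
    [NormedAddCommGroup M] [InnerProductSpace ℂ M] [CompleteSpace M]
    {x : SpatialTensor (SpatialTensor A B) C} {y : SpatialTensor A (SpatialTensor B C)}
    (h : AssocRel x y) (π : A →⋆ₙₐ[ℂ] (K →L[ℂ] K)) (ρ : B →⋆ₙₐ[ℂ] (L →L[ℂ] L))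
    (τ : C →⋆ₙₐ[ℂ] (M →L[ℂ] M)) (k' k : K) (l' l : L) (m' m : M) :
    repCoeff (rep π ρ) τ (tm k' l') (tm k l) m' m x =
      repCoeff π (rep ρ τ) k' k (tm l' m') (tm l m) y := by
  set F₁ := repCoeff (rep π ρ) τ (tm k' l') (tm k l) m' m
  set F₂ := repCoeff π (rep ρ τ) k' k (tm l' m') (tm l m)
  set F := F₁.comp (ContinuousLinearMap.fst ℂ _ _) - F₂.comp (ContinuousLinearMap.snd ℂ _ _) with hF
  have hV : (x, y) ∈ LinearMap.ker F.toLinearMap := by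
    refine Submodule.topologicalClosure_minimal _ (Submodule.span_le.mpr ?_)
      (ContinuousLinearMap.isClosed_ker F) h
    rintro _ ⟨b, c, d, rfl⟩
    refine LinearMap.mem_ker.mpr (sub_eq_zero.mpr ?_)
    change F₁ (tmul (tmul b c) d) = F₂ (tmul b (tmul c d))
    rw [repCoeff_tmul, repCoeff_tmul, rep_tmul, rep_tmul, opTensor_tm, opTensor_tm, inner_tm,
      inner_tm, mul_assoc]
  exact sub_eq_zero.mp (LinearMap.mem_ker.mp hV)

theorem repCoeff_map_id {A B C E : Type u} [NonUnitalCStarAlgebra A] [NonUnitalCStarAlgebra B]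
    [NonUnitalCStarAlgebra C] [NonUnitalCStarAlgebra E] {K L M : Type u}
    [NormedAddCommGroup K] [InnerProductSpace ℂ K] [CompleteSpace K]
    [NormedAddCommGroup L] [InnerProductSpace ℂ L] [CompleteSpace L]
    [NormedAddCommGroup M] [InnerProductSpace ℂ M] [CompleteSpace M]
    (φ : A →⋆ₙₐ[ℂ] SpatialTensor B C) (π : B →⋆ₙₐ[ℂ] (K →L[ℂ] K))
    (ρ : C →⋆ₙₐ[ℂ] (L →L[ℂ] L)) (τ : E →⋆ₙₐ[ℂ] (M →L[ℂ] M)) (k' k : K) (l' l : L) (m' m : M)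
    (w : SpatialTensor A E) :
    repCoeff (rep π ρ) τ (tm k' l') (tm k l) m' m
        (SpatialTensor.map φ (NonUnitalStarAlgHom.id ℂ E) w) =
      repCoeff π ρ k' k l' l (φ (slice A τ m' m w)) := by
  have : (repCoeff (rep π ρ) τ (tm k' l') (tm k l) m' m).comp (NonUnitalStarAlgHom.toCLM
      (SpatialTensor.map φ (NonUnitalStarAlgHom.id ℂ E))) =
      ((repCoeff π ρ k' k l' l).comp (NonUnitalStarAlgHom.toCLM φ)).comp (slice A τ m' m) := by
    refine ext_tmul fun b c => ?_
    rw [ContinuousLinearMap.comp_apply, ContinuousLinearMap.comp_apply,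
      ContinuousLinearMap.comp_apply, NonUnitalStarAlgHom.toCLM_apply,
      NonUnitalStarAlgHom.toCLM_apply, map_tmul, repCoeff_tmul, slice_tmul, map_smul, map_smul,
      repCoeff_apply, smul_eq_mul, mul_comm]
    rfl
  exact congrArg (fun f => f w) this

theorem slice_add (ρ : C →⋆ₙₐ[ℂ] (L →L[ℂ] L)) (l' l₁ l₂ : L) (x : SpatialTensor A C) :
    slice A ρ l' (l₁ + l₂) x = slice A ρ l' l₁ x + slice A ρ l' l₂ x := by
  have : slice A ρ l' (l₁ + l₂) = slice A ρ l' l₁ + slice A ρ l' l₂ :=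
    ext_tmul fun a c => by
      rw [_root_.add_apply, slice_tmul, slice_tmul, slice_tmul, map_add, inner_add_right, add_smul]
  exact congrArg (fun f => f x) this

theorem slice_smul (ρ : C →⋆ₙₐ[ℂ] (L →L[ℂ] L)) (l' l : L) (c : ℂ) (x : SpatialTensor A C) :
    slice A ρ l' (c • l) x = c • slice A ρ l' l x := by
  have : slice A ρ l' (c • l) = c • slice A ρ l' l :=
    ext_tmul fun a c' => by
      rw [_root_.smul_apply, slice_tmul, slice_tmul, map_smul, inner_smul_right, mul_smul]
  exact congrArg (fun f => f x) this

/-- The slice of a fixed element as a function of the second vector. -/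
noncomputable def sliceVec (ρ : C →⋆ₙₐ[ℂ] (L →L[ℂ] L)) (l' : L) (x : SpatialTensor A C) :
    L →L[ℂ] A :=
  LinearMap.mkContinuous
    { toFun := fun l => slice A ρ l' l x
      map_add' := fun l₁ l₂ => slice_add ρ l' l₁ l₂ x
      map_smul' := fun c l => slice_smul ρ l' l c x } (‖l'‖ * ‖x‖) fun l => by
    refine (norm_slice_le ρ l' l x).trans (le_of_eq ?_)
    ring

end SpatialTensor

namespace Coaction

variable {H D : Type u} [Group H] [NonUnitalCStarAlgebra D] (δ : Coaction H D)

/-- The spectral subspace `D_s` as a closed linear subspace. -/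
noncomputable def spectral (s : H) : Submodule ℂ D where
  carrier := δ.spectralSubspace s
  add_mem' {a b} ha hb := by
    change δ.toHom _ = _
    rw [map_add, ha, hb]
    exact (map_add (tmulLeft D (GroupCStar.of s)) a b).symm
  zero_mem' := by
    change δ.toHom _ = _
    rw [map_zero]
    exact (map_zero (tmulLeft D (GroupCStar.of s))).symm
  smul_mem' c a ha := by
    change δ.toHom _ = _
    rw [map_smul, ha]
    exact (map_smul (tmulLeft D (GroupCStar.of s)) c a).symm

variable {δ}

theorem mem_spectral {s : H} {a : D} :
    a ∈ δ.spectral s ↔ δ.toHom a = tmul a (GroupCStar.of s) := Iff.rfl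

theorem mul_mem_spectral {s t r : H} (h : s * t = r) {a b : D} (ha : a ∈ δ.spectral s)
    (hb : b ∈ δ.spectral t) : a * b ∈ δ.spectral r := by
  rw [mem_spectral] at *
  rw [map_mul, ha, hb, ← tmul_mul_tmul, ← GroupCStar.of_mul, h]

theorem star_mem_spectral {s r : H} (h : s⁻¹ = r) {a : D} (ha : a ∈ δ.spectral s) :
    star a ∈ δ.spectral r := by
  rw [mem_spectral] at *
  rw [map_star, ha, star_tmul, GroupCStar.star_of, h]

theorem isClosed_spectral (s : H) : IsClosed (δ.spectral s : Set D) :=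
  isClosed_eq (NonUnitalStarAlgHom.toCLM δ.toHom).continuous (tmulLeft D (GroupCStar.of s)).continuous

variable (δ)

/-- The projection `(id ⊗ ⟨e_h, λ(·) e_1⟩) ∘ δ` of `D` onto the spectral subspace `D_h`. -/
noncomputable def proj (h : H) : D →L[ℂ] D :=
  (slice D (GroupCStar.regularRep H) (GroupCStar.bv h) (GroupCStar.bv 1)).comp
    (NonUnitalStarAlgHom.toCLM δ.toHom)

theorem proj_apply (h : H) (a : D) : δ.proj h a =
    slice D (GroupCStar.regularRep H) (GroupCStar.bv h) (GroupCStar.bv 1) (δ.toHom a) := rfl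

theorem slice_regular_tmul_of {A : Type u} [NonUnitalCStarAlgebra A] [DecidableEq H]
    (h k s : H) (a : A) :
    slice A (GroupCStar.regularRep H) (GroupCStar.bv h) (GroupCStar.bv k)
      (tmul a (GroupCStar.of s)) = if h = s * k then a else 0 := by
  classical
  rw [slice_tmul, GroupCStar.regularRep_of, GroupCStar.inner_bv, ite_smul, one_smul, zero_smul]
  congr

theorem proj_of_mem [DecidableEq H] (h : H) {s : H} {a : D} (ha : a ∈ δ.spectral s) :
    δ.proj h a = if h = s then a else 0 := by
  rw [proj_apply, mem_spectral.mp ha, slice_regular_tmul_of, mul_one]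

/-- Slicing the last factor of `(id ⊗ δ_H)(w)` with the regular representation at `(e_h, e_1)` turns
`a ⊗ s ⊗ s` into `a ⊗ h` if `s = h`, and into `0` otherwise. -/
theorem repCoeff_map_comul {K L : Type u} [NormedAddCommGroup K] [InnerProductSpace ℂ K]
    [CompleteSpace K] [NormedAddCommGroup L] [InnerProductSpace ℂ L] [CompleteSpace L]
    (π : D →⋆ₙₐ[ℂ] (K →L[ℂ] K)) (ρ : GroupCStar H →⋆ₙₐ[ℂ] (L →L[ℂ] L)) (k' k : K) (l' l : L)
    (h : H) (w : SpatialTensor D (GroupCStar H)) :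
    repCoeff π (rep ρ (GroupCStar.regularRep H)) k' k (tm l' (GroupCStar.bv h))
        (tm l (GroupCStar.bv 1))
        (SpatialTensor.map (NonUnitalStarAlgHom.id ℂ D) GroupCStar.comul w) =
      repCoeff π ρ k' k l' l (tmul (slice D (GroupCStar.regularRep H) (GroupCStar.bv h)
        (GroupCStar.bv 1) w) (GroupCStar.of h)) := by
  classical
  have : (repCoeff π (rep ρ (GroupCStar.regularRep H)) k' k (tm l' (GroupCStar.bv h))
        (tm l (GroupCStar.bv 1))).comp (NonUnitalStarAlgHom.toCLM
        (SpatialTensor.map (NonUnitalStarAlgHom.id ℂ D) GroupCStar.comul)) =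
      ((repCoeff π ρ k' k l' l).comp (tmulLeft D (GroupCStar.of h))).comp
        (slice D (GroupCStar.regularRep H) (GroupCStar.bv h) (GroupCStar.bv 1)) := by
    refine ContinuousLinearMap.ext_of_span (span_tmul_closure
      (HilbertTensor.span_univ_closure (V := D)) (GroupCStar.span_of_closure (H := H))) ?_
    rintro _ ⟨b, -, _, ⟨s, rfl⟩, rfl⟩
    rw [ContinuousLinearMap.comp_apply, ContinuousLinearMap.comp_apply,
      ContinuousLinearMap.comp_apply, NonUnitalStarAlgHom.toCLM_apply, map_tmul, repCoeff_tmul,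
      slice_regular_tmul_of, GroupCStar.comul_of, rep_tmul, opTensor_tm, inner_tm,
      GroupCStar.regularRep_of, mul_one, GroupCStar.inner_bv]
    split_ifs with hs
    · rw [hs, mul_one]
      exact (repCoeff_tmul π ρ k' k l' l b (GroupCStar.of s)).symm
    · rw [mul_zero, mul_zero, map_zero, map_zero]
  exact congrArg (fun f => f w) this

/-- The range of the projection is the spectral subspace. This is the coaction identity, tested on
matrix coefficients. -/
theorem proj_mem (h : H) (a : D) : δ.proj h a ∈ δ.spectral h := by
  rw [mem_spectral]
  refine eq_of_repCoeff fun K _ _ _ L _ _ _ π ρ k' k l' l => ?_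
  have key := (δ.coassoc a).repCoeff_eq π ρ (GroupCStar.regularRep H) k' k l' l (GroupCStar.bv h)
    (GroupCStar.bv 1)
  rw [repCoeff_map_id, repCoeff_map_comul] at key
  exact key

/-- The spectral subspaces of a coaction are total. -/
theorem span_spectral_closure :
    (Submodule.span ℂ {a | ∃ s, a ∈ δ.spectral s}).topologicalClosure = ⊤ := by
  classical
  set V := (Submodule.span ℂ {a | ∃ s, a ∈ δ.spectral s}).topologicalClosure with hV
  set lam := GroupCStar.regularRep H
  have hVc : IsClosed (V : Set D) := Submodule.isClosed_topologicalClosure _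
  have h1 : ∀ (a : D) (η : GroupCStar.L2 H),
      slice D lam (GroupCStar.bv 1) η (δ.toHom a) ∈ V := by
    intro a η
    have : (Submodule.span ℂ (Set.range (GroupCStar.bv (H := H)))).topologicalClosure ≤
        V.comap (sliceVec lam (GroupCStar.bv 1) (δ.toHom a)).toLinearMap := by
      refine Submodule.topologicalClosure_minimal _ (Submodule.span_le.mpr ?_)
        (hVc.preimage (sliceVec lam (GroupCStar.bv 1) (δ.toHom a)).continuous)
      rintro _ ⟨k, rfl⟩
      -- `⟨e_1, λ(s) e_k⟩ = ⟨e_{k⁻¹}, λ(s) e_1⟩`, so the slice at `(e_1, e_k)` gives a projection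
      have e : slice D lam (GroupCStar.bv 1) (GroupCStar.bv k) =
          slice D lam (GroupCStar.bv k⁻¹) (GroupCStar.bv 1) := by
        refine ContinuousLinearMap.ext_of_span (span_tmul_closure
          (HilbertTensor.span_univ_closure (V := D)) (GroupCStar.span_of_closure (H := H))) ?_
        rintro _ ⟨b, -, _, ⟨s, rfl⟩, rfl⟩
        rw [slice_regular_tmul_of, slice_regular_tmul_of, mul_one]
        have : 1 = s * k ↔ k⁻¹ = s := by rw [eq_comm, mul_eq_one_iff_eq_inv, eq_comm]
        simp only [this]
      change slice D lam (GroupCStar.bv 1) (GroupCStar.bv k) (δ.toHom a) ∈ V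
      rw [e]
      exact Submodule.le_topologicalClosure _ (Submodule.subset_span ⟨k⁻¹, δ.proj_mem k⁻¹ a⟩)
    rw [GroupCStar.span_bv_closure] at this
    exact this Submodule.mem_top
  let E := slice D lam (GroupCStar.bv 1) (GroupCStar.bv 1)
  -- nondegeneracy: elements `δ(a) (1 ⊗ c)` span a dense subspace, and the slice at `(e_1, e_1)`
  -- maps them to slices of `δ(a)` at `(e_1, λ(c) e_1)`
  have h2 : (⊤ : Submodule ℂ (SpatialTensor D (GroupCStar H))) ≤ V.comap E.toLinearMap := by
    rw [← δ.nondegenerate]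
    refine Submodule.topologicalClosure_minimal _ (Submodule.span_le.mpr ?_)
      (hVc.preimage E.continuous)
    rintro _ ⟨a, c, x, hx, rfl⟩
    have e : E.comp x.snd = slice D lam (GroupCStar.bv 1) (lam c (GroupCStar.bv 1)) :=
      ext_tmul fun b d => by
        rw [ContinuousLinearMap.comp_apply, hx.snd_tmul, slice_tmul, slice_tmul, map_mul]
        rfl
    change E.comp x.snd (δ.toHom a) ∈ V
    rw [e]
    exact h1 a _
  refine eq_top_iff.mpr fun d _ => ?_
  have h3 : E (tmul d (GroupCStar.of 1)) ∈ V := h2 Submodule.mem_top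
  rwa [slice_regular_tmul_of, mul_one, if_pos rfl] at h3

end Coaction

/-! ### The spectral bundle and normal coactions -/

theorem CStarSeminorm.map_powSucc_le {A : Type u} [NonUnitalRing A] [StarRing A] [Module ℂ A]
    (p : CStarSeminorm A) (a : A) (m : ℕ) : p (powSucc a m) ≤ p a ^ (m + 1) := by
  induction m with
  | zero => rw [zero_add, pow_one]; exact le_rfl
  | succ m ih =>
    rw [powSucc, pow_succ']
    exact (p.mul_le _ _).trans (mul_le_mul_of_nonneg_left ih (p.nonneg a))

/-- The C*-seminorm `x ↦ ‖(π ⊗ ρ)(x)‖` on the spatial tensor product. -/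
noncomputable def SpatialTensor.repNorm {A C : Type u} [NonUnitalCStarAlgebra A]
    [NonUnitalCStarAlgebra C] {K L : Type u}
    [NormedAddCommGroup K] [InnerProductSpace ℂ K] [CompleteSpace K]
    [NormedAddCommGroup L] [InnerProductSpace ℂ L] [CompleteSpace L]
    (π : A →⋆ₙₐ[ℂ] (K →L[ℂ] K)) (ρ : C →⋆ₙₐ[ℂ] (L →L[ℂ] L)) : CStarSeminorm (SpatialTensor A C) :=
  .ofHom (E := HTensor K L →L[ℂ] HTensor K L) (rep π ρ)

namespace Coaction

variable {H D : Type u} [Group H] [NonUnitalCStarAlgebra D] (δ : Coaction H D)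

/-- The *-homomorphism `a ↦ a ⊗ 1`. -/
noncomputable def tmulOne : D →⋆ₙₐ[ℂ] SpatialTensor D (GroupCStar H) where
  toFun a := tmul a (GroupCStar.of 1)
  map_smul' c a := map_smul (tmulLeft D (GroupCStar.of 1)) c a
  map_zero' := map_zero (tmulLeft D (GroupCStar.of 1))
  map_add' a b := map_add (tmulLeft D (GroupCStar.of 1)) a b
  map_mul' a b := by rw [← tmul_mul_tmul, ← GroupCStar.of_mul, one_mul]
  map_star' a := by rw [star_tmul, GroupCStar.star_of, inv_one]

/-- The square root of `a* a`, and the fact that *-homomorphisms which agree on `a* a` agree on its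
square root. With `φ = δ` and `ψ = (· ⊗ 1)` it shows that the root of an element of `D_e` lies in
`D_e`. -/
theorem exists_mul_self_eq (a : D) : ∃ b : D, IsSelfAdjoint b ∧ star a * a = b * b ∧
    ∀ (E : Type u) [NonUnitalCStarAlgebra E] (φ ψ : D →⋆ₙₐ[ℂ] E),
      φ (star a * a) = ψ (star a * a) → φ b = ψ b := by
  let _ : PartialOrder D := CStarAlgebra.spectralOrder D
  have : StarOrderedRing D := CStarAlgebra.spectralOrderedRing D
  have h0 : 0 ≤ star a * a := star_mul_self_nonneg a
  have hsa : IsSelfAdjoint (star a * a) := IsSelfAdjoint.star_mul_self a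
  refine ⟨cfcₙ Real.sqrt (star a * a), cfcₙ_predicate _ _, ?_, fun E _ φ ψ h => ?_⟩
  · rw [← cfcₙ_mul Real.sqrt Real.sqrt (star a * a)
      (Real.continuous_sqrt.continuousOn) Real.sqrt_zero (Real.continuous_sqrt.continuousOn)
      Real.sqrt_zero]
    conv_lhs => rw [← cfcₙ_id ℝ (star a * a)]
    refine cfcₙ_congr fun x hx => ?_
    exact (Real.mul_self_sqrt (quasispectrum_nonneg_of_nonneg _ h0 x hx)).symm
  · have hφ : Continuous φ := (NonUnitalStarAlgHom.toCLM φ).continuous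
    have hψ : Continuous ψ := (NonUnitalStarAlgHom.toCLM ψ).continuous
    rw [NonUnitalStarAlgHomClass.map_cfcₙ φ Real.sqrt (star a * a)
        (Real.continuous_sqrt.continuousOn) Real.sqrt_zero hφ hsa (hsa.map φ),
      NonUnitalStarAlgHomClass.map_cfcₙ ψ Real.sqrt (star a * a)
        (Real.continuous_sqrt.continuousOn) Real.sqrt_zero hψ hsa (hsa.map ψ), h]

/-- The Fell bundle formed by the spectral subspaces of a coaction. -/
noncomputable def spectralBundle : FellBundle.{u, u} H :=
  { Fiber := fun s => δ.spectral s
    completeSpace := fun s => (isClosed_spectral (δ := δ) s).completeSpace_coe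
    mul := fun h a b => ⟨a * b, mul_mem_spectral h a.2 b.2⟩
    inv := fun h a => ⟨star a, star_mem_spectral h a.2⟩
    add_mul := fun h a a' b => Subtype.ext (add_mul _ _ _)
    mul_add := fun h a b b' => Subtype.ext (mul_add _ _ _)
    smul_mul := fun h c a b => Subtype.ext (smul_mul_assoc _ _ _)
    mul_smul := fun h c a b => Subtype.ext (mul_smul_comm _ _ _)
    mul_assoc := fun h₁ h₂ h₃ h₄ a b c => Subtype.ext (mul_assoc _ _ _)
    inv_add := fun h a b => Subtype.ext (star_add _ _)
    inv_smul := fun h c a => Subtype.ext (star_smul _ _)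
    inv_inv := fun h h' a => Subtype.ext (star_star _)
    inv_mul := fun h hr hs ht h' a b => Subtype.ext (star_mul _ _)
    norm_mul_le := fun h a b => norm_mul_le (a : D) (b : D)
    norm_inv := fun h a => norm_star (a : D)
    norm_inv_mul_self := fun a => by
      rw [sq]
      exact CStarRing.norm_star_mul_self (x := (a : D))
    positive := fun {s} a => by
      obtain ⟨b, hb, hab, hφ⟩ := exists_mul_self_eq (a : D)
      have hm : star (a : D) * a ∈ δ.spectral 1 :=
        mul_mem_spectral (inv_mul_cancel s) (star_mem_spectral rfl a.2) a.2
      refine ⟨⟨b, hφ _ δ.toHom tmulOne hm⟩, Subtype.ext ?_⟩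
      change star (a : D) * a = star b * b
      rw [hab, hb.star_eq] }

/-- The inclusion of the spectral subspaces, as a representation of the spectral bundle. -/
noncomputable def spectralRep : δ.spectralBundle.Rep D where
  toLin s := (δ.spectral s).subtype
  map_mul _ _ _ := rfl
  map_inv _ _ := rfl

section Norm

variable {K : Type u} [NormedAddCommGroup K] [InnerProductSpace ℂ K] [CompleteSpace K]
  {σ : D →⋆ₙₐ[ℂ] (K →L[ℂ] K)}

/-- The conditional expectation onto `D_e` is bounded in the norm of the regular representation. -/
theorem norm_proj_one_le (hσ : Function.Injective σ) (a : D) :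
    ‖δ.proj 1 a‖ ≤ repNorm σ (GroupCStar.regularRep H) (δ.toHom a) := by
  rw [← NonUnitalStarAlgHom.norm_map σ hσ]
  refine ContinuousLinearMap.opNorm_le_of_inner _ (CStarSeminorm.nonneg _ _) fun k k' => ?_
  rw [proj_apply, ← inner_slice]
  refine (norm_inner_le_norm _ _).trans ?_
  rw [norm_tm, GroupCStar.norm_bv, mul_one, mul_comm]
  refine mul_le_mul_of_nonneg_right ?_ (norm_nonneg _)
  refine (ContinuousLinearMap.le_opNorm _ _).trans ?_
  rw [norm_tm, GroupCStar.norm_bv, mul_one]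
  exact le_rfl

variable {δ}

/-- The corner of `π(a)` at a projection `μ(χ_t)` only depends on the component of `a` in `D_e`. -/
theorem CovariantRep.corner {B : Type u} [NonUnitalCStarAlgebra B] (P : δ.CovariantRep B) (t : H)
    (a : D) : P.onC0 (c0Single t) * P.onAlg a * P.onC0 (c0Single t) =
      P.onC0 (c0Single t) * P.onAlg (δ.proj 1 a) * P.onC0 (c0Single t) := by
  classical
  let F : 𝓜(ℂ, B) →L[ℂ] 𝓜(ℂ, B) :=
    ((ContinuousLinearMap.mul ℂ 𝓜(ℂ, B)).flip (P.onC0 (c0Single t))).comp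
      (ContinuousLinearMap.mul ℂ 𝓜(ℂ, B) (P.onC0 (c0Single t)))
  let Φ := NonUnitalStarAlgHom.toCLM P.onAlg
  have : F.comp Φ = (F.comp Φ).comp (δ.proj 1) := by
    refine ContinuousLinearMap.ext_of_span δ.span_spectral_closure ?_
    rintro a ⟨s, ha⟩
    rw [ContinuousLinearMap.comp_apply (F.comp Φ), δ.proj_of_mem 1 ha]
    split_ifs with hs
    · rfl
    · rw [map_zero]
      change P.onC0 (c0Single t) * P.onAlg a * P.onC0 (c0Single t) = 0
      rw [mul_assoc, P.covariant s t a ha, ← mul_assoc, ← map_mul, c0Single_mul_of_ne, map_zero,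
        zero_mul]
      intro h
      exact hs (mul_eq_right.mp h.symm).symm
  exact congrArg (fun f => f a) this

theorem CovariantRep.total_c0Single {B : Type u} [NonUnitalCStarAlgebra B]
    (P : δ.CovariantRep B) : (Submodule.span ℂ
      {x : B | ∃ t b, x = (P.onC0 (c0Single t)).fst b}).topologicalClosure = ⊤ := by
  set V := (Submodule.span ℂ {x : B | ∃ t b, x = (P.onC0 (c0Single t)).fst b}).topologicalClosure
  refine top_le_iff.mp ?_
  rw [← P.nondegenerate_onC0]
  refine Submodule.topologicalClosure_minimal _ (Submodule.span_le.mpr ?_)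
    (Submodule.isClosed_topologicalClosure _)
  rintro _ ⟨f, b, rfl⟩
  let Φ : C₀(WithDiscreteTopology H, ℂ) →L[ℂ] B :=
    LinearMap.mkContinuous
      { toFun := fun f => (P.onC0 f).fst b
        map_add' := fun f g => by rw [map_add]; rfl
        map_smul' := fun c f => by rw [map_smul]; rfl } ‖b‖ fun f => by
      refine ((P.onC0 f).fst.le_opNorm b).trans ?_
      rw [mul_comm, DoubleCentralizer.norm_fst]
      exact mul_le_mul_of_nonneg_left (NonUnitalStarAlgHom.norm_apply_le _ _) (norm_nonneg _)
  have : (⊤ : Submodule ℂ C₀(WithDiscreteTopology H, ℂ)) ≤ V.comap Φ.toLinearMap := by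
    rw [← span_c0Single_closure]
    refine Submodule.topologicalClosure_minimal _ (Submodule.span_le.mpr ?_)
      ((Submodule.isClosed_topologicalClosure _).preimage Φ.continuous)
    rintro _ ⟨t, rfl⟩
    exact Submodule.le_topologicalClosure _ (Submodule.subset_span ⟨t, b, rfl⟩)
  exact this (Submodule.mem_top : f ∈ ⊤)

/-- For a normal coaction the homomorphism `(σ ⊗ λ) ∘ δ` is isometric. -/
theorem IsNormal.norm_le (hδ : δ.IsNormal) (hσ : Function.Injective σ) (d : D) :
    ‖d‖ ≤ repNorm σ (GroupCStar.regularRep H) (δ.toHom d) := by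
  obtain ⟨B, _, P, -, hP⟩ := hδ
  set q := repNorm σ (GroupCStar.regularRep H)
  have hsa : IsSelfAdjoint (P.onAlg (star d * d)) := (IsSelfAdjoint.star_mul_self d).map P.onAlg
  -- on `μ(χ_t) b` the coefficients of `π((d* d) ^ (m + 1))` only see its component in `D_e`, which
  -- the norm of the regular representation bounds
  have h1 : ‖P.onAlg (star d * d)‖ ≤ q (δ.toHom (star d * d)) := by
    refine hsa.multiplier_norm_le_of_growth (q.nonneg _) P.total_c0Single ?_
    rintro _ ⟨t, b, rfl⟩
    refine ⟨‖b‖ * ‖b‖, fun m => ?_⟩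
    set p := P.onC0 (c0Single t) with hp
    have hps : star p = p := by rw [hp, ← map_star, star_c0Single]
    have hpn : ‖p‖ ≤ 1 := by
      have h : star p * p = p := by rw [hps, hp, ← map_mul, c0Single_mul_self]
      have := CStarRing.norm_star_mul_self (x := p)
      rw [h] at this
      by_contra! h1
      nlinarith
    have e1 : star (p.fst b) = p.snd (star b) := by
      conv_lhs => rw [← hps]
      rw [DoubleCentralizer.star_fst, star_star]
    have hc : ‖p * P.onAlg (powSucc (star d * d) m) * p‖ ≤ q (δ.toHom (star d * d)) ^ (m + 1) := by
      rw [hp, P.corner, ← hp]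
      calc _ ≤ ‖p‖ * ‖P.onAlg (δ.proj 1 (powSucc (star d * d) m))‖ * ‖p‖ :=
            (norm_mul_le _ _).trans (mul_le_mul_of_nonneg_right (norm_mul_le _ _) (norm_nonneg _))
        _ ≤ 1 * ‖P.onAlg (δ.proj 1 (powSucc (star d * d) m))‖ * 1 := by gcongr
        _ ≤ ‖δ.proj 1 (powSucc (star d * d) m)‖ := by
            rw [one_mul, mul_one]; exact NonUnitalStarAlgHom.norm_apply_le _ _
        _ ≤ q (powSucc (δ.toHom (star d * d)) m) := by
            refine (δ.norm_proj_one_le hσ _).trans (le_of_eq ?_)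
            congr 1
            generalize star d * d = a
            induction m with
            | zero => rfl
            | succ m ih => rw [powSucc, powSucc, map_mul, ih]
        _ ≤ _ := q.map_powSucc_le _ _
    rw [e1, p.central, ← map_powSucc]
    change ‖star b * (p * P.onAlg _ * p).fst b‖ ≤ _
    refine (norm_mul_le _ _).trans ?_
    rw [norm_star, mul_assoc ‖b‖]
    refine mul_le_mul_of_nonneg_left ?_ (norm_nonneg b)
    refine (ContinuousLinearMap.le_opNorm _ _).trans ?_
    rw [mul_comm, DoubleCentralizer.norm_fst]
    exact mul_le_mul_of_nonneg_left hc (norm_nonneg b)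
  rw [NonUnitalStarAlgHom.norm_map _ hP, CStarRing.norm_star_mul_self, map_mul, map_star,
    q.star_mul_self] at h1
  exact abs_le_of_sq_le_sq' (by nlinarith) (q.nonneg _) |>.2

end Norm

end Coaction

/-! ### Covariant pairs -/

section Total

variable {V W : Type*} [NormedAddCommGroup V] [NormedSpace ℂ V] [NormedAddCommGroup W]
  [NormedSpace ℂ W]

theorem ContinuousLinearMap.mem_of_mem_closure {S : Set V} {U : Submodule ℂ W}
    (hU : IsClosed (U : Set W)) (F : V →L[ℂ] W) (h : ∀ x ∈ S, F x ∈ U) {x : V}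
    (hx : x ∈ (Submodule.span ℂ S).topologicalClosure) : F x ∈ U :=
  Submodule.topologicalClosure_minimal _ (t := U.comap F.toLinearMap)
    (Submodule.span_le.mpr h) (hU.preimage F.continuous) hx

theorem ContinuousLinearMap.mem_of_total {S : Set V}
    (hS : (Submodule.span ℂ S).topologicalClosure = ⊤) {U : Submodule ℂ W}
    (hU : IsClosed (U : Set W)) (F : V →L[ℂ] W) (h : ∀ x ∈ S, F x ∈ U) (x : V) : F x ∈ U :=
  F.mem_of_mem_closure hU h (hS ▸ Submodule.mem_top)

end Total

theorem NonUnitalCStarAlgebra.mem_closure_mul (A : Type*) [NonUnitalCStarAlgebra A] (a : A) :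
    a ∈ closure (Set.range fun b => a * b) := by
  let _ : PartialOrder A := CStarAlgebra.spectralOrder A
  have : StarOrderedRing A := CStarAlgebra.spectralOrderedRing A
  have h := (CStarAlgebra.increasingApproximateUnit A).tendsto_mul_left a
  exact mem_closure_of_tendsto h (Filter.Eventually.of_forall fun b => ⟨b, rfl⟩)

section MultiplierOfSubalgebra

variable {𝓛 : Type u} [NonUnitalCStarAlgebra 𝓛] (S : NonUnitalStarSubalgebra ℂ 𝓛)
  [IsClosed (S : Set 𝓛)] {C : Type*} [NonUnitalCStarAlgebra C] (ψ : C →⋆ₙₐ[ℂ] 𝓛)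
  (hψ : ∀ c, ∀ x ∈ S, ψ c * x ∈ S)

theorem NonUnitalStarSubalgebra.mul_map_mem {S : NonUnitalStarSubalgebra ℂ 𝓛} {ψ : C →⋆ₙₐ[ℂ] 𝓛}
    (hψ : ∀ c, ∀ x ∈ S, ψ c * x ∈ S) (c : C) {x : 𝓛} (hx : x ∈ S) : x * ψ c ∈ S := by
  have := star_mem (hψ (star c) (star x) (star_mem hx))
  rwa [star_mul, star_star, map_star, star_star] at this

/-- A *-homomorphism `ψ` into an algebra containing `S`, with `ψ(C) S ⊆ S`, as a *-homomorphism into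
the multiplier algebra of `S`. -/
noncomputable def NonUnitalStarSubalgebra.multiplierHom : C →⋆ₙₐ[ℂ] 𝓜(ℂ, S) where
  toFun c :=
    { fst := LinearMap.mkContinuous
        { toFun := fun x : S => (⟨ψ c * x, hψ c x x.2⟩ : S)
          map_add' := fun x y => Subtype.ext (mul_add _ _ _)
          map_smul' := fun k x => Subtype.ext (mul_smul_comm _ _ _) } ‖ψ c‖
        fun x => norm_mul_le (ψ c) (x : 𝓛)
      snd := LinearMap.mkContinuous
        { toFun := fun x : S => (⟨x * ψ c, NonUnitalStarSubalgebra.mul_map_mem hψ c x.2⟩ : S)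
          map_add' := fun x y => Subtype.ext (add_mul _ _ _)
          map_smul' := fun k x => Subtype.ext (smul_mul_assoc _ _ _) } ‖ψ c‖
        fun x => by rw [mul_comm]; exact norm_mul_le (x : 𝓛) (ψ c)
      central := fun x y => Subtype.ext (mul_assoc (x : 𝓛) (ψ c) (y : 𝓛)) }
  map_smul' k c := by
    refine DoubleCentralizer.ext ℂ _ _ _ (Prod.ext ?_ ?_)
    · ext x
      change ψ (k • c) * (x : 𝓛) = k • (ψ c * x)
      rw [map_smul, smul_mul_assoc]
    · ext x
      change (x : 𝓛) * ψ (k • c) = k • (x * ψ c)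
      rw [map_smul, mul_smul_comm]
  map_zero' := by
    refine DoubleCentralizer.ext ℂ _ _ _ (Prod.ext ?_ ?_)
    · ext x
      change ψ 0 * (x : 𝓛) = 0
      rw [map_zero, zero_mul]
    · ext x
      change (x : 𝓛) * ψ 0 = 0
      rw [map_zero, mul_zero]
  map_add' c d := by
    refine DoubleCentralizer.ext ℂ _ _ _ (Prod.ext ?_ ?_)
    · ext x
      change ψ (c + d) * (x : 𝓛) = ψ c * x + ψ d * x
      rw [map_add, add_mul]
    · ext x
      change (x : 𝓛) * ψ (c + d) = x * ψ c + x * ψ d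
      rw [map_add, mul_add]
  map_mul' c d := by
    refine DoubleCentralizer.ext ℂ _ _ _ (Prod.ext ?_ ?_)
    · ext x
      change ψ (c * d) * (x : 𝓛) = ψ c * (ψ d * x)
      rw [map_mul, mul_assoc]
    · ext x
      change (x : 𝓛) * ψ (c * d) = x * ψ c * ψ d
      rw [map_mul, mul_assoc]
  map_star' c := by
    refine DoubleCentralizer.ext ℂ _ _ _ (Prod.ext ?_ ?_)
    · ext x
      change ψ (star c) * (x : 𝓛) = star (star (x : 𝓛) * ψ c)
      rw [star_mul, star_star, map_star]
    · ext x
      change (x : 𝓛) * ψ (star c) = star (ψ c * star (x : 𝓛))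
      rw [star_mul, star_star, map_star]

end MultiplierOfSubalgebra

namespace Coaction

variable {H D : Type u} [Group H] [NonUnitalCStarAlgebra D] (δ : Coaction H D)

/-- A pair of homomorphisms of `D` and `c₀(H)` into a C*-algebra, covariant for the coaction. -/
structure CovariantPair (𝓛 : Type w) [NonUnitalCStarAlgebra 𝓛] where
  onAlg : D →⋆ₙₐ[ℂ] 𝓛
  onC0 : C₀(WithDiscreteTopology H, ℂ) →⋆ₙₐ[ℂ] 𝓛
  covariant {s : H} {a : D} (ha : a ∈ δ.spectral s) {t r : H} (h : s * t = r) :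
    onAlg a * onC0 (c0Single t) = onC0 (c0Single r) * onAlg a

namespace CovariantPair

variable {δ} {𝓛 : Type w} [NonUnitalCStarAlgebra 𝓛] (P : δ.CovariantPair 𝓛)

/-- The products `π(a)μ(χ_t)` with `a` in a spectral subspace. -/
def gen : Set 𝓛 := {x | ∃ s t, ∃ a ∈ δ.spectral s, x = P.onAlg a * P.onC0 (c0Single t)}

theorem mul_gen {s t r r' : H} {a b : D} (hb : b ∈ δ.spectral s) (h : s * r = r') :
    P.onAlg a * P.onC0 (c0Single r') * (P.onAlg b * P.onC0 (c0Single t)) =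
      P.onAlg (a * b) * (P.onC0 (c0Single r) * P.onC0 (c0Single t)) := by
  rw [mul_assoc, ← mul_assoc _ (P.onAlg b), ← P.covariant hb h, map_mul]
  simp only [mul_assoc]

theorem gen_mul_mem {x y : 𝓛} (hx : x ∈ P.gen) (hy : y ∈ P.gen) :
    x * y ∈ Submodule.span ℂ P.gen := by
  classical
  obtain ⟨s, t, a, ha, rfl⟩ := hx
  obtain ⟨s', t', b, hb, rfl⟩ := hy
  rw [P.mul_gen hb (mul_inv_cancel_left s' t), ← map_mul]
  by_cases h : s'⁻¹ * t = t'
  · rw [h, c0Single_mul_self]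
    exact Submodule.subset_span ⟨s * s', t', a * b, mul_mem_spectral rfl ha hb, rfl⟩
  · rw [c0Single_mul_of_ne h, map_zero, mul_zero]
    exact zero_mem _

theorem star_mem_gen {x : 𝓛} (hx : x ∈ P.gen) : star x ∈ P.gen := by
  obtain ⟨s, t, a, ha, rfl⟩ := hx
  have ha' := star_mem_spectral rfl ha
  refine ⟨s⁻¹, s * t, star a, ha', ?_⟩
  rw [star_mul, ← map_star, ← map_star, star_c0Single, P.covariant ha' (inv_mul_cancel_left s t)]

/-- The *-algebra spanned by the products `π(a)μ(χ_t)`. -/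
noncomputable def core : NonUnitalStarSubalgebra ℂ 𝓛 where
  toSubmodule := Submodule.span ℂ P.gen
  mul_mem' {x y} hx hy := by
    refine Submodule.span_induction (p := fun x _ => x * y ∈ Submodule.span ℂ P.gen)
      (fun x hx => ?_) ?_ (fun x x' _ _ h h' => ?_) (fun c x _ h => ?_) hx
    · refine Submodule.span_induction (p := fun y _ => x * y ∈ Submodule.span ℂ P.gen)
        (fun y hy => P.gen_mul_mem hx hy) ?_ (fun y y' _ _ h h' => ?_) (fun c y _ h => ?_) hy
      · rw [mul_zero]; exact zero_mem _
      · rw [mul_add]; exact add_mem h h'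
      · rw [mul_smul_comm]; exact Submodule.smul_mem _ _ h
    · rw [zero_mul]; exact zero_mem _
    · rw [add_mul]; exact add_mem h h'
    · rw [smul_mul_assoc]; exact Submodule.smul_mem _ _ h
  star_mem' {x} hx := by
    refine Submodule.span_induction (p := fun x _ => star x ∈ Submodule.span ℂ P.gen)
      (fun x hx => Submodule.subset_span (P.star_mem_gen hx)) ?_ (fun x x' _ _ h h' => ?_)
      (fun c x _ h => ?_) hx
    · rw [star_zero]; exact zero_mem _
    · rw [star_add]; exact add_mem h h'
    · rw [star_smul]; exact Submodule.smul_mem _ _ h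

theorem mem_core {x : 𝓛} : x ∈ P.core ↔ x ∈ Submodule.span ℂ P.gen := Iff.rfl

/-- The closed span of the products `π(a)μ(χ_t)`. -/
noncomputable def algebra : NonUnitalStarSubalgebra ℂ 𝓛 := P.core.topologicalClosure

instance : IsClosed (P.algebra : Set 𝓛) := P.core.isClosed_topologicalClosure

theorem mem_algebra {x : 𝓛} :
    x ∈ P.algebra ↔ x ∈ (Submodule.span ℂ P.gen).topologicalClosure := Iff.rfl

theorem gen_subset_algebra {x : 𝓛} (hx : x ∈ P.gen) : x ∈ P.algebra :=
  subset_closure (Submodule.subset_span hx)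

theorem isClosed_algebra : IsClosed (P.algebra.toSubmodule : Set 𝓛) :=
  P.core.isClosed_topologicalClosure

theorem onAlg_mul_mem (d : D) {x : 𝓛} (hx : x ∈ P.algebra) : P.onAlg d * x ∈ P.algebra := by
  refine ContinuousLinearMap.mem_of_mem_closure P.isClosed_algebra
    (ContinuousLinearMap.mul ℂ 𝓛 (P.onAlg d)) (fun x hx => ?_) (P.mem_algebra.mp hx)
  refine ContinuousLinearMap.mem_of_total δ.span_spectral_closure P.isClosed_algebra
    (((ContinuousLinearMap.mul ℂ 𝓛).flip x).comp (NonUnitalStarAlgHom.toCLM P.onAlg))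
    (fun d hd => ?_) d
  obtain ⟨r, hd⟩ := hd
  obtain ⟨s, t, a, ha, rfl⟩ := hx
  refine P.gen_subset_algebra ⟨r * s, t, d * a, mul_mem_spectral rfl hd ha, ?_⟩
  change P.onAlg d * (P.onAlg a * _) = _
  rw [map_mul, mul_assoc]

theorem onC0_mul_mem (f : C₀(WithDiscreteTopology H, ℂ)) {x : 𝓛} (hx : x ∈ P.algebra) :
    P.onC0 f * x ∈ P.algebra := by
  refine ContinuousLinearMap.mem_of_mem_closure P.isClosed_algebra
    (ContinuousLinearMap.mul ℂ 𝓛 (P.onC0 f)) (fun x hx => ?_) (P.mem_algebra.mp hx)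
  refine ContinuousLinearMap.mem_of_total span_c0Single_closure P.isClosed_algebra
    (((ContinuousLinearMap.mul ℂ 𝓛).flip x).comp (NonUnitalStarAlgHom.toCLM P.onC0)) ?_ f
  rintro _ ⟨r, rfl⟩
  obtain ⟨s, t, a, ha, rfl⟩ := hx
  change P.onC0 (c0Single r) * (P.onAlg a * P.onC0 (c0Single t)) ∈ P.algebra
  rw [← mul_assoc, ← P.covariant ha (mul_inv_cancel_left s r), mul_assoc, ← map_mul]
  by_cases h : s⁻¹ * r = t
  · rw [h, c0Single_mul_self]
    exact P.gen_subset_algebra ⟨s, t, a, ha, rfl⟩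
  · rw [c0Single_mul_of_ne h, map_zero, mul_zero]
    exact zero_mem _

theorem onAlg_mul_onC0_mem (d : D) (f : C₀(WithDiscreteTopology H, ℂ)) :
    P.onAlg d * P.onC0 f ∈ P.algebra := by
  refine ContinuousLinearMap.mem_of_total span_c0Single_closure P.isClosed_algebra
    ((ContinuousLinearMap.mul ℂ 𝓛 (P.onAlg d)).comp (NonUnitalStarAlgHom.toCLM P.onC0)) ?_ f
  rintro _ ⟨t, rfl⟩
  refine ContinuousLinearMap.mem_of_total δ.span_spectral_closure P.isClosed_algebra
    (((ContinuousLinearMap.mul ℂ 𝓛).flip (P.onC0 (c0Single t))).comp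
      (NonUnitalStarAlgHom.toCLM P.onAlg)) ?_ d
  rintro a ⟨s, ha⟩
  exact P.gen_subset_algebra ⟨s, t, a, ha, rfl⟩

end CovariantPair

/-- The covariant pair underlying a covariant representation. -/
noncomputable def CovariantRep.toPair {δ : Coaction H D} {B : Type u} [NonUnitalCStarAlgebra B]
    (P : δ.CovariantRep B) :
    δ.CovariantPair 𝓜(ℂ, B) where
  onAlg := P.onAlg
  onC0 := P.onC0
  covariant {s a} ha {t r} h := by subst h; exact P.covariant s t a ha

theorem CovariantRep.algebra_eq {δ : Coaction H D} {B : Type u} [NonUnitalCStarAlgebra B]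
    (P : δ.CovariantRep B) : P.algebra = P.toPair.algebra := by
  refine le_antisymm ?_ ?_
  · refine NonUnitalStarSubalgebra.topologicalClosure_minimal _ ?_
      P.toPair.core.isClosed_topologicalClosure
    refine NonUnitalStarAlgebra.adjoin_le ?_
    rintro _ ⟨a, f, rfl⟩
    exact P.toPair.onAlg_mul_onC0_mem a f
  · refine NonUnitalStarSubalgebra.topologicalClosure_mono ?_
    intro x hx
    refine Submodule.span_le (p := (NonUnitalStarAlgebra.adjoin ℂ
      {z : 𝓜(ℂ, B) | ∃ a f, z = P.onAlg a * P.onC0 f}).toSubmodule).mpr ?_ hx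
    rintro _ ⟨s, t, a, ha, rfl⟩
    exact NonUnitalStarAlgebra.subset_adjoin ℂ _ ⟨a, c0Single t, rfl⟩

end Coaction

/-! ### Crossed products by coactions -/

namespace Coaction

variable {H D : Type u} [Group H] [NonUnitalCStarAlgebra D] {δ : Coaction H D}

namespace CovariantPair

theorem eq_top_of_gen_mem {𝓛 : Type w} [NonUnitalCStarAlgebra 𝓛] (P : δ.CovariantPair 𝓛)
    {V : Submodule ℂ P.algebra} (hV : IsClosed (V : Set P.algebra))
    (h : ∀ x (hx : x ∈ P.gen), (⟨x, P.gen_subset_algebra hx⟩ : P.algebra) ∈ V) : V = ⊤ := by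
  refine (Submodule.eq_top_iff' (p := V)).mpr fun x => ?_
  have hcl : IsClosed (V.map P.algebra.toSubmodule.subtype : Set 𝓛) := by
    rw [Submodule.map_coe]
    exact (IsClosed.isClosedEmbedding_subtypeVal P.isClosed_algebra).isClosedMap _ hV
  have : P.algebra.toSubmodule ≤ V.map P.algebra.toSubmodule.subtype :=
    Submodule.topologicalClosure_minimal _
      (Submodule.span_le.mpr fun x hx => ⟨_, h x hx, rfl⟩) hcl
  obtain ⟨y, hy, hyx⟩ := this x.2
  rwa [Subtype.ext (hyx : (y : 𝓛) = x)] at hy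

variable {𝓛 : Type u} [NonUnitalCStarAlgebra 𝓛] (P : δ.CovariantPair 𝓛)

/-- A covariant pair acts on the closed span of its products by multipliers, and this covariant
representation is nondegenerate. -/
noncomputable def toRep : δ.CovariantRep P.algebra where
  onAlg := P.algebra.multiplierHom P.onAlg fun d _ hx => P.onAlg_mul_mem d hx
  onC0 := P.algebra.multiplierHom P.onC0 fun f _ hx => P.onC0_mul_mem f hx
  nondegenerate_onAlg := by
    refine P.eq_top_of_gen_mem (Submodule.isClosed_topologicalClosure _) ?_
    rintro _ ⟨s, t, a, ha, rfl⟩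
    have hc : Continuous fun d : D =>
        (⟨P.onAlg d * P.onC0 (c0Single t), P.onAlg_mul_onC0_mem _ _⟩ : P.algebra) :=
      ((NonUnitalStarAlgHom.toCLM P.onAlg).continuous.mul continuous_const).subtype_mk _
    refine closure_minimal (s := Set.range fun b => a * b) ?_
      ((Submodule.isClosed_topologicalClosure _).preimage hc)
      (NonUnitalCStarAlgebra.mem_closure_mul D a)
    rintro _ ⟨b, rfl⟩
    refine Submodule.le_topologicalClosure _ (Submodule.subset_span
      ⟨a, ⟨P.onAlg b * P.onC0 (c0Single t), P.onAlg_mul_onC0_mem _ _⟩, Subtype.ext ?_⟩)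
    change P.onAlg (a * b) * _ = P.onAlg a * (P.onAlg b * _)
    rw [map_mul, mul_assoc]
  nondegenerate_onC0 := by
    refine P.eq_top_of_gen_mem (Submodule.isClosed_topologicalClosure _) ?_
    rintro _ ⟨s, t, a, ha, rfl⟩
    refine Submodule.le_topologicalClosure _ (Submodule.subset_span
      ⟨c0Single (s * t), ⟨_, P.gen_subset_algebra ⟨s, t, a, ha, rfl⟩⟩, Subtype.ext ?_⟩)
    change P.onAlg a * P.onC0 (c0Single t) =
      P.onC0 (c0Single (s * t)) * (P.onAlg a * P.onC0 (c0Single t))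
    rw [P.covariant ha rfl, ← mul_assoc, ← map_mul, c0Single_mul_self]
  covariant s t a ha := by
    refine DoubleCentralizer.ext ℂ _ _ _ (Prod.ext ?_ ?_)
    · ext x
      change P.onAlg a * (P.onC0 (c0Single t) * (x : 𝓛)) =
        P.onC0 (c0Single (s * t)) * (P.onAlg a * (x : 𝓛))
      rw [← mul_assoc, P.covariant ha rfl, mul_assoc]
    · ext x
      change (x : 𝓛) * P.onAlg a * P.onC0 (c0Single t) =
        (x : 𝓛) * P.onC0 (c0Single (s * t)) * P.onAlg a
      rw [mul_assoc, P.covariant ha rfl, mul_assoc]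

theorem toRep_onAlg_fst (d : D) (x : P.algebra) :
    (((P.toRep.onAlg d).fst x : P.algebra) : 𝓛) = P.onAlg d * x := rfl

/-- The multiplier `π(d)μ(χ_t)` is tested on its own adjoint, which lies in the algebra. -/
theorem norm_le_toRep (d : D) (t : H) : ‖P.onAlg d * P.onC0 (c0Single t)‖ ≤
    ‖P.toRep.onAlg d * P.toRep.onC0 (c0Single t)‖ := by
  set z := P.onAlg d * P.onC0 (c0Single t) with hz
  let y : P.algebra := ⟨star z, star_mem (P.onAlg_mul_onC0_mem d (c0Single t))⟩
  have h := (P.toRep.onAlg d * P.toRep.onC0 (c0Single t)).fst.le_opNorm y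
  have e : ‖(P.toRep.onAlg d * P.toRep.onC0 (c0Single t)).fst y‖ = ‖z‖ * ‖z‖ := by
    rw [← CStarRing.norm_self_mul_star]
    change ‖P.onAlg d * (P.onC0 (c0Single t) * star z)‖ = _
    rw [← mul_assoc]
  have e' : ‖y‖ = ‖z‖ := norm_star z
  rw [e, e', DoubleCentralizer.norm_fst] at h
  rcases (norm_nonneg z).eq_or_lt with h0 | h0
  · rw [← h0]; exact norm_nonneg _
  · exact le_of_mul_le_mul_right h h0

/-- Restricting to multipliers keeps `π` injective if the products `π(d)μ(χ_t)` separate the points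
of `D`: an element of the kernel annihilates the dense span of the spectral subspaces. -/
theorem injective_toRep (h : ∀ d : D, (∀ t, P.onAlg d * P.onC0 (c0Single t) = 0) → d = 0) :
    Function.Injective P.toRep.onAlg := by
  refine (injective_iff_map_eq_zero _).mpr fun d hd => ?_
  have h1 : ∀ s, ∀ a ∈ δ.spectral s, d * a = 0 := fun s a ha => h _ fun t => by
    have := congrArg (fun m : 𝓜(ℂ, P.algebra) => ((m.fst
      ⟨_, P.gen_subset_algebra ⟨s, t, a, ha, rfl⟩⟩ : P.algebra) : 𝓛)) hd
    beta_reduce at this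
    rw [toRep_onAlg_fst] at this
    rw [map_mul, mul_assoc]
    exact this
  have h2 : ContinuousLinearMap.mul ℂ D d = 0 :=
    ContinuousLinearMap.ext_of_span δ.span_spectral_closure (by
      rintro a ⟨s, ha⟩; exact h1 s a ha)
  exact CStarRing.mul_star_self_eq_zero_iff d |>.mp (congrArg (fun f => f (star d)) h2)

/-- The corner of an element of `P.core` at the projection `μ(χ_t)` is `π(c)μ(χ_t)` with `c ∈ D_e`.
For a direct sum of two pairs the same `c` serves both summands. -/
theorem exists_corner {𝓛 : Type w} [NonUnitalCStarAlgebra 𝓛] (P : δ.CovariantPair 𝓛) {x : 𝓛}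
    (hx : x ∈ P.core) (t : H) : ∃ c ∈ δ.spectral 1,
      P.onC0 (c0Single t) * x * P.onC0 (c0Single t) = P.onAlg c * P.onC0 (c0Single t) := by
  refine Submodule.span_induction (p := fun x _ => ∃ c ∈ δ.spectral 1,
      P.onC0 (c0Single t) * x * P.onC0 (c0Single t) = P.onAlg c * P.onC0 (c0Single t))
    ?_ ?_ ?_ ?_ (P.mem_core.mp hx)
  · rintro _ ⟨s, r, a, ha, rfl⟩
    by_cases hr : r = t
    · subst hr
      by_cases hs : s = 1
      · subst hs
        refine ⟨a, ha, ?_⟩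
        rw [← mul_assoc, ← P.covariant ha (one_mul r), mul_assoc, mul_assoc, ← map_mul,
          c0Single_mul_self, ← map_mul, c0Single_mul_self]
      · refine ⟨0, zero_mem _, ?_⟩
        rw [← mul_assoc, ← P.covariant ha (mul_inv_cancel_left s r), mul_assoc, mul_assoc,
          ← map_mul, c0Single_mul_self, ← map_mul, c0Single_mul_of_ne, map_zero, mul_zero, map_zero,
          zero_mul]
        intro h
        exact hs (inv_eq_one.mp (mul_eq_right.mp h))
    · refine ⟨0, zero_mem _, ?_⟩
      rw [mul_assoc, mul_assoc, ← map_mul, c0Single_mul_of_ne hr, map_zero, mul_zero, mul_zero,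
        map_zero, zero_mul]
  · exact ⟨0, zero_mem _, by rw [mul_zero, zero_mul, map_zero, zero_mul]⟩
  · rintro x y _ _ ⟨c, hc, h⟩ ⟨c', hc', h'⟩
    exact ⟨c + c', add_mem hc hc', by rw [mul_add, add_mul, h, h', map_add, add_mul]⟩
  · rintro k x _ ⟨c, hc, h⟩
    exact ⟨k • c, Submodule.smul_mem _ _ hc, by
      rw [mul_smul_comm, smul_mul_assoc, h, map_smul, smul_mul_assoc]⟩

/-- The direct sum of two covariant pairs. -/
noncomputable def prod {𝓛 𝓛' : Type*} [NonUnitalCStarAlgebra 𝓛] [NonUnitalCStarAlgebra 𝓛']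
    (P : δ.CovariantPair 𝓛) (Q : δ.CovariantPair 𝓛') : δ.CovariantPair (𝓛 × 𝓛') where
  onAlg := P.onAlg.prod Q.onAlg
  onC0 := P.onC0.prod Q.onC0
  covariant {_ _} ha {_ _} h := Prod.ext (P.covariant ha h) (Q.covariant ha h)

/-- A *-homomorphism that maps `π(a)μ(χ_t)` to `ρ(a)ν(χ_t)` for `a` in the spectral subspaces maps
`π(a)μ(f)` to `ρ(a)ν(f)` for all `a` and `f`. -/
theorem hom_apply {𝓛 𝓛' : Type w} [NonUnitalCStarAlgebra 𝓛] [NonUnitalCStarAlgebra 𝓛']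
    (P : δ.CovariantPair 𝓛) (Q : δ.CovariantPair 𝓛') (Θ : P.algebra →⋆ₙₐ[ℂ] 𝓛')
    (h : ∀ s, ∀ a ∈ δ.spectral s, ∀ t, Θ ⟨_, P.onAlg_mul_onC0_mem a (c0Single t)⟩ =
      Q.onAlg a * Q.onC0 (c0Single t)) (a : D) (f : C₀(WithDiscreteTopology H, ℂ)) :
    Θ ⟨_, P.onAlg_mul_onC0_mem a f⟩ = Q.onAlg a * Q.onC0 f := by
  have hΘc : Continuous Θ := (NonUnitalStarAlgHom.toCLM Θ).continuous
  have hadd : ∀ a b f, Θ ⟨_, P.onAlg_mul_onC0_mem (a + b) f⟩ =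
      Θ ⟨_, P.onAlg_mul_onC0_mem a f⟩ + Θ ⟨_, P.onAlg_mul_onC0_mem b f⟩ := fun a b f => by
    rw [← map_add]
    exact congrArg Θ (Subtype.ext (by
      change P.onAlg (a + b) * _ = P.onAlg a * _ + P.onAlg b * _
      rw [map_add, add_mul]))
  have hsmul : ∀ (c : ℂ) a f, Θ ⟨_, P.onAlg_mul_onC0_mem (c • a) f⟩ =
      c • Θ ⟨_, P.onAlg_mul_onC0_mem a f⟩ := fun c a f => by
    rw [← map_smul]
    exact congrArg Θ (Subtype.ext (by
      change P.onAlg (c • a) * _ = c • (P.onAlg a * _)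
      rw [map_smul, smul_mul_assoc]))
  have hadd' : ∀ a f g, Θ ⟨_, P.onAlg_mul_onC0_mem a (f + g)⟩ =
      Θ ⟨_, P.onAlg_mul_onC0_mem a f⟩ + Θ ⟨_, P.onAlg_mul_onC0_mem a g⟩ := fun a f g => by
    rw [← map_add]
    exact congrArg Θ (Subtype.ext (by
      change _ * P.onC0 (f + g) = _ * P.onC0 f + _ * P.onC0 g
      rw [map_add, mul_add]))
  have hsmul' : ∀ (c : ℂ) a f, Θ ⟨_, P.onAlg_mul_onC0_mem a (c • f)⟩ =
      c • Θ ⟨_, P.onAlg_mul_onC0_mem a f⟩ := fun c a f => by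
    rw [← map_smul]
    exact congrArg Θ (Subtype.ext (by
      change _ * P.onC0 (c • f) = c • (_ * P.onC0 f)
      rw [map_smul, mul_smul_comm]))
  have h2 : ∀ t a, Θ ⟨_, P.onAlg_mul_onC0_mem a (c0Single t)⟩ =
      Q.onAlg a * Q.onC0 (c0Single t) := fun t a => by
    let F : D →L[ℂ] 𝓛' :=
      { toFun := fun a => Θ ⟨_, P.onAlg_mul_onC0_mem a (c0Single t)⟩
        map_add' := fun a b => hadd a b _
        map_smul' := fun c a => hsmul c a _
        cont := hΘc.comp
          (((NonUnitalStarAlgHom.toCLM P.onAlg).continuous.mul continuous_const).subtype_mk _) }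
    have : F = ((ContinuousLinearMap.mul ℂ 𝓛').flip (Q.onC0 (c0Single t))).comp
          (NonUnitalStarAlgHom.toCLM Q.onAlg) :=
      ContinuousLinearMap.ext_of_span δ.span_spectral_closure (by
        rintro a ⟨s, ha⟩; exact h s a ha t)
    exact congrArg (fun f => f a) this
  let F : C₀(WithDiscreteTopology H, ℂ) →L[ℂ] 𝓛' :=
    { toFun := fun f => Θ ⟨_, P.onAlg_mul_onC0_mem a f⟩
      map_add' := fun f g => hadd' a f g
      map_smul' := fun c f => hsmul' c a f
      cont := hΘc.comp
        ((continuous_const.mul (NonUnitalStarAlgHom.toCLM P.onC0).continuous).subtype_mk _) }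
  have : F = (ContinuousLinearMap.mul ℂ 𝓛' (Q.onAlg a)).comp (NonUnitalStarAlgHom.toCLM Q.onC0) :=
    ContinuousLinearMap.ext_of_span span_c0Single_closure (by
      rintro _ ⟨t, rfl⟩; exact h2 t a)
  exact congrArg (fun F => F f) this

/-- A covariant pair whose norms dominate those of another one maps onto it. -/
theorem exists_hom {𝓛 𝓛' : Type w} [NonUnitalCStarAlgebra 𝓛] [NonUnitalCStarAlgebra 𝓛']
    (P : δ.CovariantPair 𝓛) (Q : δ.CovariantPair 𝓛')
    (hle : ∀ x ∈ (P.prod Q).core, ‖x.2‖ ≤ ‖x.1‖) :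
    ∃ Θ : P.algebra →⋆ₙₐ[ℂ] Q.algebra, ∀ s, ∀ a ∈ δ.spectral s, ∀ t,
      Θ ⟨_, P.onAlg_mul_onC0_mem a (c0Single t)⟩ = ⟨_, Q.onAlg_mul_onC0_mem a (c0Single t)⟩ := by
  let ι : P.algebra × Q.algebra →ₗ[ℂ] 𝓛 × 𝓛' :=
    LinearMap.prodMap P.algebra.toSubmodule.subtype Q.algebra.toSubmodule.subtype
  have hι : Function.Injective ι := fun x y h =>
    Prod.ext (Subtype.ext (congrArg Prod.fst h)) (Subtype.ext (congrArg Prod.snd h))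
  let S : Set (P.algebra × Q.algebra) := {x | ι x ∈ (P.prod Q).gen}
  let pt : D → H → P.algebra × Q.algebra := fun a t =>
    (⟨P.onAlg a * P.onC0 (c0Single t), P.onAlg_mul_onC0_mem a (c0Single t)⟩,
      ⟨Q.onAlg a * Q.onC0 (c0Single t), Q.onAlg_mul_onC0_mem a (c0Single t)⟩)
  have hS : ∀ s t, ∀ a ∈ δ.spectral s, pt a t ∈ S := fun s t a ha => ⟨s, t, a, ha, rfl⟩
  have himg : ι '' S = (P.prod Q).gen := by
    refine Set.Subset.antisymm (by rintro _ ⟨x, hx, rfl⟩; exact hx) ?_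
    rintro _ ⟨s, t, a, ha, rfl⟩
    exact ⟨pt a t, hS s t a ha, rfl⟩
  have hspan : ∀ x, x ∈ Submodule.span ℂ S ↔ ι x ∈ Submodule.span ℂ (P.prod Q).gen := fun x => by
    rw [← himg, ← Submodule.map_span, Submodule.mem_map]
    exact ⟨fun h => ⟨x, h, rfl⟩, by rintro ⟨y, hy, h⟩; rwa [hι h] at hy⟩
  obtain ⟨Θ, hΘ⟩ := exists_starHom_of_span S
    (fun x hx y hy => (hspan _).mpr ((P.prod Q).gen_mul_mem hx hy))
    (fun x hx => (P.prod Q).star_mem_gen hx)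
    (fun x hx => hle (ι x) ((hspan x).mp hx)) (by
      refine P.eq_top_of_gen_mem (Submodule.isClosed_topologicalClosure _) ?_
      rintro _ ⟨s, t, a, ha, rfl⟩
      exact Submodule.le_topologicalClosure _ (Submodule.subset_span ⟨pt a t, hS s t a ha, rfl⟩))
  exact ⟨Θ, fun s a ha t => hΘ (pt a t) (hS s t a ha)⟩

end CovariantPair

section Universal

variable {B E : Type u} [NonUnitalCStarAlgebra B] [NonUnitalCStarAlgebra E]

/-- If `c ↦ π(c)μ(χ_t)` is isometric on `D_e` for every `t`, then the norm given by the covariant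
representation `(π, μ)` on the span of the products `π(a)μ(χ_t)` dominates that given by every other
covariant representation: the corners of powers of `x* x` lie in `D_e`, where `(π, μ)` is
isometric. -/
theorem CovariantRep.norm_snd_le (P : δ.CovariantRep B) (Q : δ.CovariantRep E)
    (hP : ∀ c ∈ δ.spectral 1, ∀ t, ‖c‖ ≤ ‖P.onAlg c * P.onC0 (c0Single t)‖)
    {x : 𝓜(ℂ, B) × 𝓜(ℂ, E)} (hx : x ∈ (P.toPair.prod Q.toPair).core) : ‖x.2‖ ≤ ‖x.1‖ := by
  have hsa : IsSelfAdjoint (star x * x).2 := IsSelfAdjoint.star_mul_self x.2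
  have hT : star x * x ∈ (P.toPair.prod Q.toPair).core := MulMemClass.mul_mem (star_mem hx) hx
  have hproj : ∀ {A : Type u} [NonUnitalCStarAlgebra A] (R : δ.CovariantRep A) (t : H),
      ‖R.onC0 (c0Single t)‖ ≤ 1 := fun R t => by
    have h : star (R.onC0 (c0Single t)) * R.onC0 (c0Single t) = R.onC0 (c0Single t) := by
      rw [← map_star, star_c0Single, ← map_mul, c0Single_mul_self]
    have := CStarRing.norm_star_mul_self (x := R.onC0 (c0Single t))
    rw [h] at this
    by_contra! h1
    nlinarith
  have key : ‖(star x * x).2‖ ≤ ‖(star x * x).1‖ := by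
    refine hsa.multiplier_norm_le_of_growth (norm_nonneg _) Q.total_c0Single ?_
    rintro _ ⟨t, b, rfl⟩
    refine ⟨‖b‖ * ‖b‖, fun m => ?_⟩
    have hpow : powSucc (star x * x) m ∈ (P.toPair.prod Q.toPair).core := by
      induction m with
      | zero => exact hT
      | succ m ih => exact MulMemClass.mul_mem hT ih
    obtain ⟨c, hc, hcorner⟩ := (P.toPair.prod Q.toPair).exists_corner hpow t
    have h1 : P.onC0 (c0Single t) * (powSucc (star x * x) m).1 * P.onC0 (c0Single t) =
      P.onAlg c * P.onC0 (c0Single t) := congrArg Prod.fst hcorner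
    have h2 : Q.onC0 (c0Single t) * (powSucc (star x * x) m).2 * Q.onC0 (c0Single t) =
      Q.onAlg c * Q.onC0 (c0Single t) := congrArg Prod.snd hcorner
    have e1 : (powSucc (star x * x) m).1 = (star x * x).1 ^ (m + 1) :=
      map_powSucc (NonUnitalStarAlgHom.fst ℂ 𝓜(ℂ, B) 𝓜(ℂ, E)) (star x * x) m
    have e2 : (powSucc (star x * x) m).2 = (star x * x).2 ^ (m + 1) :=
      map_powSucc (NonUnitalStarAlgHom.snd ℂ 𝓜(ℂ, B) 𝓜(ℂ, E)) (star x * x) m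
    rw [e1] at h1
    rw [e2] at h2
    have hn : ‖Q.onAlg c * Q.onC0 (c0Single t)‖ ≤ ‖(star x * x).1‖ ^ (m + 1) := by
      calc _ ≤ ‖Q.onAlg c‖ * ‖Q.onC0 (c0Single t)‖ := norm_mul_le _ _
        _ ≤ ‖c‖ * 1 := mul_le_mul (NonUnitalStarAlgHom.norm_apply_le _ _) (hproj Q t)
            (norm_nonneg _) (norm_nonneg _)
        _ ≤ ‖P.onC0 (c0Single t) * (star x * x).1 ^ (m + 1) * P.onC0 (c0Single t)‖ := by
            rw [mul_one, h1]; exact hP c hc t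
        _ ≤ ‖P.onC0 (c0Single t)‖ * ‖(star x * x).1 ^ (m + 1)‖ * ‖P.onC0 (c0Single t)‖ :=
            (norm_mul_le _ _).trans (mul_le_mul_of_nonneg_right (norm_mul_le _ _) (norm_nonneg _))
        _ ≤ 1 * ‖(star x * x).1 ^ (m + 1)‖ * 1 := by
            gcongr
            · exact hproj P t
            · exact hproj P t
        _ ≤ _ := by
            rw [one_mul, mul_one]; exact norm_pow_le' _ (Nat.succ_pos m)
    set p := Q.onC0 (c0Single t) with hp
    have hps : star p = p := by rw [hp, ← map_star, star_c0Single]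
    have ep : star (p.fst b) = p.snd (star b) := by
      conv_lhs => rw [← hps]
      rw [DoubleCentralizer.star_fst, star_star]
    rw [ep, p.central]
    change ‖star b * (p * (star x * x).2 ^ (m + 1) * p).fst b‖ ≤ _
    refine (norm_mul_le _ _).trans ?_
    rw [norm_star, mul_assoc ‖b‖]
    refine mul_le_mul_of_nonneg_left ?_ (norm_nonneg b)
    refine (ContinuousLinearMap.le_opNorm _ _).trans ?_
    rw [mul_comm, DoubleCentralizer.norm_fst, h2]
    exact mul_le_mul_of_nonneg_left hn (norm_nonneg b)
  have k2 : ‖x.2‖ * ‖x.2‖ ≤ ‖x.1‖ * ‖x.1‖ := by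
    rw [← CStarRing.norm_star_mul_self, ← CStarRing.norm_star_mul_self]; exact key
  exact abs_le_of_sq_le_sq' (by nlinarith) (norm_nonneg _) |>.2

/-- A covariant representation that is isometric on `D_e` over every point of `H` maps onto every
other one. -/
theorem CovariantRep.exists_hom (P : δ.CovariantRep B) (Q : δ.CovariantRep E)
    (hP : ∀ c ∈ δ.spectral 1, ∀ t, ‖c‖ ≤ ‖P.onAlg c * P.onC0 (c0Single t)‖) :
    ∃ Θ : P.toPair.algebra →⋆ₙₐ[ℂ] Q.toPair.algebra, ∀ a f (x : P.toPair.algebra),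
      (x : 𝓜(ℂ, B)) = P.onAlg a * P.onC0 f → (Θ x : 𝓜(ℂ, E)) = Q.onAlg a * Q.onC0 f := by
  obtain ⟨Θ, hΘ⟩ := P.toPair.exists_hom Q.toPair fun x hx => P.norm_snd_le Q hP hx
  refine ⟨Θ, fun a f x hx => ?_⟩
  obtain rfl : x = ⟨_, P.toPair.onAlg_mul_onC0_mem a f⟩ := Subtype.ext hx
  exact P.toPair.hom_apply Q.toPair
    ((NonUnitalStarSubalgebraClass.subtype Q.toPair.algebra).comp Θ)
    (fun s a ha t => congrArg Subtype.val (hΘ s a ha t)) a f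

/-- A covariant representation that is isometric on `D_e` over every point of `H` is universal. -/
theorem CovariantRep.isCrossedProduct (P : δ.CovariantRep B)
    (hP : ∀ c ∈ δ.spectral 1, ∀ t, ‖c‖ ≤ ‖P.onAlg c * P.onC0 (c0Single t)‖) :
    P.IsCrossedProduct := by
  intro E _ Q
  have h := P.exists_hom Q hP
  rw [← P.algebra_eq, ← Q.algebra_eq] at h
  obtain ⟨Θ, hΘ⟩ := h
  exact ⟨Θ, fun a f => hΘ a f _ rfl⟩

end Universal

end Coaction

/-! ### The regular covariant pair -/

namespace HilbertTensor

variable {K L : Type u} [NormedAddCommGroup K] [InnerProductSpace ℂ K] [CompleteSpace K]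
  [NormedAddCommGroup L] [InnerProductSpace ℂ L] [CompleteSpace L]

/-- The amplification `c ↦ 1 ⊗ ρ(c)` of a representation. -/
noncomputable def amplification (K : Type u) [NormedAddCommGroup K] [InnerProductSpace ℂ K]
    [CompleteSpace K] {C : Type*} [NonUnitalCStarAlgebra C] (ρ : C →⋆ₙₐ[ℂ] (L →L[ℂ] L)) :
    C →⋆ₙₐ[ℂ] (HTensor K L →L[ℂ] HTensor K L) where
  toFun c := opTensor 1 (ρ c)
  map_smul' k c := by rw [map_smul]; exact map_smul (opTensorBilin (K := K) 1) k (ρ c)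
  map_zero' := by rw [map_zero]; exact map_zero (opTensorBilin (K := K) (L := L) 1)
  map_add' c d := by rw [map_add]; exact map_add (opTensorBilin (K := K) 1) (ρ c) (ρ d)
  map_mul' c d := by rw [map_mul, ← opTensor_mul, one_mul]
  map_star' c := by rw [map_star, ← opTensor_star, star_one]

end HilbertTensor

theorem GroupCStar.regularRep_mul_multRep {H : Type u} [Group H] (s t : H) :
    regularRep H (of s) * multRep (c0Single t) =
      multRep (c0Single (s * t)) * regularRep H (of s) := by
  refine ContinuousLinearMap.ext_of_span span_bv_closure ?_
  rintro _ ⟨r, rfl⟩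
  rw [mul_apply_eq_comp, mul_apply_eq_comp, multRep_bv, map_smul, regularRep_of, multRep_bv]
  by_cases h : r = t
  · rw [h, c0Single_apply_self, c0Single_apply_self]
  · rw [c0Single_apply_ne h, c0Single_apply_ne fun h' => h (mul_left_cancel h')]

namespace Coaction

variable {H D : Type u} [Group H] [NonUnitalCStarAlgebra D] (δ : Coaction H D)
variable {K : Type u} [NormedAddCommGroup K] [InnerProductSpace ℂ K] [CompleteSpace K]
  (σ : D →⋆ₙₐ[ℂ] (K →L[ℂ] K))

/-- The covariant pair `((σ ⊗ λ) ∘ δ, 1 ⊗ M)` on `K ⊗ ℓ²(H)`, where `M` is the representation by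
multiplication operators. -/
noncomputable def regularPair :
    δ.CovariantPair (HTensor K (GroupCStar.L2 H) →L[ℂ] HTensor K (GroupCStar.L2 H)) where
  onAlg := (rep σ (GroupCStar.regularRep H)).comp δ.toHom
  onC0 := amplification K multRep
  covariant {s a} ha {t r} h := by
    change rep σ (GroupCStar.regularRep H) (δ.toHom a) * opTensor 1 (multRep (c0Single t)) =
      opTensor 1 (multRep (c0Single r)) * rep σ (GroupCStar.regularRep H) (δ.toHom a)
    rw [mem_spectral.mp ha, rep_tmul, ← opTensor_mul, ← opTensor_mul, mul_one, one_mul,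
      GroupCStar.regularRep_mul_multRep, h]

theorem regularPair_tm (d : D) (k : K) (t : H) :
    ((δ.regularPair σ).onAlg d * (δ.regularPair σ).onC0 (c0Single t)) (tm k (GroupCStar.bv t)) =
      rep σ (GroupCStar.regularRep H) (δ.toHom d) (tm k (GroupCStar.bv t)) := by
  change rep σ (GroupCStar.regularRep H) (δ.toHom d)
    (opTensor 1 (multRep (c0Single t)) (tm k (GroupCStar.bv t))) = _
  rw [opTensor_tm, multRep_bv, c0Single_apply_self, one_smul]
  rfl

variable {δ σ}

/-- The regular covariant pair is isometric on the spectral subspaces over every point `t` of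
`H`. -/
theorem norm_le_regularPair (hσ : Function.Injective σ) {s : H} {c : D} (hc : c ∈ δ.spectral s)
    (t : H) : ‖c‖ ≤ ‖(δ.regularPair σ).onAlg c * (δ.regularPair σ).onC0 (c0Single t)‖ := by
  rw [← NonUnitalStarAlgHom.norm_map σ hσ]
  refine ContinuousLinearMap.opNorm_le_bound _ (ContinuousLinearMap.opNorm_nonneg _) fun k => ?_
  have h := ((δ.regularPair σ).onAlg c * (δ.regularPair σ).onC0 (c0Single t)).le_opNorm
    (tm k (GroupCStar.bv t))
  rw [regularPair_tm, mem_spectral.mp hc, rep_tmul, opTensor_tm, GroupCStar.regularRep_of, norm_tm,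
    norm_tm, GroupCStar.norm_bv, GroupCStar.norm_bv, mul_one, mul_one] at h
  exact h

/-- A coaction is normal if `(σ ⊗ λ) ∘ δ` is faithful for a faithful representation `σ`. -/
theorem isNormal_of_injective (hσ : Function.Injective σ)
    (h : Function.Injective fun d => rep σ (GroupCStar.regularRep H) (δ.toHom d)) : δ.IsNormal := by
  refine ⟨_, _, (δ.regularPair σ).toRep, CovariantRep.isCrossedProduct _ fun c hc t =>
    (norm_le_regularPair hσ hc t).trans ((δ.regularPair σ).norm_le_toRep c t),
    (δ.regularPair σ).injective_toRep fun d hd => ?_⟩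
  refine h ?_
  beta_reduce
  rw [map_zero, map_zero]
  refine ContinuousLinearMap.ext_of_span
    (total_tm (span_univ_closure (V := K)) GroupCStar.span_bv_closure) ?_
  rintro _ ⟨k, -, _, ⟨t, rfl⟩, rfl⟩
  rw [← regularPair_tm, hd t]

end Coaction

/-! ### The reduced norm on the unit fiber -/

namespace FellBundle

variable {H : Type u} [Group H] (𝒜 : FellBundle.{u, u} H)

section UnitFiberAction

open Classical in
/-- Left convolution by an element of the unit fiber. -/
theorem conv_single_one (a : 𝒜.Fiber 1) (g : 𝒜.Sections) :
    𝒜.conv (DFinsupp.single 1 a) g =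
      DFinsupp.mapRange.linearMap (fun t => 𝒜.mulBilin (one_mul t) a) g := by
  rw [conv_eq]
  refine LinearMap.congr_fun (𝒜.sections_hom_ext fun t b => ?_) g
  rw [← conv_eq, conv_single_single, DFinsupp.mapRange.linearMap_apply, DFinsupp.mapRange_single,
    mulBilin_apply]
  have : ∀ r (h : 1 * t = r), (DFinsupp.single (1 * t) (𝒜.mul rfl a b) : 𝒜.Sections) =
      DFinsupp.single r (𝒜.mul h a b) := by rintro _ rfl; rfl
  exact this _ _

/-- In the C*-algebra `A_e`, `b* a* a b ≤ ‖a‖² b* b`: with `w = ‖a‖ - (‖a‖² - a* a)^{1/2}`, the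
difference is `c* c` for `c = ‖a‖ b - w b`. -/
theorem exists_star_mul_self_eq_sub (a : 𝒜.UnitFiber) {t : H} (b : 𝒜.Fiber t) :
    ∃ c : 𝒜.UnitFiber, (‖a‖ ^ 2 : ℂ) • (𝒜.mul (inv_mul_cancel t) (𝒜.inv rfl b) b : 𝒜.UnitFiber) =
      𝒜.mul (inv_mul_cancel t) (𝒜.inv rfl (𝒜.mul (one_mul t) a b)) (𝒜.mul (one_mul t) a b) +
        star c * c := by
  let _ : PartialOrder 𝒜.UnitFiber := CStarAlgebra.spectralOrder 𝒜.UnitFiber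
  have : StarOrderedRing 𝒜.UnitFiber := CStarAlgebra.spectralOrderedRing 𝒜.UnitFiber
  have h0 : 0 ≤ star a * a := star_mul_self_nonneg a
  set f : ℝ → ℝ := fun x => ‖a‖ - √(‖a‖ ^ 2 - x) with hf
  have hfc : Continuous f := by fun_prop
  have hf0 : f 0 = 0 := by simp [hf]
  set w := cfcₙ f (star a * a) with hw
  have hws : star w = w := cfcₙ_predicate (R := ℝ) (p := IsSelfAdjoint) f (star a * a)
  -- the identity `(‖a‖ - w)² = ‖a‖² - a* a`, written without a unit
  have hw2 : (2 * ‖a‖ : ℝ) • w = star a * a + w * w := by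
    have hsa : IsSelfAdjoint (star a * a) := IsSelfAdjoint.star_mul_self a
    rw [hw, ← cfcₙ_mul f f (star a * a) hfc.continuousOn hf0 hfc.continuousOn hf0,
      ← cfcₙ_smul (2 * ‖a‖) f (star a * a) hfc.continuousOn hf0]
    conv_rhs => enter [1]; rw [← cfcₙ_id ℝ (star a * a)]
    rw [← cfcₙ_add id (fun x => f x * f x) (star a * a) continuousOn_id rfl
      (hfc.mul hfc).continuousOn (by simp [hf0])]
    refine cfcₙ_congr fun x hx => ?_
    have hx' : x ≤ ‖a‖ ^ 2 := by
      have := (le_abs_self x).trans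
        (NonUnitalIsometricContinuousFunctionalCalculus.norm_quasispectrum_le
          (𝕜 := ℝ) (star a * a) hx hsa)
      rwa [CStarRing.norm_star_mul_self, ← sq] at this
    have := Real.sq_sqrt (sub_nonneg.mpr hx')
    simp only [hf, smul_eq_mul, id]
    nlinarith
  let L : 𝒜.UnitFiber →ₗ[ℂ] 𝒜.UnitFiber :=
    (𝒜.mulBilin (inv_mul_cancel t) (𝒜.inv rfl b)).comp ((𝒜.mulBilin (one_mul t)).flip b)
  have hL : ∀ x y : 𝒜.UnitFiber, 𝒜.mul (inv_mul_cancel t) (𝒜.inv rfl (𝒜.mul (one_mul t) x b))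
      (𝒜.mul (one_mul t) y b) = L (star x * y) := fun x y => by
    rw [𝒜.inv_mul (one_mul t) rfl inv_one rfl (_root_.mul_one _),
      𝒜.mul_assoc (_root_.mul_one _) (inv_mul_cancel t) (one_mul t) (inv_mul_cancel t)]
    change _ = 𝒜.mul (inv_mul_cancel t) (𝒜.inv rfl b) (𝒜.mul (one_mul t) (star x * y) b)
    rw [unitFiber_mul_def, 𝒜.mul_assoc (one_mul 1) (one_mul t) (one_mul t) (one_mul t)]
    rfl
  have hLl : ∀ x : 𝒜.UnitFiber, 𝒜.mul (inv_mul_cancel t) (𝒜.inv rfl b)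
      (𝒜.mul (one_mul t) x b) = L x := fun x => rfl
  have hLr : ∀ x : 𝒜.UnitFiber, 𝒜.mul (inv_mul_cancel t) (𝒜.inv rfl (𝒜.mul (one_mul t) x b)) b =
      L (star x) := fun x => by
    rw [𝒜.inv_mul (one_mul t) rfl inv_one rfl (_root_.mul_one _),
      𝒜.mul_assoc (_root_.mul_one _) (inv_mul_cancel t) (one_mul t) (inv_mul_cancel t)]
    rfl
  have hw3 : (2 * ‖a‖ : ℂ) • L w = L (star a * a) + L (w * w) := by
    rw [← map_smul, ← map_add, ← hw2]
    congr 1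
    have := Complex.coe_smul (2 * ‖a‖) w
    push_cast at this
    exact this
  obtain ⟨c, hc⟩ := 𝒜.positive ((‖a‖ : ℂ) • b + (-1 : ℂ) • 𝒜.mul (one_mul t) w b)
  refine ⟨c, ?_⟩
  change _ = _ + 𝒜.mul (one_mul 1) (𝒜.inv inv_one c) c
  rw [← hc, hL, 𝒜.inv_add, 𝒜.inv_smul, 𝒜.inv_smul, 𝒜.add_mul, 𝒜.mul_add, 𝒜.mul_add, 𝒜.smul_mul,
    𝒜.smul_mul, 𝒜.smul_mul, 𝒜.smul_mul, 𝒜.mul_smul, 𝒜.mul_smul, 𝒜.mul_smul, 𝒜.mul_smul, hL, hLl,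
    hLr, hws, Complex.conj_ofReal, map_neg, map_one]
  have : L (star a * a) = (2 * ‖a‖ : ℂ) • L w - L (w * w) := by rw [hw3, add_sub_cancel_right]
  rw [this]
  module

open Classical in
/-- Left convolution by an element of the unit fiber is bounded on `ℓ²(𝒜)`. -/
theorem l2Norm_conv_single_one_le (a : 𝒜.Fiber 1) (g : 𝒜.Sections) :
    𝒜.l2Norm (𝒜.conv (DFinsupp.single 1 a) g) ≤ ‖a‖ * 𝒜.l2Norm g := by
  let _ : PartialOrder 𝒜.UnitFiber := CStarAlgebra.spectralOrder 𝒜.UnitFiber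
  have : StarOrderedRing 𝒜.UnitFiber := CStarAlgebra.spectralOrderedRing 𝒜.UnitFiber
  have hpos : ∀ t (b : 𝒜.Fiber t),
      (0 : 𝒜.UnitFiber) ≤ 𝒜.mul (inv_mul_cancel t) (𝒜.inv rfl b) b := fun t b => by
    obtain ⟨c, hc⟩ := 𝒜.positive b
    rw [hc]
    exact star_mul_self_nonneg (c : 𝒜.UnitFiber)
  have e : 𝒜.innerSelf (𝒜.conv (DFinsupp.single 1 a) g) = g.sum fun t b =>
      𝒜.mul (inv_mul_cancel t) (𝒜.inv rfl (𝒜.mul (one_mul t) a b)) (𝒜.mul (one_mul t) a b) := by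
    rw [conv_single_one, innerSelf, DFinsupp.mapRange.linearMap_apply, DFinsupp.sum_mapRange_index]
    · rfl
    · exact fun t => 𝒜.mul_zero _ _
  have h0 : (0 : 𝒜.UnitFiber) ≤ 𝒜.innerSelf (𝒜.conv (DFinsupp.single 1 a) g) := by
    rw [e]
    exact Finset.sum_nonneg fun t _ => hpos t _
  have h1 : (𝒜.innerSelf (𝒜.conv (DFinsupp.single 1 a) g) : 𝒜.UnitFiber) ≤
      (‖a‖ ^ 2 : ℂ) • 𝒜.innerSelf g := by
    rw [e, innerSelf, DFinsupp.sum, DFinsupp.sum, Finset.smul_sum]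
    refine Finset.sum_le_sum fun t _ => ?_
    obtain ⟨c, hc⟩ := 𝒜.exists_star_mul_self_eq_sub a (g t)
    rw [hc]
    exact le_add_of_nonneg_right (star_mul_self_nonneg c)
  have h2 := CStarAlgebra.norm_le_norm_of_nonneg_of_le h0 h1
  rw [norm_smul, ← l2Norm_sq, ← l2Norm_sq, norm_pow, Complex.norm_real, norm_norm, ← mul_pow] at h2
  exact (pow_le_pow_iff_left₀ (l2Norm_nonneg _ _)
    (mul_nonneg (norm_nonneg _) (l2Norm_nonneg _ _)) two_ne_zero).mp h2

open Classical in
/-- The reduced norm restricts to the given norm of the unit fiber. -/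
theorem reducedNorm_single_one (a : 𝒜.Fiber 1) :
    𝒜.reducedNorm (DFinsupp.single 1 a) = ‖a‖ := by
  have hbd : ∀ r ∈ {r | ∃ g : 𝒜.Sections, 𝒜.l2Norm g ≤ 1 ∧
      r = 𝒜.l2Norm (𝒜.conv (DFinsupp.single 1 a) g)}, r ≤ ‖a‖ := by
    rintro _ ⟨g, hg, rfl⟩
    exact (𝒜.l2Norm_conv_single_one_le a g).trans (mul_le_of_le_one_right (norm_nonneg a) hg)
  refine le_antisymm (Real.sSup_le hbd (norm_nonneg a)) ?_
  rcases eq_or_ne a 0 with rfl | ha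
  · rw [norm_zero]
    exact Real.sSup_nonneg (by rintro _ ⟨g, -, rfl⟩; exact 𝒜.l2Norm_nonneg _)
  have hl : ∀ x : 𝒜.Fiber 1, 𝒜.l2Norm (DFinsupp.single 1 x) = ‖x‖ := fun x => by
    refine (pow_left_inj₀ (𝒜.l2Norm_nonneg _) (norm_nonneg _) two_ne_zero).mp ?_
    rw [l2Norm_sq, innerSelf]
    rw [DFinsupp.sum_single_index (𝒜.mul_zero _ _), 𝒜.norm_inv_mul_self]
  -- the supremum is attained at a* / ‖a‖
  refine le_csSup ⟨_, hbd⟩ ⟨DFinsupp.single 1 ((‖a‖⁻¹ : ℂ) • 𝒜.inv inv_one a), ?_, ?_⟩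
  · rw [hl, norm_smul, _root_.norm_inv, Complex.norm_real, norm_norm, 𝒜.norm_inv,
      inv_mul_cancel₀ (norm_ne_zero_iff.mpr ha)]
  · have h := 𝒜.conv_single_one a (DFinsupp.single 1 ((‖a‖⁻¹ : ℂ) • 𝒜.inv inv_one a))
    rw [DFinsupp.mapRange.linearMap_apply, DFinsupp.mapRange_single, mulBilin_apply, 𝒜.mul_smul]
      at h
    rw [h, hl, norm_smul, _root_.norm_inv, Complex.norm_real, norm_norm,
      𝒜.norm_mul_inv_self inv_one, sq,
      inv_mul_cancel_left₀ (norm_ne_zero_iff.mpr ha)]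

end UnitFiberAction

end FellBundle

/-! ### The dual coaction on a reduced cross sectional algebra -/

namespace FellBundle.Rep

variable {H : Type u} [Group H] {𝒜 : FellBundle.{u, u} H} {D : Type u} [NonUnitalCStarAlgebra D]
  (R : 𝒜.Rep D)

theorem lift_convPow (h : 𝒜.Sections) (m : ℕ) :
    R.lift (𝒜.convPow h m) = powSucc (R.lift h) m := by
  induction m with
  | zero => rfl
  | succ m ih => rw [convPow, powSucc, lift_conv, ih]

theorem norm_powSucc_le (a : D) (m : ℕ) : ‖powSucc a m‖ ≤ ‖a‖ ^ (m + 1) :=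
  (CStarSeminorm.ofHom (NonUnitalStarAlgHom.id ℂ D)).map_powSucc_le a m

/-- A *-representation of the finitely supported sections on a Hilbert space with a total set of
vectors whose coefficients are bounded by the norm of `D` is itself bounded by that norm. -/
theorem norm_le_of_coeff {X : Type*} [NormedAddCommGroup X] [InnerProductSpace ℂ X]
    [CompleteSpace X] (Ψ : 𝒜.Sections →ₗ[ℂ] (X →L[ℂ] X))
    (hmul : ∀ f g, Ψ (𝒜.conv f g) = Ψ f * Ψ g) (hstar : ∀ f, Ψ (𝒜.starSection f) = star (Ψ f))
    {S : Set X} (hS : (Submodule.span ℂ S).topologicalClosure = ⊤)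
    (h : ∀ x ∈ S, ∃ C, 0 ≤ C ∧ ∀ g, ‖inner ℂ x (Ψ g x)‖ ≤ C * ‖R.lift g‖) (f : 𝒜.Sections) :
    ‖Ψ f‖ ≤ ‖R.lift f‖ := by
  set g := 𝒜.conv (𝒜.starSection f) f with hg
  have e : Ψ g = star (Ψ f) * Ψ f := by rw [hg, hmul, hstar]
  have hpow : ∀ m, Ψ (𝒜.convPow g m) = Ψ g ^ (m + 1) := fun m => by
    induction m with
    | zero => rw [zero_add, pow_one]; rfl
    | succ m ih => rw [convPow, hmul, ih, ← pow_succ']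
  have hsa : IsSelfAdjoint (Ψ g) := e ▸ IsSelfAdjoint.star_mul_self _
  have h1 : ‖Ψ g‖ ≤ ‖R.lift g‖ := by
    refine hsa.norm_le_of_inner_growth (norm_nonneg _) hS fun x hx => ?_
    obtain ⟨C, hC, hle⟩ := h x hx
    refine ⟨C, fun m => ?_⟩
    rw [← hpow]
    refine (hle _).trans (mul_le_mul_of_nonneg_left ?_ hC)
    rw [lift_convPow]
    exact norm_powSucc_le _ m
  rw [e, CStarRing.norm_star_mul_self, hg, lift_conv, lift_starSection,
    CStarRing.norm_star_mul_self] at h1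
  exact abs_le_of_sq_le_sq' (by nlinarith) (norm_nonneg _) |>.2

variable {R}

theorem total (hd : DenseRange R.lift) :
    (Submodule.span ℂ {x | ∃ s a, x = R.toLin s a}).topologicalClosure = ⊤ := by
  classical
  refine (Submodule.eq_top_iff').mpr fun x => ?_
  refine closure_mono ?_ (hd x)
  rintro _ ⟨f, rfl⟩
  rw [lift, sectionsLift_apply]
  exact Submodule.sum_mem _ fun s _ => Submodule.subset_span ⟨s, f s, rfl⟩

/-- A *-representation of the finitely supported sections that is bounded by the norm of `D` extends
to `D`. -/
theorem exists_hom (hd : DenseRange R.lift) {E : Type u} [NonUnitalCStarAlgebra E]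
    (Λ : 𝒜.Sections →ₗ[ℂ] E)
    (hmul : ∀ f g, Λ (𝒜.conv f g) = Λ f * Λ g) (hstar : ∀ f, Λ (𝒜.starSection f) = star (Λ f))
    (hle : ∀ f, ‖Λ f‖ ≤ ‖R.lift f‖) : ∃ Φ : D →⋆ₙₐ[ℂ] E, ∀ f, Φ (R.lift f) = Λ f := by
  have hS : ∀ x ∈ Submodule.span ℂ (Set.range fun f => (R.lift f, Λ f)),
      ∃ f, (R.lift f, Λ f) = x := fun x hx => by
    have : Submodule.span ℂ (Set.range (R.lift.prod Λ)) = LinearMap.range (R.lift.prod Λ) := by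
      rw [← LinearMap.coe_range, Submodule.span_eq]
    exact (this ▸ hx : x ∈ LinearMap.range (R.lift.prod Λ))
  obtain ⟨Φ, hΦ⟩ := exists_starHom_of_span (Set.range fun f => (R.lift f, Λ f))
    (by
      rintro _ ⟨f, rfl⟩ _ ⟨g, rfl⟩
      exact Submodule.subset_span ⟨𝒜.conv f g, Prod.ext (R.lift_conv f g) (hmul f g)⟩)
    (by
      rintro _ ⟨f, rfl⟩
      exact ⟨𝒜.starSection f, Prod.ext (R.lift_starSection f) (hstar f)⟩)
    (fun x hx => by
      obtain ⟨f, rfl⟩ := hS x hx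
      exact hle f)
    (by
      refine (Submodule.eq_top_iff').mpr fun x => ?_
      refine closure_mono ?_ (hd x)
      rintro _ ⟨f, rfl⟩
      exact Submodule.subset_span ⟨_, ⟨f, rfl⟩, rfl⟩)
  exact ⟨Φ, fun f => hΦ _ ⟨f, rfl⟩⟩

theorem injective_of_norm (hd : DenseRange R.lift) {E : Type u} [NonUnitalCStarAlgebra E]
    (Φ : D →⋆ₙₐ[ℂ] E) (hΦ : ∀ f, ‖Φ (R.lift f)‖ = ‖R.lift f‖) : Function.Injective Φ := by
  refine (injective_iff_map_eq_zero _).mpr fun x hx => ?_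
  have : (fun x => ‖Φ x‖) = fun x => ‖x‖ :=
    hd.equalizer (NonUnitalStarAlgHom.toCLM Φ).continuous.norm continuous_norm (funext hΦ)
  rw [← norm_eq_zero, ← congrFun this x, hx, norm_zero]

/-- If the diagonal coefficients of `(Φ ⊗ ρ)(∑ a_s ⊗ s)` at elementary tensors `y ⊗ l` only see the
term with `s = 1`, then `∑ a_s ⊗ s` is bounded in `Φ ⊗ ρ` by the norm of `∑ a_s`. -/
theorem norm_tensorRep_tensorLift_le {K L : Type u} [NormedAddCommGroup K] [InnerProductSpace ℂ K]
    [CompleteSpace K] [NormedAddCommGroup L] [InnerProductSpace ℂ L] [CompleteSpace L]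
    (Φ : D →⋆ₙₐ[ℂ] (K →L[ℂ] K)) (ρ : GroupCStar H →⋆ₙₐ[ℂ] (L →L[ℂ] L)) {S : Set K}
    (hS : (Submodule.span ℂ S).topologicalClosure = ⊤)
    (h : ∀ y ∈ S, ∀ l f, inner ℂ (tm y l) (tensorRep Φ ρ (R.tensorLift f) (tm y l)) =
      inner ℂ y (Φ (R.lift f) y) * inner ℂ l (ρ (GroupCStar.of 1) l)) (f : 𝒜.Sections) :
    ‖tensorRep Φ ρ (R.tensorLift f)‖ ≤ ‖R.lift f‖ := by
  let Ψ : 𝒜.Sections →ₗ[ℂ] (HTensor K L →L[ℂ] HTensor K L) :=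
    (tensorRep Φ ρ : _ →ₗ[ℂ] _).comp R.tensorLift
  have hmul : ∀ f g, Ψ (𝒜.conv f g) = Ψ f * Ψ g := fun f g => by
    change tensorRep Φ ρ (R.tensorLift (𝒜.conv f g)) = _
    rw [tensorLift_conv, _root_.map_mul]
    rfl
  have hstar : ∀ f, Ψ (𝒜.starSection f) = star (Ψ f) := fun f => by
    change tensorRep Φ ρ (R.tensorLift (𝒜.starSection f)) = _
    rw [tensorLift_starSection, map_star]
    rfl
  refine R.norm_le_of_coeff (X := HTensor K L) Ψ hmul hstar
    (total_tm hS (span_univ_closure (V := L))) ?_ f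
  rintro _ ⟨y, hy, l, -, rfl⟩
  refine ⟨‖y‖ * ‖y‖ * ‖inner ℂ l (ρ (GroupCStar.of 1) l)‖, by positivity, fun g => ?_⟩
  change ‖inner ℂ (tm y l) (tensorRep Φ ρ (R.tensorLift g) (tm y l))‖ ≤ _
  rw [h y hy, norm_mul, mul_right_comm]
  refine mul_le_mul_of_nonneg_right ?_ (norm_nonneg _)
  refine (norm_inner_le_norm _ _).trans ?_
  rw [_root_.mul_assoc]
  refine mul_le_mul_of_nonneg_left ?_ (norm_nonneg _)
  refine (ContinuousLinearMap.le_opNorm _ _).trans ?_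
  rw [mul_comm]
  exact mul_le_mul_of_nonneg_left (NonUnitalStarAlgHom.norm_apply_le Φ _) (norm_nonneg _)

variable {K : Type u} [NormedAddCommGroup K] [InnerProductSpace ℂ K] [CompleteSpace K]
  {σ : D →⋆ₙₐ[ℂ] (K →L[ℂ] K)}

/-- The regular representation of the sections extends to a faithful representation of the reduced
cross sectional algebra. -/
theorem exists_regular_hom (hd : DenseRange R.lift) (hR : ∀ a : 𝒜.Fiber 1, ‖R.toLin 1 a‖ = ‖a‖)
    (hn : ∀ f, ‖R.lift f‖ = 𝒜.reducedNorm f) (hσ : Function.Injective σ) :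
    ∃ Φ : D →⋆ₙₐ[ℂ] (HTensor K (GroupCStar.L2 H) →L[ℂ] HTensor K (GroupCStar.L2 H)),
      Function.Injective Φ ∧ ∀ f, Φ (R.lift f) = R.regular σ f := by
  have hnorm : ∀ f, ‖R.regular σ f‖ = ‖R.lift f‖ := fun f => by
    rw [hn, R.reducedNorm_eq hσ hR]
  obtain ⟨Φ, hΦ⟩ := exists_hom
    (E := HTensor K (GroupCStar.L2 H) →L[ℂ] HTensor K (GroupCStar.L2 H)) hd
    (R.regular σ) (R.regular_conv σ) (R.regular_starSection σ)
    fun f => (hnorm f).le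
  exact ⟨Φ, injective_of_norm
    (E := HTensor K (GroupCStar.L2 H) →L[ℂ] HTensor K (GroupCStar.L2 H)) hd
    Φ fun f => (congrArg _ (hΦ f)).trans (hnorm f), hΦ⟩

/-- The diagonal coefficients of the regular representation at `k ⊗ e_t` only see the fiber over the
identity. -/
theorem coeff_tensorLift {L : Type u} [NormedAddCommGroup L] [InnerProductSpace ℂ L]
    [CompleteSpace L] (ρ : GroupCStar H →⋆ₙₐ[ℂ] (L →L[ℂ] L))
    (Φ : D →⋆ₙₐ[ℂ] (HTensor K (GroupCStar.L2 H) →L[ℂ] HTensor K (GroupCStar.L2 H)))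
    (hΦ : ∀ f, Φ (R.lift f) = R.regular σ f) (k : K) (t : H) (l : L) (f : 𝒜.Sections) :
    inner ℂ (tm (tm k (GroupCStar.bv t)) l)
      (tensorRep Φ ρ (R.tensorLift f) (tm (tm k (GroupCStar.bv t)) l)) =
    inner ℂ (tm k (GroupCStar.bv t)) (Φ (R.lift f) (tm k (GroupCStar.bv t))) *
      inner ℂ l (ρ (GroupCStar.of 1) l) := by
  classical
  let x : HTensor (HTensor K (GroupCStar.L2 H)) L := tm (tm k (GroupCStar.bv t)) l
  let y : HTensor K (GroupCStar.L2 H) := tm k (GroupCStar.bv t)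
  let F : 𝒜.Sections →ₗ[ℂ] ℂ :=
    ((innerSL ℂ x).comp (ContinuousLinearMap.apply ℂ _ x)).toLinearMap ∘ₗ
      (tensorRep Φ ρ : _ →ₗ[ℂ] _) ∘ₗ R.tensorLift
  let F' : 𝒜.Sections →ₗ[ℂ] ℂ := inner ℂ l (ρ (GroupCStar.of 1) l) •
    (((innerSL ℂ y).comp (ContinuousLinearMap.apply ℂ _ y)).toLinearMap ∘ₗ R.regular σ)
  have key : F = F' := by
    refine 𝒜.sections_hom_ext fun s a => ?_
    change inner ℂ x (tensorRep Φ ρ (R.tensorLift (DFinsupp.single s a)) x) =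
      inner ℂ l (ρ (GroupCStar.of 1) l) * inner ℂ y (R.regular σ (DFinsupp.single s a) y)
    rw [tensorLift_single, tensorRep_tmul, opTensor_tm, inner_tm, ← R.lift_single s a, hΦ,
      regular_apply, tensorLift_single, tensorRep_tmul, opTensor_tm, inner_tm,
      GroupCStar.regularRep_of, GroupCStar.inner_bv]
    by_cases hs : s = 1
    · obtain rfl := hs
      rw [mul_comm]
    · rw [if_neg fun h => hs (mul_eq_right.mp h.symm), MulZeroClass.mul_zero, MulZeroClass.zero_mul,
        MulZeroClass.mul_zero]
  rw [hΦ, mul_comm]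
  exact LinearMap.congr_fun key f

/-- The map `a ↦ a ⊗ s`, `a ∈ A_s`, on finitely supported sections is bounded by the reduced norm,
in the spatial tensor product with the full group C*-algebra. -/
theorem norm_tensorLift_le (hd : DenseRange R.lift) (hR : ∀ a : 𝒜.Fiber 1, ‖R.toLin 1 a‖ = ‖a‖)
    (hn : ∀ f, ‖R.lift f‖ = 𝒜.reducedNorm f) (hσ : Function.Injective σ) (f : 𝒜.Sections) :
    ‖SpatialTensor.of (R.tensorLift f)‖ ≤ ‖R.lift f‖ := by
  obtain ⟨Φ, hΦi, hΦ⟩ := exists_regular_hom hd hR hn hσ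
  refine norm_of_le (K := HTensor K (GroupCStar.L2 H)) hΦi _ (norm_nonneg _) fun L _ _ _ ρ => ?_
  refine norm_tensorRep_tensorLift_le (K := HTensor K (GroupCStar.L2 H)) Φ ρ
    (total_tm (span_univ_closure (V := K)) (GroupCStar.span_bv_closure (H := H))) ?_ f
  rintro _ ⟨k, -, _, ⟨t, rfl⟩, rfl⟩ l f
  exact coeff_tensorLift ρ Φ hΦ k t l f

end FellBundle.Rep

namespace FellBundle

variable {H : Type u} [Group H] {𝒜 : FellBundle.{u, u} H} {D : Type u} [NonUnitalCStarAlgebra D]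

/-- A reduced cross sectional algebra comes with a representation of the bundle that is isometric on
the unit fiber. -/
theorem IsReducedSectionalAlgebra.exists_rep (h : 𝒜.IsReducedSectionalAlgebra D) :
    ∃ R : 𝒜.Rep D, (∀ a : 𝒜.Fiber 1, ‖R.toLin 1 a‖ = ‖a‖) ∧ DenseRange R.lift ∧
      ∀ f, ‖R.lift f‖ = 𝒜.reducedNorm f := by
  classical
  obtain ⟨ι, hmul, hinv, hd, hn⟩ := h
  let R : 𝒜.Rep D :=
    { toLin := ι
      map_mul := fun {s t r} h a b => by subst h; exact hmul s t a b
      map_inv := fun {s r} h a => by subst h; exact hinv s a }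
  have e : ∀ f, R.lift f = f.sum fun s a => ι s a := fun f => by
    rw [Rep.lift, sectionsLift_apply]
  have hn' : ∀ f, ‖R.lift f‖ = 𝒜.reducedNorm f := fun f => by
    rw [e, ← hn]
  refine ⟨R, fun a => ?_, ?_, hn'⟩
  · rw [← 𝒜.reducedNorm_single_one a, ← hn', R.lift_single]
  · have : (R.lift : 𝒜.Sections → D) = fun f => f.sum fun s a => ι s a := funext e
    rwa [this]

namespace Rep

variable {R : 𝒜.Rep D}

theorem hom_congr (hd : DenseRange R.lift) {E : Type u} [NonUnitalCStarAlgebra E]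
    (Φ Ψ : D →⋆ₙₐ[ℂ] E) (h : ∀ f, Φ (R.lift f) = Ψ (R.lift f)) (d : D) : Φ d = Ψ d :=
  congrFun (hd.equalizer (NonUnitalStarAlgHom.toCLM Φ).continuous
    (NonUnitalStarAlgHom.toCLM Ψ).continuous (funext h)) d

/-- The dual coaction `a ↦ a ⊗ s`, `a ∈ A_s`, on a reduced cross sectional algebra, and its
normality. -/
theorem exists_coaction (hR : ∀ a : 𝒜.Fiber 1, ‖R.toLin 1 a‖ = ‖a‖) (hd : DenseRange R.lift)
    (hn : ∀ f, ‖R.lift f‖ = 𝒜.reducedNorm f) : ∃ δ : Coaction H D, δ.IsNormal ∧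
      ∀ s a, δ.toHom (R.toLin s a) = tmul (R.toLin s a) (GroupCStar.of s) := by
  classical
  obtain ⟨K, _, _, _, σ, hσ⟩ := exists_faithful_rep D
  obtain ⟨Φ, hΦi, hΦ⟩ := exists_regular_hom hd hR hn hσ
  obtain ⟨δ, hδ⟩ := exists_hom hd (E := SpatialTensor D (GroupCStar H))
    ((SpatialTensor.of : _ →⋆ₙₐ[ℂ] SpatialTensor D (GroupCStar H)) ∘ₗ R.tensorLift)
    (fun f g => by
      change SpatialTensor.of (R.tensorLift (𝒜.conv f g)) = _
      rw [tensorLift_conv, _root_.map_mul]; rfl)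
    (fun f => by
      change SpatialTensor.of (R.tensorLift (𝒜.starSection f)) = _
      rw [tensorLift_starSection, map_star]; rfl)
    (fun f => norm_tensorLift_le hd hR hn hσ f)
  have hδs : ∀ s a, δ (R.toLin s a) = tmul (R.toLin s a) (GroupCStar.of s) := fun s a => by
    rw [← R.lift_single, hδ]
    change SpatialTensor.of (R.tensorLift (DFinsupp.single s a)) = _
    rw [tensorLift_single, R.lift_single]
    rfl
  have hΦs : ∀ d, rep σ (GroupCStar.regularRep H) (δ d) = Φ d := by
    refine hom_congr (E := HTensor K (GroupCStar.L2 H) →L[ℂ] HTensor K (GroupCStar.L2 H)) hd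
      ((rep σ (GroupCStar.regularRep H)).comp δ) Φ fun f => ?_
    change rep σ (GroupCStar.regularRep H) (δ (R.lift f)) = Φ (R.lift f)
    rw [hδ, hΦ]
    exact rep_of σ (GroupCStar.regularRep H) (R.tensorLift f)
  have hinj : Function.Injective fun d => rep σ (GroupCStar.regularRep H) (δ d) := by
    simp only [hΦs]
    exact hΦi
  let Δ : Coaction H D :=
    { toHom := δ
      injective := fun x y h => hinj (congrArg (rep σ (GroupCStar.regularRep H)) h)
      nondegenerate := by
        refine top_le_iff.mp ?_
        rw [← span_tmul_closure (total hd) GroupCStar.span_of_closure]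
        refine Submodule.topologicalClosure_mono (Submodule.span_mono ?_)
        rintro _ ⟨_, ⟨t, a, rfl⟩, _, ⟨r, rfl⟩, rfl⟩
        obtain ⟨x, hx, hx'⟩ := exists_mulTensor (1 : unitary 𝓜(ℂ, D)) (t⁻¹ * r)
        refine ⟨R.toLin t a, GroupCStar.of (t⁻¹ * r), x, hx, ?_⟩
        rw [hδs, hx', ← GroupCStar.of_mul, mul_inv_cancel_left]
        rfl
      coassoc := fun d => by
        refine ContinuousLinearMap.mem_of_total (total hd) (Submodule.isClosed_topologicalClosure _)
          ((NonUnitalStarAlgHom.toCLM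
            ((SpatialTensor.map δ (NonUnitalStarAlgHom.id ℂ (GroupCStar H))).comp δ)).prod
            (NonUnitalStarAlgHom.toCLM
              ((SpatialTensor.map (NonUnitalStarAlgHom.id ℂ D) GroupCStar.comul).comp δ))) ?_ d
        rintro _ ⟨s, a, rfl⟩
        refine Submodule.le_topologicalClosure _ (Submodule.subset_span
          ⟨R.toLin s a, GroupCStar.of s, GroupCStar.of s, Prod.ext ?_ ?_⟩)
        · change SpatialTensor.map δ (NonUnitalStarAlgHom.id ℂ (GroupCStar H)) (δ (R.toLin s a)) = _
          rw [hδs, map_tmul, hδs]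
          rfl
        · change SpatialTensor.map (NonUnitalStarAlgHom.id ℂ D) GroupCStar.comul
            (δ (R.toLin s a)) = _
          rw [hδs, map_tmul, GroupCStar.comul_of]
          rfl }
  exact ⟨Δ, Coaction.isNormal_of_injective hσ hinj, hδs⟩

end Rep

end FellBundle

/-! ### Unitary multipliers of reduced cross sectional algebras -/

section UnitaryMultipliers

variable {G : Type*} [Group G] {D : Type u} [NonUnitalCStarAlgebra D]

/-- The two-sided multiplier with left part `M_s`, where `M` is a representation of `G` by
adjointable operators on `D`. -/
noncomputable def leftMultiplier (M : G → D →L[ℂ] D)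
    (hadj : ∀ s x y, star (M s x) * y = star x * M s⁻¹ y) (s : G) : 𝓜(ℂ, D) where
  fst := M s
  snd := LinearMap.mkContinuous
    { toFun := fun x => star (M s⁻¹ (star x))
      map_add' := fun x y => by rw [star_add, map_add, star_add]
      map_smul' := fun c x => by
        rw [star_smul, map_smul, star_smul, star_star, RingHom.id_apply] } ‖M s⁻¹‖ fun x => by
    rw [← norm_star x]
    exact (norm_star _).trans_le ((M s⁻¹).le_opNorm (star x))
  central x y := by
    change star (M s⁻¹ (star x)) * y = x * M s y
    rw [hadj, star_star, inv_inv]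

theorem exists_unitary_of_left (M : G → D →L[ℂ] D) (hone : ∀ x, M 1 x = x)
    (hmul : ∀ s t x, M (s * t) x = M s (M t x))
    (hadj : ∀ s x y, star (M s x) * y = star x * M s⁻¹ y) :
    ∃ U : G →* unitary 𝓜(ℂ, D), ∀ s, (U s : 𝓜(ℂ, D)).fst = M s := by
  set m := leftMultiplier M hadj
  have h1 : m 1 = 1 := by
    refine DoubleCentralizer.ext ℂ _ _ _ (Prod.ext ?_ ?_)
    · ext x; exact hone x
    · ext x
      change star (M 1⁻¹ (star x)) = x
      rw [inv_one, hone, star_star]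
  have h2 : ∀ s t, m (s * t) = m s * m t := fun s t => by
    refine DoubleCentralizer.ext ℂ _ _ _ (Prod.ext ?_ ?_)
    · ext x; exact hmul s t x
    · ext x
      change star (M (s * t)⁻¹ (star x)) = star (M t⁻¹ (star (star (M s⁻¹ (star x)))))
      rw [star_star, mul_inv_rev, hmul]
  have h3 : ∀ s, star (m s) = m s⁻¹ := fun s => by
    refine DoubleCentralizer.ext ℂ _ _ _ (Prod.ext ?_ ?_)
    · ext x
      change star (star (M s⁻¹ (star (star x)))) = M s⁻¹ x
      rw [star_star, star_star]
    · ext x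
      change star (M s (star x)) = star (M s⁻¹⁻¹ (star x))
      rw [inv_inv]
  exact ⟨{ toFun := fun s => ⟨m s, by
              rw [Unitary.mem_iff, h3, ← h2, ← h2, inv_mul_cancel, mul_inv_cancel, h1]
              exact ⟨rfl, rfl⟩⟩
           map_one' := Subtype.ext h1
           map_mul' := fun s t => Subtype.ext (h2 s t) }, fun s => rfl⟩

end UnitaryMultipliers

namespace FellBundle

variable {H : Type u} [Group H] {𝒜 : FellBundle.{u, u} H} {D : Type u} [NonUnitalCStarAlgebra D]
  {G : Type*} [Group G] {φ : G →* H} (W : MultiplierRep φ 𝒜)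

namespace MultiplierRep

open Classical in
/-- The action of the multipliers on finitely supported sections. -/
noncomputable def onSections (s : G) : 𝒜.Sections →ₗ[ℂ] 𝒜.Sections :=
  𝒜.sectionsLift fun t => (DFinsupp.lsingle (φ s * t)).comp (W.left s rfl)

open Classical in
theorem onSections_single (s : G) (t : H) (a : 𝒜.Fiber t) :
    W.onSections s (DFinsupp.single t a) = DFinsupp.single (φ s * t) (W.left s rfl a) :=
  𝒜.sectionsLift_single _ _ _

open Classical in
theorem single_left {s : G} {t r : H} (h : φ s * t = r) (a : 𝒜.Fiber t) :
    (DFinsupp.single (φ s * t) (W.left s rfl a) : 𝒜.Sections) =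
      DFinsupp.single r (W.left s h a) := by
  subst h; rfl

theorem onSections_one (f : 𝒜.Sections) : W.onSections 1 f = f := by
  classical
  refine LinearMap.congr_fun (f := W.onSections 1) (g := LinearMap.id)
    (𝒜.sections_hom_ext fun t a => ?_) f
  have e : φ 1 * t = t := by rw [_root_.map_one, one_mul]
  rw [onSections_single, W.single_left e, W.left_one rfl]
  rfl

theorem onSections_mul (s s' : G) (f : 𝒜.Sections) :
    W.onSections (s * s') f = W.onSections s (W.onSections s' f) := by
  classical
  refine LinearMap.congr_fun (f := W.onSections (s * s'))
    (g := (W.onSections s).comp (W.onSections s')) (𝒜.sections_hom_ext fun t a => ?_) f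
  have e : φ (s * s') * t = φ s * (φ s' * t) := by rw [_root_.map_mul, _root_.mul_assoc]
  rw [LinearMap.comp_apply, onSections_single, onSections_single, onSections_single,
    W.single_left e, W.left_left s s' (s * s') rfl rfl rfl e]

/-- The multipliers `u_s` act by adjointable maps: `(u_s f)* g = f* (u_{s⁻¹} g)`. -/
theorem star_lift_onSections (R : 𝒜.Rep D) (s : G) (f g : 𝒜.Sections) :
    star (R.lift (W.onSections s f)) * R.lift g =
      star (R.lift f) * R.lift (W.onSections s⁻¹ g) := by
  classical
  induction f using DFinsupp.induction with
  | h0 => simp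
  | ha t a f _ _ ih =>
    rw [map_add, map_add, map_add, star_add, star_add, _root_.add_mul,
      _root_.add_mul, ih]
    congr 1
    refine LinearMap.congr_fun
      (f := (LinearMap.mulLeft ℂ (star (R.lift (W.onSections s (DFinsupp.single t a))))).comp R.lift)
      (g := ((LinearMap.mulLeft ℂ (star (R.lift (DFinsupp.single t a)))).comp R.lift).comp
        (W.onSections s⁻¹)) (𝒜.sections_hom_ext fun r b => ?_) g
    change star (R.lift (W.onSections s (DFinsupp.single t a))) * R.lift (DFinsupp.single r b) =
      star (R.lift (DFinsupp.single t a)) * R.lift (W.onSections s⁻¹ (DFinsupp.single r b))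
    have e : t⁻¹ * φ s⁻¹ = (φ s * t)⁻¹ := by rw [map_inv, mul_inv_rev]
    have e' : t⁻¹ * (φ s⁻¹ * r) = (φ s * t)⁻¹ * r := by rw [← _root_.mul_assoc, e]
    rw [onSections_single, onSections_single, R.lift_single, R.lift_single, R.lift_single,
      R.lift_single, ← R.map_inv rfl, ← R.map_inv rfl, ← R.map_mul rfl, ← R.map_mul e',
      W.inv_left s s⁻¹ rfl rfl rfl rfl e, W.right_mul s⁻¹ e rfl rfl e']

/-- The multipliers of the bundle extend to unitary multipliers of a completion of the algebra of
sections. -/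
theorem exists_unitary (R : 𝒜.Rep D) (hd : DenseRange R.lift) :
    ∃ U : G →* unitary 𝓜(ℂ, D), ∀ s t (a : 𝒜.Fiber t),
      (U s : 𝓜(ℂ, D)).fst (R.toLin t a) = R.toLin (φ s * t) (W.left s rfl a) := by
  classical
  have hnorm : ∀ s f, ‖R.lift (W.onSections s f)‖ = ‖R.lift f‖ := fun s f => by
    rw [← mul_self_inj (norm_nonneg _) (norm_nonneg _), ← CStarRing.norm_star_mul_self,
      ← CStarRing.norm_star_mul_self, W.star_lift_onSections, ← W.onSections_mul, inv_mul_cancel,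
      W.onSections_one]
  let M : G → D →L[ℂ] D := fun s => (R.lift.comp (W.onSections s)).extendOfNorm R.lift
  have hM : ∀ s f, M s (R.lift f) = R.lift (W.onSections s f) := fun s f =>
    LinearMap.extendOfNorm_eq hd ⟨1, fun f => by rw [one_mul]; exact (hnorm s f).le⟩ f
  obtain ⟨U, hU⟩ := exists_unitary_of_left M
    (congrFun (hd.equalizer (M 1).continuous continuous_id (funext fun f => by
      change M 1 (R.lift f) = R.lift f
      rw [hM, W.onSections_one])))
    (fun s t => congrFun (hd.equalizer (M (s * t)).continuous
      ((M s).continuous.comp (M t).continuous) (funext fun f => by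
        change M (s * t) (R.lift f) = M s (M t (R.lift f))
        rw [hM, hM, hM, W.onSections_mul])))
    (fun s x y => by
      refine congrFun (hd.equalizer (g := fun x => star (M s x) * y)
        (h := fun x => star x * M s⁻¹ y) (by fun_prop) (by fun_prop) (funext fun f => ?_)) x
      refine congrFun (hd.equalizer (g := fun y => star (M s (R.lift f)) * y)
        (h := fun y => star (R.lift f) * M s⁻¹ y) (by fun_prop) (by fun_prop) (funext fun g => ?_)) y
      change star (M s (R.lift f)) * R.lift g = star (R.lift f) * M s⁻¹ (R.lift g)
      rw [hM, hM, W.star_lift_onSections])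
  refine ⟨U, fun s t a => ?_⟩
  rw [hU, ← R.lift_single, hM, W.onSections_single, R.lift_single]

end MultiplierRep

/-- The reduced cross sectional algebra of a bundle with unitary multipliers has a normal coaction
and unitary multipliers that are compatible with it. -/
theorem IsReducedSectionalAlgebra.exists_coaction_unitary (h : 𝒜.IsReducedSectionalAlgebra D)
    (W : MultiplierRep φ 𝒜) : ∃ δ : Coaction H D, δ.IsNormal ∧
      ∃ U : G →* unitary 𝓜(ℂ, D), ∀ s, δ.MapsMultiplier (U s : 𝓜(ℂ, D)) (φ s) := by
  obtain ⟨R, hR, hd, hn⟩ := h.exists_rep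
  obtain ⟨δ, hδ, hδs⟩ := Rep.exists_coaction hR hd hn
  obtain ⟨U, hU⟩ := W.exists_unitary R hd
  refine ⟨δ, hδ, U, fun s => ?_⟩
  obtain ⟨x, hx, -⟩ := exists_mulTensor (U s) (φ s)
  refine ⟨x, hx, fun d => ?_⟩
  have : x.fst.comp (NonUnitalStarAlgHom.toCLM δ.toHom) =
      (NonUnitalStarAlgHom.toCLM δ.toHom).comp (U s : 𝓜(ℂ, D)).fst := by
    refine ContinuousLinearMap.ext_of_span (Rep.total hd) ?_
    rintro _ ⟨t, a, rfl⟩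
    change x.fst (δ.toHom (R.toLin t a)) = δ.toHom ((U s : 𝓜(ℂ, D)).fst (R.toLin t a))
    rw [hδs, hx, hU, hδs, GroupCStar.of_mul]
  exact congrArg (fun f => f d) this

end FellBundle

/-! ### Normal coactions and reduced cross sectional algebras -/

namespace FellBundle

variable {H : Type u} [Group H] {𝒜 ℬ : FellBundle.{u, u} H} {D : Type u} [NonUnitalCStarAlgebra D]

/-- The transport of a representation along an isomorphism of bundles. -/
noncomputable def Rep.ofIso (R : 𝒜.Rep D) (e : 𝒜.Iso ℬ) : ℬ.Rep D where
  toLin s := (R.toLin s).comp ((e.equiv s).symm.toLinearEquiv : ℬ.Fiber s →ₗ[ℂ] 𝒜.Fiber s)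
  map_mul {s t r} h a b := by
    change R.toLin r ((e.equiv r).symm (ℬ.mul h a b)) =
      R.toLin s ((e.equiv s).symm a) * R.toLin t ((e.equiv t).symm b)
    rw [← R.map_mul h]
    congr 1
    rw [LinearIsometryEquiv.symm_apply_eq, e.map_mul, LinearIsometryEquiv.apply_symm_apply,
      LinearIsometryEquiv.apply_symm_apply]
  map_inv {s r} h a := by
    change R.toLin r ((e.equiv r).symm (ℬ.inv h a)) = star (R.toLin s ((e.equiv s).symm a))
    rw [← R.map_inv h]
    congr 1
    rw [LinearIsometryEquiv.symm_apply_eq, e.map_inv, LinearIsometryEquiv.apply_symm_apply]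

/-- A C*-algebra with a normal coaction is the reduced cross sectional algebra of the bundle of its
spectral subspaces, given here by any representation `R` that maps the fibers isometrically (on the
unit fiber) onto them. -/
theorem Rep.isReducedSectionalAlgebra (R : 𝒜.Rep D) (hR : ∀ a : 𝒜.Fiber 1, ‖R.toLin 1 a‖ = ‖a‖)
    {δ : Coaction H D} (hδ : δ.IsNormal) (hmem : ∀ s a, R.toLin s a ∈ δ.spectral s)
    (hsurj : ∀ s, ∀ d ∈ δ.spectral s, ∃ a, R.toLin s a = d) : 𝒜.IsReducedSectionalAlgebra D := by
  classical
  obtain ⟨K, _, _, _, σ, hσ⟩ := exists_faithful_rep D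
  have hlift : ∀ f, δ.toHom (R.lift f) = SpatialTensor.of (R.tensorLift f) := fun f => by
    refine LinearMap.congr_fun
      (f := ((NonUnitalStarAlgHom.toCLM δ.toHom).toLinearMap ∘ₗ R.lift))
      (g := ((SpatialTensor.of : _ →⋆ₙₐ[ℂ] SpatialTensor D (GroupCStar H)) : _ →ₗ[ℂ] _) ∘ₗ
        R.tensorLift) (𝒜.sections_hom_ext fun s a => ?_) f
    change δ.toHom (R.lift (DFinsupp.single s a)) =
      SpatialTensor.of (R.tensorLift (DFinsupp.single s a))
    rw [R.lift_single, R.tensorLift_single]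
    exact hmem s a
  have hreg : ∀ f, rep σ (GroupCStar.regularRep H) (δ.toHom (R.lift f)) = R.regular σ f :=
    fun f => by
      rw [hlift]
      exact rep_of σ (GroupCStar.regularRep H) (R.tensorLift f)
  have hn : ∀ f, ‖R.lift f‖ = 𝒜.reducedNorm f := fun f => by
    rw [R.reducedNorm_eq hσ hR, ← hreg]
    exact le_antisymm (hδ.norm_le hσ _)
      ((norm_rep_le σ _ _).trans (NonUnitalStarAlgHom.norm_apply_le _ _))
  have e : ∀ f, R.lift f = f.sum fun s a => R.toLin s a := fun f => by
    rw [Rep.lift, sectionsLift_apply]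
  refine ⟨R.toLin, fun s t a b => R.map_mul rfl a b, fun s a => R.map_inv rfl a, ?_, fun f => ?_⟩
  · have hd : DenseRange R.lift := fun d => by
      have : (⊤ : Submodule ℂ D) ≤ (LinearMap.range R.lift).topologicalClosure := by
        rw [← δ.span_spectral_closure]
        refine Submodule.topologicalClosure_mono (Submodule.span_le.mpr ?_)
        rintro d ⟨s, hd⟩
        obtain ⟨a, rfl⟩ := hsurj s d hd
        exact ⟨DFinsupp.single s a, R.lift_single s a⟩
      exact this Submodule.mem_top
    rwa [show (R.lift : 𝒜.Sections → D) = fun f => f.sum fun s a => R.toLin s a from funext e] at hd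
  · rw [← hn, e]

end FellBundle

namespace Coaction

variable {H D : Type u} [Group H] [NonUnitalCStarAlgebra D] (δ : Coaction H D)

variable {δ} in
/-- If `δ(m) = m ⊗ s`, then `m D_t ⊆ D_{s t}`. -/
theorem MapsMultiplier.fst_mem {m : 𝓜(ℂ, D)} {s t r : H} (hm : δ.MapsMultiplier m s) {a : D}
    (ha : a ∈ δ.spectral t) (h : s * t = r) : m.fst a ∈ δ.spectral r := by
  obtain ⟨x, hx, hxδ⟩ := hm
  rw [mem_spectral, ← hxδ, mem_spectral.mp ha, hx, ← GroupCStar.of_mul, h]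

variable {G : Type u} [Group G] {φ : G →* H}

/-- Unitary multipliers of `D` compatible with the coaction restrict to multipliers of the spectral
bundle. -/
theorem exists_spectral_unitary (U : G →* unitary 𝓜(ℂ, D))
    (hU : ∀ s, δ.MapsMultiplier (U s : 𝓜(ℂ, D)) (φ s)) :
    ∃ V : G →* unitary δ.spectralBundle.Multiplier,
      ∀ s, (V s : δ.spectralBundle.Multiplier).order = φ s := by
  have hstar : ∀ s, star (U s : 𝓜(ℂ, D)) = U s⁻¹ := fun s => by rw [map_inv]; rfl
  -- right multiplication is determined by left multiplication by the adjoint, so that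
  -- the compatibility with `δ`, a condition on left multiplication only, suffices
  have hsnd : ∀ s a, (U s : 𝓜(ℂ, D)).snd a = star ((U s⁻¹ : 𝓜(ℂ, D)).fst (star a)) := fun s a => by
    rw [← hstar, DoubleCentralizer.star_fst, star_star, star_star]
  have hmem : ∀ {s : G} {t r : H} (h : t * φ s = r) {a : D}, a ∈ δ.spectral t →
      (U s : 𝓜(ℂ, D)).snd a ∈ δ.spectral r := fun {s t r} h {a} ha => by
    rw [hsnd]
    refine star_mem_spectral (s := φ s⁻¹ * t⁻¹) ?_
      ((hU s⁻¹).fst_mem (star_mem_spectral rfl ha) rfl)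
    rw [← h, map_inv, mul_inv_rev, inv_inv, inv_inv]
  have hmul : ∀ s t, (U (s * t) : 𝓜(ℂ, D)) = U s * U t := fun s t => by rw [map_mul]; rfl
  refine FellBundle.exists_unitary_of_family (𝒜 := δ.spectralBundle)
    (fun s t r h a => ⟨(U s : 𝓜(ℂ, D)).fst a.1, (hU s).fst_mem a.2 h⟩)
    (fun s t r h a => ⟨(U s : 𝓜(ℂ, D)).snd a.1, hmem h a.2⟩)
    (fun s t t' x y z h₁ h₂ h₃ h₄ a b => Subtype.ext ((U s : 𝓜(ℂ, D)).central a.1 b.1))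
    (fun s s' t x z h₁ h₂ h₃ a => Subtype.ext ?_) (fun s s' t x z h₁ h₂ h₃ a => Subtype.ext ?_)
    (fun h a => Subtype.ext ?_) (fun h a => Subtype.ext ?_)
    (fun s t t' x x' h₁ h₂ h₃ h₄ a => Subtype.ext ?_)
  · change (U s : 𝓜(ℂ, D)).fst ((U s' : 𝓜(ℂ, D)).fst a.1) = (U (s * s') : 𝓜(ℂ, D)).fst a.1
    rw [hmul]
    rfl
  · change (U s' : 𝓜(ℂ, D)).snd ((U s : 𝓜(ℂ, D)).snd a.1) = (U (s * s') : 𝓜(ℂ, D)).snd a.1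
    rw [hmul]
    rfl
  · change (U 1 : 𝓜(ℂ, D)).fst a.1 = a.1
    rw [map_one]
    rfl
  · change (U 1 : 𝓜(ℂ, D)).snd a.1 = a.1
    rw [map_one]
    rfl
  · change star ((U s : 𝓜(ℂ, D)).fst a.1) = (U s⁻¹ : 𝓜(ℂ, D)).snd (star a.1)
    rw [hsnd, star_star, inv_inv]

end Coaction

/-- A C*-algebra is a reduced twisted crossed product if and only if it has a normal coaction of
`G / N` and a compatible homomorphism of `G` into its unitary multipliers. -/
theorem TwistedAction.exists_isReducedCrossedProduct_iff {G : Type u} [Group G] {N : Subgroup G}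
    [N.Normal] (D : Type u) [NonUnitalCStarAlgebra D] :
    (∃ (B : Type u) (_ : NonUnitalCStarAlgebra B) (T : TwistedAction N B),
      T.IsReducedCrossedProduct D) ↔
    ∃ δ : Coaction (G ⧸ N) D, δ.IsNormal ∧ ∃ U : G →* unitary 𝓜(ℂ, D),
      ∀ s : G, δ.MapsMultiplier (U s : 𝓜(ℂ, D)) (s : G ⧸ N) := by
  constructor
  · rintro ⟨B, _, T, hT⟩
    obtain ⟨V, hV⟩ := T.bundle.exists_iso_bundle_iff.mp ⟨B, _, T, ⟨
      { equiv := fun s => LinearIsometryEquiv.refl ℂ _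
        map_mul := fun _ _ _ => rfl
        map_inv := fun _ _ => rfl }⟩⟩
    exact FellBundle.IsReducedSectionalAlgebra.exists_coaction_unitary (φ := QuotientGroup.mk' N) hT
      (FellBundle.MultiplierRep.ofUnitary V hV)
  · rintro ⟨δ, hδ, U, hU⟩
    obtain ⟨B, _, T, ⟨e⟩⟩ := δ.spectralBundle.exists_iso_bundle_iff.mpr
      (δ.exists_spectral_unitary (φ := QuotientGroup.mk' N) U hU)
    refine ⟨B, _, T, (δ.spectralRep.ofIso e).isReducedSectionalAlgebra (fun a => ?_) hδ
      (fun s a => ((e.equiv s).symm a).2) fun s d hd => ⟨e.equiv s ⟨d, hd⟩, ?_⟩⟩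
    · exact (e.equiv 1).symm.norm_map a
    · exact congrArg (δ.spectralRep.toLin s) ((e.equiv s).symm_apply_apply ⟨d, hd⟩)

theorem theorem5p2 {G : Type u} [Group G] (N : Subgroup G) [N.Normal] :
    (∀ 𝒟 : FellBundle.{u, u} (G ⧸ N),
      (∃ (B : Type u) (_ : NonUnitalCStarAlgebra B) (T : TwistedAction N B),
        Nonempty (𝒟.Iso T.bundle)) ↔
      ∃ U : G →* unitary 𝒟.Multiplier,
        ∀ s : G, (U s : 𝒟.Multiplier).order = (s : G ⧸ N)) ∧
    (∀ (D : Type u) [NonUnitalCStarAlgebra D],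
      (∃ (B : Type u) (_ : NonUnitalCStarAlgebra B) (T : TwistedAction N B),
        T.IsReducedCrossedProduct D) ↔
      ∃ δ : Coaction (G ⧸ N) D, δ.IsNormal ∧
        ∃ U : G →* unitary 𝓜(ℂ, D),
          ∀ s : G, δ.MapsMultiplier (U s : 𝓜(ℂ, D)) (s : G ⧸ N)) :=
  ⟨FellBundle.exists_iso_bundle_iff, fun D _ => TwistedAction.exists_isReducedCrossedProduct_iff D⟩
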